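/- A rank-$R$ canonical polyadic decomposition (CPD) of a tensor $T\in\mathbb F^{n_0\times n_1\times n_2}$ is a triple of matrices $A_d\in\mathbb F^{n_d\times R}$ ($d=0,1,2$) with $T_{i,j,k}=\sum_{r<R}(A_0)_{i,r}(A_1)_{j,r}(A_2)_{k,r}$ for all $i,j,k$. The tensor $T$ is concise if along each of its three axes its slices are linearly independent. $O^*$ hides factors that are polynomial in $n_0,n_1,n_2,R,|\mathbb F|$. (1) There is an algorithm that, given a finite field $\mathbb F$ (by its operation tables), a concise tensor $T\in\mathbb F^{n_0\times n_1\times n_2}$ with $n_0\ge 1$ and a number $R\ge 0$, returns a rank-$R$ CPD of $T$ or determines that none exists. With $r_*:=\lfloor R/n_0\rfloor+1$, it runs in time $$O^*\!\left(|\mathbb F|^{\,n_0+n_2+\max\{0,\ (R-n_0+1-r_*)(n_1+n_2)+r_*^2\}}\right)$$ and in space $O^*(1)$, that is, polynomial in $n_0,n_1,n_2,R,|\mathbb F|$. (For $R>n_0\ge 2$ the maximum equals $(R-n_0+1-r_*)(n_1+n_2)+r_*^2$.) The machine model is a random access machine with the logarithmic cost criterion, space being counted in bits. (2) For every finite field $\mathbb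 F$, every matrix $M\in\mathbb F^{m\times n}$ of rank $r$ and every $k\ge r$, the number of pairs $(U,V)\in\mathbb F^{m\times k}\times\mathbb F^{k\times n}$ with $M=UV$ is at most $|\mathbb F|^{(k-r)(m+n)+r^2}$. -/

import Mathlib

namespace TensorCPD

/-! ### Tensors, conciseness, and CPDs -/

/-- A three-dimensional array `T ∈ F^{n₀ × n₁ × n₂}`. -/
abbrev Tensor3 (F : Type*) (n₀ n₁ n₂ : ℕ) : Type _ := Fin n₀ → Fin n₁ → Fin n₂ → F

/-- `T` is concise: along each of the three axes, its slices are linearly independent. -/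
def Concise {F : Type*} [Field F] {n₀ n₁ n₂ : ℕ} (T : Tensor3 F n₀ n₁ n₂) : Prop :=
  LinearIndependent F (fun (i : Fin n₀) (j : Fin n₁) (k : Fin n₂) => T i j k) ∧
  LinearIndependent F (fun (j : Fin n₁) (i : Fin n₀) (k : Fin n₂) => T i j k) ∧
  LinearIndependent F (fun (k : Fin n₂) (i : Fin n₀) (j : Fin n₁) => T i j k)

/-- The factor matrices `A₀, A₁, A₂`, with `R` columns each, form a rank-`R` CPD of `T`. -/
def IsCPD {F : Type*} [Field F] {n₀ n₁ n₂ R : ℕ} (T : Tensor3 F n₀ n₁ n₂)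
    (A₀ : Matrix (Fin n₀) (Fin R) F) (A₁ : Matrix (Fin n₁) (Fin R) F)
    (A₂ : Matrix (Fin n₂) (Fin R) F) : Prop :=
  ∀ i j k, T i j k = ∑ r, A₀ i r * A₁ j r * A₂ k r

/-! ### The machine: a random access machine with the logarithmic cost criterion -/

/-- A configuration: registers (addressed only by constants of the program) and a random access
memory (addressed indirectly, through registers). All but finitely many cells hold `0`. -/
structure State where
  reg : ℕ →₀ ℕ
  mem : ℕ →₀ ℕ

/-- The number of bits in use: for each nonzero register or memory cell, the binary length of its
address plus that of its content. -/
def State.space (s : State) : ℕ :=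
  (s.reg.sum fun i v => Nat.size i + Nat.size v) + (s.mem.sum fun i v => Nat.size i + Nat.size v)

/-- Elementary instructions. -/
inductive Instr where
  /-- `reg d := c` -/
  | const (d c : ℕ)
  /-- `reg d := reg a + reg b` -/
  | add (d a b : ℕ)
  /-- `reg d := max (reg a - reg b) 0` -/
  | sub (d a b : ℕ)
  /-- `reg d := reg a * reg b` -/
  | mul (d a b : ℕ)
  /-- `reg d := mem (reg a)` -/
  | load (d a : ℕ)
  /-- `mem (reg a) := reg b` -/
  | store (a b : ℕ)

/-- The effect of an instruction. -/
noncomputable def Instr.run : Instr → State → State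
  | .const d c, s => ⟨s.reg.update d c, s.mem⟩
  | .add d a b, s => ⟨s.reg.update d (s.reg a + s.reg b), s.mem⟩
  | .sub d a b, s => ⟨s.reg.update d (s.reg a - s.reg b), s.mem⟩
  | .mul d a b, s => ⟨s.reg.update d (s.reg a * s.reg b), s.mem⟩
  | .load d a, s => ⟨s.reg.update d (s.mem (s.reg a)), s.mem⟩
  | .store a b, s => ⟨s.reg, s.mem.update (s.reg a) (s.reg b)⟩

/-- Logarithmic cost: one plus the binary lengths of the numbers that the instruction reads
(addresses included). -/
def Instr.cost : Instr → State → ℕ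
  | .const _ c, _ => 1 + Nat.size c
  | .add _ a b, s => 1 + Nat.size (s.reg a) + Nat.size (s.reg b)
  | .sub _ a b, s => 1 + Nat.size (s.reg a) + Nat.size (s.reg b)
  | .mul _ a b, s => 1 + Nat.size (s.reg a) + Nat.size (s.reg b)
  | .load _ a, s => 1 + Nat.size (s.reg a) + Nat.size (s.mem (s.reg a))
  | .store a b, s => 1 + Nat.size (s.reg a) + Nat.size (s.reg b)

/-- Programs, with structured control flow. -/
inductive Prog where
  /-- do nothing -/
  | skip
  /-- a single instruction -/
  | instr (i : Instr)
  /-- first `p`, then `q` -/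
  | seq (p q : Prog)
  /-- if `reg a < reg b` then `p` else `q` -/
  | branch (a b : ℕ) (p q : Prog)
  /-- while `reg a < reg b` do `p` -/
  | loop (a b : ℕ) (p : Prog)

/-- The cost of the test `reg a < reg b`. -/
def testCost (a b : ℕ) (s : State) : ℕ := 1 + Nat.size (s.reg a) + Nat.size (s.reg b)

/-- `Exec p s s' t m`: started in `s`, the program `p` halts in `s'`; the run takes time `t`, and
the largest space of a configuration that occurs in it is `m`. -/
inductive Exec : Prog → State → State → ℕ → ℕ → Prop where
  | skip (s : State) : Exec .skip s s 1 s.space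
  | instr (i : Instr) (s : State) :
      Exec (.instr i) s (i.run s) (i.cost s) (max s.space (i.run s).space)
  | seq {p q : Prog} {s s' s'' : State} {t t' m m' : ℕ} :
      Exec p s s' t m → Exec q s' s'' t' m' → Exec (.seq p q) s s'' (t + t') (max m m')
  | branch_true {a b : ℕ} {p q : Prog} {s s' : State} {t m : ℕ} :
      s.reg a < s.reg b → Exec p s s' t m → Exec (.branch a b p q) s s' (testCost a b s + t) m
  | branch_false {a b : ℕ} {p q : Prog} {s s' : State} {t m : ℕ} :
      ¬ s.reg a < s.reg b → Exec q s s' t m → Exec (.branch a b p q) s s' (testCost a b s + t) m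
  | loop_true {a b : ℕ} {p : Prog} {s s' s'' : State} {t t' m m' : ℕ} :
      s.reg a < s.reg b → Exec p s s' t m → Exec (.loop a b p) s' s'' t' m' →
      Exec (.loop a b p) s s'' (testCost a b s + t + t') (max m m')
  | loop_false {a b : ℕ} {p : Prog} {s : State} :
      ¬ s.reg a < s.reg b → Exec (.loop a b p) s s (testCost a b s) s.space

/-! ### Input and output -/

/-- The entries of a matrix in row-major order, an element `x` of `F` being written as the number
`code x < q`. -/
def encodeMatrix {F : Type*} {q m n : ℕ} (code : F ≃ Fin q) (A : Matrix (Fin m) (Fin n) F) :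
    List ℕ :=
  List.ofFn fun x : Fin (m * n) => (code (A x.divNat x.modNat) : ℕ)

/-- The entries of a tensor in row-major order. -/
def encodeTensor {F : Type*} {q n₀ n₁ n₂ : ℕ} (code : F ≃ Fin q) (T : Tensor3 F n₀ n₁ n₂) :
    List ℕ :=
  List.ofFn fun x : Fin (n₀ * (n₁ * n₂)) =>
    (code (T x.divNat x.modNat.divNat x.modNat.modNat) : ℕ)

/-- The input: `q = |F|`, the dimensions, the rank threshold, the addition table and the
multiplication table of `F` (row by row), and the entries of `T`. -/
def encodeInput {F : Type*} [Field F] {q n₀ n₁ n₂ : ℕ} (code : F ≃ Fin q) (R : ℕ)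
    (T : Tensor3 F n₀ n₁ n₂) : List ℕ :=
  [q, n₀, n₁, n₂, R] ++
  encodeMatrix code (Matrix.of fun a b : Fin q => code.symm a + code.symm b) ++
  encodeMatrix code (Matrix.of fun a b : Fin q => code.symm a * code.symm b) ++
  encodeTensor code T

/-- The initial configuration on a list of numbers: the list is in the memory from address `0` on,
everything else is `0`. -/
def State.init (l : List ℕ) : State := ⟨0, l.toFinsupp⟩

/-- The memory starts with the list `l`. -/
def State.Outputs (s : State) (l : List ℕ) : Prop :=
  ∀ (j : ℕ) (h : j < l.length), s.mem j = l[j]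

/-- The configuration `s` holds a correct answer to the problem of finding a rank-`R` CPD of `T`:
it shows `1` and the factor matrices of such a CPD, or it shows `0` and there is none. -/
def Solves {F : Type*} [Field F] {q n₀ n₁ n₂ : ℕ} (code : F ≃ Fin q) (R : ℕ)
    (T : Tensor3 F n₀ n₁ n₂) (s : State) : Prop :=
  (∃ (A₀ : Matrix (Fin n₀) (Fin R) F) (A₁ : Matrix (Fin n₁) (Fin R) F)
      (A₂ : Matrix (Fin n₂) (Fin R) F), IsCPD T A₀ A₁ A₂ ∧
      s.Outputs (1 :: (encodeMatrix code A₀ ++ encodeMatrix code A₁ ++ encodeMatrix code A₂))) ∨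
  ((¬ ∃ (A₀ : Matrix (Fin n₀) (Fin R) F) (A₁ : Matrix (Fin n₁) (Fin R) F)
      (A₂ : Matrix (Fin n₂) (Fin R) F), IsCPD T A₀ A₁ A₂) ∧ s.Outputs [0])

/-! ### The exponent -/

/-- `r_* = ⌊R / n₀⌋ + 1` -/
def rStar (n₀ R : ℕ) : ℕ := R / n₀ + 1

/-- `n₀ + n₂ + max 0 ((R - n₀ + 1 - r_*) (n₁ + n₂) + r_*²)`. The maximum makes a difference only
when `R - n₀ + 1 < r_*`, that is, for `n₀ ≥ 2`, only when `R ≤ n₀`. -/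
def exponent (n₀ n₁ n₂ R : ℕ) : ℕ :=
  n₀ + n₂ +
    (((R : ℤ) - n₀ + 1 - rStar n₀ R) * ((n₁ : ℤ) + n₂) + (rStar n₀ R : ℤ) ^ 2).toNat

end TensorCPD

namespace TensorCPD

/-! ### Runs with uniform bounds -/

/-! Cut the tensor along its first axis into slices `S_i`, which are matrices of shape `n₁ × n₂`. A
rank-`R` CPD exists exactly if some `R` rank-one matrices have all slices in their span; given these
matrices, the coefficients `A₀` come from linear equations (`check_spec`). So only the rank-one
matrices have to be found. Put `ρ = ⌊R/n₀⌋`, so that `r_* = ρ + 1`.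

Case 1: the coefficient vectors whose combinations of slices have rank at most `ρ` span `F^n₀`. Then
`n₀` independent ones, each combination being written with `ρ` rank-one matrices, use `n₀ρ ≤ R`
rank-one matrices that generate all slices. Running through the `|F|^n₀` coefficient vectors finds
them (`record_spec`, `lowRank_spec`).

Case 2: they do not. Take any CPD. The slices are independent, so `A₀` has full row rank, and after
a change of basis of the slices `n₀` of its columns are unit vectors (`exists_pivots`). Some new
slice has rank `r > ρ`. Its coefficients vanish at the pivots of the other `n₀ - 1` new slices, so
it is a combination of `K = R - n₀ + 1` rank-one terms, and a Cauchy–Binet argument selects `r` of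
them whose sum still has rank `r` (`exists_subset_rank_eq`). The search guesses the coefficients of
this combination of slices (`n₀` elements), the other `K - r` rank-one matrices (`n₁ + n₂` elements
each), and how many of these really occur in the combination. Subtracting them leaves a matrix of
rank `r` that is a sum of exactly `r` rank-one matrices, that is, a product `P X` where the columns
of `P` form a basis of its column space. Relative to one fixed basis `P` is an `r × r` matrix, which
is guessed too, and then `X` is determined (`dualize_spec`). In all `n₀ + (K - r)(n₁ + n₂) + r²`
elements are guessed, a number that decreases in `r` up to `min n₁ n₂`, so that `r = r_*` is the
worst case (`le_params_size`).

The remaining `n₀ - 1` terms need no guess. Let `L` be the span of the `K` matrices obtained so far.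
Each missing term is a rank-one matrix in `L + ⟨S_i⟩` (`exists_structured_combination`), and this
space has dimension at most `dim L + n₀ - 1`, because a nontrivial combination of slices lies in `L`
(`finrank_sup_span_lt`). Hence it is enough to add independent rank-one matrices of this space
greedily, and at most `n₀ - 1 = R - K` are added. For each of the `|F|^n₂` vectors `b`, the vectors
`a` such that `a ⊗ b` lies in the space form a linear space (`grow_spec`, `complete_spec`). This
accounts for the factor `|F|^n₂`.

The algorithm is written in a small imperative language with a mathematical meaning (`Cmd.den`) and
a compiler to the machine; `Cmd.run` carries meaning, time and space over. Subspaces are stored as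
generators of their annihilators, which division-free elimination keeps up to date (`addEq_ann`). A
positive answer is always verified by solving for the coefficients, so wrong guesses do no harm.
Polynomially many cells are used, each holding a number with polynomially many bits.

The bound on factorizations `M = U V` is independent of this. Choose `r` independent columns of `M`.
There are `|F|^(k r)` choices for the corresponding columns of `V`; they have rank at least `r`,
which leaves at most `|F|^((k-r) m)` matrices `U`; these have rank at least `r` as well, which
leaves at most `|F|^((k-r)(n-r))` choices for the other columns of `V`. -/

/-- Uniform bounds on the configurations of a run: `V` bounds all contents, registers from `Z` on and
memory cells from `W` on are unused. -/
structure Bounds where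
  V : ℕ
  Z : ℕ
  W : ℕ

/-- The configuration respects the bounds. -/
structure Bdd (B : Bounds) (s : State) : Prop where
  reg : ∀ i, s.reg i ≤ B.V
  regz : ∀ i, B.Z ≤ i → s.reg i = 0
  mem : ∀ i, s.mem i ≤ B.V
  memz : ∀ i, B.W ≤ i → s.mem i = 0

/-- A bound on the logarithmic cost of an elementary step. -/
def Bounds.unit (B : Bounds) : ℕ := 1 + 2 * Nat.size B.V

/-- A bound on the space of a configuration. -/
def Bounds.space (B : Bounds) : ℕ :=
  B.Z * (Nat.size B.Z + Nat.size B.V) + B.W * (Nat.size B.W + Nat.size B.V)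

lemma finsupp_space_le (f : ℕ →₀ ℕ) (Z V : ℕ) (h1 : ∀ i, f i ≤ V) (h2 : ∀ i, Z ≤ i → f i = 0) :
    (f.sum fun i v => Nat.size i + Nat.size v) ≤ Z * (Nat.size Z + Nat.size V) := by
  have hs : f.support ⊆ Finset.range Z := by
    intro i hi
    rw [Finset.mem_range]
    by_contra hc
    exact (Finsupp.mem_support_iff.mp hi) (h2 i (not_lt.mp hc))
  calc (f.sum fun i v => Nat.size i + Nat.size v)
      ≤ ∑ _i ∈ f.support, (Nat.size Z + Nat.size V) := by
        refine Finset.sum_le_sum fun i hi => ?_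
        have := Finset.mem_range.mp (hs hi)
        exact Nat.add_le_add (Nat.size_le_size this.le) (Nat.size_le_size (h1 i))
    _ ≤ Z * (Nat.size Z + Nat.size V) := by
        rw [Finset.sum_const, smul_eq_mul]
        exact Nat.mul_le_mul_right _ (by simpa using Finset.card_le_card hs)

lemma Bdd.space_le {B : Bounds} {s : State} (h : Bdd B s) : s.space ≤ B.space :=
  Nat.add_le_add (finsupp_space_le _ _ _ h.reg h.regz) (finsupp_space_le _ _ _ h.mem h.memz)

/-- The program `p` leads from `s` to `s'` in at most `n` elementary steps, within the bounds. -/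
def Run (B : Bounds) (p : Prog) (s s' : State) (n : ℕ) : Prop :=
  Bdd B s' ∧ ∃ t m, Exec p s s' t m ∧ t ≤ n * B.unit ∧ m ≤ B.space

lemma Run.mono {B : Bounds} {p : Prog} {s s' : State} {n n' : ℕ} (h : Run B p s s' n)
    (hn : n ≤ n') : Run B p s s' n' := by
  obtain ⟨h1, t, m, h2, h3, h4⟩ := h
  exact ⟨h1, t, m, h2, h3.trans (Nat.mul_le_mul_right _ hn), h4⟩

lemma Run.seq {B : Bounds} {p q : Prog} {s s' s'' : State} {n n' : ℕ} (h : Run B p s s' n)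
    (h' : Run B q s' s'' n') : Run B (.seq p q) s s'' (n + n') := by
  obtain ⟨_, t, m, h2, h3, h4⟩ := h
  obtain ⟨h1', t', m', h2', h3', h4'⟩ := h'
  exact ⟨h1', _, _, .seq h2 h2', by rw [add_mul]; omega, max_le h4 h4'⟩

lemma Run.skip {B : Bounds} {s : State} (h : Bdd B s) : Run B .skip s s 1 :=
  ⟨h, _, _, .skip s, by simp [Bounds.unit], h.space_le⟩

lemma testCost_le {B : Bounds} {s : State} (h : Bdd B s) (a b : ℕ) : testCost a b s ≤ B.unit := by
  have h1 := Nat.size_le_size (h.reg a)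
  have h2 := Nat.size_le_size (h.reg b)
  simp only [testCost, Bounds.unit]
  omega

lemma Run.branch_true {B : Bounds} {a b : ℕ} {p q : Prog} {s s' : State} {n : ℕ} (hs : Bdd B s)
    (h : s.reg a < s.reg b) (hp : Run B p s s' n) : Run B (.branch a b p q) s s' (n + 1) := by
  obtain ⟨h1, t, m, h2, h3, h4⟩ := hp
  refine ⟨h1, _, _, .branch_true h h2, ?_, h4⟩
  have := testCost_le hs a b
  rw [add_mul]; omega

lemma Run.branch_false {B : Bounds} {a b : ℕ} {p q : Prog} {s s' : State} {n : ℕ} (hs : Bdd B s)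
    (h : ¬ s.reg a < s.reg b) (hp : Run B q s s' n) : Run B (.branch a b p q) s s' (n + 1) := by
  obtain ⟨h1, t, m, h2, h3, h4⟩ := hp
  refine ⟨h1, _, _, .branch_false h h2, ?_, h4⟩
  have := testCost_le hs a b
  rw [add_mul]; omega

/-- Counting loops. -/
lemma run_loop {B : Bounds} {a b : ℕ} {p : Prog} {n c : ℕ} (Inv : ℕ → State → Prop)
    (hreg : ∀ i s, Inv i s → Bdd B s ∧ s.reg b = n ∧ s.reg a = i)
    (hstep : ∀ i s, i < n → Inv i s → ∃ s', Run B p s s' c ∧ Inv (i + 1) s')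
    {i : ℕ} {s : State} (hi : i ≤ n) (hs : Inv i s) :
    ∃ s', Run B (.loop a b p) s s' ((n - i) * (c + 1) + 1) ∧ Inv n s' := by
  -- Induction on the number `k` of rounds that remain. Each round pays one unit for its test, and
  -- the failing last test is the extra `1`.
  obtain ⟨k, rfl⟩ := Nat.exists_eq_add_of_le hi
  clear hi
  induction k generalizing i s with
  | zero =>
    obtain ⟨h1, h2, h3⟩ := hreg _ _ hs
    refine ⟨s, ⟨h1, _, _, .loop_false (by omega), ?_, h1.space_le⟩, hs⟩
    have := testCost_le h1 a b
    simpa using this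
  | succ k ih =>
    obtain ⟨h1, h2, h3⟩ := hreg _ _ hs
    obtain ⟨s1, ⟨_, t, m, e1, e2, e3⟩, hs1⟩ := hstep i s (by omega) hs
    have he : i + 1 + k = i + (k + 1) := by omega
    obtain ⟨s2, ⟨g1, t', m', g2, g3, g4⟩, hs2⟩ := ih (i := i + 1) (s := s1)
      hs1 (by rwa [he]) (by rwa [he])
    refine ⟨s2, ⟨g1, _, _, .loop_true (by omega) e1 g2, ?_, max_le e3 g4⟩, by rwa [← he]⟩
    have := testCost_le h1 a b
    have e4 : i + 1 + k - (i + 1) = k := by omega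
    have e5 : i + (k + 1) - i = k + 1 := by omega
    rw [e4] at g3
    rw [e5]
    nlinarith

/-! ### Elementary instructions -/

/-- Overwriting a register. -/
noncomputable def State.set (s : State) (d v : ℕ) : State := ⟨s.reg.update d v, s.mem⟩

/-- Overwriting a memory cell. -/
noncomputable def State.put (s : State) (d v : ℕ) : State := ⟨s.reg, s.mem.update d v⟩

@[simp] lemma State.set_reg (s : State) (d v i : ℕ) :
    (s.set d v).reg i = if i = d then v else s.reg i := by
  simp [State.set, Finsupp.update_apply]

@[simp] lemma State.set_mem (s : State) (d v : ℕ) : (s.set d v).mem = s.mem := rfl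

@[simp] lemma State.put_mem (s : State) (d v i : ℕ) :
    (s.put d v).mem i = if i = d then v else s.mem i := by
  simp [State.put, Finsupp.update_apply]

@[simp] lemma State.put_reg (s : State) (d v : ℕ) : (s.put d v).reg = s.reg := rfl

lemma State.ext' {s s' : State} (h : ∀ i, s.reg i = s'.reg i) (h' : s.mem = s'.mem) : s = s' := by
  cases s; cases s'
  simp only [State.mk.injEq]
  exact ⟨Finsupp.ext h, h'⟩

lemma Bdd.set {B : Bounds} {s : State} (h : Bdd B s) {d v : ℕ} (hd : d < B.Z) (hv : v ≤ B.V) :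
    Bdd B (s.set d v) := by
  refine ⟨fun i => ?_, fun i hi => ?_, h.mem, h.memz⟩
  · rw [State.set_reg]; split_ifs
    · exact hv
    · exact h.reg i
  · rw [State.set_reg, if_neg (by omega)]; exact h.regz i hi

lemma Bdd.put {B : Bounds} {s : State} (h : Bdd B s) {d v : ℕ} (hd : d < B.W) (hv : v ≤ B.V) :
    Bdd B (s.put d v) := by
  refine ⟨h.reg, h.regz, fun i => ?_, fun i hi => ?_⟩
  · rw [State.put_mem]; split_ifs
    · exact hv
    · exact h.mem i
  · rw [State.put_mem, if_neg (by omega)]; exact h.memz i hi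

/-- The target register of an instruction is among the first `Z`. -/
def Instr.maxReg : Instr → ℕ
  | .const d _ => d + 1
  | .add d _ _ => d + 1
  | .sub d _ _ => d + 1
  | .mul d _ _ => d + 1
  | .load d _ => d + 1
  | .store _ _ => 0

/-- A number above all registers that the program writes. -/
def Prog.maxReg : Prog → ℕ
  | .skip => 0
  | .instr i => i.maxReg
  | .seq p q => max p.maxReg q.maxReg
  | .branch _ _ p q => max p.maxReg q.maxReg
  | .loop _ _ p => p.maxReg

lemma run_const {B : Bounds} {s : State} (h : Bdd B s) {d c : ℕ} (hd : d < B.Z) (hc : c ≤ B.V) :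
    Run B (.instr (.const d c)) s (s.set d c) 1 := by
  have h' := h.set hd hc
  refine ⟨h', _, _, .instr _ _, ?_, max_le h.space_le h'.space_le⟩
  have := Nat.size_le_size hc
  simp only [Instr.cost, Bounds.unit]; omega

lemma run_add {B : Bounds} {s : State} (h : Bdd B s) {d a b : ℕ} (hd : d < B.Z)
    (hc : s.reg a + s.reg b ≤ B.V) :
    Run B (.instr (.add d a b)) s (s.set d (s.reg a + s.reg b)) 1 := by
  have h' := h.set hd hc
  refine ⟨h', _, _, .instr _ _, ?_, max_le h.space_le h'.space_le⟩
  have h1 := Nat.size_le_size (h.reg a)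
  have h2 := Nat.size_le_size (h.reg b)
  simp only [Instr.cost, Bounds.unit]; omega

lemma run_sub {B : Bounds} {s : State} (h : Bdd B s) {d a b : ℕ} (hd : d < B.Z) :
    Run B (.instr (.sub d a b)) s (s.set d (s.reg a - s.reg b)) 1 := by
  have h' := h.set (v := s.reg a - s.reg b) hd ((Nat.sub_le _ _).trans (h.reg a))
  refine ⟨h', _, _, .instr _ _, ?_, max_le h.space_le h'.space_le⟩
  have h1 := Nat.size_le_size (h.reg a)
  have h2 := Nat.size_le_size (h.reg b)
  simp only [Instr.cost, Bounds.unit]; omega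

lemma run_mul {B : Bounds} {s : State} (h : Bdd B s) {d a b : ℕ} (hd : d < B.Z)
    (hc : s.reg a * s.reg b ≤ B.V) :
    Run B (.instr (.mul d a b)) s (s.set d (s.reg a * s.reg b)) 1 := by
  have h' := h.set hd hc
  refine ⟨h', _, _, .instr _ _, ?_, max_le h.space_le h'.space_le⟩
  have h1 := Nat.size_le_size (h.reg a)
  have h2 := Nat.size_le_size (h.reg b)
  simp only [Instr.cost, Bounds.unit]; omega

lemma run_load {B : Bounds} {s : State} (h : Bdd B s) {d a : ℕ} (hd : d < B.Z) :
    Run B (.instr (.load d a)) s (s.set d (s.mem (s.reg a))) 1 := by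
  have h' := h.set (v := s.mem (s.reg a)) hd (h.mem _)
  refine ⟨h', _, _, .instr _ _, ?_, max_le h.space_le h'.space_le⟩
  have h1 := Nat.size_le_size (h.reg a)
  have h2 := Nat.size_le_size (h.mem (s.reg a))
  simp only [Instr.cost, Bounds.unit]; omega

lemma run_store {B : Bounds} {s : State} (h : Bdd B s) {a b : ℕ} (hd : s.reg a < B.W) :
    Run B (.instr (.store a b)) s (s.put (s.reg a) (s.reg b)) 1 := by
  have h' := h.put (v := s.reg b) hd (h.reg _)
  refine ⟨h', _, _, .instr _ _, ?_, max_le h.space_le h'.space_le⟩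
  have h1 := Nat.size_le_size (h.reg a)
  have h2 := Nat.size_le_size (h.reg b)
  simp only [Instr.cost, Bounds.unit]; omega

/-- Copying a register. -/
def mov (d a : ℕ) : Prog := .seq (.instr (.const d 0)) (.instr (.add d d a))

/-- The target is cleared before the source is added to it, so the two registers must differ. -/
lemma run_mov {B : Bounds} {s : State} (h : Bdd B s) {d a : ℕ} (hd : d < B.Z) (ha : a ≠ d) :
    Run B (mov d a) s (s.set d (s.reg a)) 2 := by
  have h1 := run_const h hd (Nat.zero_le _)
  have h2 := run_add (d := d) (a := d) (b := a) h1.1 hd (by simpa [ha] using h.reg a)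
  have h3 := h1.seq h2
  have e : s.set d (s.reg a) =
      (s.set d 0).set d ((s.set d 0).reg d + (s.set d 0).reg a) := by
    refine State.ext' (fun i => ?_) rfl
    simp only [State.set_reg, ha, if_true, if_false, zero_add]
    split_ifs <;> rfl
  rw [e]
  exact h3

end TensorCPD

/-! ### A small imperative language and the correctness of its compilation to the machine. -/

namespace TensorCPD

/-! ### Index expressions -/

/-- Expressions for natural numbers: constants, parameters, loop variables, and variables. -/
inductive NExpr where
  | const (c : ℕ)
  | par (i : ℕ)
  | bv (i : ℕ)
  | nv (i : ℕ)
  | add (a b : NExpr)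
  | sub (a b : NExpr)
  | mul (a b : NExpr)

namespace NExpr

/-- The value of an index expression. -/
@[simp] def eval (π ρ ν : ℕ → ℕ) : NExpr → ℕ
  | const c => c
  | par i => π i
  | bv i => ρ i
  | nv i => ν i
  | add a b => a.eval π ρ ν + b.eval π ρ ν
  | sub a b => a.eval π ρ ν - b.eval π ρ ν
  | mul a b => a.eval π ρ ν * b.eval π ρ ν

/-- An exponent that bounds the growth of the value. -/
def sz : NExpr → ℕ
  | const c => c + 1
  | par _ => 1
  | bv _ => 1
  | nv _ => 1
  | add a b => a.sz + b.sz
  | sub a b => a.sz + b.sz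
  | mul a b => a.sz + b.sz

/-- The number of elementary steps for the evaluation. -/
def steps : NExpr → ℕ
  | const _ => 1
  | par _ => 2
  | bv _ => 2
  | nv _ => 2
  | add a b => a.steps + b.steps + 1
  | sub a b => a.steps + b.steps + 1
  | mul a b => a.steps + b.steps + 1

/-- Only loop variables in `Γ` occur. -/
def wf (Γ : List ℕ) : NExpr → Bool
  | const _ => true
  | par _ => true
  | bv i => decide (i ∈ Γ)
  | nv _ => true
  | add a b => a.wf Γ && b.wf Γ
  | sub a b => a.wf Γ && b.wf Γ
  | mul a b => a.wf Γ && b.wf Γ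

/-- The code that leaves the value in the temporary register `t`. -/
def compile : NExpr → ℕ → Prog
  -- Registers are interleaved modulo `5`: temporaries at `5 * t`, parameters at `5 * i + 1`, loop
  -- variables at `5 * i + 2`, numeric variables at `5 * i + 3`, field variables at `5 * i + 4`.
  -- Disjointness is then linear arithmetic. Temporaries form a stack growing from `t`.
  | const c, t => .instr (.const (5 * t) c)
  | par i, t => mov (5 * t) (5 * i + 1)
  | bv i, t => mov (5 * t) (5 * i + 2)
  | nv i, t => mov (5 * t) (5 * i + 3)
  | add a b, t => .seq (.seq (a.compile t) (b.compile (t + 1)))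
      (.instr (.add (5 * t) (5 * t) (5 * (t + 1))))
  | sub a b, t => .seq (.seq (a.compile t) (b.compile (t + 1)))
      (.instr (.sub (5 * t) (5 * t) (5 * (t + 1))))
  | mul a b, t => .seq (.seq (a.compile t) (b.compile (t + 1)))
      (.instr (.mul (5 * t) (5 * t) (5 * (t + 1))))

/-- The minimum of an expression and a parameter. -/
def cap (e : NExpr) (p : ℕ) : NExpr := sub e (sub e (par p))

-- Cutting off indices keeps every address inside its region whatever the variables hold, so memory
-- safety of compiled code needs no knowledge about index values.
@[simp] lemma eval_cap (π ρ ν : ℕ → ℕ) (e : NExpr) (p : ℕ) :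
    (e.cap p).eval π ρ ν = min (e.eval π ρ ν) (π p) := by
  simp only [cap, eval]; omega

lemma sz_pos (e : NExpr) : 1 ≤ e.sz := by
  induction e <;> simp [sz] <;> omega

/-- The base `M + 2` is at least `2`, so a constant `c` is below `2 ^ (c + 1)`, and for two powers
that are at least `2` the sum is at most the product. One exponent per expression therefore serves
sums and products alike. -/
lemma eval_le {π ρ ν : ℕ → ℕ} {Γ : List ℕ} {M : ℕ} (hπ : ∀ i, π i ≤ M) (hρ : ∀ i ∈ Γ, ρ i ≤ M)
    (hν : ∀ i, ν i ≤ M) (e : NExpr) (hw : e.wf Γ) : e.eval π ρ ν ≤ (M + 2) ^ e.sz := by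
  induction e with
  | const c =>
    simp only [eval, sz]
    have := (Nat.lt_two_pow_self (n := c + 1)).le
    exact (Nat.le_succ c).trans (this.trans (Nat.pow_le_pow_left (by omega) _))
  | par i => simpa [sz] using (hπ i).trans (by omega)
  | bv i =>
    simp only [wf, decide_eq_true_eq] at hw
    simpa [sz] using (hρ i hw).trans (by omega)
  | nv i => simpa [sz] using (hν i).trans (by omega)
  | add a b iha ihb =>
    simp only [wf, Bool.and_eq_true] at hw
    have h1 := iha hw.1
    have h2 := ihb hw.2
    simp only [eval, sz, pow_add]
    have h3 : 2 ≤ (M + 2) ^ a.sz :=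
      (by omega : 2 ≤ M + 2).trans (Nat.le_self_pow (by have := a.sz_pos; omega) _)
    have h4 : 2 ≤ (M + 2) ^ b.sz :=
      (by omega : 2 ≤ M + 2).trans (Nat.le_self_pow (by have := b.sz_pos; omega) _)
    nlinarith
  | sub a b iha ihb =>
    simp only [wf, Bool.and_eq_true] at hw
    have h1 := iha hw.1
    simp only [eval, sz]
    exact ((Nat.sub_le _ _).trans h1).trans (Nat.pow_le_pow_right (by omega) (by omega))
  | mul a b iha ihb =>
    simp only [wf, Bool.and_eq_true] at hw
    simp only [eval, sz, pow_add]
    exact Nat.mul_le_mul (iha hw.1) (ihb hw.2)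

end NExpr

/-- Everything except temporaries from `t` on and loop registers outside `Γ` is unchanged. -/
structure Frame (Γ : List ℕ) (t : ℕ) (s s' : State) : Prop where
  mem : s'.mem = s.mem
  tmp : ∀ i < t, s'.reg (5 * i) = s.reg (5 * i)
  par : ∀ i, s'.reg (5 * i + 1) = s.reg (5 * i + 1)
  bv : ∀ i ∈ Γ, s'.reg (5 * i + 2) = s.reg (5 * i + 2)
  nv : ∀ i, s'.reg (5 * i + 3) = s.reg (5 * i + 3)
  fv : ∀ i, s'.reg (5 * i + 4) = s.reg (5 * i + 4)

namespace Frame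

lemma trans {Γ Γ' : List ℕ} {t t' : ℕ} {s s' s'' : State} (h : Frame Γ t s s') (h' : Frame Γ' t' s' s'')
    (hd : Γ ⊆ Γ') (ht : t ≤ t') : Frame Γ t s s'' :=
  ⟨h'.mem.trans h.mem, fun i hi => (h'.tmp i (by omega)).trans (h.tmp i hi),
    fun i => (h'.par i).trans (h.par i), fun i hi => (h'.bv i (hd hi)).trans (h.bv i hi),
    fun i => (h'.nv i).trans (h.nv i), fun i => (h'.fv i).trans (h.fv i)⟩

lemma set_tmp (Γ : List ℕ) {t t' : ℕ} (s : State) (v : ℕ) (h : t ≤ t') :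
    Frame Γ t s (s.set (5 * t') v) := by
  refine ⟨rfl, ?_, ?_, ?_, ?_, ?_⟩ <;> intro i <;> intros <;> rw [State.set_reg, if_neg] <;> omega

lemma set_bv {Γ : List ℕ} {x : ℕ} (t : ℕ) (s : State) (v : ℕ) (h : x ∉ Γ) :
    Frame Γ t s (s.set (5 * x + 2) v) := by
  refine ⟨rfl, ?_, ?_, fun i hi => ?_, ?_, ?_⟩
  · intro i _; rw [State.set_reg, if_neg]; omega
  · intro i; rw [State.set_reg, if_neg]; omega
  · have : i ≠ x := fun hx => h (hx ▸ hi)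
    rw [State.set_reg, if_neg]; omega
  · intro i; rw [State.set_reg, if_neg]; omega
  · intro i; rw [State.set_reg, if_neg]; omega

end Frame

/-- The registers of `s` hold the parameters, loop variables in `Γ`, and variables, all of them
at most `M`. -/
structure NRel (π ρ ν : ℕ → ℕ) (Γ : List ℕ) (M : ℕ) (s : State) : Prop where
  par : ∀ i, s.reg (5 * i + 1) = π i
  bv : ∀ i ∈ Γ, s.reg (5 * i + 2) = ρ i
  nv : ∀ i, s.reg (5 * i + 3) = ν i
  parM : ∀ i, π i ≤ M
  bvM : ∀ i ∈ Γ, ρ i ≤ M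
  nvM : ∀ i, ν i ≤ M

lemma NRel.frame {π ρ ν : ℕ → ℕ} {Γ : List ℕ} {t M : ℕ} {s s' : State} (h : NRel π ρ ν Γ M s)
    (hf : Frame Γ t s s') : NRel π ρ ν Γ M s' :=
  ⟨fun i => (hf.par i).trans (h.par i), fun i hi => (hf.bv i hi).trans (h.bv i hi),
    fun i => (hf.nv i).trans (h.nv i), h.parM, h.bvM, h.nvM⟩

/-- The code of an index expression is correct. -/
lemma NExpr.run {B : Bounds} {π ρ ν : ℕ → ℕ} {Γ : List ℕ} {M : ℕ} (e : NExpr) {t : ℕ} {s : State}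
    (hB : Bdd B s) (h : NRel π ρ ν Γ M s) (hw : e.wf Γ) (hV : (M + 2) ^ e.sz ≤ B.V)
    (hZ : (e.compile t).maxReg ≤ B.Z) :
    ∃ s', Run B (e.compile t) s s' e.steps ∧ s'.reg (5 * t) = e.eval π ρ ν ∧ Frame Γ t s s' := by
  induction e generalizing t s with
  | const c =>
    simp only [compile, Prog.maxReg, Instr.maxReg] at hZ
    refine ⟨_, run_const hB (by omega) ?_, by simp, Frame.set_tmp _ _ _ le_rfl⟩
    have := NExpr.eval_le h.parM h.bvM h.nvM (NExpr.const c) hw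
    exact this.trans hV
  | par i =>
    simp only [compile, mov, Prog.maxReg, Instr.maxReg] at hZ
    refine ⟨_, run_mov hB (by omega) (by omega), by simp [h.par], Frame.set_tmp _ _ _ le_rfl⟩
  | bv i =>
    simp only [compile, mov, Prog.maxReg, Instr.maxReg] at hZ
    simp only [wf, decide_eq_true_eq] at hw
    refine ⟨_, run_mov hB (by omega) (by omega), by simp [h.bv i hw], Frame.set_tmp _ _ _ le_rfl⟩
  | nv i =>
    simp only [compile, mov, Prog.maxReg, Instr.maxReg] at hZ
    refine ⟨_, run_mov hB (by omega) (by omega), by simp [h.nv], Frame.set_tmp _ _ _ le_rfl⟩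
  | add a b iha ihb =>
    simp only [compile, Prog.maxReg, Instr.maxReg] at hZ
    have hle := (NExpr.eval_le h.parM h.bvM h.nvM _ hw).trans hV
    simp only [wf, Bool.and_eq_true] at hw
    have hp : ∀ k, k ≤ a.sz + b.sz → (M + 2) ^ k ≤ B.V := fun k hk =>
      (Nat.pow_le_pow_right (by omega) hk).trans hV
    obtain ⟨s1, r1, v1, f1⟩ := iha hB h hw.1 (hp _ (by omega)) (t := t) (by omega)
    obtain ⟨s2, r2, v2, f2⟩ := ihb r1.1 (h.frame f1) hw.2 (hp _ (by omega)) (t := t + 1) (by omega)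
    have v1' : s2.reg (5 * t) = _ := (f2.tmp t (by omega)).trans v1
    refine ⟨_, (r1.seq r2).seq (run_add r2.1 (by omega) ?_), ?_,
      (f1.trans f2 (List.Subset.refl _) (by omega)).trans (Frame.set_tmp _ _ _ le_rfl) (List.Subset.refl _) le_rfl⟩
    · rw [v1', v2]; exact hle
    · simp [v1', v2]
  | sub a b iha ihb =>
    simp only [compile, Prog.maxReg, Instr.maxReg] at hZ
    have hle := (NExpr.eval_le h.parM h.bvM h.nvM _ hw).trans hV
    simp only [wf, Bool.and_eq_true] at hw
    have hp : ∀ k, k ≤ a.sz + b.sz → (M + 2) ^ k ≤ B.V := fun k hk =>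
      (Nat.pow_le_pow_right (by omega) hk).trans hV
    obtain ⟨s1, r1, v1, f1⟩ := iha hB h hw.1 (hp _ (by omega)) (t := t) (by omega)
    obtain ⟨s2, r2, v2, f2⟩ := ihb r1.1 (h.frame f1) hw.2 (hp _ (by omega)) (t := t + 1) (by omega)
    have v1' : s2.reg (5 * t) = _ := (f2.tmp t (by omega)).trans v1
    refine ⟨_, (r1.seq r2).seq (run_sub r2.1 (by omega)), ?_,
      (f1.trans f2 (List.Subset.refl _) (by omega)).trans (Frame.set_tmp _ _ _ le_rfl) (List.Subset.refl _) le_rfl⟩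
    simp [v1', v2]
  | mul a b iha ihb =>
    simp only [compile, Prog.maxReg, Instr.maxReg] at hZ
    have hle := (NExpr.eval_le h.parM h.bvM h.nvM _ hw).trans hV
    simp only [wf, Bool.and_eq_true] at hw
    have hp : ∀ k, k ≤ a.sz + b.sz → (M + 2) ^ k ≤ B.V := fun k hk =>
      (Nat.pow_le_pow_right (by omega) hk).trans hV
    obtain ⟨s1, r1, v1, f1⟩ := iha hB h hw.1 (hp _ (by omega)) (t := t) (by omega)
    obtain ⟨s2, r2, v2, f2⟩ := ihb r1.1 (h.frame f1) hw.2 (hp _ (by omega)) (t := t + 1) (by omega)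
    have v1' : s2.reg (5 * t) = _ := (f2.tmp t (by omega)).trans v1
    refine ⟨_, (r1.seq r2).seq (run_mul r2.1 (by omega) ?_), ?_,
      (f1.trans f2 (List.Subset.refl _) (by omega)).trans (Frame.set_tmp _ _ _ le_rfl) (List.Subset.refl _) le_rfl⟩
    · rw [v1', v2]; exact hle
    · simp [v1', v2]

end TensorCPD

namespace TensorCPD

/-! ### Field expressions -/

/-- Expressions for field elements: variables, entries of two-dimensional arrays, entries of the input
tensor, the element with a given code, the next element, sums and products, iterated sums, and
case distinctions. -/
inductive FExpr where
  | fv (x : ℕ)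
  | arr (A : ℕ) (i j : NExpr)
  | ten (i : NExpr)
  | elt (i : NExpr)
  | next (e : FExpr)
  | add (a b : FExpr)
  | mul (a b : FExpr)
  | sum (x p : ℕ) (e : FExpr)
  | iflt (a b : NExpr) (e e' : FExpr)
  | ifeq (a b : FExpr) (e e' : FExpr)

/-- The variables and arrays of a program. -/
structure HS (F : Type*) where
  nv : ℕ → ℕ
  fv : ℕ → F
  arr : ℕ → ℕ → ℕ → F

/-- The parameters have their intended meaning: number of elements, side of the arrays, and the
positions of the tables and of the tensor below the arrays. -/
structure ParOK (q : ℕ) (π : ℕ → ℕ) : Prop where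
  card : π 0 = q
  side : π 6 = π 5 + 1
  last : π 11 = q - 1
  addTab : π 22 = 5
  mulTab : π 12 = 5 + q * q
  tens : π 9 = 5 + 2 * (q * q)
  high : 5 + 2 * (q * q) + π 10 < π 7

section

variable {F : Type*} [Field F] {q : ℕ} (code : F ≃ Fin q) (π : ℕ → ℕ) (tin : ℕ → F)

/-- The element with code `n` (or `0`). -/
def elem (n : ℕ) : F := if h : n < q then code.symm ⟨n, h⟩ else 0

lemma code_elem {n : ℕ} (h : n < q) : (code (elem code n) : ℕ) = n := by
  simp [elem, h]

lemma elem_code (x : F) : elem code (code x) = x := by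
  simp [elem]

/-- The address of an array entry. -/
def adr (A i j : ℕ) : ℕ := π 7 + ((A * π 6 + i) * π 6 + j)

/-- The address of an array entry, as an expression, with indices cut off. -/
def adrE (A : ℕ) (i j : NExpr) : NExpr :=
  .add (.par 7) (.add (.mul (.add (.mul (.const A) (.par 6)) (i.cap 5)) (.par 6)) (j.cap 5))

/-- The address of an entry of the tensor, as an expression, with index cut off. -/
def adrT (i : NExpr) : NExpr := .add (.par 9) (i.cap 10)

/-- An address is a number in base `π 6` with lower digits `i` and `j`, which are at most `π 5 < π
6`. -/
lemma adr_inj (h6 : π 6 = π 5 + 1) {A i j A' i' j' : ℕ} (hi : i ≤ π 5) (hj : j ≤ π 5)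
    (hi' : i' ≤ π 5) (hj' : j' ≤ π 5) (h : adr π A i j = adr π A' i' j') :
    A = A' ∧ i = i' ∧ j = j' := by
  have key : ∀ a b c d D : ℕ, b < D → d < D → a * D + b = c * D + d → a = c ∧ b = d := by
    intro a b c d D hb hd h
    have h1 : (b + D * a) / D = (d + D * c) / D := by congr 1; linarith
    have hD : 0 < D := by omega
    rw [Nat.add_mul_div_left _ _ hD, Nat.add_mul_div_left _ _ hD, Nat.div_eq_of_lt hb,
      Nat.div_eq_of_lt hd] at h1
    have : a = c := by omega
    subst this
    exact ⟨rfl, by omega⟩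
  unfold adr at h
  obtain ⟨h1, h2⟩ := key _ j _ j' (π 6) (by omega) (by omega) (Nat.add_left_cancel h)
  obtain ⟨h3, h4⟩ := key _ i _ i' (π 6) (by omega) (by omega) h1
  exact ⟨h3, h4, h2⟩

namespace FExpr

/-- The value of a field expression. -/
noncomputable def eval (ρ : ℕ → ℕ) (σ : HS F) : FExpr → F
  | fv x => σ.fv x
  | arr A i j => σ.arr A (min (i.eval π ρ σ.nv) (π 5)) (min (j.eval π ρ σ.nv) (π 5))
  | ten i => tin (min (i.eval π ρ σ.nv) (π 10))
  | elt i => elem code (min (i.eval π ρ σ.nv) (π 11))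
  | next e => elem code (if (code (e.eval ρ σ) : ℕ) + 1 < q then code (e.eval ρ σ) + 1 else 0)
  | add a b => a.eval ρ σ + b.eval ρ σ
  | mul a b => a.eval ρ σ * b.eval ρ σ
  -- The accumulator starts from variable `0`, which is meant to hold the zero of the field: the
  -- input does not tell which code number the zero has.
  | sum x p e => σ.fv 0 + ∑ i ∈ Finset.range (π p), e.eval (Function.update ρ x i) σ
  | iflt a b e e' => if a.eval π ρ σ.nv < b.eval π ρ σ.nv then e.eval ρ σ else e'.eval ρ σ
  | ifeq a b e e' => open Classical in
      if a.eval ρ σ = b.eval ρ σ then e.eval ρ σ else e'.eval ρ σ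

/-- An exponent that bounds the numbers that occur in the evaluation. -/
def sz : FExpr → ℕ
  | fv _ => 1
  | arr A i j => (adrE A i j).sz
  | ten i => (adrT i).sz
  | elt i => (i.cap 11).sz
  | next e => e.sz
  | add a b => a.sz + b.sz
  | mul a b => a.sz + b.sz
  | sum _ _ e => e.sz
  | iflt a b e e' => a.sz + b.sz + e.sz + e'.sz
  | ifeq a b e e' => a.sz + b.sz + e.sz + e'.sz

/-- A bound on the number of elementary steps for the evaluation. -/
def steps : FExpr → ℕ
  | fv _ => 2
  | arr A i j => (adrE A i j).steps + 1
  | ten i => (adrT i).steps + 1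
  | elt i => (i.cap 11).steps
  | next e => e.steps + 4
  | add a b => a.steps + b.steps + 4
  | mul a b => a.steps + b.steps + 4
  | sum _ p e => 4 + π p * (e.steps + 7)
  | iflt a b e e' => a.steps + b.steps + e.steps + e'.steps + 1
  | ifeq a b e e' => a.steps + b.steps + e.steps + e'.steps + 2

/-- Loop variables occur only where they are bound, and are not bound twice. -/
def wf (Γ : List ℕ) : FExpr → Bool
  | fv _ => true
  | arr _ i j => i.wf Γ && j.wf Γ
  | ten i => i.wf Γ
  | elt i => i.wf Γ
  | next e => e.wf Γ
  | add a b => a.wf Γ && b.wf Γ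
  | mul a b => a.wf Γ && b.wf Γ
  | sum x _ e => decide (x ∉ Γ) && e.wf (x :: Γ)
  | iflt a b e e' => a.wf Γ && b.wf Γ && e.wf Γ && e'.wf Γ
  | ifeq a b e e' => a.wf Γ && b.wf Γ && e.wf Γ && e'.wf Γ

/-- Looking up the table at address parameter `b` at the operands in registers `t` and `t + 1`. -/
def lookup (b t : ℕ) : Prog :=
  -- Register `1` is parameter `0`, the number of elements, so the address formed is the base plus
  -- `x * q + y`.
  .seq (.seq (.seq (.instr (.mul (5 * t) (5 * t) 1)) (.instr (.add (5 * t) (5 * t) (5 * (t + 1)))))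
    (.instr (.add (5 * t) (5 * t) (5 * b + 1)))) (.instr (.load (5 * t) (5 * t)))

/-- The code that leaves the code of the value in the temporary register `t`. -/
def compile : FExpr → ℕ → Prog
  | fv x, t => mov (5 * t) (5 * x + 4)
  | arr A i j, t => .seq ((adrE A i j).compile t) (.instr (.load (5 * t) (5 * t)))
  | ten i, t => .seq ((adrT i).compile t) (.instr (.load (5 * t) (5 * t)))
  | elt i, t => (i.cap 11).compile t
  | next e, t => .seq (.seq (.seq (e.compile t) (.instr (.const (5 * (t + 1)) 1)))
      (.instr (.add (5 * t) (5 * t) (5 * (t + 1)))))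
      (.branch (5 * t) 1 .skip (.instr (.const (5 * t) 0)))
  | add a b, t => .seq (.seq (a.compile t) (b.compile (t + 1))) (lookup 22 t)
  | mul a b, t => .seq (.seq (a.compile t) (b.compile (t + 1))) (lookup 12 t)
  | sum x p e, t => .seq (.seq (mov (5 * t) 4) (.instr (.const (5 * x + 2) 0)))
      (.loop (5 * x + 2) (5 * p + 1)
        (.seq (.seq (e.compile (t + 1)) (lookup 22 t))
          (.seq (.instr (.const (5 * (t + 1)) 1))
            (.instr (.add (5 * x + 2) (5 * x + 2) (5 * (t + 1)))))))
  | iflt a b e e', t => .seq (.seq (a.compile t) (b.compile (t + 1)))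
      (.branch (5 * t) (5 * (t + 1)) (e.compile t) (e'.compile t))
  -- The machine only compares by `<`; codes are equal if both strict comparisons fail.
  | ifeq a b e e', t => .seq (.seq (a.compile t) (b.compile (t + 1)))
      (.branch (5 * t) (5 * (t + 1)) (e'.compile t)
        (.branch (5 * (t + 1)) (5 * t) (e'.compile t) (e.compile t)))

end FExpr

/-- The configuration `s` represents the variables and arrays `σ`, with the loop variables `ρ`. -/
structure Rel (B : Bounds) (Γ : List ℕ) (M : ℕ) (ρ : ℕ → ℕ) (σ : HS F) (s : State) : Prop where
  bdd : Bdd B s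
  n : NRel π ρ σ.nv Γ M s
  fv : ∀ i, s.reg (5 * i + 4) = code (σ.fv i)
  arr : ∀ A i j, i ≤ π 5 → j ≤ π 5 → s.mem (adr π A i j) = code (σ.arr A i j)
  addT : ∀ a b : F, s.mem (5 + (code a * q + code b)) = code (a + b)
  mulT : ∀ a b : F, s.mem (5 + q * q + (code a * q + code b)) = code (a * b)
  tinT : ∀ l ≤ π 10, s.mem (5 + 2 * (q * q) + l) = code (tin l)

variable {code π tin}

lemma Rel.frame {B : Bounds} {Γ : List ℕ} {t M : ℕ} {ρ : ℕ → ℕ} {σ : HS F} {s s' : State}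
    (h : Rel code π tin B Γ M ρ σ s) (hf : Frame Γ t s s') (hB : Bdd B s') :
    Rel code π tin B Γ M ρ σ s' := by
  obtain ⟨h1, h2, h3, h4, h5, h6, h7⟩ := h
  refine ⟨hB, h2.frame hf, fun i => (hf.fv i).trans (h3 i), ?_, ?_, ?_, ?_⟩ <;> rw [hf.mem] <;>
    assumption

lemma table_index_lt {F : Type*} {q : ℕ} {code : F ≃ Fin q} (a b : F) : (code a : ℕ) * q + code b < q * q := by
  have h1 := (code a).2
  have h2 := (code b).2
  nlinarith

lemma FExpr.run_lookup {B : Bounds} (hπ : ParOK q π) (hB : ∀ i, π i ≤ B.V) {b t : ℕ} {s : State}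
    {op : F → F → F} (h : Bdd B s) (h0 : s.reg 1 = π 0) (hb : s.reg (5 * b + 1) = π b)
    (hop : ∀ x y, s.mem (π b + (code x * q + code y)) = code (op x y))
    (hle : π b + q * q ≤ π 7) {x y : F} (hx : s.reg (5 * t) = code x)
    (hy : s.reg (5 * (t + 1)) = code y) (hZ : 5 * t < B.Z) :
    Run B (lookup b t) s (s.set (5 * t) (code (op x y))) 4 := by
  have hlt := table_index_lt (code := code) x y
  have hV := hB 7
  have e0 : ¬ (1 = 5 * t) := by omega
  have e1 : ¬ (5 * (t + 1) = 5 * t) := by omega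
  have e2 : ¬ (5 * b + 1 = 5 * t) := by omega
  have r1 := run_mul h (d := 5 * t) (a := 5 * t) (b := 1) hZ
    (by rw [h0, hx, hπ.card]; exact (by omega : _ ≤ π 7).trans hV)
  rw [hx, h0, hπ.card] at r1
  have r2 := run_add r1.1 (d := 5 * t) (a := 5 * t) (b := 5 * (t + 1)) hZ
    (by simp only [State.set_reg, if_true, e1, if_false, hy]; exact (by omega : _ ≤ π 7).trans hV)
  have r3 := run_add r2.1 (d := 5 * t) (a := 5 * t) (b := 5 * b + 1) hZ
    (by simp only [State.set_reg, if_true, e1, e2, if_false, hy, hb]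
        exact (by omega : _ ≤ π 7).trans hV)
  have r4 := run_load r3.1 (d := 5 * t) (a := 5 * t) hZ
  have := ((r1.seq r2).seq r3).seq r4
  have e : ∀ v, (((s.set (5 * t) (code x * q)).set (5 * t)
      (code x * q + code y)).set (5 * t) (code x * q + code y + π b)).set (5 * t) v =
      s.set (5 * t) v := fun v => by
    refine State.ext' (fun i => ?_) rfl
    simp only [State.set_reg]
    split_ifs <;> rfl
  simp only [State.set_reg, if_true, e1, e2, if_false, hy, hb, State.set_mem, e] at this
  rwa [add_comm _ (π b), hop] at this

lemma Rel.bind {B : Bounds} {Γ : List ℕ} {M : ℕ} {ρ : ℕ → ℕ} {σ : HS F} {s : State}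
    (h : Rel code π tin B Γ M ρ σ s) {x i : ℕ} (hi : s.reg (5 * x + 2) = i) (hM : i ≤ M) :
    Rel code π tin B (x :: Γ) M (Function.update ρ x i) σ s := by
  obtain ⟨h1, h2, h3, h4, h5, h6, h7⟩ := h
  refine ⟨h1, ⟨h2.par, ?_, h2.nv, h2.parM, ?_, h2.nvM⟩, h3, h4, h5, h6, h7⟩
  · intro j hj
    by_cases hjx : j = x
    · subst hjx; simpa using hi
    · rw [Function.update_of_ne hjx]
      exact h2.bv j (by simpa [hjx] using hj)
  · intro j hj
    by_cases hjx : j = x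
    · subst hjx; simpa using hM
    · rw [Function.update_of_ne hjx]
      exact h2.bvM j (by simpa [hjx] using hj)

lemma Rel.lookup_add {B : Bounds} {Γ : List ℕ} {M t : ℕ} {ρ : ℕ → ℕ} {σ : HS F} {s : State}
    (hπ : ParOK q π) (hMV : M ≤ B.V) (h : Rel code π tin B Γ M ρ σ s) {x y : F}
    (hx : s.reg (5 * t) = code x) (hy : s.reg (5 * (t + 1)) = code y) (hZ : 5 * t < B.Z) :
    Run B (FExpr.lookup 22 t) s (s.set (5 * t) (code (x + y))) 4 := by
  refine FExpr.run_lookup hπ (fun i => (h.n.parM i).trans hMV) h.bdd (h.n.par 0) (h.n.par 22) ?_ ?_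
    hx hy hZ
  · intro x y; rw [hπ.addTab]; exact h.addT x y
  · have := hπ.high; have := hπ.addTab; omega

lemma Rel.lookup_mul {B : Bounds} {Γ : List ℕ} {M t : ℕ} {ρ : ℕ → ℕ} {σ : HS F} {s : State}
    (hπ : ParOK q π) (hMV : M ≤ B.V) (h : Rel code π tin B Γ M ρ σ s) {x y : F}
    (hx : s.reg (5 * t) = code x) (hy : s.reg (5 * (t + 1)) = code y) (hZ : 5 * t < B.Z) :
    Run B (FExpr.lookup 12 t) s (s.set (5 * t) (code (x * y))) 4 := by
  refine FExpr.run_lookup hπ (fun i => (h.n.parM i).trans hMV) h.bdd (h.n.par 0) (h.n.par 12) ?_ ?_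
    hx hy hZ
  · intro x y; rw [hπ.mulTab]; exact h.mulT x y
  · have := hπ.high; have := hπ.mulTab; omega

/-- The code of a field expression is correct. -/
theorem FExpr.run {B : Bounds} {Γ : List ℕ} {M : ℕ} (hπ : ParOK q π) (hMV : M ≤ B.V) (e : FExpr)
    {t : ℕ} {ρ : ℕ → ℕ} {σ : HS F} {s : State} (h : Rel code π tin B Γ M ρ σ s) (hw : e.wf Γ)
    (hV : (M + 2) ^ e.sz ≤ B.V) (hZ : (e.compile t).maxReg ≤ B.Z) :
    ∃ s', Run B (e.compile t) s s' (e.steps π) ∧ s'.reg (5 * t) = code (e.eval code π tin ρ σ) ∧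
      Frame Γ t s s' := by
  have hmono : ∀ {k l : ℕ}, (M + 2) ^ l ≤ B.V → k ≤ l → (M + 2) ^ k ≤ B.V := fun hl hk =>
    (Nat.pow_le_pow_right (by omega) hk).trans hl
  have hq : 0 < q := by have := (code 0).2; omega
  induction e generalizing t s Γ ρ with
  | fv x =>
    simp only [compile, mov, Prog.maxReg, Instr.maxReg] at hZ
    exact ⟨_, run_mov h.bdd (by omega) (by omega), by simp [eval, h.fv],
      Frame.set_tmp _ _ _ le_rfl⟩
  | arr A i j =>
    simp only [compile, Prog.maxReg, Instr.maxReg] at hZ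
    simp only [wf, Bool.and_eq_true] at hw
    obtain ⟨s1, r1, v1, f1⟩ := NExpr.run (adrE A i j) (t := t) h.bdd h.n
      (by simp [adrE, NExpr.wf, NExpr.cap, hw]) hV (by omega)
    refine ⟨_, r1.seq (run_load r1.1 (by omega)), ?_,
      f1.trans (Frame.set_tmp _ _ _ le_rfl) (List.Subset.refl _) le_rfl⟩
    rw [State.set_reg, if_pos rfl, v1, f1.mem]
    have := h.arr A (min (i.eval π ρ σ.nv) (π 5)) (min (j.eval π ρ σ.nv) (π 5))
      (min_le_right _ _) (min_le_right _ _)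
    rw [eval, ← this]
    simp only [adrE, adr, NExpr.eval, NExpr.eval_cap]
  | ten i =>
    simp only [compile, Prog.maxReg, Instr.maxReg] at hZ
    simp only [wf] at hw
    obtain ⟨s1, r1, v1, f1⟩ := NExpr.run (adrT i) (t := t) h.bdd h.n
      (by simp [adrT, NExpr.wf, NExpr.cap, hw]) hV (by omega)
    refine ⟨_, r1.seq (run_load r1.1 (by omega)), ?_,
      f1.trans (Frame.set_tmp _ _ _ le_rfl) (List.Subset.refl _) le_rfl⟩
    rw [State.set_reg, if_pos rfl, v1, f1.mem]
    have := h.tinT (min (i.eval π ρ σ.nv) (π 10)) (min_le_right _ _)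
    rw [eval, ← this]
    simp only [adrT, NExpr.eval, NExpr.eval_cap, hπ.tens]
  | elt i =>
    simp only [compile] at hZ
    simp only [wf] at hw
    obtain ⟨s1, r1, v1, f1⟩ := NExpr.run (i.cap 11) (t := t) h.bdd h.n
      (by simp [NExpr.wf, NExpr.cap, hw]) hV (by omega)
    refine ⟨_, r1, ?_, f1⟩
    rw [v1, eval, code_elem, NExpr.eval_cap]
    have := hπ.last
    omega
  | next e ih =>
    simp only [compile, Prog.maxReg, Instr.maxReg] at hZ
    simp only [wf] at hw
    obtain ⟨s1, r1, v1, f1⟩ := ih (t := t) h hw hV (by omega)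
    have hlt := (code (e.eval code π tin ρ σ)).2
    have hqM : q ≤ M := hπ.card ▸ h.n.parM 0
    have r2 := run_const r1.1 (d := 5 * (t + 1)) (c := 1) (by omega) (by omega)
    have e1 : ¬ (5 * t = 5 * (t + 1)) := by omega
    have r3 := run_add r2.1 (d := 5 * t) (a := 5 * t) (b := 5 * (t + 1)) (by omega)
      (by simp only [State.set_reg, e1, if_false, if_true, v1]; omega)
    have f3 : Frame Γ t s _ := (f1.trans (Frame.set_tmp Γ (t' := t + 1) s1 1 (by omega))
      (List.Subset.refl _) le_rfl).trans (Frame.set_tmp Γ (t := t) (t' := t) _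
        ((s1.set (5 * (t + 1)) 1).reg (5 * t) + (s1.set (5 * (t + 1)) 1).reg (5 * (t + 1))) le_rfl)
        (List.Subset.refl _) le_rfl
    set s3 := (s1.set (5 * (t + 1)) 1).set (5 * t)
      ((s1.set (5 * (t + 1)) 1).reg (5 * t) + (s1.set (5 * (t + 1)) 1).reg (5 * (t + 1))) with hs3
    have v3 : s3.reg (5 * t) = code (e.eval code π tin ρ σ) + 1 := by
      simp only [hs3, State.set_reg, e1, if_false, if_true, v1]
    have p3 : s3.reg 1 = q := by rw [← hπ.card, ← h.n.par 0]; exact f3.par 0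
    by_cases hc : (code (e.eval code π tin ρ σ) : ℕ) + 1 < q
    · refine ⟨s3, (((r1.seq r2).seq r3).seq (Run.branch_true r3.1 (by omega)
        (Run.skip r3.1))).mono (by simp only [steps]; omega), ?_, f3⟩
      rw [v3, eval, if_pos hc, code_elem _ hc]
    · refine ⟨_, (((r1.seq r2).seq r3).seq (Run.branch_false r3.1 (by omega)
        (run_const r3.1 (d := 5 * t) (by omega) (Nat.zero_le _)))).mono
          (by simp only [steps]; omega), ?_,
          f3.trans (Frame.set_tmp _ _ _ le_rfl) (List.Subset.refl _) le_rfl⟩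
      rw [State.set_reg, if_pos rfl, eval, if_neg hc, code_elem _ hq]
  | add a b iha ihb =>
    simp only [compile, Prog.maxReg, Instr.maxReg, lookup] at hZ
    simp only [wf, Bool.and_eq_true] at hw
    simp only [sz] at hV
    obtain ⟨s1, r1, v1, f1⟩ := iha (t := t) h hw.1 (hmono hV (by omega)) (by omega)
    obtain ⟨s2, r2, v2, f2⟩ := ihb (t := t + 1) (h.frame f1 r1.1) hw.2 (hmono hV (by omega))
      (by omega)
    have v1' : s2.reg (5 * t) = _ := (f2.tmp t (by omega)).trans v1
    have f12 := f1.trans f2 (List.Subset.refl _) (by omega)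
    have r3 := (h.frame f12 r2.1).lookup_add hπ hMV v1' v2 (by omega)
    exact ⟨_, (r1.seq r2).seq r3, by simp [eval],
      f12.trans (Frame.set_tmp _ _ _ le_rfl) (List.Subset.refl _) le_rfl⟩
  | mul a b iha ihb =>
    simp only [compile, Prog.maxReg, Instr.maxReg, lookup] at hZ
    simp only [wf, Bool.and_eq_true] at hw
    simp only [sz] at hV
    obtain ⟨s1, r1, v1, f1⟩ := iha (t := t) h hw.1 (hmono hV (by omega)) (by omega)
    obtain ⟨s2, r2, v2, f2⟩ := ihb (t := t + 1) (h.frame f1 r1.1) hw.2 (hmono hV (by omega))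
      (by omega)
    have v1' : s2.reg (5 * t) = _ := (f2.tmp t (by omega)).trans v1
    have f12 := f1.trans f2 (List.Subset.refl _) (by omega)
    have r3 := (h.frame f12 r2.1).lookup_mul hπ hMV v1' v2 (by omega)
    exact ⟨_, (r1.seq r2).seq r3, by simp [eval],
      f12.trans (Frame.set_tmp _ _ _ le_rfl) (List.Subset.refl _) le_rfl⟩
  | sum x p e ih =>
    simp only [compile, Prog.maxReg, Instr.maxReg, lookup, mov] at hZ
    simp only [wf, Bool.and_eq_true, decide_eq_true_eq] at hw
    have hqM : q ≤ M := hπ.card ▸ h.n.parM 0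
    have r1 := run_mov h.bdd (d := 5 * t) (a := 4) (by omega) (by omega)
    have r2 := run_const r1.1 (d := 5 * x + 2) (c := 0) (by omega) (Nat.zero_le _)
    have f2 := (Frame.set_tmp Γ (t := t) (t' := t) s (s.reg 4) le_rfl).trans
      (Frame.set_bv (x := x) t (s.set (5 * t) (s.reg 4)) 0 hw.1) (List.Subset.refl _) le_rfl
    -- The partial sum stays in temporary `t`, which is safe because the summand is evaluated with
    -- temporaries from `t + 1` on.
    let Inv : ℕ → State → Prop := fun i s' => Bdd B s' ∧ Frame Γ t s s' ∧ i ≤ π p ∧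
      s'.reg (5 * x + 2) = i ∧ s'.reg (5 * t) = code (σ.fv 0 +
        ∑ j ∈ Finset.range i, e.eval code π tin (Function.update ρ x j) σ)
    have hInv0 : Inv 0 ((s.set (5 * t) (s.reg 4)).set (5 * x + 2) 0) := by
      refine ⟨r2.1, f2, Nat.zero_le _, by simp, ?_⟩
      have : ¬ (5 * t = 5 * x + 2) := by omega
      simp only [State.set_reg, this, if_false, if_true, Finset.range_zero, Finset.sum_empty,
        add_zero]
      exact h.fv 0
    obtain ⟨s', r3, hs'⟩ := run_loop (a := 5 * x + 2) (b := 5 * p + 1) (n := π p)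
      (c := e.steps π + 4 + (1 + 1)) Inv
      (p := .seq (.seq (e.compile (t + 1)) (lookup 22 t))
          (.seq (.instr (.const (5 * (t + 1)) 1))
            (.instr (.add (5 * x + 2) (5 * x + 2) (5 * (t + 1))))))
      (fun i s1 hs1 => ⟨hs1.1, (hs1.2.1.par p).trans (h.n.par p), hs1.2.2.2.1⟩)
      (fun i s1 hi hs1 => by
        obtain ⟨b1, g1, -, g3, g4⟩ := hs1
        have hM := h.n.parM p
        obtain ⟨s2, q2, v2, k2⟩ := ih (t := t + 1)
          ((h.frame g1 b1).bind g3 (by omega)) hw.2 hV (by omega)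
        have v2' : s2.reg (5 * t) = _ := (k2.tmp t (by omega)).trans g4
        have k2' : Frame Γ t s s2 := g1.trans k2 (List.subset_cons_self _ _) (by omega)
        have q3 := (h.frame k2' q2.1).lookup_add hπ hMV v2' v2 (by omega)
        have q4 := run_const q3.1 (d := 5 * (t + 1)) (c := 1) (by omega) (by omega)
        have x2 : s2.reg (5 * x + 2) = i := (k2.bv x (by simp)).trans g3
        have n1 : ¬ (5 * x + 2 = 5 * (t + 1)) := by omega
        have n2 : ¬ (5 * x + 2 = 5 * t) := by omega
        have n3 : ¬ (5 * t = 5 * (t + 1)) := by omega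
        have n4 : ¬ (5 * t = 5 * x + 2) := by omega
        have q5 := run_add q4.1 (d := 5 * x + 2) (a := 5 * x + 2) (b := 5 * (t + 1)) (by omega)
          (by simp only [State.set_reg, n1, n2, if_true, if_false, x2]; omega)
        refine ⟨_, (q2.seq q3).seq (q4.seq q5), q5.1, ?_, hi, ?_, ?_⟩
        · exact ((k2'.trans (Frame.set_tmp _ _ _ le_rfl) (List.Subset.refl _) le_rfl).trans
            (Frame.set_tmp _ _ _ (by omega)) (List.Subset.refl _) le_rfl).trans
            (Frame.set_bv _ _ _ hw.1) (List.Subset.refl _) le_rfl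
        · simp only [State.set_reg, n1, n2, if_true, if_false, x2]
        · simp only [State.set_reg, n3, n4, if_true, if_false]
          rw [Finset.sum_range_succ, add_assoc])
      (Nat.zero_le _) hInv0
    refine ⟨s', ((r1.seq r2).seq r3).mono ?_, hs'.2.2.2.2, hs'.2.1⟩
    simp only [steps]
    have : π p - 0 = π p := rfl
    rw [this]
    have : e.steps π + 4 + (1 + 1) + 1 = e.steps π + 7 := by ring
    rw [this]
    omega
  | iflt a b e e' ihe ihe' =>
    simp only [compile, Prog.maxReg] at hZ
    simp only [wf, Bool.and_eq_true] at hw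
    simp only [sz] at hV
    obtain ⟨⟨⟨hwa, hwb⟩, hwe⟩, hwe'⟩ := hw
    obtain ⟨s1, r1, v1, f1⟩ := NExpr.run a (t := t) h.bdd h.n hwa (hmono hV (by omega)) (by omega)
    obtain ⟨s2, r2, v2, f2⟩ := NExpr.run b (t := t + 1) r1.1 (h.n.frame f1) hwb
      (hmono hV (by omega)) (by omega)
    have v1' : s2.reg (5 * t) = _ := (f2.tmp t (by omega)).trans v1
    have f12 := f1.trans f2 (List.Subset.refl _) (by omega)
    have h2 := h.frame f12 r2.1
    rw [eval]
    split_ifs with hc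
    · obtain ⟨s3, r3, v3, f3⟩ := ihe (t := t) h2 hwe (hmono hV (by omega)) (by omega)
      exact ⟨s3, ((r1.seq r2).seq (Run.branch_true r2.1 (by omega) r3)).mono
        (by simp only [steps]; omega), v3, f12.trans f3 (List.Subset.refl _) le_rfl⟩
    · obtain ⟨s3, r3, v3, f3⟩ := ihe' (t := t) h2 hwe' (hmono hV (by omega)) (by omega)
      exact ⟨s3, ((r1.seq r2).seq (Run.branch_false r2.1 (by omega) r3)).mono
        (by simp only [steps]; omega), v3, f12.trans f3 (List.Subset.refl _) le_rfl⟩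
  | ifeq a b e e' iha ihb ihe ihe' =>
    simp only [compile, Prog.maxReg] at hZ
    simp only [wf, Bool.and_eq_true] at hw
    simp only [sz] at hV
    obtain ⟨⟨⟨hwa, hwb⟩, hwe⟩, hwe'⟩ := hw
    obtain ⟨s1, r1, v1, f1⟩ := iha (t := t) h hwa (hmono hV (by omega)) (by omega)
    obtain ⟨s2, r2, v2, f2⟩ := ihb (t := t + 1) (h.frame f1 r1.1) hwb (hmono hV (by omega))
      (by omega)
    have v1' : s2.reg (5 * t) = _ := (f2.tmp t (by omega)).trans v1
    have f12 := f1.trans f2 (List.Subset.refl _) (by omega)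
    have h2 := h.frame f12 r2.1
    have hcode : a.eval code π tin ρ σ = b.eval code π tin ρ σ ↔
        s2.reg (5 * t) = s2.reg (5 * (t + 1)) := by
      rw [v1', v2, Fin.val_inj, code.apply_eq_iff_eq]
    rw [eval]
    split_ifs with hc
    · rw [hcode] at hc
      obtain ⟨s3, r3, v3, f3⟩ := ihe (t := t) h2 hwe (hmono hV (by omega)) (by omega)
      exact ⟨s3, ((r1.seq r2).seq (Run.branch_false r2.1 (by omega)
        (Run.branch_false r2.1 (by omega) r3))).mono
        (by simp only [steps]; omega), v3, f12.trans f3 (List.Subset.refl _) le_rfl⟩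
    · rw [hcode] at hc
      obtain ⟨s3, r3, v3, f3⟩ := ihe' (t := t) h2 hwe' (hmono hV (by omega)) (by omega)
      by_cases hlt : s2.reg (5 * t) < s2.reg (5 * (t + 1))
      · exact ⟨s3, ((r1.seq r2).seq (Run.branch_true r2.1 hlt r3)).mono
          (by simp only [steps]; omega), v3, f12.trans f3 (List.Subset.refl _) le_rfl⟩
      · exact ⟨s3, ((r1.seq r2).seq (Run.branch_false r2.1 hlt
          (Run.branch_true r2.1 (by omega) r3))).mono
          (by simp only [steps]; omega), v3, f12.trans f3 (List.Subset.refl _) le_rfl⟩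

end

end TensorCPD

namespace TensorCPD

/-! ### Commands -/

/-- Commands: assignments, sequential composition, case distinctions, and counting loops whose bound
is a parameter. -/
inductive Cmd where
  | skip
  | fset (x : ℕ) (e : FExpr)
  | store (A : ℕ) (i j : NExpr) (e : FExpr)
  | nconst (x c : ℕ)
  | nbv (x i : ℕ)
  | incr (x : ℕ)
  | seq (c c' : Cmd)
  | iflt (a b : NExpr) (c c' : Cmd)
  | ifeq (a b : FExpr) (c c' : Cmd)
  | loop (x p : ℕ) (c : Cmd)

section

variable {F : Type*} [Field F] {q : ℕ} (code : F ≃ Fin q) (π : ℕ → ℕ) (tin : ℕ → F)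

namespace HS

/-- Overwriting a numeric variable. -/
def setN (σ : HS F) (x v : ℕ) : HS F := ⟨Function.update σ.nv x v, σ.fv, σ.arr⟩

/-- Overwriting a field variable. -/
def setF (σ : HS F) (x : ℕ) (v : F) : HS F := ⟨σ.nv, Function.update σ.fv x v, σ.arr⟩

/-- Overwriting an array entry. -/
def setA (σ : HS F) (A i j : ℕ) (v : F) : HS F :=
  ⟨σ.nv, σ.fv, fun A' i' j' => if A' = A ∧ i' = i ∧ j' = j then v else σ.arr A' i' j'⟩

@[simp] lemma setN_nv (σ : HS F) (x v i : ℕ) :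
    (σ.setN x v).nv i = if i = x then v else σ.nv i := by simp [setN, Function.update_apply]
@[simp] lemma setN_fv (σ : HS F) (x v : ℕ) : (σ.setN x v).fv = σ.fv := rfl
@[simp] lemma setN_arr (σ : HS F) (x v : ℕ) : (σ.setN x v).arr = σ.arr := rfl
@[simp] lemma setF_nv (σ : HS F) (x : ℕ) (v : F) : (σ.setF x v).nv = σ.nv := rfl
@[simp] lemma setF_fv (σ : HS F) (x : ℕ) (v : F) (i : ℕ) :
    (σ.setF x v).fv i = if i = x then v else σ.fv i := by simp [setF, Function.update_apply]
@[simp] lemma setF_arr (σ : HS F) (x : ℕ) (v : F) : (σ.setF x v).arr = σ.arr := rfl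
@[simp] lemma setA_nv (σ : HS F) (A i j : ℕ) (v : F) : (σ.setA A i j v).nv = σ.nv := rfl
@[simp] lemma setA_fv (σ : HS F) (A i j : ℕ) (v : F) : (σ.setA A i j v).fv = σ.fv := rfl
@[simp] lemma setA_arr (σ : HS F) (A i j : ℕ) (v : F) (A' i' j' : ℕ) :
    (σ.setA A i j v).arr A' i' j' = if A' = A ∧ i' = i ∧ j' = j then v else σ.arr A' i' j' := rfl

end HS

namespace Cmd

/-- The effect of a command. -/
noncomputable def den : Cmd → (ℕ → ℕ) → HS F → HS F
  | skip, _, σ => σ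
  | fset x e, ρ, σ => σ.setF x (e.eval code π tin ρ σ)
  | store A i j e, ρ, σ => σ.setA A (min (i.eval π ρ σ.nv) (π 5)) (min (j.eval π ρ σ.nv) (π 5))
      (e.eval code π tin ρ σ)
  | nconst x c, _, σ => σ.setN x c
  | nbv x i, ρ, σ => σ.setN x (ρ i)
  | incr x, _, σ => σ.setN x (σ.nv x + 1)
  | seq c c', ρ, σ => c'.den ρ (c.den ρ σ)
  | iflt a b c c', ρ, σ => if a.eval π ρ σ.nv < b.eval π ρ σ.nv then c.den ρ σ else c'.den ρ σ
  | ifeq a b c c', ρ, σ => open Classical in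
      if a.eval code π tin ρ σ = b.eval code π tin ρ σ then c.den ρ σ else c'.den ρ σ
  | loop x p c, ρ, σ => Nat.rec σ (fun i τ => c.den (Function.update ρ x i) τ) (π p)

/-- An exponent that bounds the numbers that occur in an execution. -/
def sz : Cmd → ℕ
  | skip => 0
  | fset _ e => e.sz
  | store A i j e => e.sz + (adrE A i j).sz
  | nconst _ c => c
  | nbv _ _ => 0
  | incr _ => 0
  | seq c c' => c.sz + c'.sz
  | iflt a b c c' => a.sz + b.sz + c.sz + c'.sz
  | ifeq a b c c' => a.sz + b.sz + c.sz + c'.sz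
  | loop _ _ c => c.sz

/-- A bound on the number of elementary steps. -/
def steps : Cmd → ℕ
  | skip => 1
  | fset _ e => e.steps π + 2
  | store A i j e => e.steps π + (adrE A i j).steps + 1
  -- For the time, `1` would do. The summand `c` makes the same quantity bound the growth of the
  -- numeric variables, as `Cmd.run` requires.
  | nconst _ c => 1 + c
  | nbv _ _ => 2
  | incr _ => 2
  | seq c c' => c.steps + c'.steps
  | iflt a b c c' => a.steps + b.steps + c.steps + c'.steps + 1
  | ifeq a b c c' => a.steps π + b.steps π + c.steps + c'.steps + 2
  | loop _ p c => 2 + π p * (c.steps + 3)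

/-- Scoping of loop variables, and the number of arrays is at most `NA`. -/
def wf (NA : ℕ) (Γ : List ℕ) : Cmd → Bool
  | skip => true
  | fset _ e => e.wf Γ
  | store A i j e => decide (A < NA) && i.wf Γ && j.wf Γ && e.wf Γ
  | nconst _ _ => true
  | nbv _ i => decide (i ∈ Γ)
  | incr _ => true
  | seq c c' => c.wf NA Γ && c'.wf NA Γ
  | iflt a b c c' => a.wf Γ && b.wf Γ && c.wf NA Γ && c'.wf NA Γ
  | ifeq a b c c' => a.wf Γ && b.wf Γ && c.wf NA Γ && c'.wf NA Γ
  | loop x _ c => decide (x ∉ Γ) && c.wf NA (x :: Γ)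

/-- The machine code of a command. -/
def compile : Cmd → Prog
  | skip => .skip
  | fset x e => .seq (e.compile 0) (mov (5 * x + 4) (5 * 0))
  | store A i j e => .seq (.seq (e.compile 0) ((adrE A i j).compile 1))
      (.instr (.store (5 * 1) (5 * 0)))
  | nconst x c => .instr (.const (5 * x + 3) c)
  | nbv x i => mov (5 * x + 3) (5 * i + 2)
  | incr x => .seq (.instr (.const (5 * 0) 1))
      (.instr (.add (5 * x + 3) (5 * x + 3) (5 * 0)))
  | seq c c' => .seq c.compile c'.compile
  | iflt a b c c' => .seq (.seq (a.compile 0) (b.compile 1))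
      (.branch (5 * 0) (5 * 1) c.compile c'.compile)
  | ifeq a b c c' => .seq (.seq (a.compile 0) (b.compile 1))
      (.branch (5 * 0) (5 * 1) c'.compile (.branch (5 * 1) (5 * 0) c'.compile c.compile))
  | loop x p c => .seq (.instr (.const (5 * x + 2) 0))
      (.loop (5 * x + 2) (5 * p + 1)
        (.seq c.compile (.seq (.instr (.const (5 * 0) 1))
          (.instr (.add (5 * x + 2) (5 * x + 2) (5 * 0))))))

end Cmd

variable {code π tin}

lemma Rel.unbind {B : Bounds} {Γ : List ℕ} {M : ℕ} {ρ : ℕ → ℕ} {σ : HS F} {s : State} {x i : ℕ}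
    (hx : x ∉ Γ) (h : Rel code π tin B (x :: Γ) M (Function.update ρ x i) σ s) :
    Rel code π tin B Γ M ρ σ s := by
  obtain ⟨h1, h2, h3, h4, h5, h6, h7⟩ := h
  have key : ∀ j ∈ Γ, Function.update ρ x i j = ρ j := fun j hj =>
    Function.update_of_ne (fun he => hx (by rwa [he] at hj)) _ _
  refine ⟨h1, ⟨h2.par, fun j hj => ?_, h2.nv, h2.parM, fun j hj => ?_, h2.nvM⟩, h3, h4, h5, h6, h7⟩
  · rw [← key j hj]; exact h2.bv j (List.mem_cons_of_mem _ hj)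
  · rw [← key j hj]; exact h2.bvM j (List.mem_cons_of_mem _ hj)

lemma Rel.setN {B : Bounds} {Γ : List ℕ} {M : ℕ} {ρ : ℕ → ℕ} {σ : HS F} {s : State} {x v : ℕ}
    (h : Rel code π tin B Γ M ρ σ s) (hv : v ≤ M) (hB : Bdd B (s.set (5 * x + 3) v)) :
    Rel code π tin B Γ M ρ (σ.setN x v) (s.set (5 * x + 3) v) := by
  obtain ⟨h1, h2, h3, h4, h5, h6, h7⟩ := h
  refine ⟨hB, ⟨fun i => ?_, fun i hi => ?_, fun i => ?_, h2.parM, h2.bvM, fun i => ?_⟩,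
    fun i => ?_, h4, h5, h6, h7⟩
  · rw [State.set_reg, if_neg (by omega), h2.par]
  · rw [State.set_reg, if_neg (by omega), h2.bv i hi]
  · by_cases hi : i = x
    · subst hi; simp
    · rw [State.set_reg, if_neg (by omega), h2.nv, HS.setN_nv, if_neg hi]
  · by_cases hi : i = x
    · subst hi; simpa using hv
    · rw [HS.setN_nv, if_neg hi]; exact h2.nvM i
  · rw [State.set_reg, if_neg (by omega), h3]; rfl

lemma Rel.setF {B : Bounds} {Γ : List ℕ} {M : ℕ} {ρ : ℕ → ℕ} {σ : HS F} {s : State} {x : ℕ} {v : F}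
    (h : Rel code π tin B Γ M ρ σ s) (hB : Bdd B (s.set (5 * x + 4) (code v))) :
    Rel code π tin B Γ M ρ (σ.setF x v) (s.set (5 * x + 4) (code v)) := by
  obtain ⟨h1, h2, h3, h4, h5, h6, h7⟩ := h
  refine ⟨hB, ⟨fun i => ?_, fun i hi => ?_, fun i => ?_, h2.parM, h2.bvM, h2.nvM⟩,
    fun i => ?_, h4, h5, h6, h7⟩
  · rw [State.set_reg, if_neg (by omega), h2.par]
  · rw [State.set_reg, if_neg (by omega), h2.bv i hi]
  · rw [State.set_reg, if_neg (by omega), h2.nv]; rfl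
  · by_cases hi : i = x
    · subst hi; simp
    · rw [State.set_reg, if_neg (by omega), h3, HS.setF_fv, if_neg hi]

/-- Arrays start at address `π 7`, above the operation tables and the tensor, so a write cannot
damage the input; `adr_inj` protects the other entries. -/
lemma Rel.setA {B : Bounds} {Γ : List ℕ} {M : ℕ} {ρ : ℕ → ℕ} {σ : HS F} {s : State} {A i j : ℕ}
    {v : F} (hπ : ParOK q π) (h : Rel code π tin B Γ M ρ σ s) (hi : i ≤ π 5) (hj : j ≤ π 5)
    (hB : Bdd B (s.put (adr π A i j) (code v))) :
    Rel code π tin B Γ M ρ (σ.setA A i j v) (s.put (adr π A i j) (code v)) := by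
  obtain ⟨h1, h2, h3, h4, h5, h6, h7⟩ := h
  have hH := hπ.high
  have hadr : π 7 ≤ adr π A i j := by unfold adr; omega
  refine ⟨hB, ⟨h2.par, h2.bv, h2.nv, h2.parM, h2.bvM, h2.nvM⟩, h3, fun A' i' j' hi' hj' => ?_,
    fun a b => ?_, fun a b => ?_, fun l hl => ?_⟩
  · rw [State.put_mem]
    by_cases hc : A' = A ∧ i' = i ∧ j' = j
    · obtain ⟨rfl, rfl, rfl⟩ := hc
      simp
    · rw [if_neg (fun he => hc (adr_inj π hπ.side hi' hj' hi hj he)), h4 _ _ _ hi' hj', HS.setA_arr,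
        if_neg hc]
  · have := table_index_lt (code := code) a b
    rw [State.put_mem, if_neg (by omega), h5]
  · have := table_index_lt (code := code) a b
    rw [State.put_mem, if_neg (by omega), h6]
  · rw [State.put_mem, if_neg (by omega), h7 l hl]

lemma adr_lt (h6 : π 6 = π 5 + 1) {NA A i j : ℕ} (hA : A < NA) (hi : i ≤ π 5) (hj : j ≤ π 5) :
    adr π A i j < π 7 + NA * π 6 * π 6 := by
  unfold adr
  have h1 : A * π 6 + i < NA * π 6 := by nlinarith
  have h2 : (A * π 6 + i) * π 6 + j < NA * π 6 * π 6 := by nlinarith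
  omega

/-- The machine code of a command is correct. -/
theorem Cmd.run {B : Bounds} {Γ : List ℕ} {M NA : ℕ} (hπ : ParOK q π) (hMV : M ≤ B.V)
    (hW : π 7 + NA * π 6 * π 6 ≤ B.W) (c : Cmd) {ρ : ℕ → ℕ} {σ : HS F} {s : State} {b : ℕ}
    (h : Rel code π tin B Γ M ρ σ s) (hw : c.wf NA Γ) (hV : (M + 2) ^ c.sz ≤ B.V)
    (hZ : c.compile.maxReg ≤ B.Z) (hbπ : ∀ i, π i ≤ b) (hbρ : ∀ i ∈ Γ, ρ i ≤ b)
    (hbν : ∀ i, σ.nv i ≤ b) (hbM : b + c.steps π ≤ M) :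
    ∃ s', Run B c.compile s s' (c.steps π) ∧ Rel code π tin B Γ M ρ (c.den code π tin ρ σ) s' ∧
      ∀ i, (c.den code π tin ρ σ).nv i ≤ b + c.steps π := by
  have hmono : ∀ {k l : ℕ}, (M + 2) ^ l ≤ B.V → k ≤ l → (M + 2) ^ k ≤ B.V := fun hl hk =>
    (Nat.pow_le_pow_right (by omega) hk).trans hl
  -- `b` bounds all numbers at the start and has to be general: the second command of a sequence,
  -- and each further round of a loop, starts from the larger bound left behind by what ran before.
  induction c generalizing s Γ ρ σ b with
  | skip =>
    exact ⟨s, Run.skip h.bdd, h, fun i => (hbν i).trans (by omega)⟩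
  | fset x e =>
    simp only [compile, Prog.maxReg, Instr.maxReg, mov] at hZ
    simp only [wf] at hw
    obtain ⟨s1, r1, v1, f1⟩ := e.run hπ hMV (t := 0) h hw hV (by omega)
    have r2 := run_mov r1.1 (d := 5 * x + 4) (a := 5 * 0) (by omega) (by omega)
    rw [v1] at r2
    exact ⟨_, r1.seq r2, (h.frame f1 r1.1).setF r2.1, fun i => (hbν i).trans (by omega)⟩
  | store A i j e =>
    simp only [compile, Prog.maxReg, Instr.maxReg] at hZ
    simp only [wf, Bool.and_eq_true, decide_eq_true_eq] at hw
    simp only [sz] at hV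
    obtain ⟨⟨⟨hA, hwi⟩, hwj⟩, hwe⟩ := hw
    obtain ⟨s1, r1, v1, f1⟩ := e.run hπ hMV (t := 0) h hwe (hmono hV (by omega)) (by omega)
    obtain ⟨s2, r2, v2, f2⟩ := NExpr.run (adrE A i j) (t := 1) r1.1 (h.n.frame f1)
      (by simp [adrE, NExpr.wf, NExpr.cap, hwi, hwj]) (hmono hV (by omega)) (by omega)
    have f12 := f1.trans f2 (List.Subset.refl _) (by omega)
    have v1' : s2.reg (5 * 0) = _ := (f2.tmp 0 (by omega)).trans v1
    have v2' : s2.reg (5 * 1) = adr π A (min (i.eval π ρ σ.nv) (π 5))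
        (min (j.eval π ρ σ.nv) (π 5)) := by
      rw [v2]
      simp only [adrE, adr, NExpr.eval, NExpr.eval_cap]
    have hlt := (adr_lt hπ.side hA (min_le_right (i.eval π ρ σ.nv) (π 5))
      (min_le_right (j.eval π ρ σ.nv) (π 5))).trans_le hW
    have r3 := run_store r2.1 (a := 5 * 1) (b := 5 * 0) (by rw [v2']; exact hlt)
    rw [v2', v1'] at r3
    exact ⟨_, (r1.seq r2).seq r3, (h.frame f12 r2.1).setA hπ (min_le_right _ _) (min_le_right _ _)
      r3.1, fun i => (hbν i).trans (by omega)⟩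
  | nconst x c =>
    simp only [compile, Prog.maxReg, Instr.maxReg] at hZ
    simp only [steps] at hbM
    have r1 := run_const h.bdd (d := 5 * x + 3) (c := c) (by omega) (by omega)
    refine ⟨_, r1.mono (by simp [steps]), h.setN (by omega) r1.1, fun i => ?_⟩
    simp only [den, HS.setN, Function.update_apply, steps]
    have := hbν i
    split_ifs <;> omega
  | nbv x i =>
    simp only [compile, Prog.maxReg, Instr.maxReg, mov] at hZ
    simp only [wf, decide_eq_true_eq] at hw
    have r1 := run_mov h.bdd (d := 5 * x + 3) (a := 5 * i + 2) (by omega) (by omega)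
    rw [h.n.bv i hw] at r1
    have := hbρ i hw
    refine ⟨_, r1, h.setN (by omega) r1.1, fun j => ?_⟩
    have := hbν j
    simp only [den, HS.setN, Function.update_apply, steps]
    split_ifs <;> omega
  | incr x =>
    simp only [compile, Prog.maxReg, Instr.maxReg] at hZ
    simp only [steps] at hbM
    have hx := hbν x
    have r1 := run_const h.bdd (d := 5 * 0) (c := 1) (by omega) (by omega)
    have f1 := Frame.set_tmp Γ (t := 0) (t' := 0) s 1 le_rfl
    have e1 : ¬ (5 * x + 3 = 5 * 0) := by omega
    have r2 := run_add r1.1 (d := 5 * x + 3) (a := 5 * x + 3) (b := 5 * 0) (by omega)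
      (by simp only [State.set_reg, e1, if_false, if_true, h.n.nv]; omega)
    have ev : (s.set (5 * 0) 1).reg (5 * x + 3) + (s.set (5 * 0) 1).reg (5 * 0) = σ.nv x + 1 := by
      simp only [State.set_reg, e1, if_false, if_true, h.n.nv]
    rw [ev] at r2
    refine ⟨_, r1.seq r2, (h.frame f1 r1.1).setN (by omega) r2.1, fun j => ?_⟩
    have := hbν j
    simp only [den, HS.setN, Function.update_apply, steps]
    split_ifs <;> omega
  | seq c c' ihc ihc' =>
    simp only [compile, Prog.maxReg] at hZ
    simp only [wf, Bool.and_eq_true] at hw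
    simp only [sz] at hV
    simp only [steps] at hbM
    obtain ⟨s1, r1, h1, n1⟩ := ihc h hw.1 (hmono hV (by omega)) (by omega) hbπ hbρ hbν (by omega)
    obtain ⟨s2, r2, h2, n2⟩ := ihc' h1 hw.2 (hmono hV (by omega)) (by omega)
      (fun i => (hbπ i).trans (Nat.le_add_right _ _))
      (fun i hi => (hbρ i hi).trans (Nat.le_add_right _ _)) n1 (by omega)
    exact ⟨s2, r1.seq r2, h2, fun i => by simpa only [steps, den, ← add_assoc] using n2 i⟩
  | iflt e e' c c' ihc ihc' =>
    simp only [compile, Prog.maxReg] at hZ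
    simp only [wf, Bool.and_eq_true] at hw
    simp only [sz] at hV
    simp only [steps] at hbM
    obtain ⟨⟨⟨hwa, hwb⟩, hwe⟩, hwe'⟩ := hw
    obtain ⟨s1, r1, v1, f1⟩ := NExpr.run e (t := 0) h.bdd h.n hwa (hmono hV (by omega)) (by omega)
    obtain ⟨s2, r2, v2, f2⟩ := NExpr.run e' (t := 1) r1.1 (h.n.frame f1) hwb
      (hmono hV (by omega)) (by omega)
    have v1' : s2.reg (5 * 0) = _ := (f2.tmp 0 (by omega)).trans v1
    have h2 := h.frame (f1.trans f2 (List.Subset.refl _) (by omega)) r2.1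
    rw [den]
    split_ifs with hc
    · obtain ⟨s3, r3, h3, n3⟩ := ihc h2 hwe (hmono hV (by omega)) (by omega) hbπ hbρ hbν (by omega)
      exact ⟨s3, ((r1.seq r2).seq (Run.branch_true r2.1 (by omega) r3)).mono
        (by simp only [steps]; omega), h3, fun i => (n3 i).trans (by simp only [steps]; omega)⟩
    · obtain ⟨s3, r3, h3, n3⟩ := ihc' h2 hwe' (hmono hV (by omega)) (by omega) hbπ hbρ hbν
        (by omega)
      exact ⟨s3, ((r1.seq r2).seq (Run.branch_false r2.1 (by omega) r3)).mono
        (by simp only [steps]; omega), h3, fun i => (n3 i).trans (by simp only [steps]; omega)⟩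
  | ifeq e e' c c' ihc ihc' =>
    simp only [compile, Prog.maxReg] at hZ
    simp only [wf, Bool.and_eq_true] at hw
    simp only [sz] at hV
    simp only [steps] at hbM
    obtain ⟨⟨⟨hwa, hwb⟩, hwe⟩, hwe'⟩ := hw
    obtain ⟨s1, r1, v1, f1⟩ := e.run hπ hMV (t := 0) h hwa (hmono hV (by omega)) (by omega)
    obtain ⟨s2, r2, v2, f2⟩ := e'.run hπ hMV (t := 1) (h.frame f1 r1.1) hwb (hmono hV (by omega))
      (by omega)
    have v1' : s2.reg (5 * 0) = _ := (f2.tmp 0 (by omega)).trans v1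
    have h2 := h.frame (f1.trans f2 (List.Subset.refl _) (by omega)) r2.1
    have hcode : e.eval code π tin ρ σ = e'.eval code π tin ρ σ ↔
        s2.reg (5 * 0) = s2.reg (5 * 1) := by
      rw [v1', v2, Fin.val_inj, code.apply_eq_iff_eq]
    rw [den]
    split_ifs with hc
    · rw [hcode] at hc
      obtain ⟨s3, r3, h3, n3⟩ := ihc h2 hwe (hmono hV (by omega)) (by omega) hbπ hbρ hbν (by omega)
      exact ⟨s3, ((r1.seq r2).seq (Run.branch_false r2.1 (by omega)
        (Run.branch_false r2.1 (by omega) r3))).mono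
        (by simp only [steps]; omega), h3, fun i => (n3 i).trans (by simp only [steps]; omega)⟩
    · rw [hcode] at hc
      obtain ⟨s3, r3, h3, n3⟩ := ihc' h2 hwe' (hmono hV (by omega)) (by omega) hbπ hbρ hbν
        (by omega)
      refine ⟨s3, ?_, h3, fun i => (n3 i).trans (by simp only [steps]; omega)⟩
      by_cases hlt : s2.reg (5 * 0) < s2.reg (5 * 1)
      · exact ((r1.seq r2).seq (Run.branch_true r2.1 hlt r3)).mono
          (by simp only [steps]; omega)
      · exact ((r1.seq r2).seq (Run.branch_false r2.1 hlt
          (Run.branch_true r2.1 (by omega) r3))).mono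
          (by simp only [steps]; omega)
  | loop x p c ih =>
    simp only [compile, Prog.maxReg, Instr.maxReg] at hZ
    simp only [wf, Bool.and_eq_true, decide_eq_true_eq] at hw
    simp only [sz] at hV
    simp only [steps] at hbM
    have r1 := run_const h.bdd (d := 5 * x + 2) (c := 0) (by omega) (Nat.zero_le _)
    have f1 := Frame.set_bv (Γ := Γ) (x := x) 0 s 0 hw.1
    set den' : ℕ → HS F := fun i =>
      Nat.rec σ (fun i τ => c.den code π tin (Function.update ρ x i) τ) i with hden'
    let Inv : ℕ → State → Prop := fun i s' => i ≤ π p ∧ s'.reg (5 * x + 2) = i ∧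
      Rel code π tin B Γ M ρ (den' i) s' ∧ ∀ j, (den' i).nv j ≤ b + i * c.steps π
    obtain ⟨s', r2, hs'⟩ := run_loop (a := 5 * x + 2) (b := 5 * p + 1) (n := π p)
      (c := c.steps π + (1 + 1)) Inv
      (p := .seq c.compile (.seq (.instr (.const (5 * 0) 1))
          (.instr (.add (5 * x + 2) (5 * x + 2) (5 * 0)))))
      (fun i s1 hs1 => ⟨hs1.2.2.1.bdd, hs1.2.2.1.n.par p, hs1.2.1⟩)
      (fun i s1 hi hs1 => by
        obtain ⟨-, g1, g2, g3⟩ := hs1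
        have hpM := h.n.parM p
        have hpb := hbπ p
        have hbi : b + i * c.steps π + c.steps π ≤ b + (2 + π p * (c.steps π + 3)) := by nlinarith
        obtain ⟨s2, q2, h2, n2⟩ := ih (b := b + i * c.steps π) (g2.bind g1 (by omega)) hw.2 hV
          (by omega) (fun i => (hbπ i).trans (Nat.le_add_right _ _))
          (fun j hj => by
            by_cases hjx : j = x
            · subst hjx; rw [Function.update_self]; omega
            · rw [Function.update_of_ne hjx]
              exact (hbρ j (by simpa [hjx] using hj)).trans (Nat.le_add_right _ _))
          g3 (by omega)
        have q3 := run_const q2.1 (d := 5 * 0) (c := 1) (by omega) (by omega)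
        have x2 : s2.reg (5 * x + 2) = i := by simpa using h2.n.bv x (by simp)
        have n1 : ¬ (5 * x + 2 = 5 * 0) := by omega
        have ev : (s2.set (5 * 0) 1).reg (5 * x + 2) + (s2.set (5 * 0) 1).reg (5 * 0) = i + 1 := by
          simp only [State.set_reg, n1, if_true, if_false, x2]
        have q4 := run_add q3.1 (d := 5 * x + 2) (a := 5 * x + 2) (b := 5 * 0) (by omega)
          (by rw [ev]; omega)
        rw [ev] at q4
        refine ⟨_, q2.seq (q3.seq q4), hi, by simp, ?_, fun j => ?_⟩
        · exact ((h2.unbind hw.1).frame (Frame.set_tmp Γ (t := 0) (t' := 0) s2 1 le_rfl) q3.1).frame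
            (Frame.set_bv (Γ := Γ) 0 _ _ hw.1) q4.1
        · have := n2 j
          rw [add_mul, one_mul, ← add_assoc]
          exact this)
      (Nat.zero_le _)
      ⟨Nat.zero_le _, by simp, h.frame f1 r1.1, fun j => (hbν j).trans (Nat.le_add_right _ _)⟩
    refine ⟨s', (r1.seq r2).mono ?_, hs'.2.2.1, fun j => (hs'.2.2.2 j).trans ?_⟩
    · simp only [steps]
      have : π p - 0 = π p := rfl
      rw [this]
      have : c.steps π + (1 + 1) + 1 = c.steps π + 3 := by ring
      rw [this]
      omega
    · simp only [steps]
      nlinarith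

end

end TensorCPD

/-! ### Linear algebra over the field in this language: elimination, annihilators, linear systems.
-/

namespace TensorCPD

/-! ### Reasoning about commands -/

/-- The array `A` is not read. -/
def FExpr.noArr (A : ℕ) : FExpr → Bool
  | .fv _ => true
  | .arr A' _ _ => decide (A' ≠ A)
  | .ten _ => true
  | .elt _ => true
  | .next e => e.noArr A
  | .add a b => a.noArr A && b.noArr A
  | .mul a b => a.noArr A && b.noArr A
  | .sum _ _ e => e.noArr A
  | .iflt _ _ e e' => e.noArr A && e'.noArr A
  | .ifeq a b e e' => a.noArr A && b.noArr A && e.noArr A && e'.noArr A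

namespace Cmd

/-- The numeric variables that a command may change. -/
def nvW : Cmd → List ℕ
  | skip => []
  | fset _ _ => []
  | store _ _ _ _ => []
  | nconst x _ => [x]
  | nbv x _ => [x]
  | incr x => [x]
  | seq c c' => c.nvW ++ c'.nvW
  | iflt _ _ c c' => c.nvW ++ c'.nvW
  | ifeq _ _ c c' => c.nvW ++ c'.nvW
  | loop _ _ c => c.nvW

/-- The field variables that a command may change. -/
def fvW : Cmd → List ℕ
  | skip => []
  | fset x _ => [x]
  | store _ _ _ _ => []
  | nconst _ _ => []
  | nbv _ _ => []
  | incr _ => []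
  | seq c c' => c.fvW ++ c'.fvW
  | iflt _ _ c c' => c.fvW ++ c'.fvW
  | ifeq _ _ c c' => c.fvW ++ c'.fvW
  | loop _ _ c => c.fvW

/-- The arrays that a command may change. -/
def arrW : Cmd → List ℕ
  | skip => []
  | fset _ _ => []
  | store A _ _ _ => [A]
  | nconst _ _ => []
  | nbv _ _ => []
  | incr _ => []
  | seq c c' => c.arrW ++ c'.arrW
  | iflt _ _ c c' => c.arrW ++ c'.arrW
  | ifeq _ _ c c' => c.arrW ++ c'.arrW
  | loop _ _ c => c.arrW

end Cmd

section

variable {F : Type*} [Field F] {q : ℕ} {code : F ≃ Fin q} {π : ℕ → ℕ} {tin : ℕ → F}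

lemma FExpr.eval_congr {A : ℕ} (e : FExpr) (he : e.noArr A) {ρ : ℕ → ℕ} {σ τ : HS F}
    (hn : σ.nv = τ.nv) (hf : σ.fv = τ.fv) (ha : ∀ A', A' ≠ A → σ.arr A' = τ.arr A') :
    e.eval code π tin ρ σ = e.eval code π tin ρ τ := by
  induction e generalizing ρ with
  | fv x => simp only [eval, hf]
  | arr A' i j =>
    simp only [noArr, decide_eq_true_eq] at he
    simp only [eval, hn, ha A' he]
  | ten i => simp only [eval, hn]
  | elt i => simp only [eval, hn]
  | next e ih => simp only [eval, ih he]
  | add a b iha ihb =>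
    simp only [noArr, Bool.and_eq_true] at he
    simp only [eval, iha he.1, ihb he.2]
  | mul a b iha ihb =>
    simp only [noArr, Bool.and_eq_true] at he
    simp only [eval, iha he.1, ihb he.2]
  | sum x p e ih => simp only [eval, ih he, hf]
  | iflt a b e e' ih ih' =>
    simp only [noArr, Bool.and_eq_true] at he
    simp only [eval, hn, ih he.1, ih' he.2]
  | ifeq a b e e' iha ihb ih ih' =>
    simp only [noArr, Bool.and_eq_true] at he
    rw [eval, eval, iha he.1.1.1, ihb he.1.1.2, ih he.1.2, ih' he.2]

lemma Cmd.den_loop_inv {x p : ℕ} {c : Cmd} {ρ : ℕ → ℕ} {σ : HS F} (P : ℕ → HS F → Prop)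
    (h0 : P 0 σ)
    (hs : ∀ i < π p, ∀ τ, P i τ → P (i + 1) (c.den code π tin (Function.update ρ x i) τ)) :
    P (π p) ((Cmd.loop x p c).den code π tin ρ σ) := by
  rw [Cmd.den]
  have : ∀ n ≤ π p, P n (Nat.rec σ (fun i τ => c.den code π tin (Function.update ρ x i) τ) n) := by
    intro n hn
    induction n with
    | zero => exact h0
    | succ n ih => exact hs n hn _ (ih (by omega))
  exact this _ le_rfl

lemma Cmd.den_nv (c : Cmd) {ρ : ℕ → ℕ} {σ : HS F} {x : ℕ} (hx : x ∉ c.nvW) :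
    (c.den code π tin ρ σ).nv x = σ.nv x := by
  induction c generalizing ρ σ with
  | skip => rfl
  | fset _ _ => rfl
  | store _ _ _ _ => rfl
  | nconst y c => simp only [nvW, List.mem_singleton] at hx; simp [den, hx]
  | nbv y i => simp only [nvW, List.mem_singleton] at hx; simp [den, hx]
  | incr y => simp only [nvW, List.mem_singleton] at hx; simp [den, hx]
  | seq c c' ih ih' =>
    simp only [nvW, List.mem_append, not_or] at hx
    rw [den, ih' hx.2, ih hx.1]
  | iflt a b c c' ih ih' =>
    simp only [nvW, List.mem_append, not_or] at hx
    rw [den]; split_ifs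
    · exact ih hx.1
    · exact ih' hx.2
  | ifeq a b c c' ih ih' =>
    simp only [nvW, List.mem_append, not_or] at hx
    rw [den]; split_ifs
    · exact ih hx.1
    · exact ih' hx.2
  | loop y p c ih =>
    exact Cmd.den_loop_inv (fun _ τ => τ.nv x = σ.nv x) rfl fun i _ τ hτ => by rw [ih hx, hτ]

lemma Cmd.den_fv (c : Cmd) {ρ : ℕ → ℕ} {σ : HS F} {x : ℕ} (hx : x ∉ c.fvW) :
    (c.den code π tin ρ σ).fv x = σ.fv x := by
  induction c generalizing ρ σ with
  | skip => rfl
  | fset y e => simp only [fvW, List.mem_singleton] at hx; simp [den, hx]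
  | store _ _ _ _ => rfl
  | nconst y c => rfl
  | nbv y i => rfl
  | incr y => rfl
  | seq c c' ih ih' =>
    simp only [fvW, List.mem_append, not_or] at hx
    rw [den, ih' hx.2, ih hx.1]
  | iflt a b c c' ih ih' =>
    simp only [fvW, List.mem_append, not_or] at hx
    rw [den]; split_ifs
    · exact ih hx.1
    · exact ih' hx.2
  | ifeq a b c c' ih ih' =>
    simp only [fvW, List.mem_append, not_or] at hx
    rw [den]; split_ifs
    · exact ih hx.1
    · exact ih' hx.2
  | loop y p c ih =>
    exact Cmd.den_loop_inv (fun _ τ => τ.fv x = σ.fv x) rfl fun i _ τ hτ => by rw [ih hx, hτ]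

lemma Cmd.den_arr (c : Cmd) {ρ : ℕ → ℕ} {σ : HS F} {x : ℕ} (hx : x ∉ c.arrW) :
    (c.den code π tin ρ σ).arr x = σ.arr x := by
  induction c generalizing ρ σ with
  | skip => rfl
  | fset y e => rfl
  | store A i j e =>
    simp only [arrW, List.mem_singleton] at hx
    ext i j; simp [den, hx]
  | nconst y c => rfl
  | nbv y i => rfl
  | incr y => rfl
  | seq c c' ih ih' =>
    simp only [arrW, List.mem_append, not_or] at hx
    rw [den, ih' hx.2, ih hx.1]
  | iflt a b c c' ih ih' =>
    simp only [arrW, List.mem_append, not_or] at hx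
    rw [den]; split_ifs
    · exact ih hx.1
    · exact ih' hx.2
  | ifeq a b c c' ih ih' =>
    simp only [arrW, List.mem_append, not_or] at hx
    rw [den]; split_ifs
    · exact ih hx.1
    · exact ih' hx.2
  | loop y p c ih =>
    exact Cmd.den_loop_inv (fun _ τ => τ.arr x = σ.arr x) rfl fun i _ τ hτ => by rw [ih hx, hτ]

/-! ### Array comprehensions -/

/-- `A[i][j] := e` for all `i < n`, `j < m` simultaneously, where `e` refers to `i`, `j` as the loop
variables `0` and `1`. Array `0` serves as scratch. -/
def fill (A n m : ℕ) (e : FExpr) : Cmd :=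
  .seq (.loop 0 n (.loop 1 m (.store 0 (.bv 0) (.bv 1) e)))
    (.loop 0 n (.loop 1 m (.store A (.bv 0) (.bv 1) (.arr 0 (.bv 0) (.bv 1)))))

/-- Serves both passes of `fill`. The hypothesis asks for the value of `e` in every state that
differs from `σ` only in the array being written; in the first pass `e` does not read the scratch
array, in the second it reads nothing else. -/
lemma den_fill_aux {A n m : ℕ} {e : FExpr} {ρ : ℕ → ℕ} {σ : HS F} (hn : π n ≤ π 5 + 1)
    (hm : π m ≤ π 5 + 1) {f : ℕ → ℕ → F}
    (he : ∀ i < π n, ∀ j < π m, ∀ τ : HS F, τ.nv = σ.nv → τ.fv = σ.fv →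
      (∀ A', A' ≠ A → τ.arr A' = σ.arr A') →
      e.eval code π tin (Function.update (Function.update ρ 0 i) 1 j) τ = f i j) :
    ∀ i j, ((Cmd.loop 0 n (.loop 1 m (.store A (.bv 0) (.bv 1) e))).den code π tin ρ σ).arr A i j =
      if i < π n ∧ j < π m then f i j else σ.arr A i j := by
  let Q : HS F → Prop := fun τ => τ.nv = σ.nv ∧ τ.fv = σ.fv ∧ ∀ A', A' ≠ A → τ.arr A' = σ.arr A'
  have main := Cmd.den_loop_inv (code := code) (π := π) (tin := tin) (x := 0) (p := n)
    (c := .loop 1 m (.store A (.bv 0) (.bv 1) e)) (ρ := ρ) (σ := σ)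
    (fun k τ => Q τ ∧ ∀ i j, τ.arr A i j =
      if i < k ∧ j < π m then f i j else σ.arr A i j)
    ⟨⟨rfl, rfl, fun _ _ => rfl⟩, fun i j => by simp⟩
    (fun k hk τ hτ => by
      have inner := Cmd.den_loop_inv (code := code) (π := π) (tin := tin) (x := 1) (p := m)
        (c := .store A (.bv 0) (.bv 1) e) (ρ := Function.update ρ 0 k) (σ := τ)
        (fun l υ => Q υ ∧ ∀ i j, υ.arr A i j =
          if (i < k ∧ j < π m) ∨ (i = k ∧ j < l) then f i j else σ.arr A i j)
        ⟨hτ.1, fun i j => by simp [hτ.2]⟩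
        (fun l hl υ hυ => by
          obtain ⟨⟨h1, h2, h3⟩, h4⟩ := hυ
          rw [Cmd.den, he k hk l hl υ h1 h2 h3]
          refine ⟨⟨h1, h2, fun A' hA' => ?_⟩, fun i j => ?_⟩
          · rw [← h3 A' hA']; ext i j; simp [hA']
          · have e1 : min k (π 5) = k := by omega
            have e2 : min l (π 5) = l := by omega
            simp only [HS.setA_arr, NExpr.eval, Function.update_self, true_and,
              Function.update_of_ne (show (0 : ℕ) ≠ 1 by decide), e1, e2, h4]
            by_cases c1 : i = k ∧ j = l
            · obtain ⟨rfl, rfl⟩ := c1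
              simp
            · rw [if_neg c1]
              have : ((i < k ∧ j < π m) ∨ (i = k ∧ j < l)) ↔
                  ((i < k ∧ j < π m) ∨ (i = k ∧ j < l + 1)) := by omega
              simp only [this])
      refine ⟨inner.1, fun i j => ?_⟩
      rw [inner.2]
      have : ((i < k ∧ j < π m) ∨ (i = k ∧ j < π m)) ↔ (i < k + 1 ∧ j < π m) := by omega
      simp only [this])
  exact main.2

lemma den_fill {A n m : ℕ} {e : FExpr} {ρ : ℕ → ℕ} {σ : HS F} (hn : π n ≤ π 5 + 1)
    (hm : π m ≤ π 5 + 1) (hA : A ≠ 0) (he : e.noArr 0) (i j : ℕ) :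
    ((fill A n m e).den code π tin ρ σ).arr A i j =
      if i < π n ∧ j < π m then
        e.eval code π tin (Function.update (Function.update ρ 0 i) 1 j) σ else σ.arr A i j := by
  rw [fill, Cmd.den]
  set c1 := Cmd.loop 0 n (.loop 1 m (.store 0 (.bv 0) (.bv 1) e))
  set σ1 := c1.den code π tin ρ σ with hσ1
  have h1 := den_fill_aux (code := code) (π := π) (tin := tin) (A := 0) (e := e) (ρ := ρ) (σ := σ)
    hn hm (f := fun i j => e.eval code π tin (Function.update (Function.update ρ 0 i) 1 j) σ)
    (fun i _ j _ τ g1 g2 g3 => FExpr.eval_congr e he g1 g2 g3)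
  have h2 := den_fill_aux (code := code) (π := π) (tin := tin) (A := A)
    (e := .arr 0 (.bv 0) (.bv 1)) (ρ := ρ) (σ := σ1) hn hm (f := σ1.arr 0)
    (fun i hi j hj τ g1 g2 g3 => by
      have e1 : min i (π 5) = i := by omega
      have e2 : min j (π 5) = j := by omega
      simp only [FExpr.eval, NExpr.eval, Function.update_self,
        Function.update_of_ne (show (0 : ℕ) ≠ 1 by decide), e1, e2, g3 0 (Ne.symm hA)])
  rw [h2]
  by_cases hc : i < π n ∧ j < π m
  · rw [if_pos hc, if_pos hc, h1, if_pos hc]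
  · rw [if_neg hc, if_neg hc, hσ1, Cmd.den_arr]
    simpa [c1, Cmd.arrW] using hA

@[simp] lemma fill_nvW (A n m : ℕ) (e : FExpr) : (fill A n m e).nvW = [] := rfl
@[simp] lemma fill_fvW (A n m : ℕ) (e : FExpr) : (fill A n m e).fvW = [] := rfl
@[simp] lemma fill_arrW (A n m : ℕ) (e : FExpr) : (fill A n m e).arrW = [0, A] := rfl

/-! ### Adding a linear equation -/

/-- Intersecting the span of the rows of the array `X` (with `r` rows and `c` columns) with the
hyperplane orthogonal to row `0` of array `1`. Variable `0` tells whether the span changes; then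
row `0` of array `3` is the pivot row. Row `0` of array `2` shows the products of the rows with the
equation. -/
def addEq (X r c : ℕ) : Cmd :=
  .seq (.seq (.seq (fill 2 19 r (.sum 2 c (.mul (.arr X (.bv 1) (.bv 2)) (.arr 1 (.const 0) (.bv 2)))))
    (.nconst 0 0))
    (.loop 5 r (.ifeq (.arr 2 (.const 0) (.bv 5)) (.fv 0) .skip (.seq (.nbv 1 5) (.nconst 0 1)))))
    (.iflt (.const 0) (.nv 0)
      (.seq (fill 3 19 c (.arr X (.nv 1) (.bv 1)))
        (fill X r c (.add (.mul (.arr 2 (.const 0) (.nv 1)) (.arr X (.bv 0) (.bv 1)))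
          (.mul (.fv 2) (.mul (.arr 2 (.const 0) (.bv 0)) (.arr X (.nv 1) (.bv 1)))))))
      .skip)

@[simp] lemma addEq_nvW (X r c : ℕ) : (addEq X r c).nvW = [0, 1, 0] := rfl
@[simp] lemma addEq_fvW (X r c : ℕ) : (addEq X r c).fvW = [] := rfl
@[simp] lemma addEq_arrW (X r c : ℕ) : (addEq X r c).arrW = [0, 2, 0, 3, 0, X] := rfl

/-- Variables `0`, `1`, `2` hold the field elements `0`, `1`, `-1`, and parameter `19` is `1`. -/
structure Good (π : ℕ → ℕ) (σ : HS F) : Prop where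
  zero : σ.fv 0 = 0
  one : σ.fv 1 = 1
  neg : σ.fv 2 = -1
  par : π 19 = 1

lemma Good.den {σ : HS F} (h : Good π σ) (c : Cmd) {ρ : ℕ → ℕ} (h0 : 0 ∉ c.fvW) (h1 : 1 ∉ c.fvW)
    (h2 : 2 ∉ c.fvW) : Good π (c.den code π tin ρ σ) :=
  ⟨by rw [c.den_fv h0, h.zero], by rw [c.den_fv h1, h.one], by rw [c.den_fv h2, h.neg], h.par⟩

/-- The loop remembers the last row `p` whose product `y p` with the equation is nonzero. The new
rows `y p * X i - y i * X p` are orthogonal to the equation and are formed without division. Row `p`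
itself becomes zero, so the number of rows can stay fixed. -/
lemma addEq_spec {X r c : ℕ} (hX : 3 < X) {ρ : ℕ → ℕ} {σ : HS F} (hg : Good π σ)
    (hr : π r ≤ π 5 + 1) (hc : π c ≤ π 5 + 1) :
    ∃ τ : HS F, τ = (addEq X r c).den code π tin ρ σ ∧ ∃ y : ℕ → F,
      (∀ i, y i = ∑ l ∈ Finset.range (π c), σ.arr X i l * σ.arr 1 0 l) ∧
      ((τ.nv 0 = 0 ∧ (∀ i < π r, y i = 0) ∧ τ.arr X = σ.arr X) ∨
       (τ.nv 0 = 1 ∧ ∃ p < π r, y p ≠ 0 ∧ (∀ i < π r, τ.arr 2 0 i = y i) ∧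
        (∀ l < π c, τ.arr 3 0 l = σ.arr X p l) ∧
        ∀ i < π r, ∀ l < π c, τ.arr X i l = y p * σ.arr X i l - y i * σ.arr X p l)) := by
  refine ⟨_, rfl, fun i => ∑ l ∈ Finset.range (π c), σ.arr X i l * σ.arr 1 0 l, fun i => rfl, ?_⟩
  have h19 := hg.par
  set y : ℕ → F := fun i => ∑ l ∈ Finset.range (π c), σ.arr X i l * σ.arr 1 0 l with hy
  rw [addEq, Cmd.den, Cmd.den, Cmd.den]
  set σ1 := (fill 2 19 r
    (.sum 2 c (.mul (.arr X (.bv 1) (.bv 2)) (.arr 1 (.const 0) (.bv 2))))).den code π tin ρ σ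
    with hσ1
  have hs1 : ∀ i < π r, σ1.arr 2 0 i = y i := by
    intro i hi
    rw [hσ1, den_fill (by omega) hr (by decide) (by simp [FExpr.noArr]; omega), if_pos (by omega)]
    simp only [FExpr.eval, hg.zero, zero_add, hy]
    refine Finset.sum_congr rfl fun l hl => ?_
    have := Finset.mem_range.mp hl
    simp [Function.update_apply, min_eq_left (show i ≤ π 5 by omega),
      min_eq_left (show l ≤ π 5 by omega)]
  have hX1 : ∀ A, A ≠ 0 → A ≠ 2 → σ1.arr A = σ.arr A := fun A h0 h2 => Cmd.den_arr _ (by simp [h0, h2])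
  have hg1 : Good π σ1 := hg.den _ (by simp) (by simp) (by simp)
  set σ2 := (Cmd.nconst 0 0).den code π tin ρ σ1 with hσ2
  set c3 := Cmd.loop 5 r (.ifeq (.arr 2 (.const 0) (.bv 5)) (.fv 0) .skip
    (.seq (.nbv 1 5) (.nconst 0 1))) with hc3
  set σ3 := c3.den code π tin ρ σ2 with hσ3
  have hfind : (σ3.arr = σ1.arr ∧ σ3.fv = σ1.fv) ∧ ((σ3.nv 0 = 0 ∧ ∀ i < π r, y i = 0) ∨
      (σ3.nv 0 = 1 ∧ σ3.nv 1 < π r ∧ y (σ3.nv 1) ≠ 0)) := by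
    refine Cmd.den_loop_inv (fun k τ => (τ.arr = σ1.arr ∧ τ.fv = σ1.fv) ∧
      ((τ.nv 0 = 0 ∧ ∀ i < k, y i = 0) ∨ (τ.nv 0 = 1 ∧ τ.nv 1 < π r ∧ y (τ.nv 1) ≠ 0)))
      ⟨⟨rfl, rfl⟩, Or.inl ⟨by simp [hσ2, Cmd.den], by simp⟩⟩ fun k hk τ hτ => ?_
    obtain ⟨⟨h1, h2⟩, h3⟩ := hτ
    have ev : FExpr.eval code π tin (Function.update ρ 5 k) τ (.arr 2 (.const 0) (.bv 5)) = y k := by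
      simp only [FExpr.eval, NExpr.eval, Function.update_self, h1, Nat.zero_min]
      rw [min_eq_left (by omega), hs1 k hk]
    rw [Cmd.den, ev, FExpr.eval, h2, hg1.zero]
    split_ifs with hk0
    · refine ⟨⟨h1, h2⟩, ?_⟩
      rcases h3 with h3 | h3
      · refine Or.inl ⟨h3.1, fun i hi => ?_⟩
        rcases Nat.lt_succ_iff_lt_or_eq.mp hi with h | rfl
        · exact h3.2 i h
        · exact hk0
      · exact Or.inr h3
    · refine ⟨⟨h1, h2⟩, Or.inr ?_⟩
      simp [Cmd.den, hk, hk0]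
  have hg3 : Good π σ3 := by
    have := hfind.1.2
    exact ⟨by rw [this, hg1.zero], by rw [this, hg1.one], by rw [this, hg1.neg], h19⟩
  have hX3 : ∀ A, A ≠ 0 → A ≠ 2 → σ3.arr A = σ.arr A := fun A h0 h2 => by
    rw [hfind.1.1, hX1 A h0 h2]
  have hs3 : ∀ i < π r, σ3.arr 2 0 i = y i := fun i hi => by rw [hfind.1.1, hs1 i hi]
  rw [Cmd.den]
  rcases hfind.2 with ⟨h0, hz⟩ | ⟨h0, hp, hne⟩
  · left
    rw [if_neg (by simp [h0])]
    exact ⟨h0, hz, hX3 X (by omega) (by omega)⟩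
  · right
    rw [if_pos (by simp [h0]), Cmd.den]
    set p := σ3.nv 1 with hpdef
    set σ4 := (fill 3 19 c (.arr X (.nv 1) (.bv 1))).den code π tin ρ σ3 with hσ4
    have hs4 : ∀ l < π c, σ4.arr 3 0 l = σ.arr X p l := by
      intro l hl
      rw [hσ4, den_fill (by omega) hc (by decide) (by simp [FExpr.noArr]; omega),
        if_pos (by omega)]
      simp [FExpr.eval, Function.update_apply, min_eq_left (show l ≤ π 5 by omega), ← hpdef,
        min_eq_left (show p ≤ π 5 by omega), hX3 X (by omega) (by omega)]
    have hX4 : ∀ A, A ≠ 0 → A ≠ 3 → σ4.arr A = σ3.arr A := fun A h0 h2 =>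
      Cmd.den_arr _ (by simp [h0, h2])
    have hg4 : Good π σ4 := hg3.den _ (by simp) (by simp) (by simp)
    have hn4 : ∀ x, σ4.nv x = σ3.nv x := fun x => Cmd.den_nv _ (by simp)
    refine ⟨by rw [Cmd.den_nv _ (by simp), hn4, h0], p, hp, hne, fun i hi => ?_, fun l hl => ?_,
      fun i hi l hl => ?_⟩
    · rw [Cmd.den_arr _ (by simp; omega), hX4 2 (by decide) (by decide), hs3 i hi]
    · rw [Cmd.den_arr _ (by simp; omega), hs4 l hl]
    · rw [den_fill hr hc (by omega) (by simp [FExpr.noArr]; omega), if_pos ⟨hi, hl⟩]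
      simp only [FExpr.eval, NExpr.eval, Function.update_self, hn4, ← hpdef, hg4.neg,
        Function.update_of_ne (show (0 : ℕ) ≠ 1 by decide), Nat.zero_min,
        min_eq_left (show i ≤ π 5 by omega), min_eq_left (show l ≤ π 5 by omega),
        min_eq_left (show p ≤ π 5 by omega), hX4 2 (by decide) (by decide),
        hX4 X (by omega) (by omega), hX3 X (by omega) (by omega), hs3 p hp, hs3 i hi]
      ring

end

end TensorCPD

namespace TensorCPD

/-! ### Annihilators -/

section

variable {F : Type*} [Field F]

/-- The vectors orthogonal to the subspace `S` with respect to the dot product. -/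
def ann {c : ℕ} (S : Submodule F (Fin c → F)) : Submodule F (Fin c → F) where
  carrier := {x | ∀ s ∈ S, x ⬝ᵥ s = 0}
  add_mem' := fun {a b} ha hb s hs => by rw [add_dotProduct, ha s hs, hb s hs, add_zero]
  zero_mem' := fun s _ => zero_dotProduct s
  smul_mem' := fun k x hx s hs => by rw [smul_dotProduct, hx s hs, smul_zero]

lemma mem_ann {c : ℕ} {S : Submodule F (Fin c → F)} {x : Fin c → F} :
    x ∈ ann S ↔ ∀ s ∈ S, x ⬝ᵥ s = 0 := Iff.rfl

lemma mem_ann_span {c : ℕ} {A : Set (Fin c → F)} {x : Fin c → F} :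
    x ∈ ann (Submodule.span F A) ↔ ∀ s ∈ A, x ⬝ᵥ s = 0 := by
  refine ⟨fun h s hs => h s (Submodule.subset_span hs), fun h s hs => ?_⟩
  induction hs using Submodule.span_induction with
  | mem s hs => exact h s hs
  | zero => exact dotProduct_zero x
  | add a b _ _ ha hb => rw [dotProduct_add, ha, hb, add_zero]
  | smul k a _ ha => rw [dotProduct_smul, ha, smul_zero]

/-- A linear functional that vanishes on `S` but not at `e` is a dot product with the vector of its
values at the unit vectors. This gives the double annihilator identity, by which membership in a
stored subspace can be tested. -/
lemma exists_mem_ann {c : ℕ} {S : Submodule F (Fin c → F)} {e : Fin c → F} (he : e ∉ S) :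
    ∃ x ∈ ann S, x ⬝ᵥ e ≠ 0 := by
  obtain ⟨φ, h1, h2⟩ := Submodule.exists_dual_map_eq_bot_of_notMem he inferInstance
  have hφ : ∀ v, φ v = (fun i => φ (Pi.single i 1)) ⬝ᵥ v := by
    intro v
    conv_lhs => rw [← LinearMap.sum_single_apply (φ := fun _ : Fin c => F) v]
    rw [map_sum, dotProduct]
    refine Finset.sum_congr rfl fun i _ => ?_
    have : (Pi.single i (v i) : Fin c → F) = v i • Pi.single i 1 := by
      rw [← Pi.single_smul, smul_eq_mul, mul_one]
    rw [this, map_smul, smul_eq_mul, mul_comm]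
  refine ⟨fun i => φ (Pi.single i 1), fun s hs => ?_, by rw [← hφ]; exact h1⟩
  rw [← hφ]
  have : φ s ∈ S.map φ := Submodule.mem_map_of_mem hs
  rw [h2] at this
  simpa using this

lemma ann_ann {c : ℕ} (S : Submodule F (Fin c → F)) : ann (ann S) = S := by
  ext e
  refine ⟨fun h => ?_, fun h x hx => by rw [dotProduct_comm]; exact hx e h⟩
  by_contra he
  obtain ⟨x, hx, hne⟩ := exists_mem_ann he
  exact hne (by rw [dotProduct_comm]; exact h x hx)

lemma ann_bot {c : ℕ} : ann (⊥ : Submodule F (Fin c → F)) = ⊤ := by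
  ext x
  simp [mem_ann]

/-- The first `c` entries of a sequence. -/
def vec (c : ℕ) (f : ℕ → F) : Fin c → F := fun l => f l

lemma vec_dot {c : ℕ} (f g : ℕ → F) :
    vec c f ⬝ᵥ vec c g = ∑ l ∈ Finset.range c, f l * g l := by
  rw [Finset.sum_range]; rfl

/-- The span of the first `r` rows of a two-dimensional array, cut off at length `c`. -/
def rows (r c : ℕ) (X : ℕ → ℕ → F) : Submodule F (Fin c → F) :=
  Submodule.span F ((fun i => vec c (X i)) '' {i | i < r})

lemma vec_mem_rows {r c : ℕ} {X : ℕ → ℕ → F} {i : ℕ} (hi : i < r) : vec c (X i) ∈ rows r c X :=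
  Submodule.subset_span ⟨i, hi, rfl⟩

lemma rows_le {r c : ℕ} {X : ℕ → ℕ → F} {S : Submodule F (Fin c → F)}
    (h : ∀ i < r, vec c (X i) ∈ S) : rows r c X ≤ S := by
  refine Submodule.span_le.mpr ?_
  rintro _ ⟨i, hi, rfl⟩
  exact h i hi

/-- Elements of the row span are combinations of the rows. -/
lemma mem_rows {r c : ℕ} {X : ℕ → ℕ → F} {x : Fin c → F} (hx : x ∈ rows r c X) :
    ∃ a : ℕ → F, x = ∑ i ∈ Finset.range r, a i • vec c (X i) := by
  induction hx using Submodule.span_induction with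
  | mem s hs =>
    obtain ⟨i, hi, rfl⟩ := hs
    refine ⟨fun k => if k = i then 1 else 0, ?_⟩
    simp only [ite_smul, one_smul, zero_smul]
    rw [Finset.sum_ite_eq' (Finset.range r) i, if_pos (Finset.mem_range.mpr hi)]
  | zero => exact ⟨0, by simp⟩
  | add x y _ _ hx hy =>
    obtain ⟨a, rfl⟩ := hx
    obtain ⟨b, rfl⟩ := hy
    exact ⟨a + b, by simp [add_smul, Finset.sum_add_distrib]⟩
  | smul k x _ hx =>
    obtain ⟨a, rfl⟩ := hx
    exact ⟨k • a, by simp [Finset.smul_sum, mul_smul]⟩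

lemma rows_identity {c : ℕ} {X : ℕ → ℕ → F} (h : ∀ i < c, ∀ l < c, X i l = if i = l then 1 else 0) :
    rows c c X = ann ⊥ := by
  rw [ann_bot, eq_top_iff]
  intro x _
  rw [← LinearMap.sum_single_apply (φ := fun _ : Fin c => F) x]
  refine Submodule.sum_mem _ fun i _ => ?_
  have : (LinearMap.single F (fun _ : Fin c => F) i) (x i) = x i • vec c (X i) := by
    ext l
    simp only [LinearMap.single_apply, Pi.smul_apply, vec, smul_eq_mul, h i i.2 l l.2, Pi.single_apply,
      Fin.ext_iff]
    by_cases hl : (l : ℕ) = i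
    · simp [hl]
    · simp [hl, Ne.symm hl]
  have h2 := Submodule.smul_mem _ (x i) (vec_mem_rows (X := X) (c := c) i.2)
  rwa [← this] at h2

/-- The elimination step intersects the row span with a hyperplane. -/
lemma rows_step {r c : ℕ} {X X' : ℕ → ℕ → F} {e : Fin c → F} {y : ℕ → F} {p : ℕ} (hp : p < r)
    (hy : ∀ i < r, y i = vec c (X i) ⬝ᵥ e) (hne : y p ≠ 0)
    (h : ∀ i < r, ∀ l < c, X' i l = y p * X i l - y i * X p l) (S : Submodule F (Fin c → F))
    (hS : rows r c X = ann S) : rows r c X' = ann (S ⊔ Submodule.span F {e}) := by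
  have hX' : ∀ i < r, vec c (X' i) = y p • vec c (X i) - y i • vec c (X p) := fun i hi => by
    ext l; exact h i hi l l.2
  have hmem : ∀ x, x ∈ ann (S ⊔ Submodule.span F {e}) ↔ x ∈ ann S ∧ x ⬝ᵥ e = 0 := by
    intro x
    refine ⟨fun hx => ⟨fun s hs => hx s (Submodule.mem_sup_left hs),
      hx e (Submodule.mem_sup_right (Submodule.mem_span_singleton_self e))⟩, fun hx s hs => ?_⟩
    obtain ⟨a, ha, b, hb, rfl⟩ := Submodule.mem_sup.mp hs
    obtain ⟨k, rfl⟩ := Submodule.mem_span_singleton.mp hb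
    rw [dotProduct_add, hx.1 a ha, dotProduct_smul, hx.2, smul_zero, add_zero]
  apply le_antisymm
  · refine rows_le fun i hi => (hmem _).mpr ⟨?_, ?_⟩
    · rw [hX' i hi, ← hS]
      exact Submodule.sub_mem _ (Submodule.smul_mem _ _ (vec_mem_rows hi))
        (Submodule.smul_mem _ _ (vec_mem_rows hp))
    · rw [hX' i hi, sub_dotProduct, smul_dotProduct, smul_dotProduct, ← hy i hi, ← hy p hp,
        smul_eq_mul, smul_eq_mul]
      ring
  · intro x hx
    obtain ⟨hx1, hx2⟩ := (hmem x).mp hx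
    rw [← hS] at hx1
    obtain ⟨a, rfl⟩ := mem_rows hx1
    -- For a combination of old rows that lies in the hyperplane, the multiples of the pivot row
    -- cancel. Hence `y p` times the combination is the same combination of the new rows.
    have hsum : ∑ i ∈ Finset.range r, a i * y i = 0 := by
      rw [sum_dotProduct] at hx2
      rw [← hx2]
      refine Finset.sum_congr rfl fun i hi => ?_
      rw [smul_dotProduct, hy i (Finset.mem_range.mp hi), smul_eq_mul]
    have : y p • ∑ i ∈ Finset.range r, a i • vec c (X i) =
        ∑ i ∈ Finset.range r, a i • vec c (X' i) := by
      have h2 : ∑ i ∈ Finset.range r, a i • vec c (X' i) =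
          ∑ i ∈ Finset.range r, (y p • (a i • vec c (X i)) - (a i * y i) • vec c (X p)) := by
        refine Finset.sum_congr rfl fun i hi => ?_
        rw [hX' i (Finset.mem_range.mp hi), smul_sub, smul_comm, mul_smul]
      rw [h2, Finset.sum_sub_distrib, ← Finset.sum_smul, hsum, zero_smul, sub_zero,
        Finset.smul_sum]
    rw [← inv_smul_smul₀ hne (∑ i ∈ Finset.range r, a i • vec c (X i)), this]
    exact Submodule.smul_mem _ _ (Submodule.sum_mem _ fun i hi =>
      Submodule.smul_mem _ _ (vec_mem_rows (Finset.mem_range.mp hi)))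

/-- By `ann_ann`, membership in `S` means orthogonality to a generating set of `ann S`, which is
what the rows are. -/
lemma mem_of_rows_orthogonal {r c : ℕ} {X : ℕ → ℕ → F} {e : Fin c → F}
    {S : Submodule F (Fin c → F)} (hS : rows r c X = ann S) :
    e ∈ S ↔ ∀ i < r, vec c (X i) ⬝ᵥ e = 0 := by
  conv_lhs => rw [← ann_ann S, ← hS]
  rw [rows, mem_ann_span]
  simp [dotProduct_comm]

variable {q : ℕ} {code : F ≃ Fin q} {π : ℕ → ℕ} {tin : ℕ → F}

/-- If the rows of `X` span the annihilator of `S`, then after adding the equation `e` they span the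
annihilator of `S + ⟨e⟩`, and variable `0` tells whether `e ∉ S`. -/
lemma addEq_ann {X r c : ℕ} (hX : 3 < X) {ρ : ℕ → ℕ} {σ : HS F} (hg : Good π σ)
    (hr : π r ≤ π 5 + 1) (hc : π c ≤ π 5 + 1) {S : Submodule F (Fin (π c) → F)}
    (hS : rows (π r) (π c) (σ.arr X) = ann S) {e : Fin (π c) → F}
    (he : vec (π c) (σ.arr 1 0) = e) {τ : HS F} (hτ : τ = (addEq X r c).den code π tin ρ σ) :
    rows (π r) (π c) (τ.arr X) = ann (S ⊔ Submodule.span F {e}) ∧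
      ((τ.nv 0 = 0 ∧ e ∈ S) ∨ (τ.nv 0 = 1 ∧ e ∉ S ∧ vec (π c) (τ.arr 3 0) ∈ ann S ∧
        vec (π c) (τ.arr 3 0) ⬝ᵥ e ≠ 0)) := by
  obtain ⟨τ', hτ', y, hy, h⟩ := addEq_spec (code := code) (tin := tin) hX (ρ := ρ) hg hr hc
  rw [← hτ'] at hτ
  subst hτ
  have hy' : ∀ i, y i = vec (π c) (σ.arr X i) ⬝ᵥ e := fun i => by rw [← he, vec_dot, hy]
  rcases h with ⟨h0, hz, hXe⟩ | ⟨h0, p, hp, hne, -, h3, hXe⟩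
  · have hes : e ∈ S := (mem_of_rows_orthogonal hS).mpr fun i hi => by rw [← hy', hz i hi]
    refine ⟨?_, Or.inl ⟨h0, hes⟩⟩
    rw [hXe, hS, sup_eq_left.mpr]
    rw [Submodule.span_le]
    simpa using hes
  · have h3' : vec (π c) (τ.arr 3 0) = vec (π c) (σ.arr X p) := funext fun l => h3 l l.2
    refine ⟨rows_step hp (fun i _ => hy' i) hne hXe S hS, Or.inr ⟨h0, fun hes => hne ?_, ?_, ?_⟩⟩
    · rw [hy']; exact (mem_of_rows_orthogonal hS).mp hes p hp
    · rw [h3', ← hS]; exact vec_mem_rows hp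
    · rw [h3', ← hy']; exact hne

/-! ### Rank-one deflation -/

lemma matrix_rank_add_le {m n : ℕ} (A B : Matrix (Fin m) (Fin n) F) :
    (A + B).rank ≤ A.rank + B.rank := by
  have hle : LinearMap.range (A + B).mulVecLin ≤
      LinearMap.range A.mulVecLin ⊔ LinearMap.range B.mulVecLin := by
    rintro _ ⟨x, rfl⟩
    rw [Matrix.mulVecLin_add]
    exact Submodule.add_mem_sup ⟨x, rfl⟩ ⟨x, rfl⟩
  exact (Submodule.finrank_mono hle).trans (Submodule.finrank_add_le_finrank_add_finrank _ _)

end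

end TensorCPD

namespace TensorCPD

/-! ### Systems of linear equations -/

/-- Case distinction on equality of indices. -/
def nEq (a b : NExpr) (e e' : FExpr) : FExpr := .iflt a b e' (.iflt b a e' e)

/-- Row `0` of array `1` becomes the unit vector with index `k`. -/
def unitE (c : ℕ) (k : NExpr) : Cmd := fill 1 19 c (nEq (.bv 1) k (.fv 1) (.fv 0))

/-- The array `X` becomes the identity matrix. -/
def ident (X c : ℕ) : Cmd := fill X c c (nEq (.bv 0) (.bv 1) (.fv 1) (.fv 0))

/-- Adding the equations `e`, one for each value of the loop variable `x` below parameter `p`. -/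
def addAll (x p X r c : ℕ) (e : FExpr) : Cmd := .loop x p (.seq (fill 1 19 c e) (addEq X r c))

section

variable {F : Type*} [Field F] {q : ℕ} {code : F ≃ Fin q} {π : ℕ → ℕ} {tin : ℕ → F}

@[simp] lemma eval_nEq (a b : NExpr) (e e' : FExpr) (ρ : ℕ → ℕ) (σ : HS F) :
    (nEq a b e e').eval code π tin ρ σ = if a.eval π ρ σ.nv = b.eval π ρ σ.nv then
      e.eval code π tin ρ σ else e'.eval code π tin ρ σ := by
  simp only [nEq, FExpr.eval]
  split_ifs <;> first | rfl | omega

@[simp] lemma unitE_nvW (c : ℕ) (k : NExpr) : (unitE c k).nvW = [] := rfl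
@[simp] lemma unitE_fvW (c : ℕ) (k : NExpr) : (unitE c k).fvW = [] := rfl
@[simp] lemma unitE_arrW (c : ℕ) (k : NExpr) : (unitE c k).arrW = [0, 1] := rfl
@[simp] lemma ident_nvW (X c : ℕ) : (ident X c).nvW = [] := rfl
@[simp] lemma ident_fvW (X c : ℕ) : (ident X c).fvW = [] := rfl
@[simp] lemma ident_arrW (X c : ℕ) : (ident X c).arrW = [0, X] := rfl

lemma unitE_spec {c : ℕ} {k : NExpr} {ρ : ℕ → ℕ} {σ : HS F} (hg : Good π σ) (hc : π c ≤ π 5 + 1)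
    {v : ℕ} (hk : ∀ j, k.eval π (Function.update (Function.update ρ 0 0) 1 j) σ.nv = v) {l : ℕ}
    (hl : l < π c) :
    ((unitE c k).den code π tin ρ σ).arr 1 0 l = if l = v then 1 else 0 := by
  have h19 := hg.par
  rw [unitE, den_fill (by omega) hc (by decide) (by simp [nEq, FExpr.noArr]), if_pos (by omega),
    eval_nEq, hk]
  simp [FExpr.eval, hg.zero, hg.one]

lemma ident_spec {X c : ℕ} (hX : X ≠ 0) {ρ : ℕ → ℕ} {σ : HS F} (hg : Good π σ)
    (hc : π c ≤ π 5 + 1) :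
    rows (π c) (π c) (((ident X c).den code π tin ρ σ).arr X) = ann ⊥ := by
  refine rows_identity fun i hi l hl => ?_
  rw [ident, den_fill hc hc hX (by simp [nEq, FExpr.noArr]), if_pos ⟨hi, hl⟩, eval_nEq]
  simp [FExpr.eval, hg.zero, hg.one]

/-- The upper left part of a two-dimensional array as a matrix. -/
def mat (m n : ℕ) (X : ℕ → ℕ → F) : Matrix (Fin m) (Fin n) F := Matrix.of fun i j => X i j

lemma mat_apply (m n : ℕ) (X : ℕ → ℕ → F) (i : Fin m) (j : Fin n) : mat m n X i j = X i j := rfl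

lemma mat_congr {m n : ℕ} {X Y : ℕ → ℕ → F} (h : ∀ i < m, ∀ j < n, X i j = Y i j) :
    mat m n X = mat m n Y := by
  ext i j; exact h i i.2 j j.2


@[simp] lemma addAll_nvW (x p X r c : ℕ) (e : FExpr) : (addAll x p X r c e).nvW = [0, 1, 0] := rfl
@[simp] lemma addAll_fvW (x p X r c : ℕ) (e : FExpr) : (addAll x p X r c e).fvW = [] := rfl
@[simp] lemma addAll_arrW (x p X r c : ℕ) (e : FExpr) :
    (addAll x p X r c e).arrW = [0, 1, 0, 2, 0, 3, 0, X] := rfl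

/-- The value `f i` of the equation is demanded in every state that the loop can reach. Such states
differ from `σ` only in the scratch arrays `0` to `3`, in `X`, and in the variables `0` and `1` used
by `addEq`. -/
lemma addAll_ann {x p X r c : ℕ} {e : FExpr} (hX : 3 < X) {ρ : ℕ → ℕ} {σ : HS F} (hg : Good π σ)
    (hr : π r ≤ π 5 + 1) (hc : π c ≤ π 5 + 1) {S : Submodule F (Fin (π c) → F)}
    (hS : rows (π r) (π c) (σ.arr X) = ann S) (he : e.noArr 0) (f : ℕ → Fin (π c) → F)
    (hf : ∀ i < π p, ∀ τ : HS F, Good π τ → (∀ A, A ∉ [0, 1, 2, 3, X] → τ.arr A = σ.arr A) →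
      (∀ n, n ∉ [0, 1] → τ.nv n = σ.nv n) → ∀ l : Fin (π c), e.eval code π tin
        (Function.update (Function.update (Function.update ρ x i) 0 0) 1 l) τ = f i l) :
    rows (π r) (π c) (((addAll x p X r c e).den code π tin ρ σ).arr X) =
      ann (S ⊔ Submodule.span F (f '' {i | i < π p})) := by
  refine (Cmd.den_loop_inv (fun k τ => Good π τ ∧ (∀ A, A ∉ [0, 1, 2, 3, X] → τ.arr A = σ.arr A) ∧
      (∀ n, n ∉ [0, 1] → τ.nv n = σ.nv n) ∧ rows (π r) (π c) (τ.arr X) =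
        ann (S ⊔ Submodule.span F (f '' {i | i < k}))) ⟨hg, fun _ _ => rfl, fun _ _ => rfl, by simpa⟩
    fun k hk τ ⟨h1, h2, h3, h4⟩ => ?_).2.2.2
  have h19 := hg.par
  rw [Cmd.den]
  set τ1 := (fill 1 19 c e).den code π tin (Function.update ρ x k) τ with hτ1
  have g1 : Good π τ1 := h1.den _ (by simp) (by simp) (by simp)
  have a1 : ∀ A, A ≠ 0 → A ≠ 1 → τ1.arr A = τ.arr A := fun A h h' => Cmd.den_arr _ (by simp [h, h'])
  have hE : vec (π c) (τ1.arr 1 0) = f k := by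
    ext l
    rw [vec, hτ1, den_fill (by omega) hc (by decide) he, if_pos ⟨by omega, l.2⟩, hf k hk τ h1 h2 h3]
  refine ⟨g1.den _ (by simp) (by simp) (by simp), fun A hA => ?_, fun n hn => ?_, ?_⟩
  · rw [← h2 A hA]
    simp only [List.mem_cons, List.not_mem_nil, or_false, not_or] at hA
    rw [Cmd.den_arr _ (by simp [hA]), a1 A hA.1 hA.2.1]
  · rw [← h3 n hn]
    simp only [List.mem_cons, List.not_mem_nil, or_false, not_or] at hn
    rw [Cmd.den_nv _ (by simp [hn]), Cmd.den_nv _ (by simp)]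
  · rw [← a1 X (by omega) (by omega)] at h4
    rw [(addEq_ann hX g1 hr hc h4 hE rfl).1, sup_assoc]
    congr 2
    rw [← Submodule.span_union]
    congr 1
    ext v
    simp only [Set.mem_union, Set.mem_image, Set.mem_ofPred_eq, Set.mem_singleton_iff,
      Nat.lt_succ_iff_lt_or_eq]
    constructor
    · rintro (⟨i, hi, rfl⟩ | rfl)
      · exact ⟨i, Or.inl hi, rfl⟩
      · exact ⟨k, Or.inr rfl, rfl⟩
    · rintro ⟨i, hi | rfl, rfl⟩
      · exact Or.inl ⟨i, hi, rfl⟩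
      · exact Or.inr rfl

/-! ### Outer products -/

/-- Entry `l` of the flattened outer product of two vectors, given as expressions in the loop
variables `2` and `3`, respectively. -/
def outerX (l : NExpr) (a b : FExpr) : FExpr :=
  .sum 2 2 (.sum 3 3 (nEq l (.add (.mul (.bv 2) (.par 3)) (.bv 3)) (.mul a b) (.fv 0)))

/-- Index expressions have no division. The position `l` of a flattened matrix is split into row and
column by summing over all pairs and keeping the one with `l = i * n + j`. -/
lemma sum_oneHot {m n : ℕ} (f : ℕ → ℕ → F) {l : ℕ} (hl : l < m * n) :
    ∑ i ∈ Finset.range m, ∑ j ∈ Finset.range n, (if l = i * n + j then f i j else 0) =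
      f (l / n) (l % n) := by
  have hn : 0 < n := Nat.pos_of_ne_zero fun h => by subst h; simp at hl
  have key : ∀ i, ∀ j ∈ Finset.range n, (if l = i * n + j then f i j else 0) =
      if i = l / n then (if j = l % n then f i j else 0) else 0 := by
    intro i j hj
    have hj' := Finset.mem_range.mp hj
    have : l = i * n + j ↔ i = l / n ∧ j = l % n := by
      constructor
      · rintro rfl
        rw [Nat.add_comm, Nat.add_mul_div_right _ _ hn, Nat.add_mul_mod_self_right,
          Nat.div_eq_of_lt hj', Nat.mod_eq_of_lt hj', zero_add]
        exact ⟨rfl, rfl⟩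
      · rintro ⟨rfl, rfl⟩
        exact (Nat.div_add_mod' l n).symm
    rw [if_congr this rfl rfl, ite_and]
  rw [Finset.sum_congr rfl fun i _ => Finset.sum_congr rfl (key i)]
  have h1 : l / n ∈ Finset.range m :=
    Finset.mem_range.mpr (Nat.div_lt_of_lt_mul (by rwa [mul_comm] at hl))
  have h2 : l % n ∈ Finset.range n := Finset.mem_range.mpr (Nat.mod_lt _ hn)
  rw [Finset.sum_eq_single_of_mem _ h1 fun i _ hi => by simp [hi]]
  rw [Finset.sum_eq_single_of_mem _ h2 fun j _ hj => by simp [hj]]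
  simp

lemma eval_outerX {l : NExpr} {ea eb : FExpr} {ρ : ℕ → ℕ} {σ : HS F} (hg : Good π σ) {L : ℕ}
    (hL : L < π 2 * π 3) {a b : ℕ → F}
    (hl : ∀ j k, l.eval π (Function.update (Function.update ρ 2 j) 3 k) σ.nv = L)
    (ha : ∀ j < π 2, ∀ k < π 3,
      ea.eval code π tin (Function.update (Function.update ρ 2 j) 3 k) σ = a j)
    (hb : ∀ j < π 2, ∀ k < π 3,
      eb.eval code π tin (Function.update (Function.update ρ 2 j) 3 k) σ = b k) :
    (outerX l ea eb).eval code π tin ρ σ = a (L / π 3) * b (L % π 3) := by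
  rw [← sum_oneHot (fun j k => a j * b k) hL]
  simp only [outerX, FExpr.eval, hg.zero, zero_add]
  refine Finset.sum_congr rfl fun j hj => Finset.sum_congr rfl fun k hk => ?_
  rw [eval_nEq, hl]
  simp only [FExpr.eval, ha j (Finset.mem_range.mp hj) k (Finset.mem_range.mp hk),
    hb j (Finset.mem_range.mp hj) k (Finset.mem_range.mp hk), hg.zero, NExpr.eval]
  simp [Function.update_apply]

/-- The flattened outer product of two vectors. -/
def outer (c n : ℕ) (a b : ℕ → F) : Fin c → F := fun l => a (l / n) * b (l % n)

/-- The parameters describe the dimensions of the problem, and the arrays are large enough. -/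
structure Lay (π : ℕ → ℕ) : Prop where
  -- In `params`, `0` is `|F|`, `1` to `4` are `n₀, n₁, n₂, R`, and `8` is `n₁n₂`. Parameter `13` is
  -- `⌊R/n₀⌋`, `14` the number of guessed field elements, `20` the length of the output, and `21` is
  -- `R + 1 - n₀`, the number of terms known before completion. The numbers `15`, `16`, `17` bound
  -- the three exponentially long loops.
  b1 : π 1 ≤ π 5 + 1
  b2 : π 2 ≤ π 5 + 1
  b3 : π 3 ≤ π 5 + 1
  b8 : π 8 ≤ π 5 + 1
  b14 : π 14 ≤ π 5 + 1
  b18 : π 18 ≤ π 5 + 1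
  b20 : π 20 ≤ π 5 + 1
  e8 : π 8 = π 2 * π 3
  e10 : π 10 + 1 = π 1 * π 8
  e15 : π 15 = π 0 ^ π 1
  e16 : π 16 = π 0 ^ π 14
  e17 : π 17 = π 0 ^ π 3
  e13 : π 1 * π 13 ≤ π 4
  e18 : π 18 = π 4 + 1
  e19 : π 19 = 1
  e20 : π 20 = 1 + (π 1 + π 2 + π 3) * π 4
  e21 : π 21 = π 4 + 1 - π 1
  n14 : π 1 ≤ π 14
  p1 : 0 < π 1
  p2 : 0 < π 2
  p3 : 0 < π 3

lemma Lay.b4 (h : Lay π) : π 4 ≤ π 5 + 1 := by have := h.e18; have := h.b18; omega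

end

end TensorCPD

/-! ### Structure of decompositions of tensors with independent slices. -/

namespace TensorCPD

/-! ### Selecting terms of a sum of rank-one matrices -/

section

variable {F : Type*} [Field F]

/-- A map with the same image as the injective `f₀` is `f₀ ∘ τ` for a permutation `τ`. Permuting the
columns of the minor of `U` contributes the sign of `τ`, and the signed products of entries of `V`
add up to a minor of `V`. -/
lemma sum_image_eq {r : ℕ} {ι : Type*} [Fintype ι] [DecidableEq ι] (U : Matrix (Fin r) ι F)
    (V : Matrix ι (Fin r) F) (f₀ : Fin r → ι) (hf : Function.Injective f₀) :
    ∑ f : Fin r → ι with Finset.univ.image f = Finset.univ.image f₀,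
      (∏ j, V (f j) j) * (U.submatrix id f).det =
    (V.submatrix f₀ id).det * (U.submatrix id f₀).det := by
  rw [Matrix.det_apply', Finset.sum_mul]
  symm
  refine Finset.sum_bij (fun τ _ => f₀ ∘ τ) (fun τ _ => ?_) (fun τ _ τ' _ h => ?_) (fun f h => ?_)
    (fun τ _ => ?_)
  · simp only [Finset.mem_filter, Finset.mem_univ, true_and]
    ext x
    simp only [Finset.mem_image, Finset.mem_univ, true_and, Function.comp]
    exact ⟨fun ⟨a, ha⟩ => ⟨τ a, ha⟩, fun ⟨a, ha⟩ => ⟨τ.symm a, by simpa using ha⟩⟩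
  · ext1 a
    exact hf (congrFun h a)
  · simp only [Finset.mem_filter, Finset.mem_univ, true_and] at h
    have h1 : ∀ a, ∃ b, f₀ b = f a := fun a => by
      have : f a ∈ Finset.univ.image f := Finset.mem_image_of_mem _ (Finset.mem_univ a)
      rw [h] at this
      simpa using this
    choose g hg using h1
    have hcard : (Finset.univ.image f).card = r := by
      rw [h, Finset.card_image_of_injective _ hf, Finset.card_univ, Fintype.card_fin]
    have hfi : Function.Injective f := by
      have h2 : (Finset.univ.image f).card = (Finset.univ : Finset (Fin r)).card := by simp [hcard]
      have h3 := Finset.card_image_iff.mp h2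
      rwa [Finset.coe_univ, Set.injOn_univ] at h3
    have hgi : Function.Injective g := fun a b hab => hfi (by rw [← hg a, ← hg b, hab])
    refine ⟨Equiv.ofBijective g (Finite.injective_iff_bijective.mp hgi), Finset.mem_univ _, ?_⟩
    ext1 a
    exact hg a
  · have : U.submatrix id (f₀ ∘ τ) = (U.submatrix id f₀).submatrix id τ := rfl
    rw [this, Matrix.det_permute']
    simp only [Matrix.submatrix_apply, id, Function.comp]
    ring

/-- A nonvanishing consequence of the Cauchy–Binet formula. -/
lemma exists_minors_ne_zero {r : ℕ} {ι : Type*} [Fintype ι] [DecidableEq ι]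
    (U : Matrix (Fin r) ι F) (V : Matrix ι (Fin r) F) (h : (U * V).det ≠ 0) :
    ∃ f : Fin r → ι, Function.Injective f ∧ (U.submatrix id f).det ≠ 0 ∧
      (V.submatrix f id).det ≠ 0 := by
  by_contra hc
  push Not at hc
  apply h
  -- The columns of `U * V` are combinations of the columns of `U`; the determinant is expanded
  -- multilinearly.
  have hexp : (U * V).det = ∑ f : Fin r → ι, (∏ j, V (f j) j) * (U.submatrix id f).det := by
    have h1 : (U * V).det = Matrix.detRowAlternating
        (fun j => ∑ i, V i j • (fun k => U k i)) := by
      rw [← Matrix.det_transpose]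
      change Matrix.det _ = Matrix.det _
      congr 1
      ext j k
      simp [Matrix.mul_apply, mul_comm]
    rw [h1]
    have h2 := (Matrix.detRowAlternating (n := Fin r) (R := F)).toMultilinearMap.map_sum
      (fun j (i : ι) => V i j • (fun k => U k i))
    refine h2.trans (Finset.sum_congr rfl fun f _ => ?_)
    rw [MultilinearMap.map_smul_univ, smul_eq_mul]
    congr 1
    rw [← Matrix.det_transpose]
    rfl
  -- Grouping the maps by their images: the image of an injective map contributes a product of two
  -- complementary minors, zero by assumption; all other groups consist of maps that repeat a
  -- column.
  rw [hexp, ← Finset.sum_fiberwise (s := Finset.univ) (g := fun f : Fin r → ι => Finset.univ.image f)]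
  refine Finset.sum_eq_zero fun J _ => ?_
  by_cases hJ : ∃ f₀ : Fin r → ι, Function.Injective f₀ ∧ Finset.univ.image f₀ = J
  · obtain ⟨f₀, hf₀, rfl⟩ := hJ
    rw [sum_image_eq U V f₀ hf₀]
    by_cases hU : (U.submatrix id f₀).det = 0
    · rw [hU, mul_zero]
    · rw [hc f₀ hf₀ hU, zero_mul]
  · refine Finset.sum_eq_zero fun f hf => ?_
    simp only [Finset.mem_filter, Finset.mem_univ, true_and] at hf
    have hni : ¬ Function.Injective f := fun hi => hJ ⟨f, hi, hf⟩
    rw [Function.not_injective_iff] at hni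
    obtain ⟨a, b, hab, hne⟩ := hni
    rw [Matrix.det_zero_of_column_eq hne (fun i => by simp [hab]), mul_zero]

/-- A matrix of rank `r` can be compressed to the identity of size `r`. -/
lemma exists_compress {m n r : ℕ} (M : Matrix (Fin m) (Fin n) F) (hr : M.rank = r) :
    ∃ (P : Matrix (Fin r) (Fin m) F) (Q : Matrix (Fin n) (Fin r) F), P * M * Q = 1 := by
  let b : Module.Basis (Fin r) F (LinearMap.range M.mulVecLin) :=
    Module.finBasisOfFinrankEq F (LinearMap.range M.mulVecLin) hr
  have hq : ∀ s, ∃ x, M.mulVecLin x = (b s : Fin m → F) := fun s => (b s).2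
  choose x hx using hq
  have hli : LinearIndependent F fun s => (b s : Fin m → F) :=
    b.linearIndependent.map' (LinearMap.range M.mulVecLin).subtype (Submodule.ker_subtype _)
  let B : Matrix (Fin m) (Fin r) F := Matrix.of fun i s => (b s : Fin m → F) i
  have hB : LinearMap.ker B.mulVecLin = ⊥ := by
    rw [LinearMap.ker_eq_bot]
    exact Matrix.mulVec_injective_iff.mpr hli
  obtain ⟨g, hg⟩ := LinearMap.exists_leftInverse_of_injective B.mulVecLin hB
  -- `Q` collects preimages of a basis of the column space, so that `M * Q` is the matrix `B` of
  -- basis vectors, and `P` is a left inverse of `B`.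
  refine ⟨LinearMap.toMatrix' g, Matrix.of fun j s => x s j, ?_⟩
  have h1 : M * (Matrix.of fun j s => x s j) = B := by
    ext i s
    exact congrFun (hx s) i
  rw [Matrix.mul_assoc, h1]
  have h2 : LinearMap.toMatrix' (g ∘ₗ B.mulVecLin) = 1 := by rw [hg, LinearMap.toMatrix'_id]
  rw [LinearMap.toMatrix'_comp] at h2
  have h3 : LinearMap.toMatrix' B.mulVecLin = B := by
    rw [← Matrix.toLin'_apply']; exact LinearMap.toMatrix'_toLin' B
  rwa [h3] at h2

lemma rank_sum_vecMulVec_le {m n : ℕ} {ι : Type*} (J : Finset ι) (u : ι → Fin m → F)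
    (v : ι → Fin n → F) : (∑ i ∈ J, Matrix.vecMulVec (u i) (v i)).rank ≤ J.card := by
  classical
  induction J using Finset.induction_on with
  | empty => simp
  | insert a s ha ih =>
    rw [Finset.sum_insert ha, Finset.card_insert_of_notMem ha, add_comm s.card]
    exact (matrix_rank_add_le _ _).trans (Nat.add_le_add (Matrix.rank_vecMulVec_le _ _) ih)

/-- From a sum of rank-one matrices of rank `r`, one can select `r` terms whose sum has rank `r`. -/
lemma exists_subset_rank_eq {m n : ℕ} {ι : Type*} (I : Finset ι)
    (u : ι → Fin m → F) (v : ι → Fin n → F) {r : ℕ}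
    (hr : (∑ i ∈ I, Matrix.vecMulVec (u i) (v i)).rank = r) :
    ∃ J ⊆ I, J.card = r ∧ (∑ i ∈ J, Matrix.vecMulVec (u i) (v i)).rank = r := by
  classical
  -- The identity `P * M * Q = 1` factors through the index set `I`: the left factor has columns `P
  -- u_i`, the right one rows `v_i Q`. A pair of nonvanishing minors with the same indices then
  -- singles out `J`.
  obtain ⟨P, Q, hPQ⟩ := exists_compress _ hr
  have hcomp : ∀ (f : Fin r → I), Function.Injective f →
      P * (∑ i ∈ Finset.univ.image (fun s => (f s : ι)), Matrix.vecMulVec (u i) (v i)) * Q =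
      (Matrix.of fun a (i : I) => (P.mulVec (u i)) a).submatrix id f *
        (Matrix.of fun (i : I) a => (Matrix.vecMul (v i) Q) a).submatrix f id := by
    intro f hf
    rw [Finset.sum_image (fun a _ b _ hab => hf (Subtype.ext hab)), Matrix.mul_sum, Matrix.sum_mul]
    ext a b
    simp only [Matrix.mul_vecMulVec, Matrix.vecMulVec_mul, Matrix.sum_apply, Matrix.vecMulVec_apply,
      Matrix.mul_apply, Matrix.submatrix_apply, Matrix.of_apply, id]
  have hfull : (Matrix.of fun a (i : I) => (P.mulVec (u i)) a) *
        (Matrix.of fun (i : I) a => (Matrix.vecMul (v i) Q) a) = 1 := by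
    rw [← hPQ, ← Finset.sum_coe_sort I, Matrix.mul_sum, Matrix.sum_mul]
    ext a b
    simp only [Matrix.mul_vecMulVec, Matrix.vecMulVec_mul, Matrix.sum_apply, Matrix.vecMulVec_apply,
      Matrix.mul_apply, Matrix.of_apply]
  obtain ⟨f, hf, hU, hV⟩ := exists_minors_ne_zero _ _
    (by rw [hfull, Matrix.det_one]; exact one_ne_zero)
  have hcard : (Finset.univ.image (fun s => (f s : ι))).card = r := by
    rw [Finset.card_image_of_injective _ (fun a b hab => hf (Subtype.ext hab)), Finset.card_univ,
      Fintype.card_fin]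
  refine ⟨Finset.univ.image (fun s => (f s : ι)), fun i hi => ?_, hcard, le_antisymm ?_ ?_⟩
  · obtain ⟨s, -, rfl⟩ := Finset.mem_image.mp hi
    exact (f s).2
  · exact (rank_sum_vecMulVec_le _ _ _).trans hcard.le
  -- After compression, the sum over `J` is the product of the two selected square matrices. It is
  -- invertible, so the sum itself has rank at least `r`.
  · have h1 : (P * (∑ i ∈ Finset.univ.image (fun s => (f s : ι)), Matrix.vecMulVec (u i) (v i)) *
        Q).rank = r := by
      have hu : IsUnit (P * (∑ i ∈ Finset.univ.image (fun s => (f s : ι)),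
          Matrix.vecMulVec (u i) (v i)) * Q) := by
        rw [Matrix.isUnit_iff_isUnit_det, hcomp f hf, Matrix.det_mul, isUnit_iff_ne_zero]
        exact mul_ne_zero hU hV
      rw [Matrix.rank_of_isUnit _ hu, Fintype.card_fin]
    refine h1.symm.le.trans ?_
    exact (Matrix.rank_mul_le_left _ _).trans (Matrix.rank_mul_le_right _ _)

end

end TensorCPD

namespace TensorCPD

/-! ### The structure of decompositions of concise tensors -/

section

variable {F : Type*} [Field F]

open Matrix

/-- An enumeration of a finite set by an initial segment of the natural numbers. -/
lemma exists_enum {ι : Type*} [Nonempty ι] (A : Type*) [AddCommMonoid A] (N : Finset ι) : ∃ g : ℕ → ι, (∀ t < N.card, g t ∈ N) ∧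
    (∀ i ∈ N, ∃ t < N.card, g t = i) ∧
    ∀ h : ι → A, ∑ t ∈ Finset.range N.card, h (g t) =
      ∑ i ∈ N, h i := by
  classical
  let g : ℕ → ι := fun t => if h : t < N.card then (N.equivFin.symm ⟨t, h⟩ : ι) else
    Classical.arbitrary ι
  have hg : ∀ t : Fin N.card, g t = (N.equivFin.symm t : ι) := fun t => by
    simp only [g, t.2, dif_pos]
  refine ⟨g, fun t ht => ?_, fun i hi => ?_, fun h => ?_⟩
  · rw [hg ⟨t, ht⟩]; exact (N.equivFin.symm ⟨t, ht⟩).2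
  · refine ⟨N.equivFin ⟨i, hi⟩, (N.equivFin ⟨i, hi⟩).2, ?_⟩
    rw [hg]; simp
  · rw [Finset.sum_range, ← Finset.sum_coe_sort N]
    refine Fintype.sum_equiv N.equivFin.symm _ _ fun t => ?_
    rw [hg]

/-- If the columns of `A₀` belong to a decomposition of linearly independent slices, some `n₀`
columns of `A₀` can be normalized to unit vectors. -/
lemma exists_pivots {n₀ R : ℕ} (A : Matrix (Fin n₀) (Fin R) F) (hA : A.rank = n₀) :
    ∃ (f : Fin n₀ → Fin R) (B : Matrix (Fin n₀) (Fin n₀) F), Function.Injective f ∧ IsUnit B ∧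
      ∀ i i', (B * A) i (f i') = if i = i' then 1 else 0 := by
  obtain ⟨P, Q, h⟩ := exists_compress A hA
  obtain ⟨f, hf, h1, -⟩ := exists_minors_ne_zero (P * A) Q (by rw [h, det_one]; exact one_ne_zero)
  have h2 : (P * A).submatrix id f = P * A.submatrix id f := rfl
  -- Because `A` has full row rank, `P` is square, so the nonvanishing minor of `P * A` yields one
  -- of `A`.
  rw [h2, det_mul] at h1
  have hu : IsUnit (A.submatrix id f).det := isUnit_iff_ne_zero.mpr (right_ne_zero_of_mul h1)
  refine ⟨f, (A.submatrix id f)⁻¹, hf, ?_, fun i i' => ?_⟩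
  · exact (isUnit_nonsing_inv_iff).mpr ((isUnit_iff_isUnit_det _).mpr hu)
  · have := congrFun (congrFun (nonsing_inv_mul _ hu) i) i'
    rw [one_apply] at this
    exact this

/-- The subspace of combinations of slices with a row vector. -/
lemma sum_smul_slices {n₀ n₁ n₂ R : ℕ} (S : Fin n₀ → Matrix (Fin n₁) (Fin n₂) F)
    (A : Matrix (Fin n₀) (Fin R) F) (X : Fin R → Matrix (Fin n₁) (Fin n₂) F)
    (h : ∀ i, S i = ∑ r, A i r • X r) (B : Matrix (Fin n₀) (Fin n₀) F) (i : Fin n₀) :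
    ∑ j, B i j • S j = ∑ r, (B * A) i r • X r := by
  simp only [h, Finset.smul_sum, smul_smul, mul_apply, Finset.sum_smul]
  rw [Finset.sum_comm]

/-- If a combination of the slices lies in `L`, then `L` and the slices span at most `n₀ - 1` more
dimensions than `L`. -/
lemma finrank_sup_span_lt {n₀ : ℕ} {V : Type*} [AddCommGroup V] [Module F V] [FiniteDimensional F V]
    (L : Submodule F V) (S : Fin n₀ → V) (v : Fin n₀ → F) (hv : v ≠ 0) (h : ∑ i, v i • S i ∈ L) :
    Module.finrank F ↥(L ⊔ Submodule.span F (Set.range S)) + 1 ≤ Module.finrank F L + n₀ := by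
  classical
  obtain ⟨i₀, hi₀⟩ := Function.ne_iff.mp hv
  have hi₀' : v i₀ ≠ 0 := hi₀
  set T := Submodule.span F ((Finset.univ.erase i₀).image S : Set V) with hT
  have hmem : ∀ i, i ≠ i₀ → S i ∈ T := fun i hi => Submodule.subset_span
    (by simpa using ⟨i, hi, rfl⟩)
  -- Modulo `L`, a slice with nonzero coefficient in the relation is a combination of the other
  -- slices.
  have hle : L ⊔ Submodule.span F (Set.range S) ≤ L ⊔ T := by
    refine sup_le le_sup_left (Submodule.span_le.mpr ?_)
    rintro _ ⟨i, rfl⟩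
    by_cases hi : i = i₀
    · subst hi
      have h1 : S i = (v i)⁻¹ • (∑ j, v j • S j - ∑ j ∈ Finset.univ.erase i, v j • S j) := by
        rw [← Finset.add_sum_erase _ _ (Finset.mem_univ i), add_sub_cancel_right,
          inv_smul_smul₀ hi₀']
      rw [h1]
      refine Submodule.smul_mem _ _ (Submodule.sub_mem _ (Submodule.mem_sup_left h)
        (Submodule.mem_sup_right (Submodule.sum_mem _ fun j hj => Submodule.smul_mem _ _
          (hmem j (Finset.ne_of_mem_erase hj)))))
    · exact Submodule.mem_sup_right (hmem i hi)
  have h1 := Submodule.finrank_mono hle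
  have h2 := Submodule.finrank_add_le_finrank_add_finrank L T
  have h3 : Module.finrank F T ≤ n₀ - 1 := by
    refine (finrank_span_finset_le_card _).trans (Finset.card_image_le.trans ?_)
    rw [Finset.card_erase_of_mem (Finset.mem_univ _), Finset.card_univ, Fintype.card_fin]
  have h4 : 0 < n₀ := i₀.pos
  omega

/-- Structure of decompositions: unless the combinations of slices of rank at most `ρ` span
everything, some combination of larger rank `r` is a sum of `zz` rank-one matrices and a matrix of
the same rank `r` such that, with `R + 1 - n₀ - r - zz` further rank-one matrices, the span `L` of all
of these and the slices contains enough rank-one matrices to generate all slices modulo `L`. -/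
theorem exists_structured_combination {n₀ n₁ n₂ R ρ : ℕ} (S : Fin n₀ → Matrix (Fin n₁) (Fin n₂) F)
    (hS : LinearIndependent F S) (A : Matrix (Fin n₀) (Fin R) F) (a : Fin R → Fin n₁ → F)
    (b : Fin R → Fin n₂ → F) (h : ∀ i, S i = ∑ r, A i r • vecMulVec (a r) (b r))
    (hρ : Submodule.span F {v : Fin n₀ → F | (∑ i, v i • S i).rank ≤ ρ} ≠ ⊤) :
    ∃ (v : Fin n₀ → F) (r zz : ℕ) (u : ℕ → Fin n₁ → F) (w : ℕ → Fin n₂ → F) (p : ℕ → Fin n₁ → F)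
      (x : ℕ → Fin n₂ → F), (∑ i, v i • S i).rank = r ∧ ρ < r ∧ zz + r + n₀ ≤ R + 1 ∧
      ∑ i, v i • S i = ∑ t ∈ Finset.range zz, vecMulVec (u t) (w t) +
        ∑ s ∈ Finset.range r, vecMulVec (p s) (x s) ∧
      (∑ s ∈ Finset.range r, vecMulVec (p s) (x s)).rank = r ∧
      ∀ L : Submodule F (Matrix (Fin n₁) (Fin n₂) F),
        (∀ t < R + 1 - n₀ - r, vecMulVec (u t) (w t) ∈ L) →
        (∀ s < r, vecMulVec (p s) (x s) ∈ L) →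
        ∀ i, S i ∈ L ⊔ Submodule.span F {m | (∃ a b, m = vecMulVec a b) ∧
          m ∈ L ⊔ Submodule.span F (Set.range S)} := by
  classical
  -- A relation between the rows of `A` would be a relation between the slices.
  have hA : A.rank = n₀ := by
    have hli : LinearIndependent F A.row := by
      rw [Fintype.linearIndependent_iff] at hS ⊢
      intro g hg
      refine hS g ?_
      simp only [h, Finset.smul_sum, smul_smul]
      rw [Finset.sum_comm]
      refine Finset.sum_eq_zero fun r _ => ?_
      rw [← Finset.sum_smul]
      have := congrFun hg r
      simp only [Finset.sum_apply, Pi.smul_apply, smul_eq_mul, Matrix.row, Pi.zero_apply] at this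
      rw [this, zero_smul]
    rw [hli.rank_matrix, Fintype.card_fin]
  obtain ⟨f, B, hf, hB, hpiv⟩ := exists_pivots A hA
  set m := B * A with hm
  have hdet := (isUnit_iff_isUnit_det _).mp hB
  have hY : ∀ i, ∑ j, B i j • S j = ∑ r, m i r • vecMulVec (a r) (b r) :=
    sum_smul_slices S A (fun r => vecMulVec (a r) (b r)) h B
  -- The rows of the invertible `B` span all coefficient vectors. If each of them gave rank at most
  -- `ρ`, the excluded case would hold.
  obtain ⟨i₀, hi₀⟩ : ∃ i₀, ρ < (∑ j, B i₀ j • S j).rank := by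
    by_contra hc
    push Not at hc
    refine hρ (eq_top_iff.mpr fun v _ => ?_)
    have hv : v = ∑ i, (v ᵥ* B⁻¹) i • B i := by
      conv_lhs => rw [← vecMul_one v, ← nonsing_inv_mul _ hdet, ← vecMul_vecMul]
      rw [vecMul_eq_sum]
    rw [hv]
    exact Submodule.sum_mem _ fun i _ => Submodule.smul_mem _ _ (Submodule.subset_span (hc i))
  -- All columns except the pivots of the other rows. Row `i₀` of `m` vanishes at the dropped `n₀ -
  -- 1` columns, so the combination is a sum over these `R + 1 - n₀` terms.
  set I : Finset (Fin R) := Finset.univ \ (Finset.univ.erase i₀).image f with hI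
  have hIcard : I.card + n₀ = R + 1 := by
    have h1 : ((Finset.univ.erase i₀).image f).card = n₀ - 1 := by
      rw [Finset.card_image_of_injective _ hf, Finset.card_erase_of_mem (Finset.mem_univ _),
        Finset.card_univ, Fintype.card_fin]
    have h2 := Finset.card_le_univ ((Finset.univ.erase i₀).image f)
    rw [hI, Finset.card_sdiff_of_subset (Finset.subset_univ _), h1, Finset.card_univ,
      Fintype.card_fin]
    rw [h1, Fintype.card_fin] at h2
    have := i₀.pos
    omega
  have hsumI : ∑ j, B i₀ j • S j = ∑ r ∈ I, vecMulVec (m i₀ r • a r) (b r) := by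
    rw [hY i₀, hI]
    symm
    refine (Finset.sum_subset (Finset.subset_univ _) fun r _ hr => ?_).trans
      (Finset.sum_congr rfl fun r _ => ?_)
    · simp only [Finset.mem_sdiff, Finset.mem_univ, true_and, not_not, Finset.mem_image,
        Finset.mem_erase, and_true] at hr
      obtain ⟨i, hi, rfl⟩ := hr
      rw [hpiv, if_neg (Ne.symm hi), zero_smul, zero_vecMulVec]
    · rw [smul_vecMulVec]
  obtain ⟨J, hJI, hJc, hJr⟩ := exists_subset_rank_eq I (fun r => m i₀ r • a r) b
    (congrArg Matrix.rank hsumI.symm)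
  set r := (∑ j, B i₀ j • S j).rank with hr
  -- A term of `J` with coefficient zero could be omitted, leaving too few terms for rank `r`.
  have hmJ : ∀ j ∈ J, m i₀ j ≠ 0 := by
    intro j hj h0
    have h1 := rank_sum_vecMulVec_le (J.erase j) (fun r => m i₀ r • a r) b
    rw [Finset.card_erase_of_mem hj, hJc] at h1
    rw [← Finset.add_sum_erase _ _ hj] at hJr
    simp only [h0, zero_smul, zero_vecMulVec, zero_add] at hJr
    omega
  have hne : Nonempty (Fin R) := by
    have : J.Nonempty := Finset.card_pos.mp (by omega)
    exact ⟨this.choose⟩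
  -- The other terms are listed with those of nonzero coefficient first, scaled by it; their number
  -- is `zz`. The terms in `Z` do not occur in the combination, but they may occur in other slices
  -- and so must belong to `L`.
  set N := (I \ J).filter fun j => m i₀ j ≠ 0 with hN
  set Z := (I \ J).filter fun j => ¬ m i₀ j ≠ 0 with hZ
  have hNZ : N.card + Z.card + r = I.card := by
    rw [hN, hZ, Finset.card_filter_add_card_filter_not, ← hJc, Finset.card_sdiff_add_card_eq_card hJI]
  obtain ⟨gJ, hgJ, hgJ', hsJ⟩ := exists_enum (Matrix (Fin n₁) (Fin n₂) F) J
  obtain ⟨gN, hgN, hgN', hsN⟩ := exists_enum (Matrix (Fin n₁) (Fin n₂) F) N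
  obtain ⟨gZ, hgZ, hgZ', -⟩ := exists_enum (Matrix (Fin n₁) (Fin n₂) F) Z
  refine ⟨B i₀, r, N.card, fun t => if t < N.card then m i₀ (gN t) • a (gN t) else a (gZ (t - N.card)),
    fun t => if t < N.card then b (gN t) else b (gZ (t - N.card)),
    fun s => m i₀ (gJ s) • a (gJ s), fun s => b (gJ s), rfl, hi₀, by omega, ?_, ?_, ?_⟩
  · rw [hsumI, ← Finset.sum_sdiff hJI, ← hJc, hsJ fun j => vecMulVec (m i₀ j • a j) (b j)]
    congr 1
    rw [← Finset.sum_filter_add_sum_filter_not (I \ J) (fun j => m i₀ j ≠ 0), ← hN, ← hZ,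
      ← hsN fun j => vecMulVec (m i₀ j • a j) (b j)]
    rw [Finset.sum_eq_zero (s := Z) fun j hj => ?_, add_zero]
    · refine Finset.sum_congr rfl fun t ht => ?_
      beta_reduce
      rw [if_pos (Finset.mem_range.mp ht), if_pos (Finset.mem_range.mp ht)]
    · rw [hZ, Finset.mem_filter, not_not] at hj
      rw [hj.2, zero_smul, zero_vecMulVec]
  · conv_lhs => rw [← hJc]
    rw [hsJ fun j => vecMulVec (m i₀ j • a j) (b j)]
    exact hJr
  · intro L hL1 hL2
    have hscale : ∀ j, m i₀ j ≠ 0 → vecMulVec (m i₀ j • a j) (b j) ∈ L →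
        vecMulVec (a j) (b j) ∈ L := fun j hj hm => by
      rw [smul_vecMulVec] at hm
      exact (Submodule.smul_mem_iff _ hj).mp hm
    -- The hypotheses on `L` provide these terms up to the coefficients `m i₀ j`, which were put
    -- into the first factors and are nonzero outside `Z`.
    have hX : ∀ j ∈ I, vecMulVec (a j) (b j) ∈ L := by
      intro j hj
      by_cases hjJ : j ∈ J
      · obtain ⟨s, hs, rfl⟩ := hgJ' j hjJ
        exact hscale _ (hmJ _ hjJ) (hL2 s (by omega))
      by_cases hj0 : m i₀ j = 0
      · obtain ⟨t, ht, rfl⟩ := hgZ' j (by simp [hZ, hj, hjJ, hj0])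
        have := hL1 (N.card + t) (by omega)
        simpa using this
      · obtain ⟨t, ht, rfl⟩ := hgN' j (by simp [hN, hj, hjJ, hj0])
        have := hL1 t (by omega)
        beta_reduce at this
        rw [if_pos ht, if_pos ht] at this
        exact hscale _ hj0 this
    have hIf : ∀ j, (∀ i, f i ≠ j) → j ∈ I := fun j hj => by simp [hI]; exact fun i _ => hj i
    -- A normalized slice is a combination of nonpivot terms, all in `L`, plus its own pivot term
    -- with coefficient `1`. Read the other way round, the pivot term is a rank-one matrix in `L`
    -- plus the span of the slices.
    have hYi : ∀ i', ∑ j, B i' j • S j ∈ L ⊔ Submodule.span F {m | (∃ a b, m = vecMulVec a b) ∧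
          m ∈ L ⊔ Submodule.span F (Set.range S)} := by
      intro i'
      have e : ∑ j, B i' j • S j = (∑ j ∈ Finset.univ \ Finset.univ.image f,
          m i' j • vecMulVec (a j) (b j)) + vecMulVec (a (f i')) (b (f i')) := by
        rw [hY i', ← Finset.sum_sdiff (Finset.subset_univ (Finset.univ.image f)),
          Finset.sum_image (fun _ _ _ _ h => hf h)]
        congr 1
        simp only [hpiv, ite_smul, one_smul, zero_smul, Finset.sum_ite_eq, Finset.mem_univ, if_true]
      have h1 : (∑ j ∈ Finset.univ \ Finset.univ.image f, m i' j • vecMulVec (a j) (b j)) ∈ L := by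
        refine Submodule.sum_mem _ fun j hj => Submodule.smul_mem _ _ (hX j (hIf j fun i hi => ?_))
        simp only [Finset.mem_sdiff, Finset.mem_univ, true_and, Finset.mem_image, not_exists] at hj
        exact hj i hi
      rw [e]
      refine Submodule.add_mem_sup h1 (Submodule.subset_span ⟨⟨_, _, rfl⟩, ?_⟩)
      have e2 : vecMulVec (a (f i')) (b (f i')) = -(∑ j ∈ Finset.univ \ Finset.univ.image f,
          m i' j • vecMulVec (a j) (b j)) + ∑ j, B i' j • S j := by rw [e]; abel
      rw [e2]
      exact Submodule.add_mem_sup (Submodule.neg_mem _ h1) (Submodule.sum_mem _ fun j _ =>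
        Submodule.smul_mem _ _ (Submodule.subset_span ⟨j, rfl⟩))
    intro i
    -- The original slices are recovered from the normalized ones by `B⁻¹`.
    have hSi : S i = ∑ i', B⁻¹ i i' • ∑ j, B i' j • S j := by
      simp only [Finset.smul_sum, smul_smul]
      rw [Finset.sum_comm]
      have : ∀ j, ∑ i', (B⁻¹ i i' * B i' j) • S j = (if i = j then S j else 0) := fun j => by
        rw [← Finset.sum_smul, ← mul_apply, nonsing_inv_mul _ hdet, one_apply]
        split_ifs <;> simp
      simp [this]
    rw [hSi]
    exact Submodule.sum_mem _ fun i' _ => Submodule.smul_mem _ _ (hYi i')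

end

end TensorCPD

/-! ### Subroutines: rank factorizations, digit counters, verification of guesses, completion of the
list. -/

namespace TensorCPD

/-! ### Bases of column spaces -/

section

variable {F : Type*} [Field F]

lemma span_image_lt_succ {V : Type*} [AddCommGroup V] [Module F V] (f : ℕ → V) (k : ℕ) :
    Submodule.span F (f '' {i | i < k + 1}) =
      Submodule.span F (f '' {i | i < k}) ⊔ Submodule.span F {f k} := by
  rw [← Submodule.span_union, ← Set.image_singleton, ← Set.image_union]
  congr 2
  ext i
  simp only [Set.mem_ofPred_eq, Set.mem_union, Set.mem_singleton_iff]
  omega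

/-- The number and the positions of the terms among the first `l` that are not in the span of the
preceding ones. -/
noncomputable def pivots {V : Type*} [AddCommGroup V] [Module F V] (c : ℕ → V) : ℕ → ℕ × (ℕ → ℕ)
  | 0 => (0, id)
  | l + 1 => open Classical in if c l ∈ Submodule.span F (c '' {i | i < l}) then pivots c l else
      ((pivots c l).1 + 1, Function.update (pivots c l).2 (pivots c l).1 l)

/-- A term outside the span of its predecessors raises the dimension by one, any other term changes
nothing. The basis is a definite greedy choice because a guessed matrix `G` has to refer to the very
basis that the program computes. -/
lemma pivots_facts {V : Type*} [AddCommGroup V] [Module F V] [FiniteDimensional F V] (c : ℕ → V)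
    (l : ℕ) : (pivots (F := F) c l).1 = Module.finrank F (Submodule.span F (c '' {i | i < l})) ∧
      Submodule.span F ((fun s => c ((pivots (F := F) c l).2 s)) '' {s | s < (pivots (F := F) c l).1}) =
        Submodule.span F (c '' {i | i < l}) := by
  induction l with
  | zero =>
    have h : ∀ f : ℕ → V, Submodule.span F (f '' {i | i < 0}) = ⊥ := by simp
    exact ⟨by rw [h, finrank_bot]; rfl, by rw [h]; exact h _⟩
  | succ l ih =>
    rw [pivots, span_image_lt_succ]
    split_ifs with h
    · rw [sup_eq_left.mpr (by simpa [Submodule.span_le] using h)]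
      exact ih
    · refine ⟨by rw [Submodule.finrank_sup_span_singleton h, ih.1], ?_⟩
      dsimp only
      rw [span_image_lt_succ, Function.update_self, ← ih.2]
      congr 2
      refine Set.image_congr fun s hs => ?_
      rw [Function.update_of_ne (ne_of_lt hs)]

/-- The columns of a matrix as a sequence. -/
def colSeq {m n : ℕ} (M : Matrix (Fin m) (Fin n) F) (l : ℕ) : Fin m → F :=
  if h : l < n then fun i => M i ⟨l, h⟩ else 0

/-- The first `M.rank` terms are a basis of the column space. -/
noncomputable def basisCol {m n : ℕ} (M : Matrix (Fin m) (Fin n) F) (s : ℕ) : Fin m → F :=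
  colSeq M ((pivots (F := F) (colSeq M) n).2 s)

lemma span_colSeq {m n : ℕ} (M : Matrix (Fin m) (Fin n) F) :
    Submodule.span F (colSeq M '' {i | i < n}) = Submodule.span F (Set.range M.col) := by
  congr 1
  ext v
  simp only [Set.mem_image, Set.mem_ofPred_eq, Set.mem_range]
  constructor
  · rintro ⟨i, hi, rfl⟩
    exact ⟨⟨i, hi⟩, by ext j; simp [colSeq, hi]⟩
  · rintro ⟨i, rfl⟩
    exact ⟨i, i.2, by ext j; simp [colSeq]⟩

lemma pivots_rank {m n : ℕ} (M : Matrix (Fin m) (Fin n) F) :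
    (pivots (F := F) (colSeq M) n).1 = M.rank := by
  rw [(pivots_facts _ _).1, span_colSeq, Matrix.rank_eq_finrank_span_cols]

lemma span_basisCol {m n : ℕ} (M : Matrix (Fin m) (Fin n) F) :
    Submodule.span F (basisCol M '' {s | s < M.rank}) = Submodule.span F (Set.range M.col) := by
  rw [← span_colSeq, ← (pivots_facts (F := F) (colSeq M) n).2, pivots_rank]
  rfl

end

/-- A basis of the column space of the matrix in array `14`, in the rows of array `5`; their number is
left in variable `2`. -/
def colBasis : Cmd :=
  .seq (ident 4 2) (.seq (.nconst 2 0)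
  (.loop 6 3 (.seq (fill 1 19 2 (.arr 14 (.bv 1) (.bv 6))) (.seq (addEq 4 2 2)
    (.iflt (.const 0) (.nv 0)
      (.seq (fill 5 3 2 (nEq (.bv 0) (.nv 2) (.arr 14 (.bv 1) (.bv 6)) (.arr 5 (.bv 0) (.bv 1))))
        (.incr 2))
      .skip)))))

/-- If the matrix in array `14` has rank `r`, the value of variable `2`, and is a sum of `r` outer
products whose first factors are in array `16`, this leaves multiples of the second factors in
array `15`. -/
def dualize : Cmd :=
  .loop 6 4 (.seq (ident 7 2) (.seq
    (addAll 7 4 7 2 2 (nEq (.bv 7) (.bv 6) (.fv 0)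
      (.iflt (.bv 7) (.nv 2) (.arr 16 (.bv 7) (.bv 1)) (.fv 0))))
    (.seq (fill 1 19 2 (.arr 16 (.bv 6) (.bv 1))) (.seq (addEq 7 2 2)
      (fill 15 4 3 (nEq (.bv 0) (.bv 6)
        (.sum 2 2 (.mul (.arr 3 (.const 0) (.bv 2)) (.arr 14 (.bv 2) (.bv 1))))
        (.arr 15 (.bv 0) (.bv 1))))))))

section

variable {F : Type*} [Field F] {q : ℕ} {code : F ≃ Fin q} {π : ℕ → ℕ} {tin : ℕ → F}

@[simp] lemma colBasis_nvW : colBasis.nvW = [2, 0, 1, 0, 2] := rfl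
@[simp] lemma colBasis_fvW : colBasis.fvW = [] := rfl
@[simp] lemma colBasis_arrW : colBasis.arrW = [0, 4, 0, 1, 0, 2, 0, 3, 0, 4, 0, 5] := rfl
@[simp] lemma dualize_nvW : dualize.nvW = [0, 1, 0, 0, 1, 0] := rfl
@[simp] lemma dualize_fvW : dualize.fvW = [] := rfl
@[simp] lemma dualize_arrW : dualize.arrW =
    [0, 7, 0, 1, 0, 2, 0, 3, 0, 7, 0, 1, 0, 2, 0, 3, 0, 7, 0, 15] := rfl

/-- Array `4` generates the annihilator of the span of the first `l` columns. The flag set by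
`addEq` tells whether column `l` is new, which is the case distinction in `pivots`. -/
lemma colBasis_spec {ρ : ℕ → ℕ} {σ τ : HS F} (hg : Good π σ) (hl : Lay π)
    (hτ : τ = colBasis.den code π tin ρ σ) :
    τ.nv 2 = (mat (π 2) (π 3) (σ.arr 14)).rank ∧
      ∀ s < τ.nv 2, vec (π 2) (τ.arr 5 s) = basisCol (mat (π 2) (π 3) (σ.arr 14)) s := by
  have h2 := hl.b2
  have h3 := hl.b3
  have h19 := hg.par
  rw [colBasis, Cmd.den, Cmd.den] at hτ
  set M := mat (π 2) (π 3) (σ.arr 14) with hM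
  set σ1 := (ident 4 2).den code π tin ρ σ with hσ1
  have main : Good π τ ∧ τ.arr 14 = σ.arr 14 ∧ rows (π 2) (π 2) (τ.arr 4) =
      ann (Submodule.span F (colSeq M '' {i | i < π 3})) ∧
      τ.nv 2 = (pivots (F := F) (colSeq M) (π 3)).1 ∧ τ.nv 2 ≤ π 3 ∧ ∀ s < τ.nv 2,
        vec (π 2) (τ.arr 5 s) = colSeq M ((pivots (F := F) (colSeq M) (π 3)).2 s) := by
    rw [hτ]
    refine Cmd.den_loop_inv (fun l τ => Good π τ ∧ τ.arr 14 = σ.arr 14 ∧ rows (π 2) (π 2) (τ.arr 4) =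
      ann (Submodule.span F (colSeq M '' {i | i < l})) ∧
      τ.nv 2 = (pivots (F := F) (colSeq M) l).1 ∧ τ.nv 2 ≤ l ∧ ∀ s < τ.nv 2,
        vec (π 2) (τ.arr 5 s) = colSeq M ((pivots (F := F) (colSeq M) l).2 s))
      ⟨?_, ?_, ?_, ?_, ?_, ?_⟩ fun l hl τ ⟨g0, e14, hr, hp, hle, hv⟩ => ?_
    · exact (hg.den _ (by simp) (by simp) (by simp)).den _ (by simp [Cmd.fvW]) (by simp [Cmd.fvW])
        (by simp [Cmd.fvW])
    · exact show σ1.arr 14 = _ from Cmd.den_arr _ (by simp)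
    · have := ident_spec (code := code) (tin := tin) (X := 4) (c := 2) (by decide) (ρ := ρ) hg h2
      exact show rows _ _ (σ1.arr 4) = _ by simpa using this
    · simp [Cmd.den, pivots]
    · simp [Cmd.den]
    · simp [Cmd.den]
    · rw [Cmd.den, Cmd.den]
      set ρ' := Function.update ρ 6 l with hρ'
      set τ1 := (fill 1 19 2 (.arr 14 (.bv 1) (.bv 6))).den code π tin ρ' τ with hτ1
      have g1 : Good π τ1 := g0.den _ (by simp) (by simp) (by simp)
      have a1 : ∀ A, A ≠ 0 → A ≠ 1 → τ1.arr A = τ.arr A := fun A h h' =>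
        Cmd.den_arr _ (by simp [h, h'])
      have hE : vec (π 2) (τ1.arr 1 0) = colSeq M l := by
        ext i
        rw [vec, hτ1, den_fill (by omega) h2 (by decide) (by simp [FExpr.noArr]),
          if_pos ⟨by omega, i.2⟩]
        have hi := i.2
        simp [FExpr.eval, hρ', Function.update_apply, min_eq_left (show l ≤ π 5 by omega),
          min_eq_left (show (i : ℕ) ≤ π 5 by omega), e14, colSeq, hl, hM, mat]
      rw [← a1 4 (by decide) (by decide)] at hr
      obtain ⟨hr2, hf⟩ := addEq_ann (code := code) (tin := tin) (X := 4) (by decide) (ρ := ρ') g1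
        h2 h2 hr hE rfl
      set τ2 := (addEq 4 2 2).den code π tin ρ' τ1 with hτ2
      have g2 : Good π τ2 := g1.den _ (by simp) (by simp) (by simp)
      have a2 : ∀ A, A ≠ 0 → A ≠ 1 → A ≠ 2 → A ≠ 3 → A ≠ 4 → τ2.arr A = τ.arr A :=
        fun A h0 h1 h2 h3 h4 => (Cmd.den_arr _ (by simp [h0, h2, h3, h4])).trans (a1 A h0 h1)
      have n2 : τ2.nv 2 = τ.nv 2 := by rw [Cmd.den_nv _ (by simp), Cmd.den_nv _ (by simp)]
      have a5 : τ2.arr 5 = τ.arr 5 :=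
        a2 5 (by decide) (by decide) (by decide) (by decide) (by decide)
      have a14 : τ2.arr 14 = τ.arr 14 :=
        a2 14 (by decide) (by decide) (by decide) (by decide) (by decide)
      rw [← span_image_lt_succ] at hr2
      rcases hf with ⟨hf0, hmem⟩ | ⟨hf0, hmem, -⟩
      · rw [Cmd.den, if_neg (by simp [hf0]), Cmd.den.eq_1, pivots, if_pos hmem, n2, a14, a5]
        exact ⟨g2, e14, hr2, hp, by omega, hv⟩
      · rw [Cmd.den, if_pos (by simp [hf0]), Cmd.den, pivots, if_neg hmem]
        set τ3 := (fill 5 3 2 (nEq (.bv 0) (.nv 2) (.arr 14 (.bv 1) (.bv 6))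
          (.arr 5 (.bv 0) (.bv 1)))).den code π tin ρ' τ2 with hτ3
        have n3 : ∀ x, τ3.nv x = τ2.nv x := fun x => Cmd.den_nv _ (by simp)
        have e1 : ((Cmd.incr 2).den code π tin ρ' τ3).arr = τ3.arr := rfl
        have e2 : ((Cmd.incr 2).den code π tin ρ' τ3).nv 2 = τ.nv 2 + 1 := by
          simp [Cmd.den, n3, n2]
        rw [e1, e2]
        refine ⟨(g2.den _ (by simp) (by simp) (by simp)).den _ (by simp [Cmd.fvW])
          (by simp [Cmd.fvW]) (by simp [Cmd.fvW]), ?_, ?_, by rw [hp], by omega, fun s hs => ?_⟩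
        · rw [hτ3, Cmd.den_arr _ (by simp), a14, e14]
        · rw [hτ3, Cmd.den_arr _ (by simp), hr2]
        · have key : vec (π 2) (τ3.arr 5 s) =
              if s = τ.nv 2 then colSeq M l else vec (π 2) (τ.arr 5 s) := by
            ext i
            have hi := i.2
            rw [vec, hτ3, den_fill h3 h2 (by decide) (by simp [nEq, FExpr.noArr]),
              if_pos ⟨by omega, i.2⟩, eval_nEq]
            simp only [NExpr.eval, Function.update_self, n2,
              Function.update_of_ne (show (0 : ℕ) ≠ 1 by decide)]
            split_ifs
            · simp [FExpr.eval, hρ', Function.update_apply, min_eq_left (show l ≤ π 5 by omega),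
                min_eq_left (show (i : ℕ) ≤ π 5 by omega), a14, e14, colSeq, hl, hM, mat]
            · simp [FExpr.eval, Function.update_apply, min_eq_left (show s ≤ π 5 by omega),
                min_eq_left (show (i : ℕ) ≤ π 5 by omega), a5, vec]
          rw [key, ← hp]
          dsimp only
          split_ifs with h
          · rw [h, Function.update_self]
          · rw [Function.update_of_ne h, hv s (by omega)]
  obtain ⟨-, -, -, hp, -, hv⟩ := main
  exact ⟨by rw [hp, pivots_rank], hv⟩

/-- In a sum of `r` rank-one matrices that has rank `r`, no first factor is in the span of the
others. -/
lemma notMem_span_of_rank_eq {m n r k : ℕ} (M : Matrix (Fin m) (Fin n) F) (hM : M.rank = r)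
    (u : ℕ → Fin m → F) (x : ℕ → ℕ → F)
    (h : ∀ i j, M i j = ∑ t ∈ Finset.range r, u t i * x t j) {t : ℕ} (ht : t < r) :
    u t ∉ Submodule.span F ((fun s => if s = t then 0 else if s < r then u s else 0) ''
      {s | s < k}) := by
  classical
  intro hmem
  set T : Submodule F (Fin m → F) := Submodule.span F
    (((Finset.range r).erase t).image u : Set (Fin m → F)) with hT
  have hmemT : ∀ s < r, s ≠ t → u s ∈ T := fun s hs hst =>
    Submodule.subset_span (by simpa using ⟨s, ⟨hs, hst⟩, rfl⟩)
  have h1 : Submodule.span F ((fun s => if s = t then 0 else if s < r then u s else 0) ''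
      {s | s < k}) ≤ T := by
    rw [Submodule.span_le]
    rintro _ ⟨s, -, rfl⟩
    dsimp only
    split_ifs with h1 h2
    · exact T.zero_mem
    · exact hmemT s h2 h1
    · exact T.zero_mem
  have hall : ∀ s < r, u s ∈ T := fun s hs => by
    by_cases hst : s = t
    · exact hst ▸ h1 hmem
    · exact hmemT s hs hst
  -- Otherwise all first factors, and hence the column space, would lie in the span of `r - 1`
  -- vectors.
  have h2 : Submodule.span F (Set.range M.col) ≤ T := by
    rw [Submodule.span_le]
    rintro _ ⟨j, rfl⟩
    have : M.col j = ∑ s ∈ Finset.range r, x s j • u s := by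
      ext i
      simp [Matrix.col_apply, h, mul_comm]
    rw [this]
    exact Submodule.sum_mem _ fun s hs => Submodule.smul_mem _ _ (hall s (Finset.mem_range.mp hs))
  have h3 := Submodule.finrank_mono h2
  rw [← Matrix.rank_eq_finrank_span_cols, hM] at h3
  have h4 : Module.finrank F T ≤ r - 1 := by
    refine (finrank_span_finset_le_card _).trans (Finset.card_image_le.trans ?_)
    rw [Finset.card_erase_of_mem (Finset.mem_range.mpr ht), Finset.card_range]
  omega

/-- A vector orthogonal to all first factors except the one of index `t`, multiplied with the
matrix, leaves a multiple of `x t`. It exists with a nonzero scalar because rank `r` makes the first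
factors independent. The scalars are not normalized, as only the spanned lines matter later. -/
lemma dualize_spec {ρ : ℕ → ℕ} {σ τ : HS F} (hg : Good π σ) (hl : Lay π)
    (hτ : τ = dualize.den code π tin ρ σ) (hr : (mat (π 2) (π 3) (σ.arr 14)).rank = σ.nv 2)
    (hr4 : σ.nv 2 ≤ π 4) (x : ℕ → ℕ → F) (hx : ∀ i < π 2, ∀ j < π 3,
      σ.arr 14 i j = ∑ t ∈ Finset.range (σ.nv 2), σ.arr 16 t i * x t j) :
    ∃ c : ℕ → F, ∀ t < σ.nv 2, c t ≠ 0 ∧ ∀ j < π 3, τ.arr 15 t j = c t * x t j := by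
  have h2 := hl.b2
  have h3 := hl.b3
  have h4 := hl.b4
  have h19 := hg.par
  have main : Good π τ ∧ τ.arr 14 = σ.arr 14 ∧ τ.arr 16 = σ.arr 16 ∧ τ.nv 2 = σ.nv 2 ∧
      ∃ c : ℕ → F, ∀ t < σ.nv 2, t < π 4 → c t ≠ 0 ∧ ∀ j < π 3, τ.arr 15 t j = c t * x t j := by
    rw [hτ, dualize]
    refine Cmd.den_loop_inv (fun k τ => Good π τ ∧ τ.arr 14 = σ.arr 14 ∧ τ.arr 16 = σ.arr 16 ∧
      τ.nv 2 = σ.nv 2 ∧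
      ∃ c : ℕ → F, ∀ t < σ.nv 2, t < k → c t ≠ 0 ∧ ∀ j < π 3, τ.arr 15 t j = c t * x t j)
      ⟨hg, rfl, rfl, rfl, 0, fun _ _ h => absurd h (by omega)⟩
      fun k hk τ ⟨g0, e14, e16, e2, c, hc⟩ => ?_
    rw [Cmd.den, Cmd.den, Cmd.den, Cmd.den]
    set ρ' := Function.update ρ 6 k with hρ'
    set τ1 := (ident 7 2).den code π tin ρ' τ with hτ1
    have r1 := ident_spec (code := code) (tin := tin) (X := 7) (c := 2) (by decide) (ρ := ρ') g0 h2
    have g1 : Good π τ1 := g0.den _ (by simp) (by simp) (by simp)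
    have a1 : ∀ A, A ≠ 0 → A ≠ 7 → τ1.arr A = τ.arr A := fun A h h' =>
        Cmd.den_arr _ (by simp [h, h'])
    have n1 : ∀ x, τ1.nv x = τ.nv x := fun x => Cmd.den_nv _ (by simp)
    set u : ℕ → Fin (π 2) → F := fun t => vec (π 2) (σ.arr 16 t) with hu
    set ex := nEq (.bv 7) (.bv 6) (.fv 0)
      (.iflt (.bv 7) (.nv 2) (.arr 16 (.bv 7) (.bv 1)) (.fv 0)) with hex
    have r2 := addAll_ann (code := code) (tin := tin) (x := 7) (p := 4) (X := 7) (r := 2) (c := 2)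
      (e := ex) (by decide) (ρ := ρ') g1 h2 h2 r1
      (by simp [hex, nEq, FExpr.noArr]) (fun s => if s = k then 0 else if s < σ.nv 2 then u s else 0)
      (fun s hs υ hυ ha hn l => by
        have hl := l.2
        have h16 : υ.arr 16 = σ.arr 16 := by
          rw [ha 16 (by decide), a1 16 (by decide) (by decide), e16]
        have hn2 : υ.nv 2 = σ.nv 2 := by rw [hn 2 (by decide), n1, e2]
        rw [hex, eval_nEq]
        simp only [NExpr.eval, Function.update_self, hρ', FExpr.eval, hυ.zero, h16, hn2,
          Function.update_of_ne (show (7 : ℕ) ≠ 1 by decide),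
          Function.update_of_ne (show (7 : ℕ) ≠ 0 by decide),
          Function.update_of_ne (show (6 : ℕ) ≠ 7 by decide),
          Function.update_of_ne (show (6 : ℕ) ≠ 1 by decide),
          Function.update_of_ne (show (6 : ℕ) ≠ 0 by decide),
          min_eq_left (show s ≤ π 5 by omega), min_eq_left (show (l : ℕ) ≤ π 5 by omega)]
        split_ifs <;> rfl)
    set τ2 := (addAll 7 4 7 2 2 ex).den code π tin ρ' τ1 with hτ2
    have g2 : Good π τ2 := g1.den _ (by simp) (by simp) (by simp)
    have a2 : ∀ A, A ∉ [0, 1, 2, 3, 7] → τ2.arr A = τ.arr A := fun A hA => by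
      simp only [List.mem_cons, List.not_mem_nil, or_false, not_or] at hA
      exact (Cmd.den_arr _ (by simp [hA])).trans (a1 A hA.1 hA.2.2.2.2)
    have n2 : τ2.nv 2 = σ.nv 2 := by rw [Cmd.den_nv _ (by simp), n1, e2]
    set τ3 := (fill 1 19 2 (.arr 16 (.bv 6) (.bv 1))).den code π tin ρ' τ2 with hτ3
    have g3 : Good π τ3 := g2.den _ (by simp) (by simp) (by simp)
    have a3 : ∀ A, A ≠ 0 → A ≠ 1 → τ3.arr A = τ2.arr A := fun A h h' =>
        Cmd.den_arr _ (by simp [h, h'])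
    have hE : vec (π 2) (τ3.arr 1 0) = u k := by
      ext i
      have hi := i.2
      rw [vec, hτ3, den_fill (by omega) h2 (by decide) (by simp [FExpr.noArr]),
        if_pos ⟨by omega, i.2⟩]
      simp [FExpr.eval, hρ', Function.update_apply, min_eq_left (show k ≤ π 5 by omega),
        min_eq_left (show (i : ℕ) ≤ π 5 by omega), a2 16 (by decide), e16, hu, vec]
    rw [← a3 7 (by decide) (by decide)] at r2
    obtain ⟨-, hf⟩ := addEq_ann (code := code) (tin := tin) (X := 7) (by decide) (ρ := ρ') g3
        h2 h2 r2 hE rfl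
    set τ4 := (addEq 7 2 2).den code π tin ρ' τ3 with hτ4
    have g4 : Good π τ4 := g3.den _ (by simp) (by simp) (by simp)
    have a4 : ∀ A, A ∉ [0, 1, 2, 3, 7] → τ4.arr A = τ.arr A := fun A hA => by
      rw [← a2 A hA]
      simp only [List.mem_cons, List.not_mem_nil, or_false, not_or] at hA
      exact (Cmd.den_arr _ (by simp [hA])).trans (a3 A hA.1 hA.2.1)
    have n4 : τ4.nv 2 = σ.nv 2 := by rw [Cmd.den_nv _ (by simp), Cmd.den_nv _ (by simp), n2]
    set ex5 := nEq (.bv 0) (.bv 6)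
        (.sum 2 2 (.mul (.arr 3 (.const 0) (.bv 2)) (.arr 14 (.bv 2) (.bv 1))))
        (.arr 15 (.bv 0) (.bv 1)) with hex5
    set τ5 := (fill 15 4 3 ex5).den code π tin ρ' τ4 with hτ5
    refine ⟨g4.den _ (by simp) (by simp) (by simp), ?_, ?_, ?_,
      fun t => if t = k then vec (π 2) (τ4.arr 3 0) ⬝ᵥ u k else c t, fun t ht htk => ?_⟩
    · rw [hτ5, Cmd.den_arr _ (by simp), a4 14 (by decide), e14]
    · rw [hτ5, Cmd.den_arr _ (by simp), a4 16 (by decide), e16]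
    · rw [hτ5, Cmd.den_nv _ (by simp), n4]
    · have key : ∀ j < π 3, τ5.arr 15 t j = if t = k then
          ∑ i ∈ Finset.range (π 2), τ4.arr 3 0 i * σ.arr 14 i j else τ.arr 15 t j := by
        intro j hj
        rw [hτ5, den_fill h4 h3 (by decide) (by simp [hex5, nEq, FExpr.noArr]),
          if_pos ⟨by omega, hj⟩, hex5, eval_nEq]
        simp only [NExpr.eval, hρ', Function.update_self,
          Function.update_of_ne (show (0 : ℕ) ≠ 1 by decide),
          Function.update_of_ne (show (6 : ℕ) ≠ 1 by decide),
          Function.update_of_ne (show (6 : ℕ) ≠ 0 by decide)]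
        split_ifs with htk'
        · simp only [FExpr.eval, g4.zero, zero_add]
          refine Finset.sum_congr rfl fun i hi => ?_
          have := Finset.mem_range.mp hi
          simp [Function.update_apply, min_eq_left (show i ≤ π 5 by omega),
            min_eq_left (show j ≤ π 5 by omega), a4 14 (by decide), e14]
        · simp [FExpr.eval, Function.update_apply, min_eq_left (show t ≤ π 5 by omega),
            min_eq_left (show j ≤ π 5 by omega), a4 15 (by decide)]
      by_cases htk' : t = k
      · subst htk'
        have hns := notMem_span_of_rank_eq (k := π 4) _ hr u x (fun i j => hx i i.2 j j.2) ht
        rcases hf with ⟨-, hmem⟩ | ⟨-, -, hz, hne⟩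
        · exact absurd (by simpa using hmem) hns
        · simp only [if_true]
          refine ⟨hne, fun j hj => ?_⟩
          rw [key j hj, if_pos rfl, vec_dot, Finset.sum_mul]
          have e1 : ∀ i ∈ Finset.range (π 2), τ4.arr 3 0 i * σ.arr 14 i j =
              ∑ s ∈ Finset.range (σ.nv 2), τ4.arr 3 0 i * σ.arr 16 s i * x s j := fun i hi => by
            rw [hx i (Finset.mem_range.mp hi) j hj, Finset.mul_sum]
            exact Finset.sum_congr rfl fun s _ => by ring
          rw [Finset.sum_congr rfl e1, Finset.sum_comm,
            Finset.sum_eq_single_of_mem t (Finset.mem_range.mpr ht)]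
          intro s hs hst
          have hs' := Finset.mem_range.mp hs
          have h0 : vec (π 2) (τ4.arr 3 0) ⬝ᵥ u s = 0 :=
            hz _ (Submodule.mem_sup_right (Submodule.subset_span
              ⟨s, by simp only [Set.mem_ofPred_eq]; omega, by simp [hst, hs']⟩))
          rw [vec_dot] at h0
          rw [← Finset.sum_mul, h0, zero_mul]
      · simp only [if_neg htk']
        obtain ⟨hc1, hc2⟩ := hc t ht (by omega)
        exact ⟨hc1, fun j hj => by rw [key j hj, if_neg htk', hc2 j hj]⟩
  obtain ⟨-, -, -, -, c, hc⟩ := main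
  exact ⟨c, fun t ht => hc t ht (by omega)⟩

end

end TensorCPD

namespace TensorCPD

/-! ### Counting with digits -/

/-- Row `0` of array `A` holds the first digits of a number, their number being parameter `p`; the
number is increased by one. -/
def inc (A p : ℕ) : Cmd :=
  .seq (.nconst 7 1) (.loop 6 p (.iflt (.const 0) (.nv 7)
    (.seq (.store A (.const 0) (.bv 6) (.next (.arr A (.const 0) (.bv 6))))
      (.ifeq (.arr A (.const 0) (.bv 6)) (.elt (.const 0)) .skip (.nconst 7 0)))
    .skip))

/-- The inverse of a field element. -/
def invX (e : FExpr) : FExpr :=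
  .sum 2 0 (.ifeq (.mul (.elt (.bv 2)) e) (.fv 1) (.elt (.bv 2)) (.fv 0))

/-- The rows of the array `X` become generators of the annihilator of the span of the rank-one
matrices whose factors are the rows of arrays `12` and `13`. -/
def nullList (X : ℕ) : Cmd :=
  .seq (ident X 8)
    (addAll 6 4 X 8 8 (outerX (.bv 1) (.arr 12 (.bv 6) (.bv 2)) (.arr 13 (.bv 6) (.bv 3))))

/-- If all slices of the tensor are combinations of the rank-one matrices in the list, the decomposition
is left in arrays `19`, `20`, `21` and variable `6` becomes `1`. -/
def check : Cmd :=
  .seq (.nconst 5 0) (.seq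
    (.loop 6 1 (.seq (ident 7 18) (.seq
      (addAll 7 8 7 18 18 (.iflt (.bv 1) (.par 4)
        (outerX (.bv 7) (.arr 12 (.bv 1) (.bv 2)) (.arr 13 (.bv 1) (.bv 3)))
        (.mul (.fv 2) (.ten (.add (.mul (.bv 6) (.par 8)) (.bv 7))))))
      (.seq (unitE 18 (.par 4)) (.seq (addEq 7 18 18) (.iflt (.const 0) (.nv 0)
        (fill 18 1 4 (nEq (.bv 0) (.bv 6)
          (.mul (.arr 3 (.const 0) (.bv 1)) (invX (.arr 3 (.const 0) (.par 4))))
          (.arr 18 (.bv 0) (.bv 1))))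
        (.nconst 5 1)))))))
    (.iflt (.nv 5) (.const 1)
      (.seq (fill 19 1 4 (.arr 18 (.bv 0) (.bv 1))) (.seq (fill 20 2 4 (.arr 12 (.bv 1) (.bv 0)))
        (.seq (fill 21 3 4 (.arr 13 (.bv 1) (.bv 0))) (.nconst 6 1))))
      .skip))

section

variable {F : Type*} [Field F] {q : ℕ} {code : F ≃ Fin q} {π : ℕ → ℕ} {tin : ℕ → F}

@[simp] lemma inc_nvW (A p : ℕ) : (inc A p).nvW = [7, 7] := rfl
@[simp] lemma inc_fvW (A p : ℕ) : (inc A p).fvW = [] := rfl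
@[simp] lemma inc_arrW (A p : ℕ) : (inc A p).arrW = [A] := rfl
@[simp] lemma nullList_nvW (X : ℕ) : (nullList X).nvW = [0, 1, 0] := rfl
@[simp] lemma nullList_fvW (X : ℕ) : (nullList X).fvW = [] := rfl
@[simp] lemma nullList_arrW (X : ℕ) : (nullList X).arrW = [0, X, 0, 1, 0, 2, 0, 3, 0, X] := rfl
@[simp] lemma check_nvW : check.nvW = [5, 0, 1, 0, 0, 1, 0, 5, 6] := rfl
@[simp] lemma check_fvW : check.fvW = [] := rfl
@[simp] lemma check_arrW : check.arrW =
    [0, 7, 0, 1, 0, 2, 0, 3, 0, 7, 0, 1, 0, 2, 0, 3, 0, 7, 0, 18, 0, 19, 0, 20, 0, 21] := rfl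

/-- Row `0` of the array `A` holds the digits of `z`, their number being `n`. -/
def Digits (code : F ≃ Fin q) (n z : ℕ) (A : ℕ → ℕ → F) : Prop :=
  ∀ j < n, A 0 j = elem code (z / q ^ j % q)

lemma Digits.zero {n : ℕ} {X : ℕ → ℕ → F} (hX : ∀ j < n, X 0 j = elem code 0) :
    Digits code n 0 X := fun j hj => by rw [hX j hj]; simp

/-- Variable `7` is the carry into position `k`; the invariant is `(z + 1) / q ^ k = z / q ^ k +
carry`. The carry survives position `k` exactly if the new digit there is `0`, that is, if `q`
divides the quotient. -/
lemma inc_spec {A p z : ℕ} {ρ : ℕ → ℕ} {σ : HS F} (hp : π p ≤ π 5 + 1)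
    (hz : Digits code (π p) z (σ.arr A)) :
    Digits code (π p) (z + 1) (((inc A p).den code π tin ρ σ).arr A) := by
  have hq : 0 < q := by have := (code 0).2; omega
  rw [inc, Cmd.den]
  have main := Cmd.den_loop_inv (code := code) (π := π) (tin := tin) (x := 6) (p := p) (ρ := ρ)
    (c := .iflt (.const 0) (.nv 7)
      (.seq (.store A (.const 0) (.bv 6) (.next (.arr A (.const 0) (.bv 6))))
        (.ifeq (.arr A (.const 0) (.bv 6)) (.elt (.const 0)) .skip (.nconst 7 0)))
      .skip) (σ := (Cmd.nconst 7 1).den code π tin ρ σ) (fun k τ => (∀ j < π p, τ.arr A 0 j =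
    elem code ((if j < k then z + 1 else z) / q ^ j % q)) ∧ τ.nv 7 ≤ 1 ∧
      (z + 1) / q ^ k = z / q ^ k + τ.nv 7) ⟨by simpa [Cmd.den] using fun j hj => hz j hj, by simp [Cmd.den],
        by simp [Cmd.den]⟩ fun k hk τ ⟨h1, h2, h3⟩ => ?_
  · intro j hj
    rw [main.1 j hj, if_pos hj]
  · have hdd : ∀ w, w / q ^ (k + 1) = w / q ^ k / q := fun w => by
      rw [pow_succ, Nat.div_div_eq_div_mul]
    rw [Cmd.den]
    split_ifs with hc
    · have hc1 : τ.nv 7 = 1 := by simp [NExpr.eval] at hc; omega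
      rw [hc1] at h3
      rw [Cmd.den]
      set a := z / q ^ k with ha
      have hval : (FExpr.next (.arr A (.const 0) (.bv 6))).eval code π tin
          (Function.update ρ 6 k) τ = elem code ((z + 1) / q ^ k % q) := by
        have : code (elem code (a % q)) = ⟨a % q, Nat.mod_lt _ hq⟩ :=
          Fin.ext (code_elem code (Nat.mod_lt _ hq))
        simp only [FExpr.eval, NExpr.eval, Function.update_self, Nat.zero_min,
          min_eq_left (show k ≤ π 5 by omega), h1 k hk, lt_irrefl, if_false, h3, ← ha, this]
        congr 1
        rw [Nat.add_mod]
        have := Nat.mod_lt a hq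
        split_ifs with h
        · rw [Nat.mod_eq_of_lt (a := 1) (by omega), Nat.mod_eq_of_lt h]
        · have : a % q = q - 1 := by omega
          rw [this]
          rcases Nat.lt_or_ge 1 q with h1 | h1
          · rw [Nat.mod_eq_of_lt h1, Nat.sub_add_cancel hq, Nat.mod_self]
          · have : q = 1 := by omega
            subst this; rfl
      set τ1 := (Cmd.store A (.const 0) (.bv 6) (.next (.arr A (.const 0) (.bv 6)))).den code π tin
        (Function.update ρ 6 k) τ with hτ1
      have a1 : ∀ j < π p, τ1.arr A 0 j =
          elem code ((if j < k + 1 then z + 1 else z) / q ^ j % q) := by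
        intro j hj
        rw [hτ1, Cmd.den, hval]
        simp only [HS.setA_arr, NExpr.eval, Nat.zero_min, Function.update_self, true_and,
          min_eq_left (show k ≤ π 5 by omega), h1 j hj]
        by_cases hjk : j = k
        · subst hjk; simp
        · rw [if_neg hjk]
          have : j < k ↔ j < k + 1 := by omega
          simp only [this]
      have n1 : τ1.nv 7 = 1 := by rw [hτ1, ← hc1]; rfl
      have hlt := Nat.mod_lt ((z + 1) / q ^ k) hq
      have hcond : (FExpr.arr A (.const 0) (.bv 6)).eval code π tin (Function.update ρ 6 k) τ1 =
          (FExpr.elt (.const 0)).eval code π tin (Function.update ρ 6 k) τ1 ↔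
            (z + 1) / q ^ k % q = 0 := by
        simp only [FExpr.eval, NExpr.eval, Function.update_self, Nat.zero_min,
          min_eq_left (show k ≤ π 5 by omega), a1 k hk, Nat.lt_succ_self, if_true]
        refine ⟨fun h => ?_, fun h => by rw [h]⟩
        have := congrArg (fun x => (code x : ℕ)) h
        simpa [code_elem code hlt, code_elem code hq] using this
      rw [Cmd.den]
      simp only [hcond]
      rw [h3] at hlt
      rw [hdd, hdd, h3]
      split_ifs with h0
      · refine ⟨a1, n1.le, ?_⟩
        rw [Cmd.den.eq_1, n1]
        exact Nat.succ_div_of_dvd (Nat.dvd_of_mod_eq_zero h0)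
      · refine ⟨a1, by simp [Cmd.den], ?_⟩
        simp only [Cmd.den, HS.setN_nv, if_true, add_zero]
        exact Nat.succ_div_of_not_dvd fun h => h0 (Nat.mod_eq_zero_of_dvd h)
    · have hc0 : τ.nv 7 = 0 := by simpa [NExpr.eval] using hc
      rw [hc0, add_zero] at h3
      refine ⟨fun j hj => ?_, by rw [Cmd.den.eq_1]; omega, ?_⟩
      · rw [Cmd.den.eq_1, h1 j hj]
        by_cases hjk : j = k
        · subst hjk; simp [h3]
        · have : j < k ↔ j < k + 1 := by omega
          simp only [this]
      · rw [Cmd.den.eq_1, hc0, hdd, hdd, h3, add_zero]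

/-- All sequences of digits occur. -/
lemma exists_digits (n : ℕ) (d : ℕ → F) : ∃ z < q ^ n, ∀ j < n, elem code (z / q ^ j % q) = d j := by
  have hq : 0 < q := by have := (code 0).2; omega
  induction n generalizing d with
  | zero => exact ⟨0, by simp, by simp⟩
  | succ n ih =>
    obtain ⟨z, hz, h⟩ := ih fun j => d (j + 1)
    have hlt := (code (d 0)).2
    refine ⟨z * q + code (d 0), ?_, fun j hj => ?_⟩
    · rw [pow_succ]; nlinarith
    · cases j with
      | zero =>
        rw [pow_zero, Nat.div_one, Nat.mul_add_mod_of_lt hlt, elem_code]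
      | succ j =>
        rw [← h j (by omega), pow_succ', ← Nat.div_div_eq_div_mul, Nat.add_comm,
          Nat.add_mul_div_right _ _ hq, Nat.div_eq_of_lt hlt, zero_add]

/-- All elements `x` are tried, and `x` is added if `x * z = 1`; for `z ≠ 0` just one summand
survives. -/
lemma eval_invX {e : FExpr} {ρ : ℕ → ℕ} {σ : HS F} (hπ : ParOK q π) (hg : Good π σ) {z : F}
    (he : ∀ x, e.eval code π tin (Function.update ρ 2 x) σ = z) (hz : z ≠ 0) :
    (invX e).eval code π tin ρ σ = z⁻¹ := by
  classical
  have hq : 0 < q := by have := (code 0).2; omega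
  have key : ∀ x < q, (FExpr.ifeq (.mul (.elt (.bv 2)) e) (.fv 1) (.elt (.bv 2)) (.fv 0)).eval code π
      tin (Function.update ρ 2 x) σ = if elem code x = z⁻¹ then elem code x else 0 := by
    intro x hx
    have e1 : (FExpr.mul (.elt (.bv 2)) e).eval code π tin (Function.update ρ 2 x) σ =
        elem code x * z := by
      simp only [FExpr.eval, NExpr.eval, Function.update_self, he, hπ.last]
      rw [min_eq_left (by omega)]
    have e2 : (FExpr.elt (.bv 2)).eval code π tin (Function.update ρ 2 x) σ = elem code x := by
      simp only [FExpr.eval, NExpr.eval, Function.update_self, hπ.last]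
      rw [min_eq_left (by omega)]
    have e3 : (FExpr.fv 1).eval code π tin (Function.update ρ 2 x) σ = 1 := hg.one
    have e4 : (FExpr.fv 0).eval code π tin (Function.update ρ 2 x) σ = 0 := hg.zero
    rw [FExpr.eval, e2, e4]
    refine if_congr ?_ rfl rfl
    rw [e1, e3, mul_eq_one_iff_eq_inv₀ hz]
  rw [invX, FExpr.eval, hg.zero, zero_add, hπ.card,
    Finset.sum_congr rfl fun x hx => key x (Finset.mem_range.mp hx)]
  rw [Finset.sum_eq_single_of_mem (code z⁻¹ : ℕ) (Finset.mem_range.mpr (code z⁻¹).2)]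
  · rw [elem_code, if_pos rfl]
  · intro x hx hne
    rw [if_neg]
    intro h
    exact hne (by rw [← h, code_elem code (Finset.mem_range.mp hx)])

/-! ### The list of rank-one matrices -/

/-- Term `r` of the list of rank-one matrices. -/
def term (π : ℕ → ℕ) (σ : HS F) (r : ℕ) : Fin (π 8) → F :=
  outer (π 8) (π 3) (σ.arr 12 r) (σ.arr 13 r)

/-- The span of the list. -/
def listSpan (π : ℕ → ℕ) (σ : HS F) : Submodule F (Fin (π 8) → F) :=
  Submodule.span F (term π σ '' {r | r < π 4})

/-- Slice `i` of the tensor. -/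
def slice (π : ℕ → ℕ) (tin : ℕ → F) (i : ℕ) : Fin (π 8) → F := fun l => tin (i * π 8 + l)

/-- The span of the slices. -/
def sliceSpan (π : ℕ → ℕ) (tin : ℕ → F) : Submodule F (Fin (π 8) → F) :=
  Submodule.span F (slice π tin '' {i | i < π 1})

lemma listSpan_congr {σ τ : HS F} (h12 : σ.arr 12 = τ.arr 12) (h13 : σ.arr 13 = τ.arr 13) :
    listSpan π σ = listSpan π τ := by
  unfold listSpan term
  rw [h12, h13]

lemma div_lt_of_lt {m n l : ℕ} (h : l < m * n) : l / n < m :=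
  Nat.div_lt_of_lt_mul (by rwa [mul_comm] at h)

lemma nullList_spec {X : ℕ} (hX : 3 < X) (h12 : X ≠ 12) (h13 : X ≠ 13) {ρ : ℕ → ℕ} {σ : HS F}
    (hg : Good π σ) (hl : Lay π) :
    rows (π 8) (π 8) (((nullList X).den code π tin ρ σ).arr X) = ann (listSpan π σ) := by
  have h8 := hl.b8
  have h2 := hl.b2
  have h3 := hl.b3
  have h4 := hl.b4
  rw [nullList, Cmd.den]
  have r1 := ident_spec (code := code) (tin := tin) (X := X) (c := 8) (by omega) (ρ := ρ) hg h8
  set σ1 := (ident X 8).den code π tin ρ σ with hσ1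
  have g1 : Good π σ1 := hg.den _ (by simp) (by simp) (by simp)
  have a1 : ∀ A, A ≠ 0 → A ≠ X → σ1.arr A = σ.arr A := fun A h h' => Cmd.den_arr _ (by simp [h, h'])
  have := addAll_ann (code := code) (tin := tin) (x := 6) (p := 4) (X := X) (r := 8) (c := 8)
    (e := outerX (.bv 1) (.arr 12 (.bv 6) (.bv 2)) (.arr 13 (.bv 6) (.bv 3))) hX (ρ := ρ) g1 h8 h8 r1
    (by simp [outerX, nEq, FExpr.noArr]) (term π σ) (fun i hi τ hτ ha hn l => by
      have hl' : (l : ℕ) < π 2 * π 3 := hl.e8 ▸ l.2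
      refine eval_outerX hτ hl' (a := σ.arr 12 i) (b := σ.arr 13 i) (fun j k => ?_)
        (fun j hj k hk => ?_) (fun j hj k hk => ?_)
      · simp [Function.update_apply]
      · rw [FExpr.eval, ha 12 (by simp; omega), a1 12 (by decide) (by omega)]
        simp [Function.update_apply, min_eq_left (show i ≤ π 5 by omega),
          min_eq_left (show j ≤ π 5 by omega)]
      · rw [FExpr.eval, ha 13 (by simp; omega), a1 13 (by decide) (by omega)]
        simp [Function.update_apply, min_eq_left (show i ≤ π 5 by omega),
          min_eq_left (show k ≤ π 5 by omega)])
  rw [this, bot_sup_eq]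
  rfl

/-- Arrays `19`, `20`, `21` hold a decomposition of the tensor. -/
def IsSol (π : ℕ → ℕ) (tin : ℕ → F) (σ : HS F) : Prop :=
  ∀ i < π 1, ∀ l < π 8, tin (i * π 8 + l) = ∑ r ∈ Finset.range (π 4),
    σ.arr 19 i r * (σ.arr 20 (l / π 3) r * σ.arr 21 (l % π 3) r)

/-- Variable `6` shows whether a decomposition has been found. -/
def Sound (π : ℕ → ℕ) (tin : ℕ → F) (σ : HS F) : Prop :=
  σ.nv 6 = 0 ∨ (σ.nv 6 = 1 ∧ IsSol π tin σ)

lemma Sound.den {σ : HS F} (h : Sound π tin σ) (c : Cmd) {ρ : ℕ → ℕ} (h6 : 6 ∉ c.nvW)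
    (h19 : 19 ∉ c.arrW) (h20 : 20 ∉ c.arrW) (h21 : 21 ∉ c.arrW) :
    Sound π tin (c.den code π tin ρ σ) := by
  unfold Sound IsSol
  rw [c.den_nv h6, c.den_arr h19, c.den_arr h20, c.den_arr h21]
  exact h

/-- Writing a slice as a combination of the list is an inhomogeneous linear system. An extra unknown
with coefficient minus the slice makes it homogeneous, and the system is solvable if and only if the
homogeneous one has a solution with nonzero last coordinate, that is, if the last unit vector is not
in the span of the equations. The pivot row found by `addEq` is such a solution, and dividing by its
last entry gives the coefficients. -/
lemma check_spec (hπ : ParOK q π) (hl : Lay π) {ρ : ℕ → ℕ} {σ τ : HS F} (hg : Good π σ)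
    (hs : Sound π tin σ) (hτ : τ = check.den code π tin ρ σ) :
    Sound π tin τ ∧ (σ.nv 6 = 1 → τ.nv 6 = 1) ∧
      ((∀ i < π 1, slice π tin i ∈ listSpan π σ) → τ.nv 6 = 1) := by
  have h8 := hl.b8
  have h1 := hl.b1
  have h2 := hl.b2
  have h3 := hl.b3
  have h4 := hl.b4
  have h18 := hl.b18
  have e18 := hl.e18
  have h19 := hl.e19
  rw [check, Cmd.den.eq_7, Cmd.den.eq_7] at hτ
  set c1 := Cmd.loop 6 1 _ with hc1
  set σ1 := (Cmd.nconst 5 0).den code π tin ρ σ with hσ1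
  have main : Good π (c1.den code π tin ρ σ1) ∧ (c1.den code π tin ρ σ1).arr 12 = σ.arr 12 ∧
      (c1.den code π tin ρ σ1).arr 13 = σ.arr 13 ∧ ((c1.den code π tin ρ σ1).nv 5 = 0 →
      ∀ i < π 1, ∀ l < π 8, tin (i * π 8 + l) = ∑ r ∈ Finset.range (π 4),
        (c1.den code π tin ρ σ1).arr 18 i r * (σ.arr 12 r (l / π 3) * σ.arr 13 r (l % π 3))) ∧
      ((∀ i < π 1, slice π tin i ∈ listSpan π σ) → (c1.den code π tin ρ σ1).nv 5 = 0) := by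
    refine Cmd.den_loop_inv (fun k τ => Good π τ ∧ τ.arr 12 = σ.arr 12 ∧
      τ.arr 13 = σ.arr 13 ∧ (τ.nv 5 = 0 →
      ∀ i < k, ∀ l < π 8, tin (i * π 8 + l) = ∑ r ∈ Finset.range (π 4),
        τ.arr 18 i r * (σ.arr 12 r (l / π 3) * σ.arr 13 r (l % π 3))) ∧
      ((∀ i < π 1, slice π tin i ∈ listSpan π σ) → τ.nv 5 = 0))
      ⟨hg.den _ (by simp [Cmd.fvW]) (by simp [Cmd.fvW]) (by simp [Cmd.fvW]), rfl, rfl, by simp,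
        fun _ => by simp [hσ1, Cmd.den]⟩ fun k hk τ ⟨g0, e12, e13, hok, hno⟩ => ?_
    rw [Cmd.den, Cmd.den, Cmd.den, Cmd.den]
    set ρ' := Function.update ρ 6 k with hρ'
    have r1 := ident_spec (code := code) (tin := tin) (X := 7) (c := 18) (by omega) (ρ := ρ') g0 h18
    set τ1 := (ident 7 18).den code π tin ρ' τ with hτ1
    have g1 : Good π τ1 := g0.den _ (by simp) (by simp) (by simp)
    have a1 : ∀ A, A ≠ 0 → A ≠ 7 → τ1.arr A = τ.arr A := fun A h h' =>
      Cmd.den_arr _ (by simp [h, h'])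
    -- The equation from matrix entry `l`, with unknowns `0` to `π 4 - 1` for the coefficients and
    -- the homogenizing unknown at index `π 4`.
    set eq : ℕ → ℕ → F := fun l r => if r < π 4 then σ.arr 12 r (l / π 3) * σ.arr 13 r (l % π 3)
      else -tin (k * π 8 + l) with heq
    set ex := FExpr.iflt (.bv 1) (.par 4)
        (outerX (.bv 7) (.arr 12 (.bv 1) (.bv 2)) (.arr 13 (.bv 1) (.bv 3)))
        (.mul (.fv 2) (.ten (.add (.mul (.bv 6) (.par 8)) (.bv 7)))) with hex
    have r2 := addAll_ann (code := code) (tin := tin) (x := 7) (p := 8) (X := 7) (r := 18) (c := 18)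
      (e := ex) (by decide) (ρ := ρ') g1 h18 h18 r1 (by simp [hex, outerX, nEq, FExpr.noArr])
      (fun l => vec (π 18) (eq l)) (fun l hll υ hυ ha hn r => by
        have hr := r.2
        have hl' : l < π 2 * π 3 := hl.e8 ▸ hll
        simp only [hex, FExpr.eval, NExpr.eval, Function.update_self, vec, heq]
        split_ifs with hc
        · refine eval_outerX hυ hl' (a := σ.arr 12 r) (b := σ.arr 13 r) (fun j k => ?_)
            (fun j hj k hk => ?_) (fun j hj k hk => ?_)
          · simp [Function.update_apply]
          · rw [FExpr.eval, ha 12 (by decide), a1 12 (by decide) (by decide), e12]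
            simp [Function.update_apply, min_eq_left (show (r : ℕ) ≤ π 5 by omega),
              min_eq_left (show j ≤ π 5 by omega)]
          · rw [FExpr.eval, ha 13 (by decide), a1 13 (by decide) (by decide), e13]
            simp [Function.update_apply, min_eq_left (show (r : ℕ) ≤ π 5 by omega),
              min_eq_left (show k ≤ π 5 by omega)]
        · have hle : k * π 8 + l ≤ π 10 := by
            have := hl.e10
            nlinarith
          simp [hρ', Function.update_apply, min_eq_left hle, hυ.neg])
    rw [bot_sup_eq] at r2
    set τ2 := (addAll 7 8 7 18 18 ex).den code π tin ρ' τ1 with hτ2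
    set S := Submodule.span F ((fun l => vec (π 18) (eq l)) '' {l | l < π 8}) with hS
    have g2 : Good π τ2 := g1.den _ (by simp) (by simp) (by simp)
    have a2 : ∀ A, A ∉ [0, 1, 2, 3, 7] → τ2.arr A = τ.arr A := fun A hA => by
      simp only [List.mem_cons, List.not_mem_nil, or_false, not_or] at hA
      exact (Cmd.den_arr _ (by simp [hA])).trans (a1 A hA.1 hA.2.2.2.2)
    set τ3 := (unitE 18 (.par 4)).den code π tin ρ' τ2 with hτ3
    have g3 : Good π τ3 := g2.den _ (by simp) (by simp) (by simp)
    have a3 : ∀ A, A ≠ 0 → A ≠ 1 → τ3.arr A = τ2.arr A := fun A h h' =>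
      Cmd.den_arr _ (by simp [h, h'])
    have hE : vec (π 18) (τ3.arr 1 0) = vec (π 18) (fun r => if r = π 4 then 1 else 0) := by
      ext r
      exact unitE_spec (k := .par 4) g2 h18 (fun j => rfl) r.2
    rw [← a3 7 (by decide) (by decide)] at r2
    obtain ⟨-, hf⟩ := addEq_ann (code := code) (tin := tin) (X := 7) (by decide) (ρ := ρ') g3
      h18 h18 r2 hE rfl
    set τ4 := (addEq 7 18 18).den code π tin ρ' τ3 with hτ4
    have g4 : Good π τ4 := g3.den _ (by simp) (by simp) (by simp)
    have a4 : ∀ A, A ∉ [0, 1, 2, 3, 7] → τ4.arr A = τ.arr A := fun A hA => by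
      rw [← a2 A hA]
      simp only [List.mem_cons, List.not_mem_nil, or_false, not_or] at hA
      exact (Cmd.den_arr _ (by simp [hA])).trans (a3 A hA.1 hA.2.1)
    have n4 : τ4.nv 5 = τ.nv 5 := by
      rw [Cmd.den_nv _ (by simp), Cmd.den_nv _ (by simp), Cmd.den_nv _ (by simp),
        Cmd.den_nv _ (by simp)]
    have hdot : ∀ z : ℕ → F, vec (π 18) z ⬝ᵥ vec (π 18) (fun r => if r = π 4 then 1 else 0) =
        z (π 4) := fun z => by
      rw [vec_dot, e18]
      simp
    have hdot2 : ∀ (z : ℕ → F) (l : ℕ), vec (π 18) z ⬝ᵥ vec (π 18) (eq l) =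
        ∑ r ∈ Finset.range (π 4), z r * (σ.arr 12 r (l / π 3) * σ.arr 13 r (l % π 3)) -
          z (π 4) * tin (k * π 8 + l) := fun z l => by
      rw [vec_dot, e18, Finset.sum_range_succ]
      simp only [heq, lt_irrefl, if_false, mul_neg, ← sub_eq_add_neg]
      congr 1
      exact Finset.sum_congr rfl fun r hr => by rw [if_pos (Finset.mem_range.mp hr)]
    rcases hf with ⟨hf0, hmem⟩ | ⟨hf0, hmem, hz, hne⟩
    · rw [Cmd.den, if_neg (by simp [hf0])]
      refine ⟨g4.den _ (by simp [Cmd.fvW]) (by simp [Cmd.fvW]) (by simp [Cmd.fvW]),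
        (a4 12 (by decide)).trans e12, (a4 13 (by decide)).trans e13, by simp [Cmd.den],
        fun hall => ?_⟩
      exfalso
      have hk' := hall k hk
      obtain ⟨c, hc⟩ := mem_rows (r := π 4) (X := fun r l => σ.arr 12 r (l / π 3) *
        σ.arr 13 r (l % π 3)) (x := slice π tin k) hk'
      -- Coefficients of slice `k`, extended by `1`, solve the homogeneous system. This contradicts
      -- that the last unit vector is a combination of the equations.
      have hx : vec (π 18) (fun r => if r < π 4 then c r else 1) ∈ ann S := by
        rw [hS, mem_ann_span]
        rintro _ ⟨l, hll, rfl⟩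
        beta_reduce
        rw [hdot2, if_neg (lt_irrefl _), one_mul]
        have := congrFun hc ⟨l, hll⟩
        simp only [slice, Finset.sum_apply, Pi.smul_apply, vec, smul_eq_mul] at this
        rw [this, sub_eq_zero]
        exact Finset.sum_congr rfl fun r hr => by rw [if_pos (Finset.mem_range.mp hr)]
      have := hx _ hmem
      rw [hdot, if_neg (lt_irrefl _)] at this
      exact one_ne_zero this
    · rw [Cmd.den, if_pos (by simp [hf0])]
      set z := τ4.arr 3 0 with hzdef
      rw [hdot] at hne
      set ex5 := nEq (.bv 0) (.bv 6)
          (.mul (.arr 3 (.const 0) (.bv 1)) (invX (.arr 3 (.const 0) (.par 4))))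
          (.arr 18 (.bv 0) (.bv 1)) with hex5
      set τ5 := (fill 18 1 4 ex5).den code π tin ρ' τ4 with hτ5
      have a5 : ∀ A, A ≠ 0 → A ≠ 18 → τ5.arr A = τ4.arr A := fun A h h' =>
        Cmd.den_arr _ (by simp [h, h'])
      have n5 : τ5.nv 5 = τ.nv 5 := by rw [hτ5, Cmd.den_nv _ (by simp), n4]
      have key : ∀ i < π 1, ∀ r < π 4, τ5.arr 18 i r =
          if i = k then z r * (z (π 4))⁻¹ else τ.arr 18 i r := by
        intro i hi r hr
        rw [hτ5, den_fill h1 h4 (by decide) (by simp [hex5, nEq, invX, FExpr.noArr]),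
          if_pos ⟨hi, hr⟩, hex5, eval_nEq]
        simp only [NExpr.eval, hρ', Function.update_self,
          Function.update_of_ne (show (0 : ℕ) ≠ 1 by decide),
          Function.update_of_ne (show (6 : ℕ) ≠ 1 by decide),
          Function.update_of_ne (show (6 : ℕ) ≠ 0 by decide)]
        split_ifs
        · rw [FExpr.eval, eval_invX hπ g4 (z := z (π 4)) (fun x => by
            simp [FExpr.eval, min_eq_left (show π 4 ≤ π 5 by omega), hzdef]) hne]
          simp [FExpr.eval, min_eq_left (show r ≤ π 5 by omega), hzdef]
        · simp [FExpr.eval, Function.update_apply, min_eq_left (show i ≤ π 5 by omega),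
            min_eq_left (show r ≤ π 5 by omega), a4 18 (by decide)]
      refine ⟨g4.den _ (by simp) (by simp) (by simp), ?_, ?_, fun h0 i hi l hll => ?_,
        fun hall => by rw [n5]; exact hno hall⟩
      · rw [a5 12 (by decide) (by decide), a4 12 (by decide), e12]
      · rw [a5 13 (by decide) (by decide), a4 13 (by decide), e13]
      · rw [n5] at h0
        by_cases hik : i = k
        · subst hik
          have h0 := hz _ (Submodule.subset_span ⟨l, hll, rfl⟩)
          rw [hdot2, sub_eq_zero] at h0
          have e : ∀ r ∈ Finset.range (π 4), τ5.arr 18 i r *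
              (σ.arr 12 r (l / π 3) * σ.arr 13 r (l % π 3)) =
              (z (π 4))⁻¹ * (z r * (σ.arr 12 r (l / π 3) * σ.arr 13 r (l % π 3))) := fun r hr => by
            rw [key i hk r (Finset.mem_range.mp hr), if_pos rfl]; ring
          rw [Finset.sum_congr rfl e, ← Finset.mul_sum, h0, inv_mul_cancel_left₀ hne]
        · rw [hok h0 i (by omega) l hll]
          refine Finset.sum_congr rfl fun r hr => ?_
          rw [key i (by omega) r (Finset.mem_range.mp hr), if_neg hik]
  obtain ⟨g, e12, e13, hok, hno⟩ := main
  have hs1 : Sound π tin (c1.den code π tin ρ σ1) := (Sound.den hs (.nconst 5 0)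
    (by simp [Cmd.nvW]) (by simp [Cmd.arrW]) (by simp [Cmd.arrW]) (by simp [Cmd.arrW])).den _
    (by simp [hc1, Cmd.nvW]) (by simp [hc1, Cmd.arrW]) (by simp [hc1, Cmd.arrW])
    (by simp [hc1, Cmd.arrW])
  have n6 : (c1.den code π tin ρ σ1).nv 6 = σ.nv 6 := by
    rw [Cmd.den_nv _ (by simp [hc1, Cmd.nvW]), hσ1, Cmd.den_nv _ (by simp [Cmd.nvW])]
  set τ1 := c1.den code π tin ρ σ1 with hτ1
  by_cases hc : τ1.nv 5 < 1
  · rw [Cmd.den.eq_8, if_pos (show NExpr.eval π ρ τ1.nv (.nv 5) < NExpr.eval π ρ τ1.nv (.const 1) from hc)] at hτ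
    have h0 : τ1.nv 5 = 0 := by omega
    have h6 : τ.nv 6 = 1 := by rw [hτ]; simp [Cmd.den]
    refine ⟨Or.inr ⟨h6, fun i hi l hll => ?_⟩, fun _ => h6, fun _ => h6⟩
    have hl' : l < π 2 * π 3 := hl.e8 ▸ hll
    have hd := div_lt_of_lt hl'
    have hm := Nat.mod_lt l hl.p3
    rw [hok h0 i hi l hll]
    refine Finset.sum_congr rfl fun r hr => ?_
    have hr' := Finset.mem_range.mp hr
    rw [hτ, Cmd.den.eq_7, Cmd.den.eq_7, Cmd.den.eq_7]
    set υ1 := (fill 19 1 4 (.arr 18 (.bv 0) (.bv 1))).den code π tin ρ τ1 with hυ1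
    set υ2 := (fill 20 2 4 (.arr 12 (.bv 1) (.bv 0))).den code π tin ρ υ1 with hυ2
    set υ3 := (fill 21 3 4 (.arr 13 (.bv 1) (.bv 0))).den code π tin ρ υ2 with hυ3
    have e1 : υ3.arr 19 i r = τ1.arr 18 i r := by
      rw [hυ3, Cmd.den_arr _ (by simp), hυ2, Cmd.den_arr _ (by simp), hυ1,
        den_fill h1 h4 (by decide) (by simp [FExpr.noArr]), if_pos ⟨hi, hr'⟩]
      simp [FExpr.eval, Function.update_apply, min_eq_left (show i ≤ π 5 by omega),
            min_eq_left (show r ≤ π 5 by omega)]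
    have e2 : υ3.arr 20 (l / π 3) r = σ.arr 12 r (l / π 3) := by
      rw [hυ3, Cmd.den_arr _ (by simp), hυ2,
        den_fill h2 h4 (by decide) (by simp [FExpr.noArr]), if_pos ⟨hd, hr'⟩]
      simp only [FExpr.eval, NExpr.eval, Function.update_self,
        Function.update_of_ne (show (0 : ℕ) ≠ 1 by decide),
        min_eq_left (show l / π 3 ≤ π 5 by omega), min_eq_left (show r ≤ π 5 by omega)]
      rw [hυ1, Cmd.den_arr _ (by simp), e12]
    have e3 : υ3.arr 21 (l % π 3) r = σ.arr 13 r (l % π 3) := by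
      rw [hυ3, den_fill h3 h4 (by decide) (by simp [FExpr.noArr]), if_pos ⟨hm, hr'⟩]
      simp only [FExpr.eval, NExpr.eval, Function.update_self,
        Function.update_of_ne (show (0 : ℕ) ≠ 1 by decide),
        min_eq_left (show l % π 3 ≤ π 5 by omega), min_eq_left (show r ≤ π 5 by omega)]
      rw [hυ2, Cmd.den_arr _ (by simp), hυ1, Cmd.den_arr _ (by simp), e13]
    have e4 : (Cmd.den code π tin (.nconst 6 1) ρ υ3).arr = υ3.arr := rfl
    rw [e4, e1, e2, e3]
  · rw [Cmd.den.eq_8, if_neg (show ¬ NExpr.eval π ρ τ1.nv (.nv 5) < NExpr.eval π ρ τ1.nv (.const 1) from hc), Cmd.den.eq_1] at hτ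
    subst hτ
    exact ⟨hs1, fun h => by rw [n6, h], fun hall => absurd (hno hall) (by omega)⟩

end

end TensorCPD

namespace TensorCPD

/-! ### Completing the list by rank-one matrices in its span with the slices -/

/-- Row `0` of array `11` holds a vector `b`, the rows of array `9` generate the annihilator of a space,
and those of array `8` the annihilator of the span of the list, of length variable `4`. All matrices
`a ⊗ b` in the space are put into the span of the list. -/
def grow : Cmd :=
  .seq (ident 10 2) (.seq
    (addAll 6 8 10 2 2 (.sum 2 3 (.mul (.arr 9 (.bv 6) (.add (.mul (.bv 1) (.par 3)) (.bv 2)))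
      (.arr 11 (.const 0) (.bv 2)))))
    (.loop 6 2 (.seq
      (fill 1 19 8 (outerX (.bv 1) (.arr 10 (.bv 6) (.bv 2)) (.arr 11 (.const 0) (.bv 3))))
      (.seq (addEq 8 8 8) (.iflt (.const 0) (.nv 0) (.iflt (.nv 4) (.par 4)
        (.seq (fill 12 4 2 (nEq (.bv 0) (.nv 4) (.arr 10 (.bv 6) (.bv 1)) (.arr 12 (.bv 0) (.bv 1))))
        (.seq (fill 13 4 3 (nEq (.bv 0) (.nv 4) (.arr 11 (.const 0) (.bv 1))
            (.arr 13 (.bv 0) (.bv 1))))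
          (.incr 4))) .skip) .skip)))))

/-- Completing the list by rank-one matrices in its span with the slices, and checking whether it
solves the problem. -/
def complete : Cmd :=
  .seq (nullList 8) (.seq (nullList 9) (.seq
    (addAll 6 1 9 8 8 (.ten (.add (.mul (.bv 6) (.par 8)) (.bv 1))))
    (.seq (fill 11 19 3 (.elt (.const 0))) (.seq (.loop 10 17 (.seq grow (inc 11 3))) check))))

section

variable {F : Type*} [Field F] {q : ℕ} {code : F ≃ Fin q} {π : ℕ → ℕ} {tin : ℕ → F}

lemma Cmd.den_seq (c c' : Cmd) (ρ : ℕ → ℕ) (σ : HS F) :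
    (Cmd.seq c c').den code π tin ρ σ = c'.den code π tin ρ (c.den code π tin ρ σ) := rfl

lemma Cmd.den_skip (ρ : ℕ → ℕ) (σ : HS F) : Cmd.skip.den code π tin ρ σ = σ := rfl

lemma Cmd.den_iflt_pos {a b : NExpr} {c c' : Cmd} {ρ : ℕ → ℕ} {σ : HS F}
    (h : a.eval π ρ σ.nv < b.eval π ρ σ.nv) :
    (Cmd.iflt a b c c').den code π tin ρ σ = c.den code π tin ρ σ := if_pos h

lemma Cmd.den_iflt_neg {a b : NExpr} {c c' : Cmd} {ρ : ℕ → ℕ} {σ : HS F}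
    (h : ¬ a.eval π ρ σ.nv < b.eval π ρ σ.nv) :
    (Cmd.iflt a b c c').den code π tin ρ σ = c'.den code π tin ρ σ := if_neg h

@[simp] lemma grow_nvW : grow.nvW = [0, 1, 0, 0, 1, 0, 4] := rfl
@[simp] lemma grow_fvW : grow.fvW = [] := rfl
@[simp] lemma grow_arrW : grow.arrW =
    [0, 10, 0, 1, 0, 2, 0, 3, 0, 10, 0, 1, 0, 2, 0, 3, 0, 8, 0, 12, 0, 13] := rfl

lemma sum_range_mul (m n : ℕ) (f : ℕ → F) : ∑ l ∈ Finset.range (m * n), f l =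
    ∑ i ∈ Finset.range m, ∑ j ∈ Finset.range n, f (i * n + j) := by
  induction m with
  | zero => simp
  | succ m ih => rw [Nat.succ_mul, Finset.sum_range_add, ih, Finset.sum_range_succ]

lemma dot_outer (hl : Lay π) (K a b : ℕ → F) : vec (π 8) K ⬝ᵥ outer (π 8) (π 3) a b =
    ∑ j ∈ Finset.range (π 2), a j * ∑ k ∈ Finset.range (π 3), K (j * π 3 + k) * b k := by
  have : outer (π 8) (π 3) a b = vec (π 8) (fun l => a (l / π 3) * b (l % π 3)) := rfl
  rw [this, vec_dot, hl.e8, sum_range_mul]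
  refine Finset.sum_congr rfl fun j _ => ?_
  rw [Finset.mul_sum]
  refine Finset.sum_congr rfl fun k hk => ?_
  have hk' := Finset.mem_range.mp hk
  rw [Nat.add_comm, Nat.add_mul_div_right _ _ hl.p3, Nat.add_mul_mod_self_right,
    Nat.div_eq_of_lt hk', Nat.mod_eq_of_lt hk', zero_add]
  ring

lemma outer_congr (hl : Lay π) {a b a' b' : ℕ → F} (ha : ∀ j < π 2, a j = a' j)
    (hb : ∀ k < π 3, b k = b' k) : outer (π 8) (π 3) a b = outer (π 8) (π 3) a' b' := by
  ext l
  have hl' : (l : ℕ) < π 2 * π 3 := hl.e8 ▸ l.2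
  rw [outer, outer, ha _ (div_lt_of_lt hl'), hb _ (Nat.mod_lt _ hl.p3)]

/-- Overwriting place `n` loses nothing because the term there was zero. -/
lemma span_insert_term {V : Type*} [AddCommGroup V] [Module F V] {f f' : ℕ → V} {R n : ℕ} {e : V}
    (hn : n < R) (h0 : f n = 0) (h : ∀ r < R, f' r = if r = n then e else f r) :
    Submodule.span F (f' '' {r | r < R}) =
      Submodule.span F (f '' {r | r < R}) ⊔ Submodule.span F {e} := by
  apply le_antisymm
  · rw [Submodule.span_le]
    rintro _ ⟨r, hr, rfl⟩
    rw [h r hr]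
    split_ifs
    · exact Submodule.mem_sup_right (Submodule.mem_span_singleton_self e)
    · exact Submodule.mem_sup_left (Submodule.subset_span ⟨r, hr, rfl⟩)
  · rw [← Submodule.span_union, Submodule.span_le]
    rintro _ (⟨r, hr, rfl⟩ | rfl)
    · by_cases hrn : r = n
      · rw [hrn, h0]; exact Submodule.zero_mem _
      · exact Submodule.subset_span ⟨r, hr, by rw [h r hr, if_neg hrn]⟩
    · exact Submodule.subset_span ⟨n, hn, by rw [h n hn, if_pos rfl]⟩

/-- The situation during the completion of the list within the space `S`. -/
structure Growing (π : ℕ → ℕ) (S : Submodule F (Fin (π 8) → F)) (σ : HS F) : Prop where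
  good : Good π σ
  r9 : rows (π 8) (π 8) (σ.arr 9) = ann S
  r8 : rows (π 8) (π 8) (σ.arr 8) = ann (listSpan π σ)
  le : listSpan π σ ≤ S
  zero : ∀ r < π 4, σ.nv 4 ≤ r → term π σ r = 0
  le4 : σ.nv 4 ≤ π 4
  -- The free places suffice: at most `R - nv 4` dimensions of `S` are missing in the list. Adding a
  -- new independent matrix raises both right-hand dimension and `nv 4` by one.
  cnt : Module.finrank F S + σ.nv 4 ≤ Module.finrank F (listSpan π σ) + π 4

lemma Growing.congr {S : Submodule F (Fin (π 8) → F)} {σ τ : HS F} (h : Growing π S σ)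
    (hg : Good π τ) (h8 : τ.arr 8 = σ.arr 8) (h9 : τ.arr 9 = σ.arr 9) (h12 : τ.arr 12 = σ.arr 12)
    (h13 : τ.arr 13 = σ.arr 13) (h4 : τ.nv 4 = σ.nv 4) : Growing π S τ := by
  have e := listSpan_congr (π := π) h12 h13
  refine ⟨hg, by rw [h9, h.r9], by rw [h8, h.r8, e], by rw [e]; exact h.le, fun r hr hr' => ?_,
    by rw [h4]; exact h.le4, by rw [h4, e]; exact h.cnt⟩
  rw [term, h12, h13]
  exact h.zero r hr (by omega)

/-- For fixed `b` the condition `a ⊗ b ∈ S` is linear in `a`: if the matrices `K_t` generate the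
annihilator of `S`, it says that `a` is orthogonal to all `K_t b`. The rows of array `10` generate
the solutions, and it is enough to treat these generators, since `a ↦ a ⊗ b` is linear. -/
lemma grow_spec (hl : Lay π) {S : Submodule F (Fin (π 8) → F)} {ρ : ℕ → ℕ} {σ τ : HS F}
    (h : Growing π S σ) (hτ : τ = grow.den code π tin ρ σ) :
    Growing π S τ ∧ listSpan π σ ≤ listSpan π τ ∧
      ∀ a, outer (π 8) (π 3) a (σ.arr 11 0) ∈ S →
        outer (π 8) (π 3) a (σ.arr 11 0) ∈ listSpan π τ := by
  have h8 := hl.b8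
  have h2 := hl.b2
  have h3 := hl.b3
  have h4 := hl.b4
  have h19 := hl.e19
  rw [grow, Cmd.den_seq, Cmd.den_seq] at hτ
  have r1 := ident_spec (code := code) (tin := tin) (X := 10) (c := 2) (by omega) (ρ := ρ) h.good h2
  set σ1 := (ident 10 2).den code π tin ρ σ with hσ1
  have g1 : Good π σ1 := h.good.den _ (by simp) (by simp) (by simp)
  have a1 : ∀ A, A ≠ 0 → A ≠ 10 → σ1.arr A = σ.arr A := fun A h h' => Cmd.den_arr _ (by simp [h, h'])
  set b := σ.arr 11 0 with hb
  set ex := FExpr.sum 2 3 (.mul (.arr 9 (.bv 6) (.add (.mul (.bv 1) (.par 3)) (.bv 2)))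
      (.arr 11 (.const 0) (.bv 2))) with hex
  set Kb : ℕ → ℕ → F := fun i j => ∑ k ∈ Finset.range (π 3), σ.arr 9 i (j * π 3 + k) * b k with hKb
  have r2 := addAll_ann (code := code) (tin := tin) (x := 6) (p := 8) (X := 10) (r := 2) (c := 2)
    (e := ex) (by decide) (ρ := ρ) g1 h2 h2 r1 (by simp [hex, FExpr.noArr])
    (fun i => vec (π 2) (Kb i)) (fun i hi τ hτ ha hn j => by
      have hj := j.2
      simp only [hex, FExpr.eval, hτ.zero, zero_add, vec, hKb]
      refine Finset.sum_congr rfl fun k hk => ?_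
      have hk' := Finset.mem_range.mp hk
      have hjk : (j : ℕ) * π 3 + k < π 8 := by rw [hl.e8]; nlinarith
      rw [ha 9 (by decide), ha 11 (by decide), a1 9 (by decide) (by decide),
        a1 11 (by decide) (by decide)]
      simp [Function.update_apply, min_eq_left (show i ≤ π 5 by omega),
        min_eq_left (show (j : ℕ) * π 3 + k ≤ π 5 by omega), min_eq_left (show k ≤ π 5 by omega), hb])
  rw [bot_sup_eq] at r2
  set σ2 := (addAll 6 8 10 2 2 ex).den code π tin ρ σ1 with hσ2
  have g2 : Good π σ2 := g1.den _ (by simp) (by simp) (by simp)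
  have a2 : ∀ A, A ∉ [0, 1, 2, 3, 10] → σ2.arr A = σ.arr A := fun A hA => by
    simp only [List.mem_cons, List.not_mem_nil, or_false, not_or] at hA
    exact (Cmd.den_arr _ (by simp [hA])).trans (a1 A hA.1 hA.2.2.2.2)
  have n2 : σ2.nv 4 = σ.nv 4 := by rw [Cmd.den_nv _ (by simp), Cmd.den_nv _ (by simp)]
  have G2 : Growing π S σ2 := h.congr g2 (a2 8 (by decide)) (a2 9 (by decide)) (a2 12 (by decide))
    (a2 13 (by decide)) n2
  have hL2 : listSpan π σ2 = listSpan π σ := listSpan_congr (a2 12 (by decide)) (a2 13 (by decide))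
  have hAB : ∀ i, outer (π 8) (π 3) (σ2.arr 10 i) b ∈ S ↔ ∀ t < π 8,
      vec (π 2) (σ2.arr 10 i) ⬝ᵥ vec (π 2) (Kb t) = 0 := fun i => by
    rw [mem_of_rows_orthogonal h.r9]
    refine forall₂_congr fun t ht => ?_
    rw [dot_outer hl, vec_dot]
  have main : Growing π S τ ∧ listSpan π σ ≤ listSpan π τ ∧ τ.arr 10 = σ2.arr 10 ∧
      τ.arr 11 = σ.arr 11 ∧ ∀ i < π 2, outer (π 8) (π 3) (σ2.arr 10 i) b ∈ listSpan π τ := by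
    rw [hτ]
    refine Cmd.den_loop_inv (fun k τ => Growing π S τ ∧ listSpan π σ ≤ listSpan π τ ∧
      τ.arr 10 = σ2.arr 10 ∧
      τ.arr 11 = σ.arr 11 ∧ ∀ i < k, outer (π 8) (π 3) (σ2.arr 10 i) b ∈ listSpan π τ)
      ⟨G2, hL2.ge, rfl, a2 11 (by decide), by simp⟩ fun k hk τ ⟨G, hle, e10, e11, hmem⟩ => ?_
    rw [Cmd.den_seq, Cmd.den_seq]
    set ρ' := Function.update ρ 6 k with hρ'
    set e := outer (π 8) (π 3) (σ2.arr 10 k) b with he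
    set ex1 := outerX (.bv 1) (.arr 10 (.bv 6) (.bv 2)) (.arr 11 (.const 0) (.bv 3)) with hex1
    set τ1 := (fill 1 19 8 ex1).den code π tin ρ' τ with hτ1
    have g1 : Good π τ1 := G.good.den _ (by simp) (by simp) (by simp)
    have a1 : ∀ A, A ≠ 0 → A ≠ 1 → τ1.arr A = τ.arr A := fun A h h' =>
      Cmd.den_arr _ (by simp [h, h'])
    have n1 : τ1.nv 4 = τ.nv 4 := Cmd.den_nv _ (by simp)
    have hE : vec (π 8) (τ1.arr 1 0) = e := by
      ext l
      have hl' : (l : ℕ) < π 2 * π 3 := hl.e8 ▸ l.2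
      rw [vec, hτ1, den_fill (by omega) h8 (by decide) (by simp [hex1, outerX, nEq, FExpr.noArr]),
        if_pos ⟨by omega, l.2⟩]
      refine eval_outerX G.good hl' (a := σ2.arr 10 k) (b := b) (fun j k => ?_)
        (fun j hj k' hk' => ?_) (fun j hj k' hk' => ?_)
      · simp [Function.update_apply]
      · rw [FExpr.eval, e10]
        simp [hρ', Function.update_apply, min_eq_left (show k ≤ π 5 by omega),
          min_eq_left (show j ≤ π 5 by omega)]
      · rw [FExpr.eval, e11]
        simp [Function.update_apply, min_eq_left (show k' ≤ π 5 by omega), hb]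
    have r8 : rows (π 8) (π 8) (τ1.arr 8) = ann (listSpan π τ) := by
      rw [a1 8 (by decide) (by decide), G.r8]
    obtain ⟨r8', hf⟩ := addEq_ann (code := code) (tin := tin) (X := 8) (by decide) (ρ := ρ') g1
      h8 h8 r8 hE rfl
    set τ2 := (addEq 8 8 8).den code π tin ρ' τ1 with hτ2
    have g2 : Good π τ2 := g1.den _ (by simp) (by simp) (by simp)
    have a2' : ∀ A, A ∉ [0, 1, 2, 3, 8] → τ2.arr A = τ.arr A := fun A hA => by
      simp only [List.mem_cons, List.not_mem_nil, or_false, not_or] at hA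
      exact (Cmd.den_arr _ (by simp [hA])).trans (a1 A hA.1 hA.2.1)
    have n2' : τ2.nv 4 = τ.nv 4 := by rw [Cmd.den_nv _ (by simp), n1]
    have hLe : listSpan π τ2 = listSpan π τ :=
      listSpan_congr (a2' 12 (by decide)) (a2' 13 (by decide))
    rcases hf with ⟨hf0, hes⟩ | ⟨hf0, hes, -⟩
    · rw [Cmd.den_iflt_neg (by simp [hf0, NExpr.eval]), Cmd.den_skip]
      rw [sup_eq_left.mpr (by simpa [Submodule.span_le] using hes)] at r8'
      refine ⟨⟨g2, by rw [a2' 9 (by decide), G.r9], by rw [r8', hLe], by rw [hLe]; exact G.le,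
        fun r hr hr' => ?_, by rw [n2']; exact G.le4, by rw [n2', hLe]; exact G.cnt⟩, by rwa [hLe],
        (a2' 10 (by decide)).trans e10, (a2' 11 (by decide)).trans e11, fun i hi => ?_⟩
      · rw [term, a2' 12 (by decide), a2' 13 (by decide)]
        exact G.zero r hr (by omega)
      · rw [hLe]
        rcases Nat.lt_succ_iff_lt_or_eq.mp hi with hi | rfl
        · exact hmem i hi
        · exact hes
    · have heS : e ∈ S := (hAB k).mpr fun t ht => by
        have := (r2 ▸ vec_mem_rows hk : vec (π 2) (σ2.arr 10 k) ∈ _)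
        exact this _ (Submodule.subset_span ⟨t, ht, rfl⟩)
      -- A matrix of `S` that is not yet in the span shows that the list is not complete, so by
      -- `cnt` a place is still free.
      have hlt : τ.nv 4 < π 4 := by
        have : listSpan π τ < S := lt_of_le_of_ne G.le fun h => hes (h ▸ heS)
        have := Submodule.finrank_lt_finrank_of_lt this
        have := G.cnt
        omega
      rw [Cmd.den_iflt_pos (by simp [hf0, NExpr.eval]),
        Cmd.den_iflt_pos (by simpa [NExpr.eval, n2'] using hlt), Cmd.den_seq, Cmd.den_seq]
      set ex3 := nEq (.bv 0) (.nv 4) (.arr 10 (.bv 6) (.bv 1)) (.arr 12 (.bv 0) (.bv 1)) with hex3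
      set τ3 := (fill 12 4 2 ex3).den code π tin ρ' τ2 with hτ3
      set ex4 := nEq (.bv 0) (.nv 4) (.arr 11 (.const 0) (.bv 1)) (.arr 13 (.bv 0) (.bv 1)) with hex4
      set τ4 := (fill 13 4 3 ex4).den code π tin ρ' τ3 with hτ4
      set τ5 := (Cmd.incr 4).den code π tin ρ' τ4 with hτ5
      have n3 : ∀ x, τ3.nv x = τ2.nv x := fun x => Cmd.den_nv _ (by simp)
      have n4 : ∀ x, τ4.nv x = τ2.nv x := fun x => (Cmd.den_nv _ (by simp)).trans (n3 x)
      have n5 : τ5.nv 4 = τ.nv 4 + 1 := by rw [hτ5]; simp [Cmd.den, n4, n2']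
      have e5 : τ5.arr = τ4.arr := rfl
      have a5 : ∀ A, A ∉ [0, 1, 2, 3, 8, 12, 13] → τ5.arr A = τ.arr A := fun A hA => by
        simp only [List.mem_cons, List.not_mem_nil, or_false, not_or] at hA
        rw [e5, hτ4, Cmd.den_arr _ (by simp [hA]), hτ3, Cmd.den_arr _ (by simp [hA]),
          a2' A (by simp [hA])]
      have k12 : ∀ r < π 4, ∀ j < π 2, τ5.arr 12 r j =
          if r = τ.nv 4 then σ2.arr 10 k j else τ.arr 12 r j := by
        intro r hr j hj
        rw [e5, hτ4, Cmd.den_arr _ (by simp), hτ3, den_fill h4 h2 (by decide)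
          (by simp [hex3, nEq, FExpr.noArr]), if_pos ⟨hr, hj⟩, hex3, eval_nEq]
        simp only [NExpr.eval, Function.update_self, n2',
          Function.update_of_ne (show (0 : ℕ) ≠ 1 by decide)]
        split_ifs
        · simp [FExpr.eval, hρ', Function.update_apply, min_eq_left (show k ≤ π 5 by omega),
            min_eq_left (show j ≤ π 5 by omega), a2' 10 (by decide), e10]
        · simp [FExpr.eval, Function.update_apply, min_eq_left (show r ≤ π 5 by omega),
            min_eq_left (show j ≤ π 5 by omega), a2' 12 (by decide)]
      have k13 : ∀ r < π 4, ∀ j < π 3, τ5.arr 13 r j =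
          if r = τ.nv 4 then b j else τ.arr 13 r j := by
        intro r hr j hj
        rw [e5, hτ4, den_fill h4 h3 (by decide)
          (by simp [hex4, nEq, FExpr.noArr]), if_pos ⟨hr, hj⟩, hex4, eval_nEq]
        simp only [NExpr.eval, Function.update_self, n3, n2',
          Function.update_of_ne (show (0 : ℕ) ≠ 1 by decide)]
        split_ifs
        · rw [FExpr.eval, hτ3, Cmd.den_arr _ (by simp), a2' 11 (by decide), e11]
          simp [min_eq_left (show j ≤ π 5 by omega), hb]
        · rw [FExpr.eval, hτ3, Cmd.den_arr _ (by simp), a2' 13 (by decide)]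
          simp [Function.update_apply, min_eq_left (show r ≤ π 5 by omega),
            min_eq_left (show j ≤ π 5 by omega)]
      have kt : ∀ r < π 4, term π τ5 r = if r = τ.nv 4 then e else term π τ r := by
        intro r hr
        split_ifs with hrn
        · exact outer_congr hl (fun j hj => by rw [k12 r hr j hj, if_pos hrn])
            (fun j hj => by rw [k13 r hr j hj, if_pos hrn])
        · exact outer_congr hl (fun j hj => by rw [k12 r hr j hj, if_neg hrn])
            (fun j hj => by rw [k13 r hr j hj, if_neg hrn])
      have hLS : listSpan π τ5 = listSpan π τ ⊔ Submodule.span F {e} :=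
        span_insert_term hlt (G.zero _ hlt le_rfl) kt
      have g5 : Good π τ5 := ((g2.den _ (by simp) (by simp) (by simp)).den _ (by simp) (by simp)
        (by simp)).den _ (by simp [Cmd.fvW]) (by simp [Cmd.fvW]) (by simp [Cmd.fvW])
      have hle5 : listSpan π τ ≤ listSpan π τ5 := by rw [hLS]; exact le_sup_left
      refine ⟨⟨g5, by rw [a5 9 (by decide), G.r9], ?_, ?_, fun r hr hr' => ?_, by omega, ?_⟩,
        hle.trans hle5, (a5 10 (by decide)).trans e10, (a5 11 (by decide)).trans e11,
        fun i hi => ?_⟩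
      · rw [e5, hτ4, Cmd.den_arr _ (by simp), hτ3, Cmd.den_arr _ (by simp), r8', hLS]
      · rw [hLS]
        exact sup_le G.le (by simpa [Submodule.span_le] using heS)
      · rw [kt r hr, if_neg (by omega)]
        exact G.zero r hr (by omega)
      · rw [n5, hLS, Submodule.finrank_sup_span_singleton hes]
        have := G.cnt
        omega
      · rcases Nat.lt_succ_iff_lt_or_eq.mp hi with hi | rfl
        · exact hle5 (hmem i hi)
        · rw [hLS]; exact Submodule.mem_sup_right (Submodule.mem_span_singleton_self e)
  obtain ⟨G, hle, e10, e11, hmem⟩ := main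
  refine ⟨G, hle, fun a ha => ?_⟩
  have ha' : vec (π 2) a ∈ rows (π 2) (π 2) (σ2.arr 10) := by
    rw [r2, mem_ann_span]
    rintro _ ⟨t, ht, rfl⟩
    have := (mem_of_rows_orthogonal h.r9).mp ha t ht
    rwa [dot_outer hl, ← vec_dot] at this
  obtain ⟨c, hc⟩ := mem_rows ha'
  have : outer (π 8) (π 3) a b = ∑ i ∈ Finset.range (π 2), c i •
      outer (π 8) (π 3) (σ2.arr 10 i) b := by
    ext l
    have hl' : (l : ℕ) < π 2 * π 3 := hl.e8 ▸ l.2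
    have := congrFun hc ⟨l / π 3, div_lt_of_lt hl'⟩
    simp only [vec, Finset.sum_apply, Pi.smul_apply, smul_eq_mul] at this
    simp only [outer, this, Finset.sum_apply, Pi.smul_apply, smul_eq_mul, Finset.sum_mul, mul_assoc]
  rw [this]
  exact Submodule.sum_mem _ fun i hi => Submodule.smul_mem _ _ (hmem i (Finset.mem_range.mp hi))

/-- Once all `|F| ^ n₂` vectors `b` have been treated, the list spans every rank-one matrix in its
original span plus the slices. Soundness holds without any assumption on the list; the assumptions
on zero terms, room and generation are needed for success only. -/
lemma complete_spec (hπ : ParOK q π) (hl : Lay π) {ρ : ℕ → ℕ} {σ τ : HS F} (hg : Good π σ)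
    (hs : Sound π tin σ) (hτ : τ = complete.den code π tin ρ σ) :
    Sound π tin τ ∧ (σ.nv 6 = 1 → τ.nv 6 = 1) ∧
      ((∀ r < π 4, σ.nv 4 ≤ r → term π σ r = 0) → σ.nv 4 ≤ π 4 →
        Module.finrank F ↥(listSpan π σ ⊔ sliceSpan π tin) + σ.nv 4 ≤
          Module.finrank F (listSpan π σ) + π 4 →
        (∀ i < π 1, slice π tin i ∈ listSpan π σ ⊔ Submodule.span F
          {m | (∃ a b, m = outer (π 8) (π 3) a b) ∧ m ∈ listSpan π σ ⊔ sliceSpan π tin}) →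
        τ.nv 6 = 1) := by
  have h8 := hl.b8
  have h1 := hl.b1
  have h3 := hl.b3
  have h19 := hl.e19
  have hq : 0 < q := by have := (code 0).2; omega
  rw [complete, Cmd.den_seq, Cmd.den_seq, Cmd.den_seq, Cmd.den_seq, Cmd.den_seq] at hτ
  have r1 := nullList_spec (code := code) (tin := tin) (X := 8) (by decide) (by decide) (by decide)
    (ρ := ρ) hg hl
  set σ1 := (nullList 8).den code π tin ρ σ with hσ1
  have g1 : Good π σ1 := hg.den _ (by simp) (by simp) (by simp)
  have s1 : Sound π tin σ1 := hs.den _ (by simp) (by simp) (by simp) (by simp)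
  have r2 := nullList_spec (code := code) (tin := tin) (X := 9) (by decide) (by decide) (by decide)
    (ρ := ρ) g1 hl
  have eL1 : listSpan π σ1 = listSpan π σ := listSpan_congr (Cmd.den_arr _ (by simp))
    (Cmd.den_arr _ (by simp))
  rw [eL1] at r2
  set σ2 := (nullList 9).den code π tin ρ σ1 with hσ2
  have g2 : Good π σ2 := g1.den _ (by simp) (by simp) (by simp)
  have s2 : Sound π tin σ2 := s1.den _ (by simp) (by simp) (by simp) (by simp)
  have r3 := addAll_ann (code := code) (tin := tin) (x := 6) (p := 1) (X := 9) (r := 8) (c := 8)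
    (e := .ten (.add (.mul (.bv 6) (.par 8)) (.bv 1))) (by decide) (ρ := ρ) g2 h8 h8 r2
    (by simp [FExpr.noArr]) (slice π tin) (fun i hi τ hτ ha hn l => by
      have hle : i * π 8 + l ≤ π 10 := by
        have := hl.e10
        have := l.2
        nlinarith
      simp [FExpr.eval, Function.update_apply, min_eq_left hle, slice])
  set σ3 := (addAll 6 1 9 8 8 (.ten (.add (.mul (.bv 6) (.par 8)) (.bv 1)))).den code π tin ρ σ2
    with hσ3
  have g3 : Good π σ3 := g2.den _ (by simp) (by simp) (by simp)
  have s3 : Sound π tin σ3 := s2.den _ (by simp) (by simp) (by simp) (by simp)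
  set σ4 := (fill 11 19 3 (.elt (.const 0))).den code π tin ρ σ3 with hσ4
  have g4 : Good π σ4 := g3.den _ (by simp) (by simp) (by simp)
  have s4 : Sound π tin σ4 := s3.den _ (by simp) (by simp) (by simp) (by simp)
  have a4 : ∀ A, A ∉ [0, 1, 2, 3, 8, 9, 11] → σ4.arr A = σ.arr A := fun A hA => by
    simp only [List.mem_cons, List.not_mem_nil, or_false, not_or] at hA
    rw [hσ4, Cmd.den_arr _ (by simp [hA]), hσ3, Cmd.den_arr _ (by simp [hA]), hσ2,
      Cmd.den_arr _ (by simp [hA]), hσ1, Cmd.den_arr _ (by simp [hA])]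
  have n4 : ∀ x, x ∉ [0, 1] → σ4.nv x = σ.nv x := fun x hx => by
    simp only [List.mem_cons, List.not_mem_nil, or_false, not_or] at hx
    rw [hσ4, Cmd.den_nv _ (by simp), hσ3, Cmd.den_nv _ (by simp [hx]), hσ2,
      Cmd.den_nv _ (by simp [hx]), hσ1, Cmd.den_nv _ (by simp [hx])]
  have eL4 : listSpan π σ4 = listSpan π σ := listSpan_congr (a4 12 (by decide)) (a4 13 (by decide))
  set cl := Cmd.loop 10 17 (.seq grow (inc 11 3)) with hcl
  set σ5 := cl.den code π tin ρ σ4 with hσ5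
  have g5 : Good π σ5 := g4.den _ (by simp [hcl, Cmd.fvW]) (by simp [hcl, Cmd.fvW])
    (by simp [hcl, Cmd.fvW])
  have s5 : Sound π tin σ5 := s4.den _ (by simp [hcl, Cmd.nvW]) (by simp [hcl, Cmd.arrW])
    (by simp [hcl, Cmd.arrW]) (by simp [hcl, Cmd.arrW])
  have n5 : σ5.nv 6 = σ.nv 6 := by
    rw [hσ5, Cmd.den_nv _ (by simp [hcl, Cmd.nvW]), n4 6 (by decide)]
  obtain ⟨c1, c2, c3⟩ := check_spec hπ hl g5 s5 hτ
  refine ⟨c1, fun h => c2 (by rw [n5, h]), fun hz hle hcnt hsl => c3 ?_⟩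
  set S := listSpan π σ ⊔ sliceSpan π tin with hS
  have d4 : Digits code (π 3) 0 (σ4.arr 11) := Digits.zero fun j hj => by
    rw [hσ4, den_fill (by omega) h3 (by decide) (by simp [FExpr.noArr]), if_pos ⟨by omega, hj⟩]
    simp [FExpr.eval]
  have G4 : Growing π S σ4 := by
    refine ⟨g4, ?_, ?_, by rw [eL4]; exact le_sup_left, fun r hr hr' => ?_, ?_, ?_⟩
    · rw [hσ4, Cmd.den_arr _ (by simp)]
      exact r3
    · rw [hσ4, Cmd.den_arr _ (by simp), hσ3, Cmd.den_arr _ (by simp), hσ2, Cmd.den_arr _ (by simp),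
        r1, eL4]
    · rw [term, a4 12 (by decide), a4 13 (by decide)]
      rw [n4 4 (by decide)] at hr'
      exact hz r hr hr'
    · rw [n4 4 (by decide)]; exact hle
    · rw [n4 4 (by decide), eL4]; exact hcnt
  have main : Growing π S σ5 ∧ listSpan π σ ≤ listSpan π σ5 ∧ Digits code (π 3) (π 17) (σ5.arr 11) ∧
      ∀ z < π 17, ∀ a b : ℕ → F, (∀ j < π 3, b j = elem code (z / q ^ j % q)) →
        outer (π 8) (π 3) a b ∈ S → outer (π 8) (π 3) a b ∈ listSpan π σ5 := by
    refine Cmd.den_loop_inv (fun k τ => Growing π S τ ∧ listSpan π σ ≤ listSpan π τ ∧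
      Digits code (π 3) k (τ.arr 11) ∧
      ∀ z < k, ∀ a b : ℕ → F, (∀ j < π 3, b j = elem code (z / q ^ j % q)) →
        outer (π 8) (π 3) a b ∈ S → outer (π 8) (π 3) a b ∈ listSpan π τ)
      ⟨G4, eL4.ge, d4, by simp⟩ fun k hk τ ⟨G, hle, hd, hall⟩ => ?_
    rw [Cmd.den_seq]
    obtain ⟨G', hle', hall'⟩ := grow_spec hl (ρ := Function.update ρ 10 k) G rfl
    set τ1 := grow.den code π tin (Function.update ρ 10 k) τ with hτ1
    have hd1 : Digits code (π 3) k (τ1.arr 11) := by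
      rw [hτ1, Cmd.den_arr _ (by simp)]; exact hd
    have hd2 := inc_spec (tin := tin) (ρ := Function.update ρ 10 k) h3 hd1
    set τ2 := (inc 11 3).den code π tin (Function.update ρ 10 k) τ1 with hτ2
    have eL : listSpan π τ2 = listSpan π τ1 := listSpan_congr (Cmd.den_arr _ (by simp))
      (Cmd.den_arr _ (by simp))
    refine ⟨G'.congr (G'.good.den _ (by simp) (by simp) (by simp)) (Cmd.den_arr _ (by simp))
      (Cmd.den_arr _ (by simp)) (Cmd.den_arr _ (by simp)) (Cmd.den_arr _ (by simp))
      (Cmd.den_nv _ (by simp)), by rw [eL]; exact hle.trans hle', hd2, fun z hz a b hb hab => ?_⟩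
    rw [eL]
    rcases Nat.lt_succ_iff_lt_or_eq.mp hz with hz | rfl
    · exact hle' (hall z hz a b hb hab)
    · have e : outer (π 8) (π 3) a b = outer (π 8) (π 3) a (τ.arr 11 0) :=
        outer_congr hl (fun _ _ => rfl) fun j hj => by rw [hb j hj, hd j hj]
      rw [e] at hab ⊢
      exact hall' a hab
  obtain ⟨-, hle5, -, hall⟩ := main
  intro i hi
  refine (sup_le hle5 (Submodule.span_le.mpr ?_)) (hsl i hi)
  rintro _ ⟨⟨a, b, rfl⟩, hm⟩
  obtain ⟨z, hz, hd⟩ := exists_digits (code := code) (π 3) b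
  exact hall z (by rw [hl.e17, hπ.card]; exact hz) a b (fun j hj => (hd j hj).symm) hm

end

end TensorCPD

/-! ### The two branches of the search and the existence of a successful guess. -/

namespace TensorCPD

/-! ### The case that the combinations of slices of small rank span everything -/

/-- Array `14` becomes the combination of slices with coefficients in row `0` of array `17`. -/
def combine : Cmd := fill 14 2 3 (.sum 2 1 (.mul (.arr 17 (.const 0) (.bv 2))
  (.ten (.add (.mul (.bv 2) (.par 8)) (.add (.mul (.bv 0) (.par 3)) (.bv 1))))))

/-- Recording the combination of slices with the current coefficients, if its rank is at most
parameter `13` and the coefficients are not in the span of the preceding ones. -/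
def record : Cmd :=
  .seq combine (.seq colBasis (.iflt (.nv 2) (.add (.par 13) (.const 1))
    (.seq (fill 1 19 1 (.arr 17 (.const 0) (.bv 1))) (.seq (addEq 23 1 1)
      (.iflt (.const 0) (.nv 0)
        (.seq (fill 16 4 2 (.arr 5 (.bv 0) (.bv 1))) (.seq dualize (.seq
          (fill 12 4 2 (.iflt (.bv 0) (.mul (.nv 3) (.par 13)) (.arr 12 (.bv 0) (.bv 1))
            (.arr 16 (.sub (.bv 0) (.mul (.nv 3) (.par 13))) (.bv 1))))
          (.seq (fill 13 4 3 (.iflt (.bv 0) (.mul (.nv 3) (.par 13)) (.arr 13 (.bv 0) (.bv 1))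
            (.arr 15 (.sub (.bv 0) (.mul (.nv 3) (.par 13))) (.bv 1))))
          (.incr 3)))))
        .skip)))
    .skip))

/-- Looking for a decomposition in which every slice is a combination of combinations of slices of rank
at most parameter `13`. -/
def lowRank : Cmd :=
  .seq (ident 23 1) (.seq (.nconst 3 0) (.seq (fill 17 19 1 (.elt (.const 0)))
    (.seq (.loop 8 15 (.seq record (inc 17 1))) check)))

section

variable {F : Type*} [Field F] {q : ℕ} {code : F ≃ Fin q} {π : ℕ → ℕ} {tin : ℕ → F}

@[simp] lemma combine_nvW : combine.nvW = [] := rfl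
@[simp] lemma combine_fvW : combine.fvW = [] := rfl
@[simp] lemma combine_arrW : combine.arrW = [0, 14] := rfl

/-- The combination of slices with given coefficients. -/
def comb (π : ℕ → ℕ) (tin : ℕ → F) (v : ℕ → F) (i j : ℕ) : F :=
  ∑ t ∈ Finset.range (π 1), v t * tin (t * π 8 + (i * π 3 + j))

lemma comb_congr {v v' : ℕ → F} (h : ∀ t < π 1, v t = v' t) : comb π tin v = comb π tin v' := by
  ext i j
  exact Finset.sum_congr rfl fun t ht => by rw [h t (Finset.mem_range.mp ht)]

lemma combine_spec (hl : Lay π) {ρ : ℕ → ℕ} {σ : HS F} (hg : Good π σ) {i j : ℕ} (hi : i < π 2)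
    (hj : j < π 3) :
    (combine.den code π tin ρ σ).arr 14 i j = comb π tin (σ.arr 17 0) i j := by
  have h1 := hl.b1
  rw [combine, den_fill hl.b2 hl.b3 (by decide) (by simp [FExpr.noArr]), if_pos ⟨hi, hj⟩]
  simp only [FExpr.eval, hg.zero, zero_add, comb]
  refine Finset.sum_congr rfl fun t ht => ?_
  have ht' := Finset.mem_range.mp ht
  have hle : t * π 8 + (i * π 3 + j) ≤ π 10 := by
    have := hl.e10
    have := hl.e8
    have h2 : i * π 3 + j < π 8 := by rw [hl.e8]; nlinarith
    nlinarith
  simp [Function.update_apply, min_eq_left (show t ≤ π 5 by omega), min_eq_left hle]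

/-- The flattened combination of slices. -/
lemma comb_flat (hl : Lay π) (v : ℕ → F) (l : Fin (π 8)) :
    comb π tin v (l / π 3) (l % π 3) = (∑ t ∈ Finset.range (π 1), v t • slice π tin t) l := by
  simp only [comb, Finset.sum_apply, Pi.smul_apply, slice, smul_eq_mul, Nat.div_add_mod']

lemma flat_eq (hl : Lay π) {v : ℕ → F} {r : ℕ} {u x : ℕ → ℕ → F} (h : ∀ i < π 2, ∀ j < π 3,
    comb π tin v i j = ∑ s ∈ Finset.range r, u s i * x s j) :
    ∑ t ∈ Finset.range (π 1), v t • slice π tin t =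
      ∑ s ∈ Finset.range r, outer (π 8) (π 3) (u s) (x s) := by
  ext l
  have hl' : (l : ℕ) < π 2 * π 3 := hl.e8 ▸ l.2
  rw [← comb_flat hl, h _ (div_lt_of_lt hl') _ (Nat.mod_lt _ hl.p3), Finset.sum_apply]
  rfl

/-- The situation during the search for combinations of small rank. -/
structure Recorded (code : F ≃ Fin q) (π : ℕ → ℕ) (tin : ℕ → F) (V : Submodule F (Fin (π 1) → F))
    (σ : HS F) : Prop where
  good : Good π σ
  r23 : rows (π 1) (π 1) (σ.arr 23) = ann V
  cnt : σ.nv 3 = Module.finrank F V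
  mem : ∀ v : ℕ → F, vec (π 1) v ∈ V → ∑ t ∈ Finset.range (π 1), v t • slice π tin t ∈
    Submodule.span F (term π σ '' {r | r < σ.nv 3 * π 13})

/-- Each recorded combination gets a block of `⌊R/n₀⌋` consecutive places of the list, filled from a
rank factorization. Places of a block beyond the rank, and places after the last block, may hold
anything: further terms only enlarge the span. -/
lemma record_spec (hl : Lay π) {V : Submodule F (Fin (π 1) → F)} {ρ : ℕ → ℕ} {σ τ : HS F}
    (h : Recorded code π tin V σ) (hτ : τ = record.den code π tin ρ σ) :
    ∃ V', V ≤ V' ∧ Recorded code π tin V' τ ∧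
      ((mat (π 2) (π 3) (comb π tin (σ.arr 17 0))).rank ≤ π 13 → vec (π 1) (σ.arr 17 0) ∈ V') := by
  have h1 := hl.b1
  have h2 := hl.b2
  have h3 := hl.b3
  have h4 := hl.b4
  have h19 := hl.e19
  rw [record, Cmd.den_seq, Cmd.den_seq] at hτ
  set v := σ.arr 17 0 with hv
  set σ1 := combine.den code π tin ρ σ with hσ1
  have g1 : Good π σ1 := h.good.den _ (by simp) (by simp) (by simp)
  have c1 : ∀ i < π 2, ∀ j < π 3, σ1.arr 14 i j = comb π tin v i j := fun i hi j hj =>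
    combine_spec hl h.good hi hj
  have hmat : mat (π 2) (π 3) (σ1.arr 14) = mat (π 2) (π 3) (comb π tin v) := mat_congr c1
  obtain ⟨hr, hC⟩ := colBasis_spec (code := code) (tin := tin) (ρ := ρ) g1 hl rfl
  set σ2 := colBasis.den code π tin ρ σ1 with hσ2
  have g2 : Good π σ2 := g1.den _ (by simp) (by simp) (by simp)
  rw [hmat] at hr hC
  set M := mat (π 2) (π 3) (comb π tin v) with hM
  have a2 : ∀ A, A ∉ [0, 1, 2, 3, 4, 5, 14] → σ2.arr A = σ.arr A := fun A hA => by
    simp only [List.mem_cons, List.not_mem_nil, or_false, not_or] at hA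
    rw [hσ2, Cmd.den_arr _ (by simp [hA]), hσ1, Cmd.den_arr _ (by simp [hA])]
  have a214 : σ2.arr 14 = σ1.arr 14 := Cmd.den_arr _ (by simp)
  have n2 : σ2.nv 3 = σ.nv 3 := by rw [hσ2, Cmd.den_nv _ (by simp), hσ1, Cmd.den_nv _ (by simp)]
  have same : ∀ τ : HS F, Good π τ → τ.arr 23 = σ.arr 23 → τ.arr 12 = σ.arr 12 →
      τ.arr 13 = σ.arr 13 → τ.nv 3 = σ.nv 3 → Recorded code π tin V τ := fun τ hg e23 e12 e13 e3 => by
    refine ⟨hg, by rw [e23, h.r23], by rw [e3, h.cnt], fun w hw => ?_⟩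
    have : term π τ = term π σ := by ext r; rw [term, term, e12, e13]
    rw [this, e3]
    exact h.mem w hw
  by_cases hrk : σ2.nv 2 < π 13 + 1
  swap
  · rw [Cmd.den_iflt_neg (by simpa [NExpr.eval] using hrk), Cmd.den_skip] at hτ
    rw [hτ]
    exact ⟨V, le_rfl, same σ2 g2 (a2 23 (by decide)) (a2 12 (by decide)) (a2 13 (by decide)) n2,
      fun hc => absurd hc (by omega)⟩
  rw [Cmd.den_iflt_pos (by simpa [NExpr.eval] using hrk), Cmd.den_seq, Cmd.den_seq] at hτ
  set σ3 := (fill 1 19 1 (.arr 17 (.const 0) (.bv 1))).den code π tin ρ σ2 with hσ3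
  have g3 : Good π σ3 := g2.den _ (by simp) (by simp) (by simp)
  have a3 : ∀ A, A ≠ 0 → A ≠ 1 → σ3.arr A = σ2.arr A := fun A h h' => Cmd.den_arr _ (by simp [h, h'])
  have hE : vec (π 1) (σ3.arr 1 0) = vec (π 1) v := by
    ext l
    have := l.2
    rw [vec, hσ3, den_fill (by omega) h1 (by decide) (by simp [FExpr.noArr]), if_pos ⟨by omega, l.2⟩]
    simp [FExpr.eval, min_eq_left (show (l : ℕ) ≤ π 5 by omega), a2 17 (by decide), hv, vec]
  have r3 : rows (π 1) (π 1) (σ3.arr 23) = ann V := by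
    rw [a3 23 (by decide) (by decide), a2 23 (by decide), h.r23]
  obtain ⟨r4, hf⟩ := addEq_ann (code := code) (tin := tin) (X := 23) (by decide) (ρ := ρ) g3
    h1 h1 r3 hE rfl
  set σ4 := (addEq 23 1 1).den code π tin ρ σ3 with hσ4
  have g4 : Good π σ4 := g3.den _ (by simp) (by simp) (by simp)
  have a4 : ∀ A, A ∉ [0, 1, 2, 3, 23] → σ4.arr A = σ2.arr A := fun A hA => by
    simp only [List.mem_cons, List.not_mem_nil, or_false, not_or] at hA
    exact (Cmd.den_arr _ (by simp [hA])).trans (a3 A hA.1 hA.2.1)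
  have n4 : ∀ x, x ∉ [0, 1] → σ4.nv x = σ2.nv x := fun x hx => by
    simp only [List.mem_cons, List.not_mem_nil, or_false, not_or] at hx
    rw [hσ4, Cmd.den_nv _ (by simp [hx]), Cmd.den_nv _ (by simp)]
  rcases hf with ⟨hf0, hmem⟩ | ⟨hf0, hmem, -⟩
  · rw [Cmd.den_iflt_neg (by simp [hf0, NExpr.eval]), Cmd.den_skip] at hτ
    refine ⟨V, le_rfl, ?_, fun _ => hmem⟩
    rw [sup_eq_left.mpr (by simpa [Submodule.span_le] using hmem)] at r4
    have e12 : σ4.arr 12 = σ.arr 12 := (a4 12 (by decide)).trans (a2 12 (by decide))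
    have e13 : σ4.arr 13 = σ.arr 13 := (a4 13 (by decide)).trans (a2 13 (by decide))
    have e3 : σ4.nv 3 = σ.nv 3 := (n4 3 (by decide)).trans n2
    have : term π σ4 = term π σ := by funext r; simp only [term, e12, e13]
    rw [hτ]
    exact ⟨g4, r4, e3.trans h.cnt, fun w hw => by rw [this, e3]; exact h.mem w hw⟩
  rw [Cmd.den_iflt_pos (by simp [hf0, NExpr.eval]), Cmd.den_seq, Cmd.den_seq, Cmd.den_seq,
    Cmd.den_seq] at hτ
  set V' := V ⊔ Submodule.span F {vec (π 1) v} with hV'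
  have hfr : Module.finrank F V' = Module.finrank F V + 1 :=
    Submodule.finrank_sup_span_singleton hmem
  -- The recorded vectors are independent and a further one is about to be added, so there are fewer
  -- than `n₀` of them, and the new block fits because `n₀ * ⌊R/n₀⌋ ≤ R`.
  have hlt : σ.nv 3 < π 1 := by
    have := Submodule.finrank_le V'
    rw [Module.finrank_fin_fun, hfr] at this
    rw [h.cnt]; omega
  have hoff : σ.nv 3 * π 13 + π 13 ≤ π 4 := by
    have := hl.e13
    nlinarith
  set σ5 := (fill 16 4 2 (.arr 5 (.bv 0) (.bv 1))).den code π tin ρ σ4 with hσ5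
  have g5 : Good π σ5 := g4.den _ (by simp) (by simp) (by simp)
  have a5 : ∀ A, A ≠ 0 → A ≠ 16 → σ5.arr A = σ4.arr A := fun A h h' => Cmd.den_arr _ (by simp [h, h'])
  have n5 : ∀ x, σ5.nv x = σ4.nv x := fun x => Cmd.den_nv _ (by simp)
  have hr4 : σ2.nv 2 ≤ π 4 := by omega
  have u5 : ∀ s < π 4, ∀ i < π 2, σ5.arr 16 s i = σ2.arr 5 s i := by
    intro s hs i hi
    rw [hσ5, den_fill h4 h2 (by decide) (by simp [FExpr.noArr]), if_pos ⟨hs, hi⟩]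
    simp [FExpr.eval, Function.update_apply, min_eq_left (show s ≤ π 5 by omega),
      min_eq_left (show i ≤ π 5 by omega), a4 5 (by decide)]
  have m5 : σ5.arr 14 = σ1.arr 14 := by
    rw [a5 14 (by decide) (by decide), a4 14 (by decide), a214]
  have n52 : σ5.nv 2 = σ2.nv 2 := (n5 2).trans (n4 2 (by decide))
  -- Expressing the columns in the basis of the column space gives a factorization with inner
  -- dimension equal to the rank; `dualize` finds its second factors up to scalars.
  obtain ⟨x, hx⟩ : ∃ x : ℕ → ℕ → F, ∀ i < π 2, ∀ j < π 3,
      σ1.arr 14 i j = ∑ s ∈ Finset.range (σ2.nv 2), σ2.arr 5 s i * x s j := by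
    have hcol : ∀ j : Fin (π 3), ∃ a : ℕ → F,
        M.col j = ∑ s ∈ Finset.range (σ2.nv 2), a s • vec (π 2) (σ2.arr 5 s) := fun j => by
      refine mem_rows ?_
      have : M.col j ∈ Submodule.span F (basisCol M '' {s | s < M.rank}) := by
        rw [span_basisCol]
        exact Submodule.subset_span ⟨j, rfl⟩
      rw [rows]
      convert this using 1
      rw [← hr]
      congr 1
      exact Set.image_congr fun s hs => hC s hs
    choose a ha using hcol
    refine ⟨fun s j => if hj : j < π 3 then a ⟨j, hj⟩ s else 0, fun i hi j hj => ?_⟩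
    rw [c1 i hi j hj]
    have := congrFun (ha ⟨j, hj⟩) ⟨i, hi⟩
    simp only [Finset.sum_apply, Pi.smul_apply, smul_eq_mul, vec] at this
    simp only [hj, dif_pos]
    rw [Finset.sum_congr rfl fun s _ => mul_comm _ _, ← this]
    rfl
  obtain ⟨c, hc⟩ := dualize_spec (code := code) (tin := tin) (ρ := ρ) g5 hl rfl
    (by rw [m5, hmat, n52, hr]) (by rw [n52]; exact hr4) x (fun i hi j hj => by
      rw [m5, n52, hx i hi j hj]
      refine Finset.sum_congr rfl fun s hs => ?_
      rw [u5 s (by have := Finset.mem_range.mp hs; omega) i hi])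
  set σ6 := dualize.den code π tin ρ σ5 with hσ6
  have g6 : Good π σ6 := g5.den _ (by simp) (by simp) (by simp)
  have a6 : ∀ A, A ∉ [0, 1, 2, 3, 7, 15] → σ6.arr A = σ5.arr A := fun A hA => by
    simp only [List.mem_cons, List.not_mem_nil, or_false, not_or] at hA
    exact Cmd.den_arr _ (by simp [hA])
  have n6 : σ6.nv 3 = σ.nv 3 := by
    rw [hσ6, Cmd.den_nv _ (by simp), n5, n4 3 (by decide), n2]
  set ex7 := FExpr.iflt (.bv 0) (.mul (.nv 3) (.par 13)) (.arr 12 (.bv 0) (.bv 1))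
            (.arr 16 (.sub (.bv 0) (.mul (.nv 3) (.par 13))) (.bv 1)) with hex7
  set σ7 := (fill 12 4 2 ex7).den code π tin ρ σ6 with hσ7
  have n7 : σ7.nv 3 = σ.nv 3 := by rw [hσ7, Cmd.den_nv _ (by simp), n6]
  have a7 : ∀ A, A ≠ 0 → A ≠ 12 → σ7.arr A = σ6.arr A :=
    fun A h h' => Cmd.den_arr _ (by simp [h, h'])
  set ex8 := FExpr.iflt (.bv 0) (.mul (.nv 3) (.par 13)) (.arr 13 (.bv 0) (.bv 1))
            (.arr 15 (.sub (.bv 0) (.mul (.nv 3) (.par 13))) (.bv 1)) with hex8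
  set σ8 := (fill 13 4 3 ex8).den code π tin ρ σ7 with hσ8
  have e8 : τ.arr = σ8.arr := by rw [hτ]; rfl
  have n8 : τ.nv 3 = σ.nv 3 + 1 := by
    rw [hτ]
    simp [Cmd.den, hσ8, Cmd.den_nv (fill 13 4 3 ex8) (show 3 ∉ [] by simp), n7]
  have g8 : Good π τ := by
    rw [hτ]
    exact ((g6.den _ (by simp) (by simp) (by simp)).den _ (by simp) (by simp)
      (by simp)).den _ (by simp [Cmd.fvW]) (by simp [Cmd.fvW]) (by simp [Cmd.fvW])
  set off := σ.nv 3 * π 13 with hoffdef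
  have k12 : ∀ r < π 4, ∀ j < π 2, τ.arr 12 r j =
      if r < off then σ.arr 12 r j else σ2.arr 5 (r - off) j := by
    intro r hr j hj
    rw [e8, hσ8, Cmd.den_arr _ (by simp), hσ7, den_fill h4 h2 (by decide)
      (by simp [hex7, FExpr.noArr]), if_pos ⟨hr, hj⟩]
    simp only [hex7, FExpr.eval, NExpr.eval, Function.update_self, n6, ← hoffdef,
      Function.update_of_ne (show (0 : ℕ) ≠ 1 by decide), min_eq_left (show r ≤ π 5 by omega),
      min_eq_left (show j ≤ π 5 by omega), min_eq_left (show r - off ≤ π 5 by omega)]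
    rw [a6 12 (by decide), a5 12 (by decide) (by decide), a4 12 (by decide), a2 12 (by decide),
      a6 16 (by decide), u5 _ (by omega) j hj]
  have k13 : ∀ r < π 4, ∀ j < π 3, τ.arr 13 r j =
      if r < off then σ.arr 13 r j else σ6.arr 15 (r - off) j := by
    intro r hr j hj
    rw [e8, hσ8, den_fill h4 h3 (by decide) (by simp [hex8, FExpr.noArr]), if_pos ⟨hr, hj⟩]
    simp only [hex8, FExpr.eval, NExpr.eval, Function.update_self, n7, ← hoffdef,
      Function.update_of_ne (show (0 : ℕ) ≠ 1 by decide), min_eq_left (show r ≤ π 5 by omega),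
      min_eq_left (show j ≤ π 5 by omega), min_eq_left (show r - off ≤ π 5 by omega)]
    rw [a7 13 (by decide) (by decide), a7 15 (by decide) (by decide), a6 13 (by decide), a5 13 (by decide) (by decide), a4 13 (by decide), a2 13 (by decide)]
  have t1 : ∀ r < off, term π τ r = term π σ r := fun r hr =>
    outer_congr hl (fun j hj => by rw [k12 r (by omega) j hj, if_pos hr])
      (fun j hj => by rw [k13 r (by omega) j hj, if_pos hr])
  have t2 : ∀ s < σ2.nv 2, term π τ (off + s) =
      c s • outer (π 8) (π 3) (σ2.arr 5 s) (x s) := fun s hs => by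
    have : term π τ (off + s) = outer (π 8) (π 3) (σ2.arr 5 s) (fun j => c s * x s j) :=
      outer_congr hl (fun j hj => by
          rw [k12 (off + s) (by omega) j hj, if_neg (by omega), Nat.add_sub_cancel_left])
        (fun j hj => by rw [k13 (off + s) (by omega) j hj, if_neg (by omega),
          Nat.add_sub_cancel_left, (hc s (by omega)).2 j hj])
    rw [this]
    ext l
    simp only [outer, Pi.smul_apply, smul_eq_mul]
    ring
  have hmono : Submodule.span F (term π σ '' {r | r < off}) ≤
      Submodule.span F (term π τ '' {r | r < τ.nv 3 * π 13}) := by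
    rw [Submodule.span_le]
    rintro _ ⟨r, hr, rfl⟩
    refine Submodule.subset_span ⟨r, ?_, t1 r hr⟩
    rw [Set.mem_ofPred_eq] at hr ⊢
    rw [n8, Nat.succ_mul]
    omega
  refine ⟨V', le_sup_left, ⟨g8, ?_, by rw [n8, hfr, h.cnt], fun w hw => ?_⟩, fun _ =>
    Submodule.mem_sup_right (Submodule.mem_span_singleton_self _)⟩
  · rw [e8, hσ8, Cmd.den_arr _ (by simp), hσ7, Cmd.den_arr _ (by simp), a6 23 (by decide),
      a5 23 (by decide) (by decide), r4]
  · obtain ⟨w1, hw1, w2, hw2, hw12⟩ := Submodule.mem_sup.mp hw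
    obtain ⟨κ, rfl⟩ := Submodule.mem_span_singleton.mp hw2
    have hv' : ∑ t ∈ Finset.range (π 1), v t • slice π tin t ∈
        Submodule.span F (term π τ '' {r | r < τ.nv 3 * π 13}) := by
      rw [flat_eq hl (fun i hi j hj => by rw [← c1 i hi j hj]; exact hx i hi j hj)]
      refine Submodule.sum_mem _ fun s hs => ?_
      have hs' := Finset.mem_range.mp hs
      have hcs := (hc s (by omega)).1
      rw [← inv_smul_smul₀ hcs (outer (π 8) (π 3) (σ2.arr 5 s) (x s)), ← t2 s hs']
      refine Submodule.smul_mem _ _ (Submodule.subset_span ⟨off + s, ?_, rfl⟩)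
      rw [Set.mem_ofPred_eq, n8, Nat.succ_mul]
      omega
    have hdecomp : ∑ t ∈ Finset.range (π 1), w t • slice π tin t =
        ∑ t ∈ Finset.range (π 1), (w t - κ * v t) • slice π tin t +
          κ • ∑ t ∈ Finset.range (π 1), v t • slice π tin t := by
      rw [Finset.smul_sum, ← Finset.sum_add_distrib]
      refine Finset.sum_congr rfl fun t _ => ?_
      rw [smul_smul, ← add_smul, sub_add_cancel]
    rw [hdecomp]
    refine Submodule.add_mem _ (hmono (h.mem (fun t => w t - κ * v t) ?_))
      (Submodule.smul_mem _ _ hv')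
    have : vec (π 1) (fun t => w t - κ * v t) = w1 := by
      have h1 : w1 = vec (π 1) w - κ • vec (π 1) v := eq_sub_of_add_eq hw12
      rw [h1]; rfl
    rwa [this]

@[simp] lemma record_nvW : record.nvW = [2, 0, 1, 0, 2, 0, 1, 0, 0, 1, 0, 0, 1, 0, 3] := rfl
@[simp] lemma record_fvW : record.fvW = [] := rfl
@[simp] lemma record_arrW : record.arrW =
    [0, 14, 0, 4, 0, 1, 0, 2, 0, 3, 0, 4, 0, 5, 0, 1, 0, 2, 0, 3, 0, 23, 0, 16,
      0, 7, 0, 1, 0, 2, 0, 3, 0, 7, 0, 1, 0, 2, 0, 3, 0, 7, 0, 15, 0, 12, 0, 13] := rfl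
@[simp] lemma lowRank_fvW : lowRank.fvW = [] := rfl

/-- After all coefficient vectors, the recorded space contains every one of small rank. If these
span everything, its dimension is `n₀`, and the unit vectors show that each slice is in the span of
the first `n₀ * ⌊R/n₀⌋ ≤ R` terms. -/
lemma lowRank_spec (hπ : ParOK q π) (hl : Lay π) {ρ : ℕ → ℕ} {σ τ : HS F} (hg : Good π σ)
    (hs : Sound π tin σ) (hτ : τ = lowRank.den code π tin ρ σ) :
    Sound π tin τ ∧ (Submodule.span F {v : Fin (π 1) → F | ∃ w : ℕ → F, v = vec (π 1) w ∧
      (mat (π 2) (π 3) (comb π tin w)).rank ≤ π 13} = ⊤ → τ.nv 6 = 1) := by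
  have h1 := hl.b1
  have h19 := hl.e19
  rw [lowRank, Cmd.den_seq, Cmd.den_seq, Cmd.den_seq, Cmd.den_seq] at hτ
  have r1 := ident_spec (code := code) (tin := tin) (X := 23) (c := 1) (by decide) (ρ := ρ) hg h1
  set σ1 := (ident 23 1).den code π tin ρ σ with hσ1
  have g1 : Good π σ1 := hg.den _ (by simp) (by simp) (by simp)
  have s1 : Sound π tin σ1 := hs.den _ (by simp) (by simp) (by simp) (by simp)
  set σ2 := (Cmd.nconst 3 0).den code π tin ρ σ1 with hσ2
  have g2 : Good π σ2 := g1.den _ (by simp [Cmd.fvW]) (by simp [Cmd.fvW]) (by simp [Cmd.fvW])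
  have s2 : Sound π tin σ2 := s1.den _ (by simp [Cmd.nvW]) (by simp [Cmd.arrW])
    (by simp [Cmd.arrW]) (by simp [Cmd.arrW])
  set σ3 := (fill 17 19 1 (.elt (.const 0))).den code π tin ρ σ2 with hσ3
  have g3 : Good π σ3 := g2.den _ (by simp) (by simp) (by simp)
  have s3 : Sound π tin σ3 := s2.den _ (by simp) (by simp) (by simp) (by simp)
  have d3 : Digits code (π 1) 0 (σ3.arr 17) := Digits.zero fun j hj => by
    rw [hσ3, den_fill (by omega) h1 (by decide) (by simp [FExpr.noArr]), if_pos ⟨by omega, hj⟩]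
    simp [FExpr.eval]
  have n3 : σ3.nv 3 = 0 := by
    rw [hσ3, Cmd.den_nv _ (by simp), hσ2]; simp [Cmd.den]
  have R3 : Recorded code π tin ⊥ σ3 := by
    refine ⟨g3, ?_, by rw [n3, finrank_bot], fun v hv => ?_⟩
    · rw [hσ3, Cmd.den_arr _ (by simp)]; exact r1
    · have hv0 : ∀ t < π 1, v t = 0 := fun t ht => congrFun ((Submodule.mem_bot F).mp hv) ⟨t, ht⟩
      rw [Finset.sum_eq_zero fun t ht => by rw [hv0 t (Finset.mem_range.mp ht), zero_smul]]
      exact Submodule.zero_mem _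
  set cl := Cmd.loop 8 15 (.seq record (inc 17 1)) with hcl
  have main : ∃ V, Recorded code π tin V (cl.den code π tin ρ σ3) ∧
      Digits code (π 1) (π 15) ((cl.den code π tin ρ σ3).arr 17) ∧
      ∀ z < π 15, ∀ w : ℕ → F, (∀ j < π 1, w j = elem code (z / q ^ j % q)) →
        (mat (π 2) (π 3) (comb π tin w)).rank ≤ π 13 → vec (π 1) w ∈ V := by
    refine Cmd.den_loop_inv (fun k τ => ∃ V, Recorded code π tin V τ ∧
      Digits code (π 1) k (τ.arr 17) ∧
      ∀ z < k, ∀ w : ℕ → F, (∀ j < π 1, w j = elem code (z / q ^ j % q)) →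
        (mat (π 2) (π 3) (comb π tin w)).rank ≤ π 13 → vec (π 1) w ∈ V)
      ⟨⊥, R3, d3, by simp⟩ fun k hk τ ⟨V, hR, hd, hall⟩ => ?_
    rw [Cmd.den_seq]
    obtain ⟨V', hVV, hR', hv⟩ := record_spec hl (ρ := Function.update ρ 8 k) hR rfl
    set τ1 := record.den code π tin (Function.update ρ 8 k) τ with hτ1
    have hd1 : Digits code (π 1) k (τ1.arr 17) := by
      rw [hτ1, Cmd.den_arr _ (by simp)]; exact hd
    refine ⟨V', ⟨hR'.good.den _ (by simp) (by simp) (by simp), ?_, ?_, fun v hv => ?_⟩,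
      inc_spec (tin := tin) h1 hd1, fun z hz w hw hrk => ?_⟩
    · rw [Cmd.den_arr _ (by simp)]; exact hR'.r23
    · rw [Cmd.den_nv _ (by simp)]; exact hR'.cnt
    · have : term π ((inc 17 1).den code π tin (Function.update ρ 8 k) τ1) = term π τ1 := by
        have e12 := Cmd.den_arr (code := code) (π := π) (tin := tin)
          (ρ := Function.update ρ 8 k) (σ := τ1) (inc 17 1) (x := 12) (by simp)
        have e13 := Cmd.den_arr (code := code) (π := π) (tin := tin)
          (ρ := Function.update ρ 8 k) (σ := τ1) (inc 17 1) (x := 13) (by simp)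
        funext r
        simp only [term, e12, e13]
      rw [this, Cmd.den_nv _ (by simp)]
      exact hR'.mem v hv
    · rcases Nat.lt_succ_iff_lt_or_eq.mp hz with hz | rfl
      · exact hVV (hall z hz w hw hrk)
      · have e : ∀ j < π 1, w j = τ.arr 17 0 j := fun j hj => by rw [hw j hj, hd j hj]
        rw [comb_congr e] at hrk
        have e2 : vec (π 1) w = vec (π 1) (τ.arr 17 0) := funext fun j => e j j.2
        rw [e2]
        exact hv hrk
  set σ4 := cl.den code π tin ρ σ3 with hσ4
  have s4 : Sound π tin σ4 := s3.den _ (by simp [hcl, Cmd.nvW]) (by simp [hcl, Cmd.arrW])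
    (by simp [hcl, Cmd.arrW]) (by simp [hcl, Cmd.arrW])
  obtain ⟨V, hR, -, hall⟩ := main
  obtain ⟨c1, -, c3⟩ := check_spec hπ hl hR.good s4 hτ
  refine ⟨c1, fun htop => c3 fun i hi => ?_⟩
  have hV : V = ⊤ := by
    rw [eq_top_iff, ← htop, Submodule.span_le]
    rintro _ ⟨w, rfl, hw⟩
    obtain ⟨z, hz, hd⟩ := exists_digits (code := code) (π 1) w
    exact hall z (by rw [hl.e15, hπ.card]; exact hz) w (fun j hj => (hd j hj).symm) hw
  have := hR.mem (fun t => if t = i then 1 else 0) (by rw [hV]; exact Submodule.mem_top)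
  simp only [ite_smul, one_smul, zero_smul] at this
  rw [Finset.sum_ite_eq' (Finset.range (π 1)) i, if_pos (Finset.mem_range.mpr hi)] at this
  refine Submodule.span_mono ?_ this
  rintro _ ⟨r, hr, rfl⟩
  refine ⟨r, ?_, rfl⟩
  rw [Set.mem_ofPred_eq, hR.cnt, hV, finrank_top, Module.finrank_fin_fun] at hr
  exact lt_of_lt_of_le hr hl.e13

end

end TensorCPD

namespace TensorCPD

/-! ### A combination of slices of large rank -/

/-- Reading off rank-one matrices from row `0` of array `17`, given that the combination of slices in
array `14` has rank equal to variable `2`: outer products of the rows of arrays `12` and `13`, and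
outer products of the rows of arrays `16` and `15`. The latter are guessed in such a way that
they add up to the difference of the combination and the sum of the first `k` of the former, where
`k` is the loop variable `9`. -/
def guess : Cmd :=
  .seq (fill 12 4 2 (.arr 17 (.const 0)
    (.add (.par 1) (.add (.mul (.bv 0) (.add (.par 2) (.par 3))) (.bv 1)))))
  (.seq (fill 13 4 3 (.arr 17 (.const 0)
    (.add (.par 1) (.add (.mul (.bv 0) (.add (.par 2) (.par 3))) (.add (.par 2) (.bv 1))))))
  (.seq (fill 14 2 3 (.add (.arr 14 (.bv 0) (.bv 1)) (.mul (.fv 2) (.sum 2 4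
    (.iflt (.bv 2) (.bv 9) (.mul (.arr 12 (.bv 2) (.bv 0)) (.arr 13 (.bv 2) (.bv 1))) (.fv 0))))))
  (.seq colBasis (.seq
    (fill 16 4 2 (.sum 2 4 (.iflt (.bv 2) (.nv 2) (.mul
      (.arr 17 (.const 0) (.add (.par 1) (.add
        (.mul (.sub (.par 21) (.nv 2)) (.add (.par 2) (.par 3)))
        (.add (.mul (.bv 0) (.nv 2)) (.bv 2)))))
      (.arr 5 (.bv 2) (.bv 1))) (.fv 0))))
    dualize))))

/-- Writing the guessed rank-one matrices into the list. -/
def arrange : Cmd :=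
  .seq (fill 12 4 2 (.iflt (.bv 0) (.sub (.par 21) (.nv 2)) (.arr 12 (.bv 0) (.bv 1))
    (.iflt (.bv 0) (.par 21) (.arr 16 (.sub (.bv 0) (.sub (.par 21) (.nv 2))) (.bv 1)) (.fv 0))))
  (.seq (fill 13 4 3 (.iflt (.bv 0) (.sub (.par 21) (.nv 2)) (.arr 13 (.bv 0) (.bv 1))
    (.iflt (.bv 0) (.par 21) (.arr 15 (.sub (.bv 0) (.sub (.par 21) (.nv 2))) (.bv 1)) (.fv 0))))
  (.seq (.nconst 4 0) (.loop 6 21 (.incr 4))))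

/-- Looking for a decomposition that conforms to row `0` of array `17`. -/
def attempt : Cmd :=
  .seq combine (.seq colBasis (.iflt (.par 13) (.nv 2) (.iflt (.nv 2) (.add (.par 21) (.const 1))
    (.seq guess (.seq arrange complete)) .skip) .skip))

section

variable {F : Type*} [Field F] {q : ℕ} {code : F ≃ Fin q} {π : ℕ → ℕ} {tin : ℕ → F}

@[simp] lemma guess_nvW : guess.nvW = [2, 0, 1, 0, 2, 0, 1, 0, 0, 1, 0] := rfl
@[simp] lemma guess_fvW : guess.fvW = [] := rfl
@[simp] lemma guess_arrW : guess.arrW = [0, 12, 0, 13, 0, 14, 0, 4, 0, 1, 0, 2, 0, 3, 0, 4, 0, 5,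
    0, 16, 0, 7, 0, 1, 0, 2, 0, 3, 0, 7, 0, 1, 0, 2, 0, 3, 0, 7, 0, 15] := rfl
@[simp] lemma arrange_nvW : arrange.nvW = [4, 4] := rfl
@[simp] lemma arrange_fvW : arrange.fvW = [] := rfl
@[simp] lemma arrange_arrW : arrange.arrW = [0, 12, 0, 13] := rfl
@[simp] lemma complete_fvW : complete.fvW = [] := rfl

/-- What is left of a combination of slices after subtracting outer products. -/
def resid (π : ℕ → ℕ) (tin : ℕ → F) (zz : ℕ) (v : ℕ → F) (u w : ℕ → ℕ → F) (i j : ℕ) : F :=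
  comb π tin v i j - ∑ t ∈ Finset.range zz, u t i * w t j

/-- The sequence `d` describes a combination of slices together with rank-one matrices that
generate the slices as required by `complete`. -/
structure Certificate (π : ℕ → ℕ) (tin : ℕ → F) (d : ℕ → F) (zz r : ℕ) (v : ℕ → F)
    (u w p x G : ℕ → ℕ → F) : Prop where
  -- The guessed elements in order: the `n₀` coefficients, the `π 21 - r` pairs of factors of length
  -- `n₁ + n₂`, and the square matrix `G` of size `r`, row by row. The number `zz` is not among
  -- them; it is the value of a separate loop.
  dv : ∀ t < π 1, d t = v t
  du : ∀ t < π 21 - r, ∀ j < π 2, d (π 1 + (t * (π 2 + π 3) + j)) = u t j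
  dw : ∀ t < π 21 - r, ∀ j < π 3, d (π 1 + (t * (π 2 + π 3) + (π 2 + j))) = w t j
  dG : ∀ t < r, ∀ s < r, d (π 1 + ((π 21 - r) * (π 2 + π 3) + (t * r + s))) = G t s
  size : π 1 + ((π 21 - r) * (π 2 + π 3) + r * r) ≤ π 14
  le : zz + r ≤ π 21
  low : π 13 < r
  rank_comb : (mat (π 2) (π 3) (comb π tin v)).rank = r
  rank_resid : (mat (π 2) (π 3) (resid π tin zz v u w)).rank = r
  eq : ∀ i < π 2, ∀ j < π 3, resid π tin zz v u w i j = ∑ s ∈ Finset.range r, p s i * x s j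
  basis : ∀ t < r, vec (π 2) (p t) =
    ∑ s ∈ Finset.range r, G t s • basisCol (mat (π 2) (π 3) (resid π tin zz v u w)) s
  gen : ∀ L : Submodule F (Fin (π 8) → F), (∀ t < π 21 - r, outer (π 8) (π 3) (u t) (w t) ∈ L) →
    (∀ s < r, outer (π 8) (π 3) (p s) (x s) ∈ L) → ∀ i < π 1, slice π tin i ∈ L ⊔ Submodule.span F
      {m | (∃ a b, m = outer (π 8) (π 3) a b) ∧ m ∈ L ⊔ sliceSpan π tin}

/-- The residual matrix has rank `r` by the certificate, so `colBasis` yields the basis to which `G`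
refers. Hence array `16` receives the first factors `p`, and `dualize` recovers the second ones up
to nonzero scalars. -/
lemma guess_spec (hl : Lay π) {ρ : ℕ → ℕ} {σ τ : HS F} (hg : Good π σ) {r : ℕ} {v : ℕ → F}
    {u w p x G : ℕ → ℕ → F} (h : Certificate π tin (σ.arr 17 0) (ρ 9) r v u w p x G)
    (h14 : ∀ i < π 2, ∀ j < π 3, σ.arr 14 i j = comb π tin v i j)
    (hτ : τ = guess.den code π tin ρ σ) :
    τ.nv 2 = r ∧ (∀ t < π 21 - r, ∀ j < π 2, τ.arr 12 t j = u t j) ∧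
      (∀ t < π 21 - r, ∀ j < π 3, τ.arr 13 t j = w t j) ∧
      ∃ c : ℕ → F, ∀ t < r, c t ≠ 0 ∧ (∀ j < π 2, τ.arr 16 t j = p t j) ∧
        ∀ j < π 3, τ.arr 15 t j = c t * x t j := by
  have h1 := hl.b1
  have h2 := hl.b2
  have h3 := hl.b3
  have h4 := hl.b4
  have hb14 := hl.b14
  have h21 := hl.e21
  have hp1 := hl.p1
  have hsz := h.size
  have hle := h.le
  rw [guess, Cmd.den_seq, Cmd.den_seq, Cmd.den_seq, Cmd.den_seq, Cmd.den_seq] at hτ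
  set ex1 := FExpr.arr 17 (.const 0)
    (.add (.par 1) (.add (.mul (.bv 0) (.add (.par 2) (.par 3))) (.bv 1))) with hex1
  set σ1 := (fill 12 4 2 ex1).den code π tin ρ σ with hσ1
  have g1 : Good π σ1 := hg.den _ (by simp) (by simp) (by simp)
  have a1 : ∀ A, A ≠ 0 → A ≠ 12 → σ1.arr A = σ.arr A := fun A h h' => Cmd.den_arr _ (by simp [h, h'])
  have idx : ∀ t < π 21 - r, ∀ j < π 2 + π 3, π 1 + (t * (π 2 + π 3) + j) ≤ π 5 := by
    intro t ht j hj
    have : (t + 1) * (π 2 + π 3) ≤ (π 21 - r) * (π 2 + π 3) := Nat.mul_le_mul_right _ ht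
    rw [Nat.succ_mul] at this
    omega
  have u1 : ∀ t < π 21 - r, ∀ j < π 2, σ1.arr 12 t j = u t j := by
    intro t ht j hj
    rw [hσ1, den_fill h4 h2 (by decide) (by simp [hex1, FExpr.noArr]), if_pos ⟨by omega, hj⟩,
      ← h.du t ht j hj]
    simp only [hex1, FExpr.eval, NExpr.eval, Function.update_self, Nat.zero_min,
      Function.update_of_ne (show (0 : ℕ) ≠ 1 by decide), min_eq_left (idx t ht j (by omega))]
  set ex2 := FExpr.arr 17 (.const 0)
    (.add (.par 1) (.add (.mul (.bv 0) (.add (.par 2) (.par 3))) (.add (.par 2) (.bv 1)))) with hex2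
  set σ2 := (fill 13 4 3 ex2).den code π tin ρ σ1 with hσ2
  have g2 : Good π σ2 := g1.den _ (by simp) (by simp) (by simp)
  have a2 : ∀ A, A ≠ 0 → A ≠ 13 → σ2.arr A = σ1.arr A := fun A h h' => Cmd.den_arr _ (by simp [h, h'])
  have w2 : ∀ t < π 21 - r, ∀ j < π 3, σ2.arr 13 t j = w t j := by
    intro t ht j hj
    rw [hσ2, den_fill h4 h3 (by decide) (by simp [hex2, FExpr.noArr]), if_pos ⟨by omega, hj⟩,
      ← h.dw t ht j hj]
    simp only [hex2, FExpr.eval, NExpr.eval, Function.update_self, Nat.zero_min,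
      Function.update_of_ne (show (0 : ℕ) ≠ 1 by decide),
      min_eq_left (idx t ht (π 2 + j) (by omega))]
    rw [a1 17 (by decide) (by decide)]
  set ex3 := FExpr.add (.arr 14 (.bv 0) (.bv 1)) (.mul (.fv 2) (.sum 2 4
    (.iflt (.bv 2) (.bv 9) (.mul (.arr 12 (.bv 2) (.bv 0)) (.arr 13 (.bv 2) (.bv 1))) (.fv 0))))
    with hex3
  set σ3 := (fill 14 2 3 ex3).den code π tin ρ σ2 with hσ3
  have g3 : Good π σ3 := g2.den _ (by simp) (by simp) (by simp)
  have a3 : ∀ A, A ≠ 0 → A ≠ 14 → σ3.arr A = σ2.arr A := fun A h h' => Cmd.den_arr _ (by simp [h, h'])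
  have c3 : ∀ i < π 2, ∀ j < π 3, σ3.arr 14 i j = resid π tin (ρ 9) v u w i j := by
    intro i hi j hj
    rw [hσ3, den_fill h2 h3 (by decide) (by simp [hex3, FExpr.noArr]), if_pos ⟨hi, hj⟩]
    have hsum : ∀ t ∈ Finset.range (π 4), (FExpr.iflt (.bv 2) (.bv 9)
        (.mul (.arr 12 (.bv 2) (.bv 0)) (.arr 13 (.bv 2) (.bv 1))) (.fv 0)).eval code π tin
        (Function.update (Function.update (Function.update ρ 0 i) 1 j) 2 t) σ2 =
        if t < ρ 9 then u t i * w t j else 0 := by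
      intro t ht
      have ht' := Finset.mem_range.mp ht
      simp only [FExpr.eval, NExpr.eval, Function.update_apply, g2.zero]
      norm_num
      rw [min_eq_left (show t ≤ π 5 by omega), min_eq_left (show i ≤ π 5 by omega),
        min_eq_left (show j ≤ π 5 by omega)]
      by_cases htz : t < ρ 9
      · rw [if_pos htz, if_pos htz, a2 12 (by decide) (by decide), u1 t (by omega) i hi,
          w2 t (by omega) j hj]
      · rw [if_neg htz, if_neg htz]
    rw [hex3]
    have e1 : ∀ (a b : FExpr) (ρ : ℕ → ℕ) (σ : HS F), (FExpr.add a b).eval code π tin ρ σ =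
      a.eval code π tin ρ σ + b.eval code π tin ρ σ := fun _ _ _ _ => rfl
    have e2 : ∀ (a b : FExpr) (ρ : ℕ → ℕ) (σ : HS F), (FExpr.mul a b).eval code π tin ρ σ =
      a.eval code π tin ρ σ * b.eval code π tin ρ σ := fun _ _ _ _ => rfl
    have e3 : ∀ (x p : ℕ) (a : FExpr) (ρ : ℕ → ℕ) (σ : HS F), (FExpr.sum x p a).eval code π tin ρ σ =
      σ.fv 0 + ∑ k ∈ Finset.range (π p), a.eval code π tin (Function.update ρ x k) σ :=
      fun _ _ _ _ _ => rfl
    rw [e1, e2, e3, Finset.sum_congr rfl hsum, ← Finset.sum_filter]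
    have : (Finset.range (π 4)).filter (· < ρ 9) = Finset.range (ρ 9) := by
      ext t; simp only [Finset.mem_filter, Finset.mem_range]; omega
    rw [this]
    simp only [FExpr.eval, NExpr.eval, g2.zero, g2.neg, Function.update_self,
      Function.update_of_ne (show (0 : ℕ) ≠ 1 by decide), min_eq_left (show i ≤ π 5 by omega),
      min_eq_left (show j ≤ π 5 by omega), a2 14 (by decide) (by decide),
      a1 14 (by decide) (by decide), h14 i hi j hj, resid]
    ring
  have hmat : mat (π 2) (π 3) (σ3.arr 14) = mat (π 2) (π 3) (resid π tin (ρ 9) v u w) := mat_congr c3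
  obtain ⟨hr, hC⟩ := colBasis_spec (code := code) (tin := tin) (ρ := ρ) g3 hl rfl
  set σ4 := colBasis.den code π tin ρ σ3 with hσ4
  have g4 : Good π σ4 := g3.den _ (by simp) (by simp) (by simp)
  rw [hmat, h.rank_resid] at hr
  rw [hmat] at hC
  have a4 : ∀ A, A ∉ [0, 1, 2, 3, 4, 5] → σ4.arr A = σ3.arr A := fun A hA => by
    simp only [List.mem_cons, List.not_mem_nil, or_false, not_or] at hA
    exact Cmd.den_arr _ (by simp [hA])
  set ex5 := FExpr.sum 2 4 (.iflt (.bv 2) (.nv 2) (.mul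
      (.arr 17 (.const 0) (.add (.par 1) (.add
        (.mul (.sub (.par 21) (.nv 2)) (.add (.par 2) (.par 3)))
        (.add (.mul (.bv 0) (.nv 2)) (.bv 2)))))
      (.arr 5 (.bv 2) (.bv 1))) (.fv 0)) with hex5
  set σ5 := (fill 16 4 2 ex5).den code π tin ρ σ4 with hσ5
  have g5 : Good π σ5 := g4.den _ (by simp) (by simp) (by simp)
  have a5 : ∀ A, A ≠ 0 → A ≠ 16 → σ5.arr A = σ4.arr A := fun A h h' => Cmd.den_arr _ (by simp [h, h'])
  have n5 : σ5.nv 2 = r := (Cmd.den_nv _ (by simp)).trans hr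
  have p5 : ∀ t < r, ∀ i < π 2, σ5.arr 16 t i = p t i := by
    intro t ht i hi
    rw [hσ5, den_fill h4 h2 (by decide) (by simp [hex5, FExpr.noArr]), if_pos ⟨by omega, hi⟩]
    have hsum : ∀ s ∈ Finset.range (π 4), (FExpr.iflt (.bv 2) (.nv 2) (.mul
        (.arr 17 (.const 0) (.add (.par 1) (.add
          (.mul (.sub (.par 21) (.nv 2)) (.add (.par 2) (.par 3)))
          (.add (.mul (.bv 0) (.nv 2)) (.bv 2)))))
        (.arr 5 (.bv 2) (.bv 1))) (.fv 0)).eval code π tin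
        (Function.update (Function.update (Function.update ρ 0 t) 1 i) 2 s) σ4 =
        if s < r then G t s * basisCol (mat (π 2) (π 3) (resid π tin (ρ 9) v u w)) s ⟨i, hi⟩
          else 0 := by
      intro s hs
      have hs' := Finset.mem_range.mp hs
      simp only [FExpr.eval, NExpr.eval, Function.update_apply, g4.zero, hr, Nat.zero_min]
      norm_num
      by_cases hsr : s < r
      · have hts : t * r + s < r * r := by nlinarith
        rw [if_pos hsr, if_pos hsr, ← hC s (by rw [hr]; exact hsr), ← h.dG t ht s hsr,
          min_eq_left (by omega), min_eq_left (by omega), min_eq_left (by omega), vec,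
          a4 17 (by decide), a3 17 (by decide) (by decide), a2 17 (by decide) (by decide),
          a1 17 (by decide) (by decide)]
      · rw [if_neg hsr, if_neg hsr]
    have e3 : ∀ (x p : ℕ) (a : FExpr) (ρ : ℕ → ℕ) (σ : HS F), (FExpr.sum x p a).eval code π tin ρ σ =
      σ.fv 0 + ∑ k ∈ Finset.range (π p), a.eval code π tin (Function.update ρ x k) σ :=
      fun _ _ _ _ _ => rfl
    rw [hex5, e3, Finset.sum_congr rfl hsum, ← Finset.sum_filter, g4.zero, zero_add]
    have : (Finset.range (π 4)).filter (· < r) = Finset.range r := by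
      ext t; simp only [Finset.mem_filter, Finset.mem_range]; omega
    rw [this]
    have := congrFun (h.basis t ht) ⟨i, hi⟩
    simp only [Finset.sum_apply, Pi.smul_apply, smul_eq_mul, vec] at this
    exact this.symm
  have m5 : σ5.arr 14 = σ3.arr 14 := by rw [a5 14 (by decide) (by decide), a4 14 (by decide)]
  obtain ⟨c, hc⟩ := dualize_spec (code := code) (tin := tin) (ρ := ρ) g5 hl rfl
    (by rw [m5, hmat, n5, h.rank_resid]) (by rw [n5]; omega) x (fun i hi j hj => by
      rw [m5, n5, c3 i hi j hj, h.eq i hi j hj]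
      refine Finset.sum_congr rfl fun s hs => ?_
      rw [p5 s (Finset.mem_range.mp hs) i hi])
  rw [← hτ] at hc
  have a6 : ∀ A, A ∉ [0, 1, 2, 3, 7, 15] → τ.arr A = σ5.arr A := fun A hA => by
    simp only [List.mem_cons, List.not_mem_nil, or_false, not_or] at hA
    rw [hτ]
    exact Cmd.den_arr _ (by simp [hA])
  rw [n5] at hc
  refine ⟨by rw [hτ, Cmd.den_nv _ (by simp), n5], fun t ht j hj => ?_, fun t ht j hj => ?_, c,
    fun t ht => ⟨(hc t ht).1, fun j hj => ?_, (hc t ht).2⟩⟩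
  · rw [a6 12 (by decide), a5 12 (by decide) (by decide), a4 12 (by decide),
      a3 12 (by decide) (by decide), a2 12 (by decide) (by decide), u1 t ht j hj]
  · rw [a6 13 (by decide), a5 13 (by decide) (by decide), a4 13 (by decide),
      a3 13 (by decide) (by decide), w2 t ht j hj]
  · rw [a6 16 (by decide), p5 t ht j hj]

/-- The list becomes the `π 21 - r` guessed terms, the `r` computed ones, and zeros in the places
that `complete` may fill. Variable `4` is set to `π 21` by counting, as commands cannot assign a
parameter to a variable. -/
lemma arrange_spec (hl : Lay π) {ρ : ℕ → ℕ} {σ τ : HS F} (hg : Good π σ) {r : ℕ}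
    {u w p x : ℕ → ℕ → F} {c : ℕ → F} (hr : r ≤ π 21) (h2 : σ.nv 2 = r)
    (hu : ∀ t < π 21 - r, ∀ j < π 2, σ.arr 12 t j = u t j)
    (hw : ∀ t < π 21 - r, ∀ j < π 3, σ.arr 13 t j = w t j)
    (hp : ∀ t < r, ∀ j < π 2, σ.arr 16 t j = p t j)
    (hx : ∀ t < r, ∀ j < π 3, σ.arr 15 t j = c t * x t j)
    (hτ : τ = arrange.den code π tin ρ σ) :
    τ.nv 4 = π 21 ∧ (∀ t < π 21 - r, term π τ t = outer (π 8) (π 3) (u t) (w t)) ∧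
      (∀ s < r, term π τ (π 21 - r + s) = c s • outer (π 8) (π 3) (p s) (x s)) ∧
      ∀ t < π 4, π 21 ≤ t → term π τ t = 0 := by
  have b2 := hl.b2
  have b3 := hl.b3
  have b4 := hl.b4
  have h21 := hl.e21
  have hp1 := hl.p1
  rw [arrange, Cmd.den_seq, Cmd.den_seq, Cmd.den_seq] at hτ
  set ex1 := FExpr.iflt (.bv 0) (.sub (.par 21) (.nv 2)) (.arr 12 (.bv 0) (.bv 1))
    (.iflt (.bv 0) (.par 21) (.arr 16 (.sub (.bv 0) (.sub (.par 21) (.nv 2))) (.bv 1)) (.fv 0))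
    with hex1
  set σ1 := (fill 12 4 2 ex1).den code π tin ρ σ with hσ1
  have g1 : Good π σ1 := hg.den _ (by simp) (by simp) (by simp)
  have a1 : ∀ A, A ≠ 0 → A ≠ 12 → σ1.arr A = σ.arr A := fun A h h' => Cmd.den_arr _ (by simp [h, h'])
  have n1 : σ1.nv 2 = r := (Cmd.den_nv _ (by simp)).trans h2
  set ex2 := FExpr.iflt (.bv 0) (.sub (.par 21) (.nv 2)) (.arr 13 (.bv 0) (.bv 1))
    (.iflt (.bv 0) (.par 21) (.arr 15 (.sub (.bv 0) (.sub (.par 21) (.nv 2))) (.bv 1)) (.fv 0))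
    with hex2
  set σ2 := (fill 13 4 3 ex2).den code π tin ρ σ1 with hσ2
  set σ3 := (Cmd.nconst 4 0).den code π tin ρ σ2 with hσ3
  have t12 : τ.arr 12 = σ1.arr 12 := by
    rw [hτ, Cmd.den_arr _ (by simp [Cmd.arrW]), hσ3, Cmd.den_arr _ (by simp [Cmd.arrW]), hσ2,
      Cmd.den_arr _ (by simp)]
  have t13 : τ.arr 13 = σ2.arr 13 := by
    rw [hτ, Cmd.den_arr _ (by simp [Cmd.arrW]), hσ3, Cmd.den_arr _ (by simp [Cmd.arrW])]
  have t4 : τ.nv 4 = π 21 := by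
    rw [hτ]
    refine Cmd.den_loop_inv (fun k τ => τ.nv 4 = k) (by rw [hσ3]; simp [Cmd.den]) fun i _ τ h => ?_
    simp [Cmd.den, h]
  have k12 : ∀ t < π 4, ∀ j < π 2, τ.arr 12 t j = if t < π 21 - r then u t j else
      if t < π 21 then p (t - (π 21 - r)) j else 0 := by
    intro t ht j hj
    rw [t12, hσ1, den_fill b4 b2 (by decide) (by simp [hex1, FExpr.noArr]), if_pos ⟨ht, hj⟩]
    simp only [hex1, FExpr.eval, NExpr.eval, Function.update_self, h2, hg.zero,
      Function.update_of_ne (show (0 : ℕ) ≠ 1 by decide), min_eq_left (show t ≤ π 5 by omega),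
      min_eq_left (show j ≤ π 5 by omega), min_eq_left (show t - (π 21 - r) ≤ π 5 by omega)]
    split_ifs with i1 i2
    · exact hu t i1 j hj
    · exact hp _ (by omega) j hj
    · rfl
  have k13 : ∀ t < π 4, ∀ j < π 3, τ.arr 13 t j = if t < π 21 - r then w t j else
      if t < π 21 then c (t - (π 21 - r)) * x (t - (π 21 - r)) j else 0 := by
    intro t ht j hj
    rw [t13, hσ2, den_fill b4 b3 (by decide) (by simp [hex2, FExpr.noArr]), if_pos ⟨ht, hj⟩]
    simp only [hex2, FExpr.eval, NExpr.eval, Function.update_self, n1, g1.zero,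
      Function.update_of_ne (show (0 : ℕ) ≠ 1 by decide), min_eq_left (show t ≤ π 5 by omega),
      min_eq_left (show j ≤ π 5 by omega), min_eq_left (show t - (π 21 - r) ≤ π 5 by omega),
      a1 13 (by decide) (by decide), a1 15 (by decide) (by decide)]
    split_ifs with i1 i2
    · exact hw t i1 j hj
    · exact hx _ (by omega) j hj
    · rfl
  refine ⟨t4, fun t ht => ?_, fun s hs => ?_, fun t ht ht' => ?_⟩
  · exact outer_congr hl (fun j hj => by rw [k12 t (by omega) j hj, if_pos ht])
      (fun j hj => by rw [k13 t (by omega) j hj, if_pos ht])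
  · have : term π τ (π 21 - r + s) = outer (π 8) (π 3) (p s) (fun j => c s * x s j) :=
      outer_congr hl (fun j hj => by
          rw [k12 _ (by omega) j hj, if_neg (by omega), if_pos (by omega), Nat.add_sub_cancel_left])
        (fun j hj => by
          rw [k13 _ (by omega) j hj, if_neg (by omega), if_pos (by omega), Nat.add_sub_cancel_left])
    rw [this]
    ext l
    simp only [outer, Pi.smul_apply, smul_eq_mul]
    ring
  · have : term π τ t = outer (π 8) (π 3) (fun _ => 0) (fun _ => 0) :=
      outer_congr hl (fun j hj => by
          rw [k12 _ ht j hj, if_neg (by omega), if_neg (by omega)])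
        (fun j hj => by
          rw [k13 _ ht j hj, if_neg (by omega), if_neg (by omega)])
    rw [this]
    ext l
    simp [outer]

/-- With a certificate the combination of slices lies in the span `L` of the list. It is nontrivial,
so the slices add at most `n₀ - 1` dimensions to `L`, just the number of places left free by `R + 1
- n₀` terms. This is the room that `complete_spec` asks for. -/
lemma attempt_spec (hπ : ParOK q π) (hl : Lay π) {ρ : ℕ → ℕ} {σ τ : HS F} (hg : Good π σ)
    (hs : Sound π tin σ) (hτ : τ = attempt.den code π tin ρ σ) :
    Sound π tin τ ∧ (σ.nv 6 = 1 → τ.nv 6 = 1) ∧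
      ((∃ r v u w p x G, Certificate π tin (σ.arr 17 0) (ρ 9) r v u w p x G) → τ.nv 6 = 1) := by
  have h21 := hl.e21
  have hp1 := hl.p1
  rw [attempt, Cmd.den_seq, Cmd.den_seq] at hτ
  set σ1 := combine.den code π tin ρ σ with hσ1
  have g1 : Good π σ1 := hg.den _ (by simp) (by simp) (by simp)
  have s1 : Sound π tin σ1 := hs.den _ (by simp) (by simp) (by simp) (by simp)
  have c1 : ∀ i < π 2, ∀ j < π 3, σ1.arr 14 i j = comb π tin (σ.arr 17 0) i j := fun i hi j hj =>
    combine_spec hl hg hi hj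
  obtain ⟨hr, -⟩ := colBasis_spec (code := code) (tin := tin) (ρ := ρ) g1 hl rfl
  set σ2 := colBasis.den code π tin ρ σ1 with hσ2
  have g2 : Good π σ2 := g1.den _ (by simp) (by simp) (by simp)
  have s2 : Sound π tin σ2 := s1.den _ (by simp) (by simp) (by simp) (by simp)
  have n2 : σ2.nv 6 = σ.nv 6 := by rw [hσ2, Cmd.den_nv _ (by simp), hσ1, Cmd.den_nv _ (by simp)]
  rw [mat_congr c1] at hr
  have key : ∀ {r v u w p x G}, Certificate π tin (σ.arr 17 0) (ρ 9) r v u w p x G → σ2.nv 2 = r := by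
    intro r v u w p x G h
    rw [hr, comb_congr h.dv, h.rank_comb]
  by_cases hlt1 : π 13 < σ2.nv 2
  swap
  · rw [Cmd.den_iflt_neg (by simpa [NExpr.eval] using hlt1), Cmd.den_skip] at hτ
    rw [hτ]
    refine ⟨s2, fun h => n2.trans h, ?_⟩
    rintro ⟨r, v, u, w, p, x, G, h⟩
    have := h.low
    rw [← key h] at this
    exact absurd this hlt1
  rw [Cmd.den_iflt_pos (by simpa [NExpr.eval] using hlt1)] at hτ
  by_cases hlt2 : σ2.nv 2 < π 21 + 1
  swap
  · rw [Cmd.den_iflt_neg (by simpa [NExpr.eval] using hlt2), Cmd.den_skip] at hτ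
    rw [hτ]
    refine ⟨s2, fun h => n2.trans h, ?_⟩
    rintro ⟨r, v, u, w, p, x, G, h⟩
    have := h.le
    rw [← key h] at this
    omega
  rw [Cmd.den_iflt_pos (by simpa [NExpr.eval] using hlt2), Cmd.den_seq, Cmd.den_seq] at hτ
  set σ3 := guess.den code π tin ρ σ2 with hσ3
  have g3 : Good π σ3 := g2.den _ (by simp) (by simp) (by simp)
  have s3 : Sound π tin σ3 := s2.den _ (by simp) (by simp) (by simp) (by simp)
  have n3 : σ3.nv 6 = σ2.nv 6 := Cmd.den_nv _ (by simp)
  set σ4 := arrange.den code π tin ρ σ3 with hσ4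
  have g4 : Good π σ4 := g3.den _ (by simp) (by simp) (by simp)
  have s4 : Sound π tin σ4 := s3.den _ (by simp) (by simp) (by simp) (by simp)
  have n4 : σ4.nv 6 = σ3.nv 6 := Cmd.den_nv _ (by simp)
  obtain ⟨e1, e2, e3⟩ := complete_spec hπ hl g4 s4 hτ
  refine ⟨e1, fun h => e2 (by rw [n4, n3, n2, h]), ?_⟩
  rintro ⟨r, v, u, w, p, x, G, h⟩
  have a17 : σ2.arr 17 = σ.arr 17 := by
    rw [hσ2, Cmd.den_arr _ (by simp), hσ1, Cmd.den_arr _ (by simp)]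
  have a14 : σ2.arr 14 = σ1.arr 14 := Cmd.den_arr _ (by simp)
  have hle := h.le
  have hlow := h.low
  obtain ⟨f1, f2, f3, c, hc⟩ := guess_spec hl g2 (a17 ▸ h) (fun i hi j hj => by
    rw [a14, c1 i hi j hj, comb_congr h.dv]) hσ3
  obtain ⟨k1, k2, k3, k4⟩ := arrange_spec hl g3 (by omega) f1 f2 f3 (fun t ht => (hc t ht).2.1)
    (fun t ht => (hc t ht).2.2) hσ4
  have m1 : ∀ t < π 21 - r, outer (π 8) (π 3) (u t) (w t) ∈ listSpan π σ4 := fun t ht => by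
    rw [← k2 t ht]
    exact Submodule.subset_span ⟨t, by rw [Set.mem_ofPred_eq]; omega, rfl⟩
  have m2 : ∀ s < r, outer (π 8) (π 3) (p s) (x s) ∈ listSpan π σ4 := fun s hs => by
    have : outer (π 8) (π 3) (p s) (x s) = (c s)⁻¹ • term π σ4 (π 21 - r + s) := by
      rw [k3 s hs, inv_smul_smul₀ (hc s hs).1]
    rw [this]
    exact Submodule.smul_mem _ _ (Submodule.subset_span ⟨_, by rw [Set.mem_ofPred_eq]; omega, rfl⟩)
  refine e3 (fun t ht ht' => k4 t ht (k1 ▸ ht')) (by omega) ?_ (h.gen _ m1 m2)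
  have hcomb : ∑ t ∈ Finset.range (π 1), v t • slice π tin t =
      ∑ t ∈ Finset.range (ρ 9), outer (π 8) (π 3) (u t) (w t) +
        ∑ s ∈ Finset.range r, outer (π 8) (π 3) (p s) (x s) := by
    ext l
    have hl' : (l : ℕ) < π 2 * π 3 := hl.e8 ▸ l.2
    have := h.eq _ (div_lt_of_lt hl') _ (Nat.mod_lt l hl.p3)
    rw [resid, sub_eq_iff_eq_add] at this
    rw [← comb_flat hl, this, Pi.add_apply, Finset.sum_apply, Finset.sum_apply, add_comm]
    rfl
  have hmem : ∑ i : Fin (π 1), v i • slice π tin i ∈ listSpan π σ4 := by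
    rw [← Finset.sum_range fun t => v t • slice π tin t, hcomb]
    exact Submodule.add_mem _
      (Submodule.sum_mem _ fun t ht => m1 t (by have := Finset.mem_range.mp ht; omega))
      (Submodule.sum_mem _ fun s hs => m2 s (Finset.mem_range.mp hs))
  -- The zero vector would give the zero matrix, whereas the rank `r` exceeds `π 13`.
  have hv : (fun i : Fin (π 1) => v i) ≠ 0 := by
    intro h0
    have : mat (π 2) (π 3) (comb π tin v) = 0 := by
      ext i j
      rw [mat_apply, comb]
      refine Finset.sum_eq_zero fun t ht => ?_
      have : v t = 0 := congrFun h0 ⟨t, Finset.mem_range.mp ht⟩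
      rw [this, zero_mul]
    have h' := h.rank_comb
    rw [this, Matrix.rank_zero] at h'
    omega
  have := finrank_sup_span_lt (listSpan π σ4) (fun i : Fin (π 1) => slice π tin i) _ hv hmem
  have hS : sliceSpan π tin = Submodule.span F (Set.range fun i : Fin (π 1) => slice π tin i) := by
    rw [sliceSpan]
    congr 1
    ext m
    constructor
    · rintro ⟨i, hi, rfl⟩; exact ⟨⟨i, hi⟩, rfl⟩
    · rintro ⟨i, rfl⟩; exact ⟨i, i.2, rfl⟩
  rw [k1, hS]
  omega

end

end TensorCPD

namespace TensorCPD

/-! ### Existence of certificates -/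

section

variable {F : Type*} [Field F] {q : ℕ} {code : F ≃ Fin q} {π : ℕ → ℕ} {tin : ℕ → F}

open Matrix

/-- Extending a vector by zeros to a sequence. -/
def ext0 {n : ℕ} (f : Fin n → F) (i : ℕ) : F := if h : i < n then f ⟨i, h⟩ else 0

@[simp] lemma ext0_val {n : ℕ} (f : Fin n → F) (i : Fin n) : ext0 f i = f i := by simp [ext0]

lemma vec_ext0 {n : ℕ} (f : Fin n → F) : vec n (ext0 f) = f := funext fun i => ext0_val f i

/-- Flattening of matrices. -/
def flatten (hl : Lay π) : Matrix (Fin (π 2)) (Fin (π 3)) F →ₗ[F] (Fin (π 8) → F) where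
  toFun m l := m ⟨l / π 3, div_lt_of_lt (hl.e8 ▸ l.2)⟩ ⟨l % π 3, Nat.mod_lt _ hl.p3⟩
  map_add' _ _ := rfl
  map_smul' _ _ := rfl

lemma flatten_vecMulVec (hl : Lay π) (a : Fin (π 2) → F) (b : Fin (π 3) → F) :
    flatten hl (vecMulVec a b) = outer (π 8) (π 3) (ext0 a) (ext0 b) := by
  ext l
  have h1 : (l : ℕ) / π 3 < π 2 := div_lt_of_lt (hl.e8 ▸ l.2)
  have h2 : (l : ℕ) % π 3 < π 3 := Nat.mod_lt _ hl.p3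
  simp only [outer, ext0, h1, h2, dif_pos]
  rfl

/-- A slice of the tensor as a matrix. -/
def sliceMat (π : ℕ → ℕ) (tin : ℕ → F) (i : ℕ) : Matrix (Fin (π 2)) (Fin (π 3)) F :=
  mat (π 2) (π 3) fun j k => tin (i * π 8 + (j * π 3 + k))

lemma flatten_sliceMat (hl : Lay π) (i : ℕ) : flatten hl (sliceMat π tin i) = slice π tin i := by
  ext l
  rw [slice, ← Nat.div_add_mod' l (π 3)]
  rfl

lemma mat_comb (v : ℕ → F) : mat (π 2) (π 3) (comb π tin v) =
    ∑ i : Fin (π 1), v i • sliceMat π tin i := by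
  ext j k
  rw [mat_apply, comb, Finset.sum_range, Matrix.sum_apply]
  rfl

lemma Certificate.congr {d d' : ℕ → F} {zz r : ℕ} {v : ℕ → F} {u w p x G : ℕ → ℕ → F} (hl : Lay π)
    (h : Certificate π tin d zz r v u w p x G) (hd : ∀ j < π 14, d' j = d j) :
    Certificate π tin d' zz r v u w p x G := by
  have hsz := h.size
  have idx : ∀ t < π 21 - r, ∀ j < π 2 + π 3, π 1 + (t * (π 2 + π 3) + j) < π 14 := by
    intro t ht j hj
    have : (t + 1) * (π 2 + π 3) ≤ (π 21 - r) * (π 2 + π 3) := Nat.mul_le_mul_right _ ht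
    rw [Nat.succ_mul] at this
    omega
  exact { h with
    dv := fun t ht => by rw [hd _ (lt_of_lt_of_le ht hl.n14), h.dv t ht]
    du := fun t ht j hj => by rw [hd _ (idx t ht j (by omega)), h.du t ht j hj]
    dw := fun t ht j hj => by rw [hd _ (idx t ht _ (by omega)), h.dw t ht j hj]
    dG := fun t ht s hs => by
      have : t * r + s < r * r := by nlinarith
      rw [hd _ (by omega), h.dG t ht s hs] }

/-- The sequence that lists given data as expected in a certificate. -/
def layout (π : ℕ → ℕ) (r : ℕ) (v : ℕ → F) (u w G : ℕ → ℕ → F) (i : ℕ) : F :=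
  if i < π 1 then v i else if i - π 1 < (π 21 - r) * (π 2 + π 3) then
    (if (i - π 1) % (π 2 + π 3) < π 2 then
      u ((i - π 1) / (π 2 + π 3)) ((i - π 1) % (π 2 + π 3))
    else w ((i - π 1) / (π 2 + π 3)) ((i - π 1) % (π 2 + π 3) - π 2))
  else G ((i - π 1 - (π 21 - r) * (π 2 + π 3)) / r) ((i - π 1 - (π 21 - r) * (π 2 + π 3)) % r)

lemma layout_mid {r t j : ℕ} (v : ℕ → F) (u w G : ℕ → ℕ → F) (ht : t < π 21 - r)
    (hj : j < π 2 + π 3) : layout π r v u w G (π 1 + (t * (π 2 + π 3) + j)) =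
      if j < π 2 then u t j else w t (j - π 2) := by
  have hlt : t * (π 2 + π 3) + j < (π 21 - r) * (π 2 + π 3) := by
    have : (t + 1) * (π 2 + π 3) ≤ (π 21 - r) * (π 2 + π 3) := Nat.mul_le_mul_right _ ht
    rw [Nat.succ_mul] at this
    omega
  rw [layout, if_neg (by omega), Nat.add_sub_cancel_left, if_pos hlt, Nat.mul_add_mod',
    Nat.mod_eq_of_lt hj, Nat.add_comm (t * _), Nat.add_mul_div_right _ _ (by omega),
    Nat.div_eq_of_lt hj, zero_add]

lemma layout_last {r t s : ℕ} (v : ℕ → F) (u w G : ℕ → ℕ → F) (hs : s < r) :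
    layout π r v u w G (π 1 + ((π 21 - r) * (π 2 + π 3) + (t * r + s))) = G t s := by
  rw [layout, if_neg (by omega), Nat.add_sub_cancel_left, if_neg (by omega),
    Nat.add_sub_cancel_left, Nat.mul_add_mod', Nat.mod_eq_of_lt hs, Nat.add_comm (t * _),
    Nat.add_mul_div_right _ _ (by omega), Nat.div_eq_of_lt hs, zero_add]

/-- The column space lies in the span of the `r` first factors and has dimension `r`, so the two
coincide. -/
lemma mem_span_cols_of_rank {m n r : ℕ} {M : Matrix (Fin m) (Fin n) F} {p : ℕ → Fin m → F}
    {x : ℕ → Fin n → F} (h : M = ∑ s ∈ Finset.range r, vecMulVec (p s) (x s)) (hr : M.rank = r)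
    {t : ℕ} (ht : t < r) : p t ∈ Submodule.span F (Set.range M.col) := by
  classical
  set T : Submodule F (Fin m → F) := Submodule.span F ((Finset.range r).image p : Set (Fin m → F))
    with hT
  have hle : Submodule.span F (Set.range M.col) ≤ T := by
    rw [Submodule.span_le]
    rintro _ ⟨j, rfl⟩
    have : M.col j = ∑ s ∈ Finset.range r, x s j • p s := by
      ext i
      rw [Matrix.col_apply, h, Matrix.sum_apply, Finset.sum_apply]
      exact Finset.sum_congr rfl fun s _ => by
        rw [vecMulVec_apply, Pi.smul_apply, smul_eq_mul, mul_comm]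
    rw [this]
    exact Submodule.sum_mem _ fun s hs => Submodule.smul_mem _ _ (Submodule.subset_span
      (Finset.mem_coe.mpr (Finset.mem_image_of_mem _ hs)))
  have heq : Submodule.span F (Set.range M.col) = T := by
    refine Submodule.eq_of_le_of_finrank_le hle ?_
    rw [← Matrix.rank_eq_finrank_span_cols, hr]
    exact (finrank_span_finset_le_card _).trans (Finset.card_image_le.trans (by simp))
  rw [heq]
  exact Submodule.subset_span (Finset.mem_coe.mpr (Finset.mem_image_of_mem _ (Finset.mem_range.mpr ht)))

/-- The tensor has a decomposition with parameter `4` terms. -/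
def HasSol (π : ℕ → ℕ) (tin : ℕ → F) : Prop :=
  ∃ A B C : ℕ → ℕ → F, ∀ i < π 1, ∀ j < π 2, ∀ k < π 3, tin (i * π 8 + (j * π 3 + k)) =
    ∑ r ∈ Finset.range (π 4), A i r * (B j r * C k r)

lemma mem_sup_span_of {V : Type*} [AddCommGroup V] [Module F V] {L L' : Submodule F V}
    {A A' : Set V} (h : L ≤ L') (h' : A ⊆ A') {x : V} (hx : x ∈ L ⊔ Submodule.span F A) :
    x ∈ L' ⊔ Submodule.span F A' := by
  have hle := sup_le_sup h (Submodule.span_mono (R := F) h')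
  exact hle hx

/-- Translates `exists_structured_combination` into guessed elements. The rank `r` is at most `n₁`
and `n₂`, as `hsize` requires for the elements to fit. -/
theorem exists_certificate (hl : Lay π)
    (hS : LinearIndependent F fun i : Fin (π 1) => sliceMat π tin i)
    (hsize : ∀ r, π 13 < r → r ≤ π 2 → r ≤ π 3 → r ≤ π 21 →
      π 1 + ((π 21 - r) * (π 2 + π 3) + r * r) ≤ π 14)
    (hsol : HasSol π tin) (htop : Submodule.span F {v : Fin (π 1) → F | ∃ w : ℕ → F, v = vec (π 1) w ∧
      (mat (π 2) (π 3) (comb π tin w)).rank ≤ π 13} ≠ ⊤) :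
    ∃ d zz r v u w p x G, zz < π 18 ∧ Certificate π tin d zz r v u w p x G := by
  obtain ⟨A, B, C, hABC⟩ := hsol
  have h21 := hl.e21
  have h18 := hl.e18
  obtain ⟨v, r, zz, u, w, p, x, h1, h2, h3, h4, h5, h6⟩ := exists_structured_combination
    (ρ := π 13) (R := π 4) (fun i : Fin (π 1) => sliceMat π tin i) hS (fun i r => A i r)
    (fun r j => B j r) (fun r k => C k r) (fun i => by
      ext j k
      rw [sliceMat, mat_apply, hABC i i.2 j j.2 k k.2, Finset.sum_range, Matrix.sum_apply]
      rfl) (fun h => htop (by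
        rw [eq_top_iff, ← h]
        refine Submodule.span_mono fun v hv => ⟨ext0 v, (vec_ext0 v).symm, ?_⟩
        rw [mat_comb]
        simpa using hv))
  have hp1 := hl.p1
  have hcomb : mat (π 2) (π 3) (comb π tin (ext0 v)) = ∑ i : Fin (π 1), v i • sliceMat π tin i := by
    rw [mat_comb]; simp
  set U : ℕ → ℕ → F := fun t => ext0 (u t) with hU
  set W : ℕ → ℕ → F := fun t => ext0 (w t) with hW
  have hres : mat (π 2) (π 3) (resid π tin zz (ext0 v) U W) =
      ∑ s ∈ Finset.range r, vecMulVec (p s) (x s) := by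
    rw [← add_right_inj (∑ t ∈ Finset.range zz, vecMulVec (u t) (w t)), ← h4, ← hcomb]
    ext i j
    rw [Matrix.add_apply, mat_apply, resid, mat_apply, Matrix.sum_apply]
    simp [hU, hW, vecMulVec_apply]
  set Mr := mat (π 2) (π 3) (resid π tin zz (ext0 v) U W) with hMr
  have hrank : Mr.rank = r := by rw [hres, h5]
  -- The first factors lie in the column space of the residual, so they are combinations of its
  -- greedy basis; the coefficients form `G`.
  have hG : ∀ t, ∃ g : ℕ → F, t < r → p t = ∑ s ∈ Finset.range r, g s • basisCol Mr s := by
    intro t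
    by_cases ht : t < r
    · have hm := mem_span_cols_of_rank hres hrank ht
      rw [← span_basisCol, hrank] at hm
      have hm' : p t ∈ rows r (π 2) fun s => ext0 (basisCol Mr s) := by
        rw [rows]; simp only [vec_ext0]; exact hm
      obtain ⟨g, hg⟩ := mem_rows hm'
      exact ⟨g, fun _ => by simpa only [vec_ext0] using hg⟩
    · exact ⟨fun _ => 0, fun h => absurd h ht⟩
  choose G hG using hG
  have hr2 : r ≤ π 2 := h1 ▸ (rank_le_height _)
  have hr3 : r ≤ π 3 := h1 ▸ (rank_le_width _)
  refine ⟨layout π r (ext0 v) U W G, zz, r, ext0 v, U, W, fun s => ext0 (p s), fun s => ext0 (x s), G,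
    by omega, fun t ht => if_pos ht, fun t ht j hj => ?_, fun t ht j hj => ?_, fun t ht s hs => ?_,
    hsize r h2 hr2 hr3 (by omega), by omega, h2, by rw [hcomb, h1], hrank, fun i hi j hj => ?_,
    fun t ht => ?_, fun L hL1 hL2 i hi => ?_⟩
  · rw [layout_mid _ _ _ _ ht (by omega), if_pos hj]
  · rw [layout_mid _ _ _ _ ht (by omega), if_neg (by omega), Nat.add_sub_cancel_left]
  · exact layout_last _ _ _ _ hs
  · have := congrFun (congrFun hres ⟨i, hi⟩) ⟨j, hj⟩
    rw [hMr, mat_apply, Matrix.sum_apply] at this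
    rw [this]
    refine Finset.sum_congr rfl fun s _ => ?_
    simp [vecMulVec_apply, ext0, hi, hj]
  · rw [vec_ext0]; exact hG t ht
  -- The structural result speaks of matrices, the program of flattened ones. It is applied to the
  -- preimage of `L` under flattening and then mapped forward.
  · have key := h6 (L.comap (flatten hl)) (fun t ht => by
      rw [Submodule.mem_comap, flatten_vecMulVec]
      exact hL1 t (by omega)) (fun s hs => by
      rw [Submodule.mem_comap, flatten_vecMulVec]
      exact hL2 s hs) ⟨i, hi⟩
    have key2 := Submodule.mem_map_of_mem (f := flatten hl) key
    rw [flatten_sliceMat, Submodule.map_sup, Submodule.map_span] at key2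
    refine mem_sup_span_of (Submodule.map_comap_le _ _) ?_ key2
    rintro _ ⟨m, ⟨⟨a, b, rfl⟩, hm⟩, rfl⟩
    refine ⟨⟨_, _, flatten_vecMulVec hl a b⟩, ?_⟩
    have hm2 := Submodule.mem_map_of_mem (f := flatten hl) hm
    rw [Submodule.map_sup, Submodule.map_span] at hm2
    refine mem_sup_span_of (Submodule.map_comap_le _ _) ?_ hm2
    rintro _ ⟨_, ⟨i, rfl⟩, rfl⟩
    exact ⟨i, i.2, (flatten_sliceMat hl i).symm⟩

end

end TensorCPD

namespace TensorCPD

/-! ### The whole search -/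

/-- Setting variables `0`, `1`, `2` to the field elements `0`, `1`, `-1`. -/
def consts : Cmd :=
  .seq (.loop 6 0 (.ifeq (.add (.elt (.bv 6)) (.elt (.bv 6))) (.elt (.bv 6))
    (.fset 0 (.elt (.bv 6))) .skip))
  (.seq (.loop 6 0 (.ifeq (.mul (.elt (.bv 6)) (.elt (.bv 6))) (.elt (.bv 6))
    (.ifeq (.elt (.bv 6)) (.fv 0) .skip (.fset 1 (.elt (.bv 6)))) .skip))
  (.loop 6 0 (.ifeq (.add (.elt (.bv 6)) (.fv 1)) (.fv 0) (.fset 2 (.elt (.bv 6))) .skip)))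

/-- Trying all values of row `0` of array `17`. -/
def search : Cmd :=
  .seq (fill 17 19 14 (.elt (.const 0)))
    (.loop 8 16 (.seq (.loop 9 18 attempt) (inc 17 14)))

/-- Writing the array `A`, with parameter `p` rows and parameter `4` columns, into row `0` of array
`22`, from position `o` on. -/
def flatOut (A p : ℕ) (o : NExpr) : Cmd :=
  .loop 6 p (.loop 7 4 (.store 22 (.const 0)
    (.add o (.add (.mul (.bv 6) (.par 4)) (.bv 7))) (.arr A (.bv 6) (.bv 7))))

/-- Preparing the output in row `0` of array `22`. -/
def output : Cmd :=
  .seq (.store 22 (.const 0) (.const 0) (.iflt (.const 0) (.nv 6) (.elt (.const 1)) (.elt (.const 0))))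
  (.seq (flatOut 19 1 (.const 1))
  (.seq (flatOut 20 2 (.add (.const 1) (.mul (.par 1) (.par 4))))
    (flatOut 21 3 (.add (.const 1) (.mul (.add (.par 1) (.par 2)) (.par 4))))))

/-- The algorithm, except for the input and the output. -/
def mainCmd : Cmd := .seq consts (.seq lowRank (.seq search output))

section

variable {F : Type*} [Field F] {q : ℕ} {code : F ≃ Fin q} {π : ℕ → ℕ} {tin : ℕ → F}

/-- When all elements are scanned, variable `y` gets the value `x` at the code of `x` and keeps it
afterwards, no matter what it held before. -/
lemma den_scan {y : ℕ} {c : Cmd} {ρ : ℕ → ℕ} {σ : HS F} (hπ : ParOK q π) (x : F)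
    (h : ∀ i < q, ∀ τ : HS F, (∀ z, z ≠ y → τ.fv z = σ.fv z) →
      (elem code i = x → (c.den code π tin (Function.update ρ 6 i) τ).fv y = x) ∧
      (elem code i ≠ x → (c.den code π tin (Function.update ρ 6 i) τ).fv y = τ.fv y) ∧
      ∀ z, z ≠ y → (c.den code π tin (Function.update ρ 6 i) τ).fv z = τ.fv z) :
    ((Cmd.loop 6 0 c).den code π tin ρ σ).fv y = x ∧
      ∀ z, z ≠ y → ((Cmd.loop 6 0 c).den code π tin ρ σ).fv z = σ.fv z := by
  have main := Cmd.den_loop_inv (code := code) (π := π) (tin := tin) (x := 6) (p := 0) (c := c)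
    (ρ := ρ) (σ := σ) (fun k τ => ((code x : ℕ) < k → τ.fv y = x) ∧ ∀ z, z ≠ y → τ.fv z = σ.fv z)
    ⟨fun h => absurd h (Nat.not_lt_zero _), fun _ _ => rfl⟩ fun i hi τ ⟨h1, h2⟩ => by
      rw [hπ.card] at hi
      obtain ⟨k1, k2, k3⟩ := h i hi τ h2
      refine ⟨fun hlt => ?_, fun z hz => (k3 z hz).trans (h2 z hz)⟩
      by_cases hx : elem code i = x
      · exact k1 hx
      · rw [k2 hx]
        refine h1 (lt_of_le_of_ne (Nat.lt_succ_iff.mp hlt) fun he => hx ?_)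
        rw [← he, elem_code]
  rw [hπ.card] at main
  exact ⟨main.1 (code x).2, main.2⟩

@[simp] lemma consts_nvW : consts.nvW = [] := rfl
@[simp] lemma consts_arrW : consts.arrW = [] := rfl

/-- The operation tables determine the constants: `0` is the only solution of `x + x = x`, `1` the
only other solution of `x * x = x`, and `-1` the solution of `x + 1 = 0`. -/
lemma consts_spec (hπ : ParOK q π) (hl : Lay π) {ρ : ℕ → ℕ} {σ : HS F} :
    Good π (consts.den code π tin ρ σ) := by
  classical
  have he : ∀ i < q, ∀ (ρ : ℕ → ℕ) (τ : HS F), (FExpr.elt (.bv 6)).eval code π tin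
      (Function.update ρ 6 i) τ = elem code i := by
    intro i hi ρ τ
    simp only [FExpr.eval, NExpr.eval, Function.update_self]
    rw [min_eq_left (by rw [hπ.last]; omega)]
  rw [consts, Cmd.den_seq, Cmd.den_seq]
  set c1 := Cmd.loop 6 0 (.ifeq (.add (.elt (.bv 6)) (.elt (.bv 6))) (.elt (.bv 6))
    (.fset 0 (.elt (.bv 6))) .skip) with hc1
  obtain ⟨a1, -⟩ : (c1.den code π tin ρ σ).fv 0 = 0 ∧ _ := den_scan hπ (0 : F) fun i hi τ _ => by
    have hiff : (FExpr.add (.elt (.bv 6)) (.elt (.bv 6))).eval code π tin (Function.update ρ 6 i) τ =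
        (FExpr.elt (.bv 6)).eval code π tin (Function.update ρ 6 i) τ ↔ elem code i = 0 := by
      change (FExpr.elt (.bv 6)).eval code π tin (Function.update ρ 6 i) τ + (FExpr.elt (.bv 6)).eval code π tin (Function.update ρ 6 i) τ = _ ↔ _
      rw [he i hi, add_eq_left]
    refine ⟨fun hx => ?_, fun hx => ?_, fun z hz => ?_⟩
    · rw [Cmd.den, if_pos (hiff.mpr hx), Cmd.den, he i hi]; simp [HS.setF, hx]
    · rw [Cmd.den, if_neg (mt hiff.mp hx), Cmd.den_skip]
    · exact Cmd.den_fv _ (by simp [Cmd.fvW, hz])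
  set σ1 := c1.den code π tin ρ σ with hσ1
  set c2 := Cmd.loop 6 0 (.ifeq (.mul (.elt (.bv 6)) (.elt (.bv 6))) (.elt (.bv 6))
    (.ifeq (.elt (.bv 6)) (.fv 0) .skip (.fset 1 (.elt (.bv 6)))) .skip) with hc2
  obtain ⟨b1, b2⟩ : (c2.den code π tin ρ σ1).fv 1 = 1 ∧ _ := den_scan hπ (1 : F) fun i hi τ hτ => by
    have h0 : τ.fv 0 = 0 := by rw [hτ 0 (by decide), a1]
    have hiff : (FExpr.mul (.elt (.bv 6)) (.elt (.bv 6))).eval code π tin (Function.update ρ 6 i) τ =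
        (FExpr.elt (.bv 6)).eval code π tin (Function.update ρ 6 i) τ ↔
          elem code i = 1 ∨ elem code i = 0 := by
      change (FExpr.elt (.bv 6)).eval code π tin (Function.update ρ 6 i) τ * (FExpr.elt (.bv 6)).eval code π tin (Function.update ρ 6 i) τ = _ ↔ _
      rw [he i hi, or_comm]
      exact IsIdempotentElem.iff_eq_zero_or_one
    have hiff2 : (FExpr.elt (.bv 6)).eval code π tin (Function.update ρ 6 i) τ =
        (FExpr.fv 0).eval code π tin (Function.update ρ 6 i) τ ↔ elem code i = 0 := by
      rw [he i hi, FExpr.eval, h0]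
    refine ⟨fun hx => ?_, fun hx => ?_, fun z hz => ?_⟩
    · rw [Cmd.den, if_pos (hiff.mpr (Or.inl hx)), Cmd.den,
        if_neg (mt hiff2.mp (by rw [hx]; exact one_ne_zero)), Cmd.den, he i hi]
      simp [HS.setF, hx]
    · by_cases hz : elem code i = 0
      · rw [Cmd.den, if_pos (hiff.mpr (Or.inr hz)), Cmd.den, if_pos (hiff2.mpr hz), Cmd.den_skip]
      · rw [Cmd.den, if_neg (mt hiff.mp (by tauto)), Cmd.den_skip]
    · exact Cmd.den_fv _ (by simp [Cmd.fvW, hz])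
  set σ2 := c2.den code π tin ρ σ1 with hσ2
  have e0 : σ2.fv 0 = 0 := by rw [b2 0 (by decide), a1]
  set c3 := Cmd.loop 6 0 (.ifeq (.add (.elt (.bv 6)) (.fv 1)) (.fv 0) (.fset 2 (.elt (.bv 6))) .skip)
    with hc3
  obtain ⟨d1, d2⟩ : (c3.den code π tin ρ σ2).fv 2 = -1 ∧ _ := den_scan hπ (-1 : F) fun i hi τ hτ => by
    have h0 : τ.fv 0 = 0 := by rw [hτ 0 (by decide), e0]
    have h1 : τ.fv 1 = 1 := by rw [hτ 1 (by decide), b1]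
    have hiff : (FExpr.add (.elt (.bv 6)) (.fv 1)).eval code π tin (Function.update ρ 6 i) τ =
        (FExpr.fv 0).eval code π tin (Function.update ρ 6 i) τ ↔ elem code i = -1 := by
      change (FExpr.elt (.bv 6)).eval code π tin (Function.update ρ 6 i) τ + τ.fv 1 = τ.fv 0 ↔ _
      rw [he i hi, h0, h1, add_eq_zero_iff_eq_neg]
    refine ⟨fun hx => ?_, fun hx => ?_, fun z hz => ?_⟩
    · rw [Cmd.den, if_pos (hiff.mpr hx), Cmd.den, he i hi]; simp [HS.setF, hx]
    · rw [Cmd.den, if_neg (mt hiff.mp hx), Cmd.den_skip]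
    · exact Cmd.den_fv _ (by simp [Cmd.fvW, hz])
  exact ⟨by rw [d2 0 (by decide), e0], by rw [d2 1 (by decide), b1], d1, hl.e19⟩

@[simp] lemma attempt_fvW : attempt.fvW = [] := rfl

lemma attempt_notMem_arrW : 17 ∉ attempt.arrW := by decide

/-- The outer loop counts through all rows of `π 14` digits, the inner one through the values of
`zz`. A certificate depends only on these digits, so the round that reaches it succeeds, and later
rounds never undo success. -/
lemma search_spec (hπ : ParOK q π) (hl : Lay π) {ρ : ℕ → ℕ} {σ τ : HS F} (hg : Good π σ)
    (hs : Sound π tin σ) (hτ : τ = search.den code π tin ρ σ) :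
    Sound π tin τ ∧ (σ.nv 6 = 1 → τ.nv 6 = 1) ∧
      ((∃ d zz r v u w p x G, zz < π 18 ∧ Certificate π tin d zz r v u w p x G) → τ.nv 6 = 1) := by
  have h14 := hl.b14
  have h19 := hl.e19
  rw [search, Cmd.den_seq] at hτ
  set σ1 := (fill 17 19 14 (.elt (.const 0))).den code π tin ρ σ with hσ1
  have g1 : Good π σ1 := hg.den _ (by simp) (by simp) (by simp)
  have s1 : Sound π tin σ1 := hs.den _ (by simp) (by simp) (by simp) (by simp)
  have n1 : σ1.nv 6 = σ.nv 6 := Cmd.den_nv _ (by simp)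
  have d1 : Digits code (π 14) 0 (σ1.arr 17) := Digits.zero fun j hj => by
    rw [hσ1, den_fill (by omega) h14 (by decide) (by simp [FExpr.noArr]), if_pos ⟨by omega, hj⟩]
    simp [FExpr.eval]
  have main : Good π τ ∧ Sound π tin τ ∧ (σ1.nv 6 = 1 → τ.nv 6 = 1) ∧
      Digits code (π 14) (π 16) (τ.arr 17) ∧ ∀ z < π 16,
      (∃ zz r v u w p x G, zz < π 18 ∧ Certificate π tin (fun j => elem code (z / q ^ j % q)) zz
        r v u w p x G) → τ.nv 6 = 1 := by
    rw [hτ]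
    refine Cmd.den_loop_inv (fun k τ => Good π τ ∧ Sound π tin τ ∧ (σ1.nv 6 = 1 → τ.nv 6 = 1) ∧
      Digits code (π 14) k (τ.arr 17) ∧ ∀ z < k,
      (∃ zz r v u w p x G, zz < π 18 ∧ Certificate π tin (fun j => elem code (z / q ^ j % q)) zz
        r v u w p x G) → τ.nv 6 = 1) ⟨g1, s1, id, d1, by simp⟩
      fun k hk τ ⟨i1, i2, i3, i4, i5⟩ => ?_
    rw [Cmd.den_seq]
    set ρ' := Function.update ρ 8 k
    have inner : Good π ((Cmd.loop 9 18 attempt).den code π tin ρ' τ) ∧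
        Sound π tin ((Cmd.loop 9 18 attempt).den code π tin ρ' τ) ∧
        (τ.nv 6 = 1 → ((Cmd.loop 9 18 attempt).den code π tin ρ' τ).nv 6 = 1) ∧
        ((Cmd.loop 9 18 attempt).den code π tin ρ' τ).arr 17 = τ.arr 17 ∧
        ∀ zz < π 18, (∃ r v u w p x G, Certificate π tin (τ.arr 17 0) zz r v u w p x G) →
          ((Cmd.loop 9 18 attempt).den code π tin ρ' τ).nv 6 = 1 := by
      refine Cmd.den_loop_inv (fun l τ' => Good π τ' ∧ Sound π tin τ' ∧ (τ.nv 6 = 1 → τ'.nv 6 = 1) ∧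
        τ'.arr 17 = τ.arr 17 ∧ ∀ zz < l,
          (∃ r v u w p x G, Certificate π tin (τ.arr 17 0) zz r v u w p x G) → τ'.nv 6 = 1)
        ⟨i1, i2, id, rfl, by simp⟩ fun l _ τ' ⟨j1, j2, j3, j4, j5⟩ => ?_
      obtain ⟨k1, k2, k3⟩ := attempt_spec hπ hl (ρ := Function.update ρ' 9 l) j1 j2 rfl
      refine ⟨j1.den _ (by simp) (by simp) (by simp), k1, fun h => k2 (j3 h),
        (Cmd.den_arr _ attempt_notMem_arrW).trans j4, fun zz hzz hc => ?_⟩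
      rcases Nat.lt_succ_iff_lt_or_eq.mp hzz with hlt | rfl
      · exact k2 (j5 zz hlt hc)
      · exact k3 (by rw [j4, Function.update_self]; exact hc)
    set τ1 := (Cmd.loop 9 18 attempt).den code π tin ρ' τ with hτ1
    obtain ⟨j1, j2, j3, j4, j5⟩ := inner
    have n2 : ((inc 17 14).den code π tin ρ' τ1).nv 6 = τ1.nv 6 := Cmd.den_nv _ (by simp)
    refine ⟨j1.den _ (by simp) (by simp) (by simp), j2.den _ (by simp) (by simp) (by simp) (by simp),
      fun h => n2.trans (j3 (i3 h)), inc_spec h14 (j4 ▸ i4), fun z hz hc => n2.trans ?_⟩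
    rcases Nat.lt_succ_iff_lt_or_eq.mp hz with hlt | rfl
    · exact j3 (i5 z hlt hc)
    · obtain ⟨zz, r, v, u, w, p, x, G, hzz, hC⟩ := hc
      exact j5 zz hzz ⟨r, v, u, w, p, x, G, hC.congr hl fun j hj => i4 j hj⟩
  obtain ⟨-, m2, m3, -, m5⟩ := main
  refine ⟨m2, fun h => m3 (n1.trans h), ?_⟩
  rintro ⟨d, zz, r, v, u, w, p, x, G, hzz, hC⟩
  obtain ⟨z, hz, hd⟩ := exists_digits (code := code) (π 14) d
  exact m5 z (by rw [hl.e16, hπ.card]; exact hz) ⟨zz, r, v, u, w, p, x, G, hzz, hC.congr hl hd⟩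

lemma flatOut_spec (h4 : π 4 ≤ π 5 + 1) {A p off : ℕ} {o : NExpr} (hA : A ≠ 22) (hp : π p ≤ π 5 + 1)
    (ho : ∀ ρ ν, o.eval π ρ ν = off) (hoff : off + π p * π 4 ≤ π 5 + 1) {ρ : ℕ → ℕ} {σ τ : HS F}
    (hτ : τ = (flatOut A p o).den code π tin ρ σ) :
    (∀ l < off, τ.arr 22 0 l = σ.arr 22 0 l) ∧
      ∀ l < π p * π 4, τ.arr 22 0 (off + l) = σ.arr A (l / π 4) (l % π 4) := by
  set f : ℕ → F := fun l => if l < off then σ.arr 22 0 l else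
    σ.arr A ((l - off) / π 4) ((l - off) % π 4) with hf
  have main : τ.arr A = σ.arr A ∧ ∀ l < off + π p * π 4, τ.arr 22 0 l = f l := by
    rw [hτ]
    refine Cmd.den_loop_inv (fun k τ => τ.arr A = σ.arr A ∧ ∀ l < off + k * π 4, τ.arr 22 0 l = f l)
      ⟨rfl, fun l hl => by rw [zero_mul] at hl; simp [hf, show l < off from hl]⟩
      fun k hk τ ⟨h1, h2⟩ => ?_
    rw [Nat.succ_mul, ← add_assoc]
    refine Cmd.den_loop_inv (fun t τ => τ.arr A = σ.arr A ∧ ∀ l < off + k * π 4 + t,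
      τ.arr 22 0 l = f l) ⟨h1, h2⟩ fun t ht τ ⟨h1, h2⟩ => ?_
    have hkt : k * π 4 + t < π p * π 4 := by nlinarith
    simp only [Cmd.den, FExpr.eval, NExpr.eval, ho, HS.setA, Function.update_self, Nat.zero_min,
      Function.update_of_ne (show (6 : ℕ) ≠ 7 by decide), min_eq_left (show k ≤ π 5 by omega),
      min_eq_left (show t ≤ π 5 by omega), min_eq_left (show off + (k * π 4 + t) ≤ π 5 by omega)]
    refine ⟨by simp [hA, h1], fun l hlt => ?_⟩
    by_cases hl : l = off + (k * π 4 + t)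
    · subst hl
      have h0 : 0 < π 4 := by omega
      simp [hf, h1, Nat.mul_add_mod', Nat.mod_eq_of_lt ht, Nat.add_comm (k * π 4),
        Nat.add_mul_div_right _ _ h0, Nat.div_eq_of_lt ht]
    · have := h2 l (by omega)
      simpa [hl] using this
  refine ⟨fun l hl => ?_, fun l hl => ?_⟩
  · rw [main.2 l (by omega)]; simp [hf, hl]
  · rw [main.2 _ (by omega)]; simp [hf]

/-- The result of the algorithm in row `0` of array `22`. -/
def Result (code : F ≃ Fin q) (π : ℕ → ℕ) (tin : ℕ → F) (σ : HS F) : Prop :=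
  (σ.arr 22 0 0 = elem code 0 ∧ ¬ HasSol π tin) ∨ (σ.arr 22 0 0 = elem code 1 ∧
    ∃ A B C : ℕ → ℕ → F, (∀ i < π 1, ∀ j < π 2, ∀ k < π 3, tin (i * π 8 + (j * π 3 + k)) =
      ∑ r ∈ Finset.range (π 4), A i r * (B j r * C k r)) ∧
    (∀ l < π 1 * π 4, σ.arr 22 0 (1 + l) = A (l / π 4) (l % π 4)) ∧
    (∀ l < π 2 * π 4, σ.arr 22 0 (1 + π 1 * π 4 + l) = B (l / π 4) (l % π 4)) ∧
    ∀ l < π 3 * π 4, σ.arr 22 0 (1 + (π 1 + π 2) * π 4 + l) = C (l / π 4) (l % π 4))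

lemma output_spec (hπ : ParOK q π) (hl : Lay π) {ρ : ℕ → ℕ} {σ τ : HS F} (hs : Sound π tin σ)
    (hno : σ.nv 6 = 0 → ¬ HasSol π tin) (hτ : τ = output.den code π tin ρ σ) :
    Result code π tin τ := by
  have h1 := hl.b1
  have h2 := hl.b2
  have h3 := hl.b3
  have h4 := hl.b4
  have h20 := hl.b20
  have e20 := hl.e20
  have hq : 1 < q := by
    rcases Nat.lt_or_ge 1 q with h | h
    · exact h
    · have h0 := (code 0).2
      have h1 := (code 1).2
      exact absurd (code.injective (Fin.ext (by omega))) (zero_ne_one (α := F))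
  have m1 : π 1 * π 4 + π 2 * π 4 + π 3 * π 4 = (π 1 + π 2 + π 3) * π 4 := by ring
  have m2 : (π 1 + π 2) * π 4 = π 1 * π 4 + π 2 * π 4 := by ring
  rw [output, Cmd.den_seq, Cmd.den_seq, Cmd.den_seq] at hτ
  set c0 := Cmd.store 22 (.const 0) (.const 0)
    (.iflt (.const 0) (.nv 6) (.elt (.const 1)) (.elt (.const 0))) with hc0
  set σ0 := c0.den code π tin ρ σ with hσ0
  have a0 : σ0.arr 22 0 0 = if 0 < σ.nv 6 then elem code 1 else elem code 0 := by
    simp [hσ0, hc0, Cmd.den, FExpr.eval, min_eq_left (show 1 ≤ π 11 by rw [hπ.last]; omega)]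
  have f0 : ∀ A, A ≠ 22 → σ0.arr A = σ.arr A := fun A hA => Cmd.den_arr _ (by simp [hc0, Cmd.arrW, hA])
  obtain ⟨b1, b2⟩ := flatOut_spec (code := code) (tin := tin) (σ := σ0) (ρ := ρ) h4
    (show 19 ≠ 22 by decide) h1 (off := 1) (o := .const 1) (fun _ _ => rfl) (by omega) rfl
  set σ1 := (flatOut 19 1 (.const 1)).den code π tin ρ σ0 with hσ1
  have f1 : ∀ A, A ≠ 22 → σ1.arr A = σ0.arr A := fun A hA =>
    Cmd.den_arr _ (by simp [flatOut, Cmd.arrW, hA])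
  obtain ⟨c1, c2⟩ := flatOut_spec (code := code) (tin := tin) (σ := σ1) (ρ := ρ) h4
    (show 20 ≠ 22 by decide) h2 (off := 1 + π 1 * π 4)
    (o := .add (.const 1) (.mul (.par 1) (.par 4))) (fun _ _ => rfl) (by omega) rfl
  set σ2 := (flatOut 20 2 (.add (.const 1) (.mul (.par 1) (.par 4)))).den code π tin ρ σ1 with hσ2
  have f2 : ∀ A, A ≠ 22 → σ2.arr A = σ1.arr A := fun A hA =>
    Cmd.den_arr _ (by simp [flatOut, Cmd.arrW, hA])
  obtain ⟨d1, d2⟩ := flatOut_spec (code := code) (tin := tin) (σ := σ2) (ρ := ρ) h4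
    (show 21 ≠ 22 by decide) h3 (off := 1 + (π 1 + π 2) * π 4)
    (o := .add (.const 1) (.mul (.add (.par 1) (.par 2)) (.par 4))) (fun _ _ => rfl) (by omega) hτ
  have e0 : τ.arr 22 0 0 = if 0 < σ.nv 6 then elem code 1 else elem code 0 := by
    rw [d1 0 (by omega), c1 0 (by omega), b1 0 (by omega), a0]
  rcases hs with h | ⟨h, hsol⟩
  · exact Or.inl ⟨by rw [e0, if_neg (by omega)], hno h⟩
  · refine Or.inr ⟨by rw [e0, if_pos (by omega)], σ.arr 19, σ.arr 20, σ.arr 21,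
      fun i hi j hj k hk => ?_, fun l hl => ?_, fun l hl => ?_, fun l hl => ?_⟩
    · rw [hsol i hi (j * π 3 + k) (by rw [hl.e8]; nlinarith), Nat.mul_add_mod',
        Nat.mod_eq_of_lt hk, Nat.add_comm (j * _), Nat.add_mul_div_right _ _ hl.p3,
        Nat.div_eq_of_lt hk, zero_add]
    · rw [d1 _ (by omega), c1 _ (by omega), b2 l hl, f0 _ (by decide)]
    · rw [d1 _ (by omega), c2 l hl, f1 _ (by decide), f0 _ (by decide)]
    · rw [d2 l hl, f2 _ (by decide), f1 _ (by decide), f0 _ (by decide)]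

/-- The dichotomy: if the coefficient vectors of small rank span everything, `lowRank` succeeds
whether or not a solution was assumed; otherwise a solution yields a certificate, which `search`
meets. A flag still `0` at the end therefore excludes a solution. -/
theorem mainCmd_spec (hπ : ParOK q π) (hl : Lay π)
    (hS : LinearIndependent F fun i : Fin (π 1) => sliceMat π tin i)
    (hsize : ∀ r, π 13 < r → r ≤ π 2 → r ≤ π 3 → r ≤ π 21 →
      π 1 + ((π 21 - r) * (π 2 + π 3) + r * r) ≤ π 14) {ρ : ℕ → ℕ} {σ τ : HS F} (h6 : σ.nv 6 = 0)
    (hτ : τ = mainCmd.den code π tin ρ σ) : Result code π tin τ := by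
  rw [mainCmd, Cmd.den_seq, Cmd.den_seq, Cmd.den_seq] at hτ
  have g1 : Good π (consts.den code π tin ρ σ) := consts_spec hπ hl
  set σ1 := consts.den code π tin ρ σ with hσ1
  have s1 : Sound π tin σ1 := Or.inl (by rw [hσ1, Cmd.den_nv _ (by simp), h6])
  obtain ⟨s2, hlow⟩ := lowRank_spec (code := code) hπ hl (ρ := ρ) g1 s1 rfl
  set σ2 := lowRank.den code π tin ρ σ1 with hσ2
  have g2 : Good π σ2 := g1.den _ (by simp) (by simp) (by simp)
  obtain ⟨s3, hst, hcert⟩ := search_spec (code := code) hπ hl (ρ := ρ) g2 s2 rfl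
  refine output_spec hπ hl s3 (fun h0 hsol => ?_) hτ
  by_cases htop : Submodule.span F {v : Fin (π 1) → F | ∃ w : ℕ → F, v = vec (π 1) w ∧
      (mat (π 2) (π 3) (comb π tin w)).rank ≤ π 13} = ⊤
  · have := hst (hlow htop)
    omega
  · have := hcert (exists_certificate hl hS hsize hsol htop)
    omega

lemma mainCmd_wf : mainCmd.wf 24 [] = true := by decide

end

end TensorCPD

/-! ### Counting elementary steps. -/

namespace TensorCPD

/-! ### Bounds for the number of steps -/

lemma add_le_pow {X u v a b : ℕ} (hX : 2 ≤ X) (hu : u ≤ X ^ a) (hv : v ≤ X ^ b) :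
    u + v ≤ X ^ (a + b + 1) := by
  have h1 : X ^ a ≤ X ^ (a + b) := Nat.pow_le_pow_right (by omega) (by omega)
  have h2 : X ^ b ≤ X ^ (a + b) := Nat.pow_le_pow_right (by omega) (by omega)
  have h3 : X ^ (a + b) * 2 ≤ X ^ (a + b + 1) := by rw [pow_succ]; exact Nat.mul_le_mul_left _ hX
  omega

lemma mul_le_pow {X u v a b : ℕ} (hu : u ≤ X ^ a) (hv : v ≤ X ^ b) : u * v ≤ X ^ (a + b) := by
  rw [pow_add]; exact Nat.mul_le_mul hu hv

lemma self_le_pow {X : ℕ} (hX : 2 ≤ X) (k : ℕ) : k ≤ X ^ k :=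
  (Nat.lt_two_pow_self).le.trans (Nat.pow_le_pow_left hX k)

/-- Parameters that are bounded polynomially. -/
def smallPars : List ℕ := [0, 1, 2, 3, 4, 8, 14, 18, 19, 20, 21]

/-- An exponent that bounds the number of steps. -/
def FExpr.ex : FExpr → ℕ
  | fv _ => 2
  | arr A i j => (adrE A i j).steps + 1
  | ten i => (adrT i).steps + 1
  | elt i => (i.cap 11).steps
  | next e => e.ex + 4 + 1
  | add a b => a.ex + b.ex + 1 + 4 + 1
  | mul a b => a.ex + b.ex + 1 + 4 + 1
  | sum _ _ e => 4 + (1 + (e.ex + 7 + 1)) + 1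
  | iflt a b e e' => a.steps + b.steps + 1 + e.ex + 1 + e'.ex + 1 + 1 + 1
  | ifeq a b e e' => a.ex + b.ex + 1 + e.ex + 1 + e'.ex + 1 + 2 + 1

/-- All sums are over small parameters. -/
def FExpr.light : FExpr → Bool
  | fv _ => true
  | arr _ _ _ => true
  | ten _ => true
  | elt _ => true
  | next e => e.light
  | add a b => a.light && b.light
  | mul a b => a.light && b.light
  | sum _ p e => decide (p ∈ smallPars) && e.light
  | iflt _ _ e e' => e.light && e'.light
  | ifeq a b e e' => a.light && b.light && e.light && e'.light

lemma FExpr.steps_le {π : ℕ → ℕ} {X : ℕ} (hX : 2 ≤ X) (hp : ∀ p ∈ smallPars, π p ≤ X) (e : FExpr)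
    (h : e.light) : e.steps π ≤ X ^ e.ex := by
  have hs := fun k => self_le_pow hX k
  induction e with
  | fv => exact hs 2
  | arr => exact hs _
  | ten => exact hs _
  | elt => exact hs _
  | next e ih => exact add_le_pow hX (ih h) (hs 4)
  | add a b iha ihb =>
    simp only [light, Bool.and_eq_true] at h
    exact (add_le_pow hX (add_le_pow hX (iha h.1) (ihb h.2)) (hs 4)).trans le_rfl
  | mul a b iha ihb =>
    simp only [light, Bool.and_eq_true] at h
    exact (add_le_pow hX (add_le_pow hX (iha h.1) (ihb h.2)) (hs 4)).trans le_rfl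
  | sum x p e ih =>
    simp only [light, Bool.and_eq_true, decide_eq_true_eq] at h
    exact add_le_pow hX (hs 4) (mul_le_pow ((pow_one X).symm ▸ hp p h.1)
      (add_le_pow hX (ih h.2) (hs 7)))
  | iflt a b e e' ih ih' =>
    simp only [light, Bool.and_eq_true] at h
    exact (add_le_pow hX (add_le_pow hX (add_le_pow hX (add_le_pow hX (hs a.steps) (hs b.steps))
      (ih h.1)) (ih' h.2)) (hs 1)).trans le_rfl
  | ifeq a b e e' iha ihb ih ih' =>
    simp only [light, Bool.and_eq_true] at h
    exact (add_le_pow hX (add_le_pow hX (add_le_pow hX (add_le_pow hX (iha h.1.1.1) (ihb h.1.1.2))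
      (ih h.1.2)) (ih' h.2)) (hs 2)).trans le_rfl

namespace Cmd

/-- An exponent that bounds the number of steps. -/
def ex : Cmd → ℕ
  | skip => 1
  | fset _ e => e.ex + 2 + 1
  | store A i j e => e.ex + (adrE A i j).steps + 1 + 1 + 1
  | nconst _ c => 1 + c
  | nbv _ _ => 2
  | incr _ => 2
  | seq c c' => c.ex + c'.ex + 1
  | iflt a b c c' => a.steps + b.steps + 1 + c.ex + 1 + c'.ex + 1 + 1 + 1
  | ifeq a b c c' => a.ex + b.ex + 1 + c.ex + 1 + c'.ex + 1 + 2 + 1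
  | loop _ _ c => 2 + (1 + (c.ex + 3 + 1)) + 1

/-- All loops are over small parameters. -/
def light : Cmd → Bool
  | skip => true
  | fset _ e => e.light
  | store _ _ _ e => e.light
  | nconst _ _ => true
  | nbv _ _ => true
  | incr _ => true
  | seq c c' => c.light && c'.light
  | iflt _ _ c c' => c.light && c'.light
  | ifeq a b c c' => a.light && b.light && c.light && c'.light
  | loop _ p c => decide (p ∈ smallPars) && c.light

lemma steps_le {π : ℕ → ℕ} {X : ℕ} (hX : 2 ≤ X) (hp : ∀ p ∈ smallPars, π p ≤ X) (c : Cmd)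
    (h : c.light) : c.steps π ≤ X ^ c.ex := by
  have hs := fun k => self_le_pow hX k
  induction c with
  | skip => exact hs 1
  | fset x e => exact add_le_pow hX (e.steps_le hX hp h) (hs 2)
  | store A i j e => 
    exact (add_le_pow hX (add_le_pow hX (e.steps_le hX hp h) (hs (adrE A i j).steps))
      (hs 1)).trans le_rfl
  | nconst => exact hs _
  | nbv => exact hs 2
  | incr => exact hs 2
  | seq c c' ih ih' =>
    simp only [light, Bool.and_eq_true] at h
    exact add_le_pow hX (ih h.1) (ih' h.2)
  | iflt a b e e' ih ih' =>
    simp only [light, Bool.and_eq_true] at h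
    exact (add_le_pow hX (add_le_pow hX (add_le_pow hX (add_le_pow hX (hs a.steps) (hs b.steps))
      (ih h.1)) (ih' h.2)) (hs 1)).trans le_rfl
  | ifeq a b e e' ih ih' =>
    simp only [light, Bool.and_eq_true] at h
    exact (add_le_pow hX (add_le_pow hX (add_le_pow hX (add_le_pow hX
      (a.steps_le hX hp h.1.1.1) (b.steps_le hX hp h.1.1.2)) (ih h.1.2)) (ih' h.2))
      (hs 2)).trans le_rfl
  | loop x p c ih =>
    simp only [light, Bool.and_eq_true, decide_eq_true_eq] at h
    exact add_le_pow hX (hs 2) (mul_le_pow ((pow_one X).symm ▸ hp p h.1)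
      (add_le_pow hX (ih h.2) (hs 3)))

/-- The bound for a command with loops over large parameters. -/
lemma steps_loop_le {π : ℕ → ℕ} {X x p a Y Z : ℕ} {c : Cmd} (hX : 2 ≤ X) (hY : 1 ≤ Y) (hZ : 1 ≤ Z)
    (hc : c.steps π ≤ X ^ a * Y) (hp : π p ≤ X * Z) :
    (loop x p c).steps π ≤ X ^ (a + 6) * (Z * Y) := by
  have h1 : 1 ≤ X ^ a := Nat.one_le_pow _ _ (by omega)
  have h2 : 1 ≤ X ^ a * Y := Nat.one_le_iff_ne_zero.mpr (by positivity)
  have h2' : 2 ^ 2 ≤ X ^ 2 := Nat.pow_le_pow_left hX 2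
  have h3 : c.steps π + 3 ≤ X ^ 2 * (X ^ a * Y) := by nlinarith
  have h4 : π p * (c.steps π + 3) ≤ X ^ (a + 3) * (Z * Y) :=
    (Nat.mul_le_mul hp h3).trans (le_of_eq (by ring))
  have h5 : 1 ≤ X ^ (a + 3) * (Z * Y) :=
    Nat.one_le_iff_ne_zero.mpr (by positivity)
  have h6 : X ^ (a + 6) * (Z * Y) = X ^ 3 * (X ^ (a + 3) * (Z * Y)) := by ring
  have h7 : 2 ^ 3 ≤ X ^ 3 := Nat.pow_le_pow_left hX 3
  rw [h6, steps]
  nlinarith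

lemma steps_seq_le {π : ℕ → ℕ} {X a b Y : ℕ} {c c' : Cmd} (hX : 2 ≤ X)
    (hc : c.steps π ≤ X ^ a * Y) (hc' : c'.steps π ≤ X ^ b * Y) :
    (seq c c').steps π ≤ X ^ (a + b + 1) * Y := by
  rw [steps]
  have h1 : X ^ a ≤ X ^ (a + b) := Nat.pow_le_pow_right (by omega) (by omega)
  have h2 : X ^ b ≤ X ^ (a + b) := Nat.pow_le_pow_right (by omega) (by omega)
  have h3 : X ^ (a + b + 1) * Y = X * (X ^ (a + b) * Y) := by ring
  have h4 := Nat.mul_le_mul_right Y h1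
  have h5 := Nat.mul_le_mul_right Y h2
  rw [h3]
  nlinarith

lemma steps_iflt_le {π : ℕ → ℕ} {X a Y : ℕ} {u v : NExpr} {c c' : Cmd} (hX : 2 ≤ X) (hY : 1 ≤ Y)
    (hc : c.steps π ≤ X ^ a * Y) (hc' : c'.steps π ≤ 1) :
    (iflt u v c c').steps π ≤ X ^ (a + (u.steps + v.steps + 2) + 1) * Y := by
  rw [steps]
  have h1 := self_le_pow hX (u.steps + v.steps + 2)
  have h2 := add_le_pow hX (u := X ^ a) le_rfl h1
  have h3 := Nat.mul_le_mul_right Y h2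
  rw [add_mul] at h3
  have h4 : u.steps + v.steps + 2 ≤ (u.steps + v.steps + 2) * Y := Nat.le_mul_of_pos_right _ hY
  omega

end Cmd

/-- Only three loops have more than polynomially many rounds. The one over `|F| ^ n₂` is nested in
the one over `|F| ^ π 14`, which gives the product `Q₁ * Q₂`. The one over `|F| ^ n₀` in `lowRank`
stands alone, and `Q₀ ≤ Q₁` absorbs it. -/
lemma mainCmd_steps_le : ∃ K, ∀ (π : ℕ → ℕ) (X Q₀ Q₁ Q₂ : ℕ), 2 ≤ X →
    (∀ p ∈ smallPars, π p ≤ X) → 1 ≤ Q₁ → 1 ≤ Q₂ → Q₀ ≤ Q₁ → π 15 ≤ Q₀ → π 16 ≤ Q₁ → π 17 ≤ Q₂ →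
      mainCmd.steps π ≤ X ^ K * (Q₁ * Q₂) := by
  -- The exponent stays open until the bounds assembled below determine it by unification; thus it
  -- depends on the program alone.
  refine Exists.intro ?K ?_
  rotate_left
  intro π X Q₀ Q₁ Q₂ hX hp h1 h2 h01 h15 h16 h17
  have hl : ∀ c : Cmd, c.light → ∀ Y, 1 ≤ Y → c.steps π ≤ X ^ c.ex * Y := fun c hc Y hY =>
    (c.steps_le hX hp hc).trans (Nat.le_mul_of_pos_right _ hY)
  have hQ : 1 ≤ Q₁ * Q₂ := Nat.one_le_iff_ne_zero.mpr (by positivity)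
  have hX1 : 1 ≤ X := by omega
  have low : lowRank.steps π ≤ X ^ _ * (Q₁ * Q₂) :=
    Cmd.steps_seq_le hX (hl _ rfl _ hQ) (Cmd.steps_seq_le hX (hl _ rfl _ hQ)
      (Cmd.steps_seq_le hX (hl _ rfl _ hQ) (Cmd.steps_seq_le hX
        ((Cmd.steps_loop_le hX h2 h1 (hl _ rfl _ h2) (by nlinarith : π 15 ≤ X * Q₁)))
        (hl _ rfl _ hQ))))
  have comp : complete.steps π ≤ X ^ _ * Q₂ :=
    Cmd.steps_seq_le hX (hl _ rfl _ h2) (Cmd.steps_seq_le hX (hl _ rfl _ h2)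
      (Cmd.steps_seq_le hX (hl _ rfl _ h2) (Cmd.steps_seq_le hX (hl _ rfl _ h2)
        (Cmd.steps_seq_le hX ((Cmd.steps_loop_le hX le_rfl h2 (hl _ rfl _ le_rfl)
          (by nlinarith : π 17 ≤ X * Q₂)).trans (by rw [mul_one])) (hl _ rfl _ h2)))))
  have att : attempt.steps π ≤ X ^ _ * Q₂ :=
    Cmd.steps_seq_le hX (hl _ rfl _ h2) (Cmd.steps_seq_le hX (hl _ rfl _ h2)
      (Cmd.steps_iflt_le hX h2 (Cmd.steps_iflt_le hX h2 (Cmd.steps_seq_le hX (hl _ rfl _ h2)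
        (Cmd.steps_seq_le hX (hl _ rfl _ h2) comp)) le_rfl) le_rfl))
  have sea : search.steps π ≤ X ^ _ * (Q₁ * Q₂) :=
    Cmd.steps_seq_le hX (hl _ rfl _ hQ) (Cmd.steps_loop_le hX h2 h1
      (Cmd.steps_seq_le hX ((Cmd.steps_loop_le hX h2 le_rfl att
        (by have := hp 18 (by decide); omega : π 18 ≤ X * 1)).trans (by rw [one_mul]))
        (hl _ rfl _ h2)) (by nlinarith : π 16 ≤ X * Q₁))
  exact Cmd.steps_seq_le hX (hl consts rfl _ hQ) (Cmd.steps_seq_le hX low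
    (Cmd.steps_seq_le hX sea (hl output rfl _ hQ)))

end TensorCPD

namespace TensorCPD

/-! ### Computing the parameters -/

/-- The instructions for computing parameters: reading from a fixed address, evaluating an
expression, and iterating an expression in the parameter itself and the loop variable `0`, starting
with a constant, as often as another parameter says. -/
inductive ParOp where
  | read (i a : ℕ)
  | put (i : ℕ) (e : NExpr)
  | iter (i p c : ℕ) (e : NExpr)

namespace ParOp

/-- The index of the parameter that is computed. -/
def target : ParOp → ℕ
  | read i _ => i
  | put i _ => i
  | iter i _ _ _ => i

/-- The code that leaves the value of an expression in a parameter. -/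
def assign (i : ℕ) (e : NExpr) : Prog := .seq (e.compile 0) (mov (5 * i + 1) (5 * 0))

/-- The machine code of an instruction. -/
def compile : ParOp → Prog
  | read i a => .seq (.instr (.const (5 * 0) a)) (.instr (.load (5 * i + 1) (5 * 0)))
  | put i e => assign i e
  | iter i p c e => .seq (.seq (.instr (.const (5 * i + 1) c)) (.instr (.const (5 * 0 + 2) 0)))
      (.loop (5 * 0 + 2) (5 * p + 1) (.seq (assign i e) (.seq (.instr (.const (5 * 0) 1))
        (.instr (.add (5 * 0 + 2) (5 * 0 + 2) (5 * 0))))))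

/-- The number of elementary steps, if all parameters are at most `X`. -/
def cost (X : ℕ) : ParOp → ℕ
  | read _ _ => 2
  | put _ e => e.steps + 2
  | iter _ _ _ e => 3 + X * (e.steps + 5)

/-- An exponent that bounds the growth of numbers. -/
def sz : ParOp → ℕ
  | read _ a => a + 1
  | put _ e => e.sz
  | iter _ _ _ e => e.sz

/-- The machine code of a list of instructions. -/
def compileList : List ParOp → Prog
  | [] => .skip
  | o :: l => .seq o.compile (compileList l)

/-- The cost of a list of instructions. -/
def costList (X : ℕ) : List ParOp → ℕ
  | [] => 1
  | o :: l => o.cost X + costList X l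

/-- The exponent for a list of instructions. -/
def szList : List ParOp → ℕ
  | [] => 0
  | o :: l => o.sz + szList l

end ParOp

/-- The parameters in `L` have been computed, and nothing else has changed. -/
structure Prep (B : Bounds) (M : ℕ) (m : ℕ →₀ ℕ) (π ρ : ℕ → ℕ) (Γ : List ℕ) (s : State) : Prop where
  bdd : Bdd B s
  n : NRel π ρ (fun _ => 0) Γ M s
  fv : ∀ i, s.reg (5 * i + 4) = 0
  mem : s.mem = m

section

variable {B : Bounds} {M : ℕ} {m : ℕ →₀ ℕ} {π ρ : ℕ → ℕ} {Γ : List ℕ} {s : State}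

lemma Prep.frame (h : Prep B M m π ρ Γ s) {t : ℕ} {s' : State} (hf : Frame Γ t s s') (hB : Bdd B s') :
    Prep B M m π ρ Γ s' :=
  ⟨hB, h.n.frame hf, fun i => (hf.fv i).trans (h.fv i), hf.mem.trans h.mem⟩

lemma Prep.set_par (h : Prep B M m π ρ Γ s) {i v : ℕ} (hv : v ≤ M) (hMV : M ≤ B.V)
    (hi : 5 * i + 1 < B.Z) : Prep B M m (Function.update π i v) ρ Γ (s.set (5 * i + 1) v) := by
  refine ⟨h.bdd.set hi (hv.trans hMV), ⟨fun j => ?_, fun j hj => ?_, fun j => ?_, fun j => ?_,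
    h.n.bvM, h.n.nvM⟩, fun j => ?_, h.mem⟩
  · rw [State.set_reg, Function.update_apply]
    by_cases hj : j = i
    · simp [hj]
    · rw [if_neg (by omega), if_neg hj, h.n.par]
  · rw [State.set_reg, if_neg (by omega), h.n.bv j hj]
  · rw [State.set_reg, if_neg (by omega), h.n.nv]
  · rw [Function.update_apply]; split_ifs
    · exact hv
    · exact h.n.parM j
  · rw [State.set_reg, if_neg (by omega), h.fv]

lemma Prep.set_bv (h : Prep B M m π ρ Γ s) {x v : ℕ} (hv : v ≤ M) (hMV : M ≤ B.V)
    (hx : 5 * x + 2 < B.Z) : Prep B M m π (Function.update ρ x v) (x :: Γ) (s.set (5 * x + 2) v) := by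
  refine ⟨h.bdd.set hx (hv.trans hMV), ⟨fun j => ?_, fun j hj => ?_, fun j => ?_, h.n.parM,
    fun j hj => ?_, h.n.nvM⟩, fun j => ?_, h.mem⟩
  · rw [State.set_reg, if_neg (by omega), h.n.par]
  · rw [State.set_reg, Function.update_apply]
    by_cases hjx : j = x
    · simp [hjx]
    · rw [if_neg (by omega), if_neg hjx, h.n.bv j (by simpa [hjx] using hj)]
  · rw [State.set_reg, if_neg (by omega), h.n.nv]
  · rw [Function.update_apply]
    split_ifs with hjx
    · exact hv
    · exact h.n.bvM j (by simpa [hjx] using hj)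
  · rw [State.set_reg, if_neg (by omega), h.fv]

lemma Prep.weaken (h : Prep B M m π ρ Γ s) {ρ' : ℕ → ℕ} {Γ' : List ℕ} (hΓ : Γ' ⊆ Γ)
    (hρ : ∀ i ∈ Γ', ρ' i = ρ i) : Prep B M m π ρ' Γ' s :=
  ⟨h.bdd, ⟨h.n.par, fun i hi => by rw [h.n.bv i (hΓ hi), hρ i hi], h.n.nv, h.n.parM,
    fun i hi => by rw [hρ i hi]; exact h.n.bvM i (hΓ hi), h.n.nvM⟩, h.fv, h.mem⟩

lemma Prep.assign (h : Prep B M m π ρ Γ s) (hMV : M ≤ B.V) {i : ℕ} {e : NExpr} (hw : e.wf Γ)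
    (hsz : (M + 2) ^ e.sz ≤ B.V) (hZ : (ParOp.assign i e).maxReg ≤ B.Z)
    (he : e.eval π ρ (fun _ => 0) ≤ M) :
    ∃ s', Run B (ParOp.assign i e) s s' (e.steps + 2) ∧
      Prep B M m (Function.update π i (e.eval π ρ fun _ => 0)) ρ Γ s' := by
  simp only [ParOp.assign, mov, Prog.maxReg, Instr.maxReg] at hZ
  obtain ⟨s1, r1, v1, f1⟩ := NExpr.run e h.bdd h.n hw hsz (t := 0) (by omega)
  have h1 := h.frame f1 r1.1
  have r2 := run_mov r1.1 (d := 5 * i + 1) (a := 5 * 0) (by omega) (by omega)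
  rw [v1] at r2
  exact ⟨_, r1.seq r2, h1.set_par he hMV (by omega)⟩

/-- The instruction computes a parameter of `π` from those in `L`. -/
def ParOp.Valid (M : ℕ) (m : ℕ →₀ ℕ) (π : ℕ → ℕ) (L : List ℕ) : ParOp → Prop
  | read i a => m a = π i
  | put i e => e.wf [] ∧ e.eval (fun j => if j ∈ L then π j else 0) (fun _ => 0) (fun _ => 0) = π i
  | iter i p c e => e.wf [0] ∧ p ∈ L ∧ p ≠ i ∧ ∃ f : ℕ → ℕ, f 0 = c ∧ f (π p) = π i ∧
      (∀ k ≤ π p, f k ≤ M) ∧ ∀ k < π p,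
        e.eval (Function.update (fun j => if j ∈ L then π j else 0) i (f k))
          (Function.update (fun _ => 0) 0 k) (fun _ => 0) = f (k + 1)

/-- A parameter that has not been computed yet is `0` in its register. So the intermediate states
hold `π` cut off to the list `L` of finished parameters. -/
lemma update_restrict (π : ℕ → ℕ) (L : List ℕ) (i : ℕ) :
    Function.update (fun j => if j ∈ L then π j else 0) i (π i) =
      fun j => if j ∈ i :: L then π j else 0 := by
  ext j
  by_cases h : j = i
  · simp [h]
  · simp [h]

lemma ParOp.run {X : ℕ} {L : List ℕ} (o : ParOp)
    (h : Prep B M m (fun j => if j ∈ L then π j else 0) (fun _ => 0) [] s) (hMV : M ≤ B.V)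
    (hM : ∀ i, π i ≤ M) (ho : o.Valid M m π L) (hsz : (M + 2) ^ o.sz ≤ B.V)
    (hZ : o.compile.maxReg ≤ B.Z) (hX : ∀ i p c e, o = .iter i p c e → π p ≤ X) :
    ∃ s', Run B o.compile s s' (o.cost X) ∧
      Prep B M m (fun j => if j ∈ o.target :: L then π j else 0) (fun _ => 0) [] s' := by
  cases o with
  | read i a =>
    simp only [compile, Prog.maxReg, Instr.maxReg] at hZ
    have ha : a ≤ B.V := by
      have := self_le_pow (show 2 ≤ M + 2 by omega) (a + 1)
      simp only [sz] at hsz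
      omega
    have r1 := run_const h.bdd (d := 5 * 0) (c := a) (by omega) ha
    have h1 := h.frame (Frame.set_tmp [] (t := 0) s a le_rfl) r1.1
    have r2 := run_load r1.1 (d := 5 * i + 1) (a := 5 * 0) (by omega)
    have e : (s.set (5 * 0) a).mem ((s.set (5 * 0) a).reg (5 * 0)) = π i := by
      rw [h1.mem, State.set_reg, if_pos rfl]; exact ho
    rw [e] at r2
    refine ⟨_, r1.seq r2, ?_⟩
    rw [target, ← update_restrict]
    exact h1.set_par (hM i) hMV (by omega)
  | put i e =>
    obtain ⟨hw, he⟩ := ho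
    obtain ⟨s', r, hs⟩ := h.assign hMV hw hsz hZ (by rw [he]; exact hM i)
    refine ⟨s', r, ?_⟩
    rw [target, ← update_restrict, ← he]
    exact hs
  | iter i p c e =>
    obtain ⟨hw, hpL, hpi, f, f0, f1, fM, fs⟩ := ho
    have hpX := hX i p c e rfl
    have hZ' := hZ
    simp only [compile, assign, mov, Prog.maxReg, Instr.maxReg] at hZ'
    have hc : c ≤ M := f0 ▸ fM 0 (Nat.zero_le _)
    have r1 := run_const h.bdd (d := 5 * i + 1) (c := c) (by omega) (hc.trans hMV)
    have h1 := h.set_par (i := i) hc hMV (by omega)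
    have r2 := run_const h1.bdd (d := 5 * 0 + 2) (c := 0) (by omega) (Nat.zero_le _)
    have h2 := h1.set_bv (x := 0) (v := 0) (Nat.zero_le _) hMV (by omega)
    have hpp : ∀ k, Function.update (fun j => if j ∈ L then π j else 0) i k p = π p := fun k => by
      rw [Function.update_of_ne hpi, if_pos hpL]
    obtain ⟨s', r3, h3⟩ := run_loop (B := B) (a := 5 * 0 + 2) (b := 5 * p + 1)
      (p := .seq (assign i e) (.seq (.instr (.const (5 * 0) 1))
        (.instr (.add (5 * 0 + 2) (5 * 0 + 2) (5 * 0))))) (n := π p) (c := e.steps + 2 + (1 + 1))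
      (fun k s => Prep B M m (Function.update (fun j => if j ∈ L then π j else 0) i (f k))
        (Function.update (fun _ => 0) 0 k) [0] s)
      (fun k s hs => ⟨hs.bdd, by rw [hs.n.par, hpp], by
        rw [hs.n.bv 0 (by simp)]; simp⟩)
      (fun k s hk hs => by
        obtain ⟨s1, q1, g1⟩ := hs.assign hMV (i := i) hw hsz
          (by simp only [assign, mov, Prog.maxReg, Instr.maxReg]; omega)
          (by rw [fs k hk]; exact fM _ hk)
        rw [fs k hk, Function.update_idem] at g1
        have q2 := run_const g1.bdd (d := 5 * 0) (c := 1) (by omega)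
          (by have := hM p; omega)
        have g2 := g1.frame (Frame.set_tmp [0] (t := 0) s1 1 le_rfl) q2.1
        have b2 : (s1.set (5 * 0) 1).reg (5 * 0 + 2) = k := by
          rw [g2.n.bv 0 (by simp)]; simp
        have hk1 : k + 1 ≤ M := hk.trans_le (hM p)
        have q3 := run_add g2.bdd (d := 5 * 0 + 2) (a := 5 * 0 + 2) (b := 5 * 0) (by omega)
          (by rw [b2, State.set_reg, if_pos rfl]; omega)
        rw [b2, State.set_reg, if_pos rfl] at q3
        refine ⟨_, q1.seq (q2.seq q3), ?_⟩
        refine (g2.set_bv (x := 0) hk1 hMV (by omega)).weaken (by simp) fun j hj => ?_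
        rw [Function.update_idem])
      (Nat.zero_le _) (by rw [f0]; exact h2)
    refine ⟨s', ((r1.seq r2).seq r3).mono ?_, ?_⟩
    · rw [cost, Nat.sub_zero]
      have := Nat.mul_le_mul_right (e.steps + 5) hpX
      have e1 : e.steps + 2 + (1 + 1) + 1 = e.steps + 5 := by ring
      rw [e1]
      omega
    · rw [target, ← update_restrict, ← f1]
      exact h3.weaken (by simp) (by simp)

/-- The list of instructions computes parameters of `π`, starting with those in `L`. -/
def ParOp.ValidList (M : ℕ) (m : ℕ →₀ ℕ) (π : ℕ → ℕ) : List ℕ → List ParOp → Prop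
  | _, [] => True
  | L, o :: l => o.Valid M m π L ∧ ValidList M m π (o.target :: L) l

/-- The parameters computed by a list of instructions. -/
def ParOp.targets : List ℕ → List ParOp → List ℕ
  | L, [] => L
  | L, o :: l => targets (o.target :: L) l

lemma ParOp.run_list {X : ℕ} (l : List ParOp) {L : List ℕ}
    (h : Prep B M m (fun j => if j ∈ L then π j else 0) (fun _ => 0) [] s) (hMV : M ≤ B.V)
    (hM : ∀ i, π i ≤ M) (ho : ValidList M m π L l) (hsz : (M + 2) ^ szList l ≤ B.V)
    (hZ : (compileList l).maxReg ≤ B.Z) (hX : ∀ i p c e, ParOp.iter i p c e ∈ l → π p ≤ X) :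
    ∃ s', Run B (compileList l) s s' (costList X l) ∧
      Prep B M m (fun j => if j ∈ targets L l then π j else 0) (fun _ => 0) [] s' := by
  induction l generalizing L s with
  | nil => exact ⟨s, Run.skip h.bdd, h⟩
  | cons o l ih =>
    simp only [compileList, Prog.maxReg] at hZ
    have hp : ∀ k ≤ szList (o :: l), (M + 2) ^ k ≤ B.V := fun k hk =>
      (Nat.pow_le_pow_right (by omega) hk).trans hsz
    obtain ⟨s1, r1, h1⟩ := o.run h hMV hM ho.1 (hp _ (by simp [szList])) (by omega) (X := X)
      fun i p c e he => hX i p c e (by simp [he])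
    obtain ⟨s2, r2, h2⟩ := ih h1 ho.2 (hp _ (by simp [szList])) (by omega)
      fun i p c e he => hX i p c e (by simp [he])
    exact ⟨s2, r1.seq r2, h2⟩

lemma ParOp.costList_le {X : ℕ} (hX : 1 ≤ X) (l : List ParOp) : costList X l ≤ costList 1 l * X := by
  induction l with
  | nil => simpa [costList] using hX
  | cons o l ih =>
    rw [costList, costList, add_mul]
    refine Nat.add_le_add ?_ ih
    cases o <;> simp only [cost] <;> nlinarith

end

end TensorCPD

/-! ### The numerical parameters of the search. -/

namespace TensorCPD

/-- The parameters for given number of elements, dimensions, and rank. -/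
def params (q n₀ n₁ n₂ R : ℕ) : ℕ → ℕ
  | 0 => q
  | 1 => n₀
  | 2 => n₁
  | 3 => n₂
  | 4 => R
  -- The side of the arrays is the cube of the input size: the longest rows, the guessed elements
  -- and the output, are of quadratic length.
  | 5 => (q + n₀ + n₁ + n₂ + R + 2) ^ 3 - 1
  | 6 => (q + n₀ + n₁ + n₂ + R + 2) ^ 3
  | 7 => 5 + 2 * (q * q) + n₀ * (n₁ * n₂)
  | 8 => n₁ * n₂
  | 9 => 5 + 2 * (q * q)
  | 10 => n₀ * (n₁ * n₂) - 1
  | 11 => q - 1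
  | 12 => 5 + q * q
  | 13 => R / n₀
  -- The negative terms are collected on the right, so that truncated subtraction acts as the
  -- maximum with `0`. The rank put in here is `r_*`.
  | 14 => n₀ + ((R + 1) * (n₁ + n₂) + (R / n₀ + 1) * (R / n₀ + 1) -
      (n₀ + (R / n₀ + 1)) * (n₁ + n₂))
  | 15 => q ^ n₀
  | 16 => q ^ (n₀ + ((R + 1) * (n₁ + n₂) + (R / n₀ + 1) * (R / n₀ + 1) -
      (n₀ + (R / n₀ + 1)) * (n₁ + n₂)))
  | 17 => q ^ n₂
  | 18 => R + 1
  | 19 => 1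
  | 20 => 1 + (n₀ + n₁ + n₂) * R
  | 21 => R + 1 - n₀
  | 22 => 5
  | _ => 0

/-- The instructions that compute the parameters. -/
def paramOps : List ParOp :=
  let S : NExpr := .add (.add (.add (.add (.add (.par 0) (.par 1)) (.par 2)) (.par 3)) (.par 4))
    (.const 2)
  let r : NExpr := .add (.par 13) (.const 1)
  [.read 0 0, .read 1 1, .read 2 2, .read 3 3, .read 4 4, .put 19 (.const 1),
    .put 18 (.add (.par 4) (.const 1)),
    .iter 13 4 0 (.add (.par 13) (.sub (.const 1)
      (.sub (.mul (.add (.bv 0) (.const 1)) (.par 1)) (.par 4)))),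
    .put 8 (.mul (.par 2) (.par 3)),
    .put 21 (.sub (.par 18) (.par 1)),
    .put 14 (.add (.par 1) (.sub (.add (.mul (.par 18) (.add (.par 2) (.par 3))) (.mul r r))
      (.mul (.add (.par 1) r) (.add (.par 2) (.par 3))))),
    .iter 15 1 1 (.mul (.par 15) (.par 0)), .iter 16 14 1 (.mul (.par 16) (.par 0)),
    .iter 17 3 1 (.mul (.par 17) (.par 0)),
    .put 20 (.add (.const 1) (.mul (.add (.add (.par 1) (.par 2)) (.par 3)) (.par 4))),
    .put 10 (.sub (.mul (.par 1) (.par 8)) (.const 1)), .put 11 (.sub (.par 0) (.const 1)),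
    .put 22 (.const 5), .put 12 (.add (.const 5) (.mul (.par 0) (.par 0))),
    .put 9 (.add (.const 5) (.mul (.const 2) (.mul (.par 0) (.par 0)))),
    .put 7 (.add (.par 9) (.mul (.par 1) (.par 8))),
    .put 6 (.mul (.mul S S) S), .put 5 (.sub (.par 6) (.const 1))]

section

variable {q n₀ n₁ n₂ R : ℕ}

/-- The truncated difference `1 - ((k + 1) * n₀ - R)` is `1` exactly if `(k + 1) * n₀ ≤ R`. Summing
over `k < R` counts up to the quotient without a division instruction. -/
lemma division_step (hn : 1 ≤ n₀) (k : ℕ) :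
    min k (R / n₀) + (1 - ((k + 1) * n₀ - R)) = min (k + 1) (R / n₀) := by
  by_cases h : k + 1 ≤ R / n₀
  · have h1 := (Nat.le_div_iff_mul_le hn).mp h
    rw [min_eq_left (by omega), min_eq_left h]
    omega
  · have h1 := mt (Nat.le_div_iff_mul_le hn).mpr h
    rw [min_eq_right (by omega), min_eq_right (by omega)]
    omega

lemma paramOps_valid {M : ℕ} {m : ℕ →₀ ℕ} (hn : 1 ≤ n₀) (hq : 1 ≤ q) (hM : ∀ i, params q n₀ n₁ n₂ R i ≤ M)
    (h0 : m 0 = q) (h1 : m 1 = n₀) (h2 : m 2 = n₁) (h3 : m 3 = n₂) (h4 : m 4 = R) :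
    ParOp.ValidList M m (params q n₀ n₁ n₂ R) [] paramOps := by
  refine ⟨h0, h1, h2, h3, h4, ⟨rfl, rfl⟩, ⟨rfl, rfl⟩, ⟨rfl, by simp [ParOp.target], by decide,
    fun k => min k (R / n₀), by simp, ?_, fun k _ => (min_le_right _ _).trans (hM 13), fun k _ => ?_⟩,
    ⟨rfl, rfl⟩, ⟨rfl, rfl⟩, ⟨rfl, rfl⟩,
    ⟨rfl, by simp [ParOp.target], by decide, fun k => q ^ k, rfl, rfl,
      fun k hk => (Nat.pow_le_pow_right hq hk).trans (hM 15), fun k _ => ?_⟩,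
    ⟨rfl, by simp [ParOp.target], by decide, fun k => q ^ k, rfl, rfl,
      fun k hk => (Nat.pow_le_pow_right hq hk).trans (hM 16), fun k _ => ?_⟩,
    ⟨rfl, by simp [ParOp.target], by decide, fun k => q ^ k, rfl, rfl,
      fun k hk => (Nat.pow_le_pow_right hq hk).trans (hM 17), fun k _ => ?_⟩,
    ⟨rfl, rfl⟩, ⟨rfl, rfl⟩, ⟨rfl, rfl⟩, ⟨rfl, rfl⟩, ⟨rfl, rfl⟩, ⟨rfl, rfl⟩, ⟨rfl, rfl⟩,
    ⟨rfl, ?_⟩, ⟨rfl, rfl⟩, trivial⟩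
  · exact min_eq_right (Nat.div_le_self _ _)
  · exact division_step hn k
  · exact (pow_succ q k).symm
  · exact (pow_succ q k).symm
  · exact (pow_succ q k).symm
  · change (q + n₀ + n₁ + n₂ + R + 2) * (q + n₀ + n₁ + n₂ + R + 2) * (q + n₀ + n₁ + n₂ + R + 2) =
      (q + n₀ + n₁ + n₂ + R + 2) ^ 3
    ring

lemma params_restrict : (fun j => if j ∈ ParOp.targets [] paramOps then params q n₀ n₁ n₂ R j else 0) =
    params q n₀ n₁ n₂ R := by
  ext j
  by_cases h : j ∈ ParOp.targets [] paramOps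
  · simp only [h, if_true]
  · simp only [h, if_false]
    have : 22 < j := by
      by_contra hj
      exact h ((by decide : ∀ j ≤ 22, j ∈ ParOp.targets [] paramOps) j (by omega))
    obtain ⟨k, rfl⟩ := Nat.exists_eq_add_of_lt this
    rw [show 22 + k + 1 = k + 23 by ring]
    rfl

lemma params_ok (hq : 1 ≤ q) (h0 : 1 ≤ n₀) (h1 : 1 ≤ n₁) (h2 : 1 ≤ n₂) :
    ParOK q (params q n₀ n₁ n₂ R) := by
  have hS : 1 ≤ (q + n₀ + n₁ + n₂ + R + 2) ^ 3 := Nat.one_le_pow _ _ (by omega)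
  have hn : 1 ≤ n₀ * (n₁ * n₂) := Nat.mul_pos h0 (Nat.mul_pos h1 h2)
  refine ⟨rfl, ?_, rfl, rfl, rfl, rfl, ?_⟩ <;> simp only [params] <;> omega

lemma params_lay (hq : 1 ≤ q) (h0 : 1 ≤ n₀) (h1 : 1 ≤ n₁) (h2 : 1 ≤ n₂) :
    Lay (params q n₀ n₁ n₂ R) := by
  set S := q + n₀ + n₁ + n₂ + R + 2 with hS
  have hS1 : 1 ≤ S ^ 3 := Nat.one_le_pow _ _ (by omega)
  have hS3 : 3 ≤ S := by omega
  have hcube : S ^ 3 = S * S * S := by ring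
  have hSS : S ≤ S * S := Nat.le_mul_self S
  have hSSS : S * S * 3 ≤ S ^ 3 := by rw [hcube]; exact Nat.mul_le_mul_left _ hS3
  have hr : R / n₀ + 1 ≤ S := by have := Nat.div_le_self R n₀; omega
  have hr2 : (R / n₀ + 1) * (R / n₀ + 1) ≤ S * S := Nat.mul_le_mul hr hr
  have hk : (R + 1) * (n₁ + n₂) ≤ S * S := Nat.mul_le_mul (by omega) (by omega)
  have hl : (n₀ + n₁ + n₂) * R ≤ S * S := Nat.mul_le_mul (by omega) (by omega)
  have h12 : n₁ * n₂ ≤ S * S := Nat.mul_le_mul (by omega) (by omega)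
  have hn : 1 ≤ n₀ * (n₁ * n₂) := Nat.mul_pos h0 (Nat.mul_pos h1 h2)
  refine ⟨?_, ?_, ?_, ?_, ?_, ?_, ?_, rfl, ?_, rfl, rfl, rfl, Nat.mul_div_le R n₀, rfl, rfl, rfl, rfl,
    ?_, h0, h1, h2⟩ <;> simp only [params, ← hS]
  all_goals omega

/-- With `r = r_* + a`, the squares differ by `a * (2 * r_* + a)`. This is at most the saving `a *
(n₁ + n₂)`, since `r_* + a ≤ n₁` and `r_* ≤ n₂`. So the smallest possible rank needs the most
guessed elements. -/
lemma le_params_size {r : ℕ} (h0 : 1 ≤ n₀) (hr : R / n₀ < r) (hr1 : r ≤ n₁) (hr2 : r ≤ n₂)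
    (hrk : r ≤ R + 1 - n₀) : n₀ + ((R + 1 - n₀ - r) * (n₁ + n₂) + r * r) ≤
      params q n₀ n₁ n₂ R 14 := by
  simp only [params]
  refine Nat.add_le_add_left (Nat.le_sub_of_add_le ?_) _
  generalize R / n₀ = c at hr ⊢
  obtain ⟨a, rfl⟩ := Nat.exists_eq_add_of_le (show c + 1 ≤ r from hr)
  obtain ⟨b, hb⟩ := Nat.exists_eq_add_of_le (show n₀ + (c + 1 + a) ≤ R + 1 by omega)
  have e : R + 1 - n₀ - (c + 1 + a) = b := by omega
  rw [e, hb]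
  nlinarith [Nat.mul_le_mul_left a (show 2 * (c + 1) + a ≤ n₁ + n₂ by omega)]

end

end TensorCPD

namespace TensorCPD

/-! ### Input and output -/

/-- Copying the first entries (as many as parameter `20` says) of row `0` of array `22` to the
beginning of the memory. -/
def copyOut : Prog :=
  .seq (.instr (.const (5 * 0 + 2) 0)) (.loop (5 * 0 + 2) (5 * 20 + 1)
    (.seq ((adrE 22 (.const 0) (.bv 0)).compile 0) (.seq (.instr (.load (5 * 0) (5 * 0)))
      (.seq (.instr (.store (5 * 0 + 2) (5 * 0))) (.seq (.instr (.const (5 * 0) 1))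
        (.instr (.add (5 * 0 + 2) (5 * 0 + 2) (5 * 0))))))))

/-- The whole program. -/
def program : Prog := .seq (ParOp.compileList paramOps) (.seq mainCmd.compile copyOut)

section

variable {F : Type*} [Field F] {q : ℕ} {code : F ≃ Fin q}

lemma NRel.set_bv {π ρ ν : ℕ → ℕ} {Γ : List ℕ} {M : ℕ} {s : State} (h : NRel π ρ ν Γ M s) {x v : ℕ}
    (hv : v ≤ M) : NRel π (Function.update ρ x v) ν (x :: Γ) M (s.set (5 * x + 2) v) := by
  refine ⟨fun j => ?_, fun j hj => ?_, fun j => ?_, h.parM, fun j hj => ?_, h.nvM⟩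
  · rw [State.set_reg, if_neg (by omega), h.par]
  · rw [State.set_reg, Function.update_apply]
    by_cases hjx : j = x
    · simp [hjx]
    · rw [if_neg (by omega), if_neg hjx, h.bv j (by simpa [hjx] using hj)]
  · rw [State.set_reg, if_neg (by omega), h.nv]
  · rw [Function.update_apply]
    split_ifs with hjx
    · exact hv
    · exact h.bvM j (by simpa [hjx] using hj)

/-- The source, row `0` of array `22`, lies beyond `22 * π 6 * π 6 ≥ π 20`, so the copied entries
never overwrite what is still to be read. The input at the beginning of the memory is no longer
needed. -/
lemma run_copyOut {π : ℕ → ℕ} {tin : ℕ → F} {B : Bounds} {M : ℕ} {ρ : ℕ → ℕ} {σ : HS F} {s : State}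
    (hπ : ParOK q π) (h20 : π 20 ≤ π 6) (hMV : M ≤ B.V) (hW : π 7 ≤ B.W) (h6W : π 6 ≤ B.W)
    (hV : (M + 2) ^ (adrE 22 (.const 0) (.bv 0)).sz ≤ B.V) (hZ : copyOut.maxReg ≤ B.Z)
    (h : Rel code π tin B [] M ρ σ s) :
    ∃ s', Run B copyOut s s' (1 + (π 20 * ((adrE 22 (.const 0) (.bv 0)).steps + 5) + 1)) ∧
      ∀ j < π 20, s'.mem j = code (σ.arr 22 0 j) := by
  have hside := hπ.side
  have hZ' := hZ
  simp only [copyOut, Prog.maxReg, Instr.maxReg] at hZ'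
  have r1 := run_const h.bdd (d := 5 * 0 + 2) (c := 0) (by omega) (Nat.zero_le _)
  have h1 := h.n.set_bv (x := 0) (Nat.zero_le M)
  have hadr : ∀ j k, k < π 20 → adr π 22 0 j ≠ k := by
    intro j k hk
    have h6 : 1 ≤ π 6 := by omega
    have : π 6 ≤ 22 * π 6 * π 6 := by nlinarith
    simp only [adr, add_zero]
    omega
  obtain ⟨s', r2, h2⟩ := run_loop (B := B) (a := 5 * 0 + 2) (b := 5 * 20 + 1)
    (p := .seq ((adrE 22 (.const 0) (.bv 0)).compile 0) (.seq (.instr (.load (5 * 0) (5 * 0)))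
      (.seq (.instr (.store (5 * 0 + 2) (5 * 0))) (.seq (.instr (.const (5 * 0) 1))
        (.instr (.add (5 * 0 + 2) (5 * 0 + 2) (5 * 0)))))))
    (n := π 20) (c := (adrE 22 (.const 0) (.bv 0)).steps + (1 + (1 + (1 + 1))))
    (fun k s => Bdd B s ∧ NRel π (Function.update ρ 0 k) σ.nv [0] M s ∧
      (∀ j < k, s.mem j = code (σ.arr 22 0 j)) ∧
      ∀ j < π 20, s.mem (adr π 22 0 j) = code (σ.arr 22 0 j))
    (fun k s hs => ⟨hs.1, hs.2.1.par 20, by rw [hs.2.1.bv 0 (by simp)]; simp⟩)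
    (fun k s hk ⟨i1, i2, i3, i4⟩ => by
      obtain ⟨s1, q1, v1, f1⟩ := NExpr.run (adrE 22 (.const 0) (.bv 0)) i1 i2 rfl hV (t := 0)
        (by omega)
      have e1 : (adrE 22 (.const 0) (.bv 0)).eval π (Function.update ρ 0 k) σ.nv = adr π 22 0 k := by
        simp [adrE, NExpr.cap, adr]
        omega
      rw [e1] at v1
      have q2 := run_load q1.1 (d := 5 * 0) (a := 5 * 0) (by omega)
      have e2 : s1.mem (s1.reg (5 * 0)) = code (σ.arr 22 0 k) := by rw [v1, f1.mem, i4 k hk]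
      rw [e2] at q2
      have n2 := (i2.frame f1).frame (Frame.set_tmp [0] (t := 0) s1 (code (σ.arr 22 0 k)) le_rfl)
      have b2 : (s1.set (5 * 0) (code (σ.arr 22 0 k))).reg (5 * 0 + 2) = k := by
        rw [n2.bv 0 (by simp)]; simp
      have q3 := run_store q2.1 (a := 5 * 0 + 2) (b := 5 * 0) (by rw [b2]; omega)
      rw [b2, State.set_reg, if_pos rfl] at q3
      set s3 := (s1.set (5 * 0) (code (σ.arr 22 0 k))).put k (code (σ.arr 22 0 k)) with hs3
      have q4 := run_const q3.1 (d := 5 * 0) (c := 1) (by omega)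
        (by have := i2.parM 20; omega)
      have n4 : NRel π (Function.update ρ 0 k) σ.nv [0] M (s3.set (5 * 0) 1) :=
        NRel.frame (s := s3) (t := 0) ⟨n2.par, n2.bv, n2.nv, n2.parM, n2.bvM, n2.nvM⟩
          (Frame.set_tmp [0] s3 1 le_rfl)
      have b4 : (s3.set (5 * 0) 1).reg (5 * 0 + 2) = k := by
        rw [n4.bv 0 (by simp)]; simp
      have hk1 : k + 1 ≤ M := hk.trans_le (i2.parM 20)
      have q5 := run_add q4.1 (d := 5 * 0 + 2) (a := 5 * 0 + 2) (b := 5 * 0) (by omega)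
        (by rw [b4, State.set_reg, if_pos rfl]; omega)
      rw [b4, State.set_reg, if_pos rfl] at q5
      refine ⟨_, q1.seq (q2.seq (q3.seq (q4.seq q5))), q5.1, ?_, fun j hj => ?_, fun j hj => ?_⟩
      · have := n4.set_bv (x := 0) hk1
        rw [Function.update_idem] at this
        exact ⟨this.par, fun i hi => this.bv i (by simpa using hi), this.nv, this.parM,
          fun i hi => this.bvM i (by simpa using hi), this.nvM⟩
      · rw [State.set_mem, State.set_mem, hs3, State.put_mem]
        split_ifs with hjk
        · rw [hjk]
        · rw [State.set_mem, f1.mem, i3 j (by omega)]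
      · rw [State.set_mem, State.set_mem, hs3, State.put_mem, if_neg (hadr j k hk), State.set_mem,
          f1.mem, i4 j hj])
    (Nat.zero_le _) ⟨r1.1, h1, fun j hj => absurd hj (Nat.not_lt_zero _), fun j hj =>
      h.arr 22 0 j (Nat.zero_le _) (by omega)⟩
  refine ⟨s', (r1.seq r2).mono ?_, h2.2.2.1⟩
  rw [Nat.sub_zero]

/-! ### The encoding of the input -/

lemma getD_ofFn {n : ℕ} (f : Fin n → ℕ) {i : ℕ} (h : i < n) : (List.ofFn f).getD i 0 = f ⟨i, h⟩ := by
  rw [List.getD_eq_getElem _ _ (by simpa using h), List.getElem_ofFn]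

variable {n₀ n₁ n₂ R : ℕ}

lemma encodeInput_length (T : Tensor3 F n₀ n₁ n₂) :
    (encodeInput code R T).length = 5 + 2 * (q * q) + n₀ * (n₁ * n₂) := by
  simp [encodeInput, encodeMatrix, encodeTensor]; ring

lemma encodeInput_add (T : Tensor3 F n₀ n₁ n₂) (a b : F) :
    (encodeInput code R T).getD (5 + (code a * q + code b)) 0 = code (a + b) := by
  have h := table_index_lt (code := code) a b
  have hb := (code b).2
  have hq : 0 < q := by omega
  rw [encodeInput, List.getD_append _ _ _ _ (by simp [encodeMatrix]; omega),
    List.getD_append _ _ _ _ (by simp [encodeMatrix]; omega),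
    List.getD_append_right _ _ _ _ (by simp)]
  simp only [List.length_cons, List.length_nil, encodeMatrix]
  rw [show 5 + (code a * q + code b : ℕ) - (0 + 1 + 1 + 1 + 1 + 1) = code a * q + code b by omega,
    getD_ofFn _ h]
  simp only [Matrix.of_apply]
  congr 2
  · congr 1
    · rw [Equiv.symm_apply_eq]
      ext
      simp only [Fin.divNat]
      rw [Nat.add_comm, Nat.add_mul_div_right _ _ hq, Nat.div_eq_of_lt hb, zero_add]
    · rw [Equiv.symm_apply_eq]
      ext
      simp only [Fin.modNat]
      rw [Nat.mul_add_mod', Nat.mod_eq_of_lt hb]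

lemma encodeInput_mul (T : Tensor3 F n₀ n₁ n₂) (a b : F) :
    (encodeInput code R T).getD (5 + q * q + (code a * q + code b)) 0 = code (a * b) := by
  have h := table_index_lt (code := code) a b
  have hb := (code b).2
  have hq : 0 < q := by omega
  rw [encodeInput, List.getD_append _ _ _ _ (by simp [encodeMatrix]; omega),
    List.getD_append_right _ _ _ _ (by simp [encodeMatrix]; omega)]
  simp only [List.length_append, List.length_cons, List.length_nil, encodeMatrix, List.length_ofFn]
  rw [show 5 + q * q + (code a * q + code b : ℕ) - (0 + 1 + 1 + 1 + 1 + 1 + q * q) =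
    code a * q + code b by omega, getD_ofFn _ h]
  simp only [Matrix.of_apply]
  congr 2
  · congr 1
    · rw [Equiv.symm_apply_eq]
      ext
      simp only [Fin.divNat]
      rw [Nat.add_comm, Nat.add_mul_div_right _ _ hq, Nat.div_eq_of_lt hb, zero_add]
    · rw [Equiv.symm_apply_eq]
      ext
      simp only [Fin.modNat]
      rw [Nat.mul_add_mod', Nat.mod_eq_of_lt hb]

/-- The entries of a tensor in row-major order. -/
def entry (T : Tensor3 F n₀ n₁ n₂) (l : ℕ) : F :=
  if h : l < n₀ * (n₁ * n₂) then
    let x : Fin (n₀ * (n₁ * n₂)) := ⟨l, h⟩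
    T x.divNat x.modNat.divNat x.modNat.modNat
  else 0

lemma encodeInput_entry (T : Tensor3 F n₀ n₁ n₂) {l : ℕ} (h : l < n₀ * (n₁ * n₂)) :
    (encodeInput code R T).getD (5 + 2 * (q * q) + l) 0 = code (entry T l) := by
  rw [encodeInput, List.getD_append_right _ _ _ _ (by simp [encodeMatrix]; omega)]
  simp only [List.length_append, List.length_cons, List.length_nil, encodeMatrix, List.length_ofFn,
    encodeTensor]
  rw [show 5 + 2 * (q * q) + l - (0 + 1 + 1 + 1 + 1 + 1 + q * q + q * q) = l by omega,
    getD_ofFn _ h, entry, dif_pos h]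

lemma entry_index (T : Tensor3 F n₀ n₁ n₂) (i : Fin n₀) (j : Fin n₁) (k : Fin n₂) :
    entry T (i * (n₁ * n₂) + (j * n₂ + k)) = T i j k := by
  have hjk : (j : ℕ) * n₂ + k < n₁ * n₂ := by have := j.2; have := k.2; nlinarith
  have hlt : (i : ℕ) * (n₁ * n₂) + (j * n₂ + k) < n₀ * (n₁ * n₂) := by
    have := Nat.mul_le_mul_right (n₁ * n₂) (show (i : ℕ) + 1 ≤ n₀ from i.2)
    rw [Nat.succ_mul] at this
    omega
  have hk := k.2
  have e1 : ((i : ℕ) * (n₁ * n₂) + (j * n₂ + k)) / (n₁ * n₂) = i := by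
    rw [Nat.add_comm, Nat.add_mul_div_right _ _ (by omega), Nat.div_eq_of_lt hjk, zero_add]
  have e2 : ((i : ℕ) * (n₁ * n₂) + (j * n₂ + k)) % (n₁ * n₂) = j * n₂ + k := by
    rw [Nat.mul_add_mod', Nat.mod_eq_of_lt hjk]
  rw [entry, dif_pos hlt]
  refine congr (congr (congrArg T ?_) ?_) ?_
  · ext; exact e1
  · ext
    simp only [Fin.divNat, Fin.modNat, e2]
    rw [Nat.add_comm, Nat.add_mul_div_right _ _ (by omega), Nat.div_eq_of_lt hk, zero_add]
  · ext
    simp only [Fin.modNat, e2]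
    rw [Nat.mul_add_mod', Nat.mod_eq_of_lt hk]

lemma encodeInput_le (T : Tensor3 F n₀ n₁ n₂) {V : ℕ} (hq : q ≤ V) (h0 : n₀ ≤ V) (h1 : n₁ ≤ V)
    (h2 : n₂ ≤ V) (h3 : R ≤ V) (i : ℕ) : (encodeInput code R T).getD i 0 ≤ V := by
  have key : ∀ x ∈ encodeInput code R T, x ≤ V := by
    intro x hx
    simp only [encodeInput, encodeMatrix, encodeTensor, List.mem_append, List.mem_cons,
      List.not_mem_nil, or_false, List.mem_ofFn] at hx
    rcases hx with (((rfl | rfl | rfl | rfl | rfl) | ⟨y, rfl⟩) | ⟨y, rfl⟩) | ⟨y, rfl⟩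
    all_goals first | assumption | exact (Fin.is_lt _).le.trans hq
  by_cases hi : i < (encodeInput code R T).length
  · rw [List.getD_eq_getElem _ _ hi]
    exact key _ (List.getElem_mem _)
  · rw [List.getD_eq_default _ _ (by omega)]
    exact Nat.zero_le _

end

end TensorCPD

/-! ### Correctness of the complete program on encoded inputs. -/

namespace TensorCPD

section

variable {F : Type*} [Field F] {q : ℕ} {code : F ≃ Fin q} {n₀ n₁ n₂ R : ℕ}

lemma Concise.pos {T : Tensor3 F n₀ n₁ n₂} (hT : Concise T) (h0 : 1 ≤ n₀) : 1 ≤ n₁ ∧ 1 ≤ n₂ := by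
  have hne := hT.1.ne_zero ⟨0, h0⟩
  constructor
  · by_contra h
    obtain rfl : n₁ = 0 := by omega
    exact hne (funext fun j => j.elim0)
  · by_contra h
    obtain rfl : n₂ = 0 := by omega
    exact hne (funext fun j => funext fun k => k.elim0)

lemma one_lt_card (code : F ≃ Fin q) : 1 < q := by
  by_contra h
  have h0 := (code 0).2
  have h1 := (code 1).2
  exact absurd (code.injective (Fin.ext (by omega))) (zero_ne_one (α := F))

lemma hasSol_of_isCPD {T : Tensor3 F n₀ n₁ n₂} {A₀ : Matrix (Fin n₀) (Fin R) F}
    {A₁ : Matrix (Fin n₁) (Fin R) F} {A₂ : Matrix (Fin n₂) (Fin R) F} (h : IsCPD T A₀ A₁ A₂) :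
    HasSol (params q n₀ n₁ n₂ R) (entry T) := by
  refine ⟨fun i => ext0 fun r => ext0 (fun i => A₀ i r) i, fun i => ext0 fun r => ext0 (fun i => A₁ i r) i,
    fun i => ext0 fun r => ext0 (fun i => A₂ i r) i, fun i hi j hj k hk => ?_⟩
  refine (entry_index T ⟨i, hi⟩ ⟨j, hj⟩ ⟨k, hk⟩).trans ((h _ _ _).trans ?_)
  change _ = ∑ r ∈ Finset.range R, _
  rw [Finset.sum_range]
  refine Finset.sum_congr rfl fun r _ => ?_
  simp only [ext0_val]
  exact (mul_assoc _ _ _).trans (congrArg₂ _ (ext0_val (fun i => A₀ i r) ⟨i, hi⟩).symm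
    (congrArg₂ _ (ext0_val (fun j => A₁ j r) ⟨j, hj⟩).symm
      (ext0_val (fun k => A₂ k r) ⟨k, hk⟩).symm))

lemma encodeMatrix_length {m n : ℕ} (A : Matrix (Fin m) (Fin n) F) :
    (encodeMatrix code A).length = m * n := by simp [encodeMatrix]

lemma encodeMatrix_of {m n : ℕ} (A : ℕ → ℕ → F) {l : ℕ}
    (h : l < (encodeMatrix code (Matrix.of fun (i : Fin m) (j : Fin n) => A i j)).length) :
    (encodeMatrix code (Matrix.of fun (i : Fin m) (j : Fin n) => A i j))[l] =
      code (A (l / n) (l % n)) := by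
  simp only [encodeMatrix, List.getElem_ofFn]
  rfl

lemma solves_of_result {T : Tensor3 F n₀ n₁ n₂} {σ : HS F} {s : State}
    (h : Result code (params q n₀ n₁ n₂ R) (entry T) σ)
    (hs : ∀ j < params q n₀ n₁ n₂ R 20, s.mem j = code (σ.arr 22 0 j)) : Solves code R T s := by
  have hq := one_lt_card code
  change ∀ j < 1 + (n₀ + n₁ + n₂) * R, _ at hs
  have m1 : (n₀ + n₁ + n₂) * R = n₀ * R + n₁ * R + n₂ * R := by ring
  have m2 : (n₀ + n₁) * R = n₀ * R + n₁ * R := by ring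
  rcases h with ⟨h0, hno⟩ | ⟨h1, A, B, C, hABC, hA, hB, hC⟩
  · refine Or.inr ⟨?_, fun j hj => ?_⟩
    · rintro ⟨A₀, A₁, A₂, h⟩
      exact hno (hasSol_of_isCPD h)
    · obtain rfl : j = 0 := by simpa using hj
      rw [hs 0 (by omega), h0, code_elem _ (by omega)]
      rfl
  · change ∀ l < n₀ * R, σ.arr 22 0 (1 + l) = A (l / R) (l % R) at hA
    change ∀ l < n₁ * R, σ.arr 22 0 (1 + n₀ * R + l) = B (l / R) (l % R) at hB
    change ∀ l < n₂ * R, σ.arr 22 0 (1 + (n₀ + n₁) * R + l) = C (l / R) (l % R) at hC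
    refine Or.inl ⟨Matrix.of fun i r => A i r, Matrix.of fun j r => B j r, Matrix.of fun k r => C k r,
      fun i j k => ?_, fun l hl => ?_⟩
    · rw [← entry_index T i j k]
      refine (hABC i i.2 j j.2 k k.2).trans ?_
      change ∑ r ∈ Finset.range R, _ = _
      rw [Finset.sum_range]
      exact Finset.sum_congr rfl fun r _ => (mul_assoc _ _ _).symm
    · rcases Nat.eq_zero_or_pos l with rfl | hpos
      · rw [hs 0 (by omega), h1, code_elem _ hq]
        rfl
      obtain ⟨l, rfl⟩ := Nat.exists_eq_add_of_le' hpos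
      simp only [List.length_cons, List.length_append, encodeMatrix_length] at hl
      rw [List.getElem_cons_succ, List.getElem_append]
      split_ifs with i1
      · rw [List.getElem_append]
        split_ifs with i2
        · rw [encodeMatrix_of, ← hA l (by simpa [encodeMatrix_length] using i2), add_comm 1,
            hs _ (by omega)]
        · rw [encodeMatrix_of, encodeMatrix_length]
          simp only [encodeMatrix_length, List.length_append] at i1 i2
          rw [← hB (l - n₀ * R) (show _ < n₁ * R by omega), hs _ (by omega)]
          congr 3
          omega
      · rw [encodeMatrix_of]
        simp only [encodeMatrix_length, List.length_append] at i1 ⊢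
        rw [← hC (l - (n₀ * R + n₁ * R)) (show _ < n₂ * R by omega), hs _ (by omega)]
        congr 3
        omega

/-- The program solves the problem, for any bounds that are large enough. -/
theorem run_program (code : F ≃ Fin q) (T : Tensor3 F n₀ n₁ n₂) (hn : 1 ≤ n₀) (hT : Concise T)
    {B : Bounds} {M b X : ℕ} (hb : ∀ i, params q n₀ n₁ n₂ R i ≤ b)
    (hbM : b + mainCmd.steps (params q n₀ n₁ n₂ R) ≤ M)
    (hV : (M + 2) ^ (1 + ParOp.szList paramOps + mainCmd.sz + (adrE 22 (.const 0) (.bv 0)).sz) ≤ B.V)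
    (hZ : program.maxReg ≤ B.Z) (hW : params q n₀ n₁ n₂ R 7 +
      24 * params q n₀ n₁ n₂ R 6 * params q n₀ n₁ n₂ R 6 ≤ B.W)
    (hX : params q n₀ n₁ n₂ R 6 ≤ X) :
    ∃ s', Run B program (State.init (encodeInput code R T)) s'
      (ParOp.costList X paramOps + (mainCmd.steps (params q n₀ n₁ n₂ R) +
        (1 + (X * ((adrE 22 (.const 0) (.bv 0)).steps + 5) + 1)))) ∧ Solves code R T s' := by
  have hq := one_lt_card code
  obtain ⟨h1, h2⟩ := hT.pos hn
  have hπ : ParOK q (params q n₀ n₁ n₂ R) := params_ok hq.le hn h1 h2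
  have hl : Lay (params q n₀ n₁ n₂ R) := params_lay hq.le hn h1 h2
  have hp : ∀ k ≤ 1 + ParOp.szList paramOps + mainCmd.sz + (adrE 22 (.const 0) (.bv 0)).sz,
      (M + 2) ^ k ≤ B.V := fun k hk => (Nat.pow_le_pow_right (by omega) hk).trans hV
  have hMV : M ≤ B.V := le_trans (by rw [pow_one]; omega) (hp 1 (by omega))
  have hM : ∀ i, params q n₀ n₁ n₂ R i ≤ M := fun i => (hb i).trans (by omega)
  simp only [program, Prog.maxReg] at hZ
  have hmem : ∀ i, (State.init (encodeInput code R T)).mem i = (encodeInput code R T).getD i 0 :=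
    fun i => List.toFinsupp_apply _ _
  have hlen : (encodeInput code R T).length = params q n₀ n₁ n₂ R 7 := encodeInput_length T
  have hbdd : Bdd B (State.init (encodeInput code R T)) := by
    refine ⟨fun i => Nat.zero_le _, fun i _ => rfl, fun i => ?_, fun i hi => ?_⟩
    · rw [hmem]
      exact encodeInput_le T ((hM 0).trans hMV) ((hM 1).trans hMV) ((hM 2).trans hMV)
        ((hM 3).trans hMV) ((hM 4).trans hMV) i
    · rw [hmem, List.getD_eq_default]
      omega
  have hprep : Prep B M (State.init (encodeInput code R T)).mem
      (fun j => if j ∈ [] then params q n₀ n₁ n₂ R j else 0) (fun _ => 0) []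
      (State.init (encodeInput code R T)) :=
    ⟨hbdd, ⟨fun i => rfl, fun i hi => by simp at hi, fun i => rfl, fun i => by simp,
      fun i hi => by simp at hi, fun i => Nat.zero_le _⟩, fun i => rfl, rfl⟩
  have h614 : params q n₀ n₁ n₂ R 14 ≤ X := by
    have := hl.b14; have := hπ.side; omega
  have h63 : params q n₀ n₁ n₂ R 3 ≤ X := by have := hl.b3; have := hπ.side; omega
  have h61 : params q n₀ n₁ n₂ R 1 ≤ X := by have := hl.b1; have := hπ.side; omega
  have h64 : params q n₀ n₁ n₂ R 4 ≤ X := by have := hl.b4; have := hπ.side; omega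
  obtain ⟨s1, r1, p1⟩ := ParOp.run_list (X := X) paramOps hprep hMV hM
    (paramOps_valid hn hq.le hM (hmem 0) (hmem 1) (hmem 2) (hmem 3) (hmem 4)) (hp _ (by omega))
    (by omega) (fun i p c e he => by
      simp only [paramOps, List.mem_cons, ParOp.iter.injEq, reduceCtorEq, false_or, or_false,
        List.not_mem_nil] at he
      rcases he with ⟨-, rfl, -⟩ | ⟨-, rfl, -⟩ | ⟨-, rfl, -⟩ | ⟨-, rfl, -⟩ <;> assumption)
  rw [params_restrict] at p1
  -- Empty cells represent the element with code `0`, which need not be the zero of the field;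
  -- `consts` sets the true constants before they are used.
  set σ0 : HS F := ⟨fun _ => 0, fun _ => elem code 0, fun _ _ _ => elem code 0⟩ with hσ0
  have hce : (code (elem code 0) : ℕ) = 0 := code_elem _ (by omega)
  have hrel : Rel code (params q n₀ n₁ n₂ R) (entry T) B [] M (fun _ => 0) σ0 s1 := by
    refine ⟨p1.bdd, p1.n, fun i => by rw [p1.fv, hσ0, hce], fun A i j _ _ => ?_, fun a b => ?_,
      fun a b => ?_, fun l hl' => ?_⟩
    · rw [p1.mem, hmem, List.getD_eq_default, hσ0, hce]
      rw [hlen, adr]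
      omega
    · rw [p1.mem, hmem, encodeInput_add]
    · rw [p1.mem, hmem, encodeInput_mul]
    · rw [p1.mem, hmem, encodeInput_entry]
      have : 1 ≤ n₀ * (n₁ * n₂) := Nat.mul_pos hn (Nat.mul_pos h1 h2)
      change l ≤ n₀ * (n₁ * n₂) - 1 at hl'
      omega
  obtain ⟨s2, r2, p2, -⟩ := Cmd.run (NA := 24) hπ hMV hW mainCmd hrel mainCmd_wf (hp _ (by omega))
    (by omega) hb (by simp) (fun i => Nat.zero_le _) hbM
  have h20 : params q n₀ n₁ n₂ R 20 ≤ params q n₀ n₁ n₂ R 6 := by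
    have := hl.b20; have := hπ.side; omega
  have h6W : params q n₀ n₁ n₂ R 6 ≤ B.W := by
    have h6 : 1 ≤ params q n₀ n₁ n₂ R 6 := by have := hπ.side; omega
    nlinarith
  obtain ⟨s3, r3, p3⟩ := run_copyOut hπ h20 hMV (by omega) h6W (hp _ (by omega)) (by omega) p2
  refine ⟨s3, (r1.seq (r2.seq r3)).mono ?_, solves_of_result (mainCmd_spec hπ hl ?_
    (fun r k1 k2 k3 k4 => le_params_size hn k1 k2 k3 k4) rfl rfl) p3⟩
  · have := Nat.mul_le_mul_right ((adrE 22 (.const 0) (.bv 0)).steps + 5) (h20.trans hX)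
    omega
  -- Read back from row-major order, the slice matrices are the slices of `T` along the first axis,
  -- whose independence is part of conciseness.
  · have e : (fun i : Fin n₀ => sliceMat (params q n₀ n₁ n₂ R) (entry T) i) = T :=
      funext fun i => funext fun j => funext fun k => entry_index T i j k
    change LinearIndependent F (fun i : Fin n₀ => sliceMat (params q n₀ n₁ n₂ R) (entry T) i)
    rw [e]
    exact hT.1

end

end TensorCPD

/-! ### Polynomial bounds for the bit lengths, the time factor and the space. -/

namespace TensorCPD

lemma size_pow_le {a k : ℕ} (hk : k ≠ 0) : Nat.size (a ^ k) ≤ k * Nat.size a := by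
  rw [Nat.size_le, mul_comm, pow_mul]
  exact Nat.pow_lt_pow_left (Nat.lt_size_self a) hk

/-- Since `S ≤ 2 ^ S`, a number up to `S ^ c * q ^ E` has about `S * c + S * E` bits, which is
polynomial in `S` although the number itself is exponential. -/
lemma size_le_pow {S q E c M k : ℕ} (hS : 2 ≤ S) (hq : q ≤ S) (hE : E ≤ S ^ 4)
    (hM : M ≤ S ^ c * q ^ E) (hk : k ≠ 0) : Nat.size (M ^ k) ≤ S ^ (k + (1 + c + (1 + 4) + 1 + 0 + 1)) := by
  refine (size_pow_le hk).trans (mul_le_pow (self_le_pow hS k) ?_)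
  have h : Nat.size M ≤ S * c + S * E + 1 := by
    rw [Nat.size_le]
    have h1 : M ≤ 2 ^ (S * c + S * E) := by
      rw [pow_add, pow_mul, pow_mul]
      have h2 : S ≤ 2 ^ S := Nat.lt_two_pow_self.le
      exact hM.trans (Nat.mul_le_mul (Nat.pow_le_pow_left h2 _) (Nat.pow_le_pow_left (hq.trans h2) _))
    exact h1.trans_lt (Nat.pow_lt_pow_right (by norm_num) (by omega))
  refine h.trans ?_
  have h1 : S * c ≤ S ^ (1 + c) := mul_le_pow (pow_one S).ge (self_le_pow hS c)
  have h2 : S * E ≤ S ^ (1 + 4) := mul_le_pow (pow_one S).ge hE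
  have h4 : S * c + S * E ≤ S ^ (1 + c + (1 + 4) + 1) := add_le_pow hS h1 h2
  have h3 := add_le_pow hS h4 (pow_zero S).ge
  exact h3.trans le_rfl

lemma exists_size_bound (K : ℕ) {k : ℕ} (hk : k ≠ 0) : ∃ a, ∀ S q E t : ℕ, 2 ≤ S → 1 ≤ q → q ≤ S →
    E ≤ S ^ 4 → t ≤ S ^ (3 * K) * q ^ E → Nat.size ((S ^ 4 * q ^ E + t + 2) ^ k) ≤ S ^ a := by
  refine ⟨_, fun S q E t hS hq hqS hE ht => size_le_pow (c := 4 + 3 * K + 1 + 2 + 1) hS hqS hE ?_ hk⟩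
  have hQ : 1 ≤ q ^ E := Nat.one_le_pow _ _ hq
  have h1 : S ^ 4 + S ^ (3 * K) ≤ S ^ (4 + 3 * K + 1) := add_le_pow hS le_rfl le_rfl
  have h2 := add_le_pow hS h1 (self_le_pow hS 2)
  refine le_trans ?_ (Nat.mul_le_mul_right (q ^ E) h2)
  rw [add_mul, add_mul]
  omega

lemma exists_time_bound (a K C D : ℕ) : ∃ A, ∀ S Q t v : ℕ, 2 ≤ S → 1 ≤ Q → t ≤ S ^ (3 * K) * Q →
    v ≤ S ^ a → (C * S ^ 3 + (t + (1 + (S ^ 3 * D + 1)))) * (1 + 2 * v) ≤ S ^ A * Q := by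
  refine Exists.intro ?A ?_
  rotate_left
  intro S Q t v hS hQ ht hv
  have h1 : 1 + 2 * v ≤ S ^ (0 + (1 + a) + 1) :=
    add_le_pow hS (pow_zero S).ge (mul_le_pow (hS.trans (pow_one S).ge) hv)
  have h4 : S ^ 3 * D ≤ S ^ (3 + D) := mul_le_pow le_rfl (self_le_pow hS D)
  have h5 := add_le_pow hS h4 (pow_zero S).ge
  have h2 : C * S ^ 3 + (S ^ (3 * K) + (1 + (S ^ 3 * D + 1))) ≤
      S ^ (C + 3 + (3 * K + (0 + (3 + D + 0 + 1) + 1) + 1) + 1) :=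
    add_le_pow hS (mul_le_pow (self_le_pow hS C) le_rfl) (add_le_pow hS le_rfl
      (add_le_pow hS (pow_zero S).ge h5))
  have h3 : C * S ^ 3 + (t + (1 + (S ^ 3 * D + 1))) ≤
      (C * S ^ 3 + (S ^ (3 * K) + (1 + (S ^ 3 * D + 1)))) * Q := by
    have := Nat.le_mul_of_pos_right (C * S ^ 3 + (1 + (S ^ 3 * D + 1))) hQ
    nlinarith
  refine (Nat.mul_le_mul (h3.trans (Nat.mul_le_mul_right Q h2)) h1).trans (le_of_eq ?_)
  rw [mul_right_comm, ← pow_add]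

lemma exists_space_bound (a Z : ℕ) : ∃ A, ∀ S v W : ℕ, 2 ≤ S → W ≤ S ^ 11 → v ≤ S ^ a →
    Z * (Nat.size Z + v) + W * (Nat.size W + v) ≤ S ^ A := by
  refine Exists.intro ?A ?_
  rotate_left
  intro S v W hS hW hv
  have hs : ∀ x, Nat.size x ≤ x := fun x => Nat.size_le.mpr Nat.lt_two_pow_self
  exact add_le_pow hS (mul_le_pow (self_le_pow hS Z) (add_le_pow hS ((hs Z).trans (self_le_pow hS Z)) hv))
    (mul_le_pow hW (add_le_pow hS ((hs W).trans hW) hv))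

section

variable {q n₀ n₁ n₂ R : ℕ}

/-- Both sides express the maximum with `0`, once through integers and once through truncated
subtraction. The summand `n₀` is inside parameter `14`, while `n₂` belongs to the loop of
`complete`. -/
lemma exponent_eq : exponent n₀ n₁ n₂ R = params q n₀ n₁ n₂ R 14 + n₂ := by
  have h : ((R : ℤ) - n₀ + 1 - rStar n₀ R) * ((n₁ : ℤ) + n₂) + (rStar n₀ R : ℤ) ^ 2 =
      (((R + 1) * (n₁ + n₂) + (R / n₀ + 1) * (R / n₀ + 1) : ℕ) : ℤ) -
        (((n₀ + (R / n₀ + 1)) * (n₁ + n₂) : ℕ) : ℤ) := by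
    simp only [rStar]
    push_cast
    ring
  rw [exponent, h, Int.toNat_sub]
  simp only [params]
  omega

/-- Only the three powers of `q` can be exponential, and their exponents `n₀`, `π 14`, `n₂` are at
most `π 14 + n₂`; all other parameters are polynomial. -/
lemma params_le (hq : 1 ≤ q) (h0 : 1 ≤ n₀) (h1 : 1 ≤ n₁) (h2 : 1 ≤ n₂) (i : ℕ) :
    params q n₀ n₁ n₂ R i ≤ (q + n₀ + n₁ + n₂ + R + 2) ^ 4 * q ^ (params q n₀ n₁ n₂ R 14 + n₂) := by
  have hl : Lay (params q n₀ n₁ n₂ R) := params_lay hq h0 h1 h2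
  have b1 := hl.b1
  have b8 := hl.b8
  have b14 := hl.b14
  have b20 := hl.b20
  have n14 := hl.n14
  clear hl
  have e16 : params q n₀ n₁ n₂ R 16 = q ^ params q n₀ n₁ n₂ R 14 := rfl
  have e5 : params q n₀ n₁ n₂ R 5 = (q + n₀ + n₁ + n₂ + R + 2) ^ 3 - 1 := rfl
  have e6 : params q n₀ n₁ n₂ R 6 = (q + n₀ + n₁ + n₂ + R + 2) ^ 3 := rfl
  have e7 : params q n₀ n₁ n₂ R 7 = 5 + 2 * (q * q) + n₀ * (n₁ * n₂) := rfl
  have e10 : params q n₀ n₁ n₂ R 10 = n₀ * (n₁ * n₂) - 1 := rfl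
  have hd : R / n₀ ≤ R := Nat.div_le_self _ _
  set S := q + n₀ + n₁ + n₂ + R + 2 with hS
  generalize hE : params q n₀ n₁ n₂ R 14 = E at *
  have hQ : 1 ≤ q ^ (E + n₂) := Nat.one_le_pow _ _ hq
  have small : ∀ {x}, x ≤ S ^ 4 → x ≤ S ^ 4 * q ^ (E + n₂) := fun h =>
    h.trans (Nat.le_mul_of_pos_right _ hQ)
  have large : ∀ {x}, x ≤ q ^ (E + n₂) → x ≤ S ^ 4 * q ^ (E + n₂) := fun h =>
    h.trans (Nat.le_mul_of_pos_left _ (Nat.pow_pos (by omega)))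
  have hqq : q * q ≤ S * S := Nat.mul_le_mul (by omega) (by omega)
  have h12 : n₀ * (n₁ * n₂) ≤ S * (S * S) :=
    Nat.mul_le_mul (by omega) (Nat.mul_le_mul (by omega) (by omega))
  have h3 : S ^ 3 = S * (S * S) := by ring
  have h4 : S ^ 4 = S * S ^ 3 := by ring
  have hSS : 5 * S ≤ S * S := Nat.mul_le_mul_right _ (by omega)
  have hSSS : 5 * (S * S) ≤ S * (S * S) := Nat.mul_le_mul_right _ (by omega)
  have h34 : 5 * S ^ 3 ≤ S ^ 4 := by rw [h4]; exact Nat.mul_le_mul_right _ (by omega)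
  match i with
  | 0 | 1 | 2 | 3 | 4 | 9 | 11 | 12 | 13 | 18 | 19 | 21 | 22 =>
    refine small ?_; simp only [params]; omega
  | 5 => exact small (by omega)
  | 6 => exact small (by omega)
  | 7 => exact small (by omega)
  | 8 => exact small (by omega)
  | 10 => exact small (by omega)
  | 14 => exact small (by omega)
  | 20 => exact small (by omega)
  | 15 => exact large (Nat.pow_le_pow_right hq (n14.trans (Nat.le_add_right _ _)))
  | 16 => exact large (e16.le.trans (Nat.pow_le_pow_right hq (Nat.le_add_right _ _)))
  | 17 => exact large (Nat.pow_le_pow_right hq (Nat.le_add_left _ _))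
  | _ + 23 => exact Nat.zero_le _

lemma params_small (hq : 1 ≤ q) (h0 : 1 ≤ n₀) (h1 : 1 ≤ n₁) (h2 : 1 ≤ n₂) {p : ℕ} (hp : p ∈ smallPars) :
    params q n₀ n₁ n₂ R p ≤ (q + n₀ + n₁ + n₂ + R + 2) ^ 3 := by
  have hl : Lay (params q n₀ n₁ n₂ R) := params_lay hq h0 h1 h2
  have hS : q + n₀ + n₁ + n₂ + R + 2 ≤ (q + n₀ + n₁ + n₂ + R + 2) ^ 3 :=
    Nat.le_self_pow (by norm_num) _
  have h56 : params q n₀ n₁ n₂ R 5 + 1 = (q + n₀ + n₁ + n₂ + R + 2) ^ 3 :=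
    Nat.sub_add_cancel (Nat.one_le_pow _ _ (by omega))
  rw [← h56] at hS ⊢
  simp only [smallPars, List.mem_cons, List.not_mem_nil, or_false] at hp
  rcases hp with rfl | rfl | rfl | rfl | rfl | rfl | rfl | rfl | rfl | rfl | rfl
  · exact (show q ≤ _ by omega)
  · exact hl.b1
  · exact hl.b2
  · exact hl.b3
  · exact (show R ≤ _ by omega)
  · exact hl.b8
  · exact hl.b14
  · exact hl.b18
  · exact hl.e19.le.trans (by omega)
  · exact hl.b20
  · exact (show R + 1 - n₀ ≤ _ by omega)

lemma params_exponent_le (hq : 1 ≤ q) (h0 : 1 ≤ n₀) (h1 : 1 ≤ n₁) (h2 : 1 ≤ n₂) :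
    params q n₀ n₁ n₂ R 14 + n₂ ≤ (q + n₀ + n₁ + n₂ + R + 2) ^ 4 := by
  have h14 := params_small (R := R) hq h0 h1 h2 (show 14 ∈ smallPars by decide)
  have h3 : n₂ ≤ _ := params_small (R := R) hq h0 h1 h2 (show 3 ∈ smallPars by decide)
  rw [pow_succ]
  nlinarith

lemma params_memory_le : params q n₀ n₁ n₂ R 7 + 24 * params q n₀ n₁ n₂ R 6 * params q n₀ n₁ n₂ R 6 ≤
    (q + n₀ + n₁ + n₂ + R + 2) ^ 11 := by
  have e7 : params q n₀ n₁ n₂ R 7 = 5 + 2 * (q * q) + n₀ * (n₁ * n₂) := rfl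
  have e6 : params q n₀ n₁ n₂ R 6 = (q + n₀ + n₁ + n₂ + R + 2) ^ 3 := rfl
  rw [e6, e7]
  set S := q + n₀ + n₁ + n₂ + R + 2 with hS
  have hqq : q * q ≤ S * S := Nat.mul_le_mul (by omega) (by omega)
  have h12 : n₀ * (n₁ * n₂) ≤ S * (S * S) :=
    Nat.mul_le_mul (by omega) (Nat.mul_le_mul (by omega) (by omega))
  have hS2 : 2 ≤ S := by omega
  clear_value S
  have h2 : 2 * 2 ≤ S * S := Nat.mul_le_mul hS2 hS2
  have h3 : 2 * (S * S) ≤ S * (S * S) := Nat.mul_le_mul_right _ hS2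
  have h6 : 8 * (S * (S * S)) ≤ S ^ 6 := by
    calc 8 * (S * (S * S)) = 2 * 2 * 2 * (S * (S * S)) := by ring
      _ ≤ S * S * S * (S * (S * S)) := by gcongr
      _ = S ^ 6 := by ring
  have h11 : 2 ^ 5 * S ^ 6 ≤ S ^ 11 := by
    calc 2 ^ 5 * S ^ 6 ≤ S ^ 5 * S ^ 6 := by gcongr
      _ = S ^ 11 := by ring
  have e : 24 * S ^ 3 * S ^ 3 = 24 * S ^ 6 := by ring
  omega

end

/-- The time and space bounds for the program. -/
theorem exists_bounds : ∃ A₁ A₂ : ℕ, ∀ (F : Type*) [Field F] (q : ℕ) (code : F ≃ Fin q)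
    (n₀ n₁ n₂ R : ℕ) (T : Tensor3 F n₀ n₁ n₂), 1 ≤ n₀ → Concise T →
    ∃ (s : State) (time space : ℕ),
      Exec program (State.init (encodeInput code R T)) s time space ∧ Solves code R T s ∧
      time ≤ (q + n₀ + n₁ + n₂ + R + 2) ^ A₁ * q ^ exponent n₀ n₁ n₂ R ∧
      space ≤ (q + n₀ + n₁ + n₂ + R + 2) ^ A₂ := by
  obtain ⟨K, hK⟩ := mainCmd_steps_le
  obtain ⟨a, ha⟩ := exists_size_bound K
    (k := 1 + ParOp.szList paramOps + mainCmd.sz + (adrE 22 (.const 0) (.bv 0)).sz) (by omega)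
  obtain ⟨A₁, hA₁⟩ := exists_time_bound a K (ParOp.costList 1 paramOps)
    ((adrE 22 (.const 0) (.bv 0)).steps + 5)
  obtain ⟨A₂, hA₂⟩ := exists_space_bound a program.maxReg
  refine ⟨A₁, A₂, fun F _ q code n₀ n₁ n₂ R T hn hT => ?_⟩
  have hq := one_lt_card code
  obtain ⟨h1, h2⟩ := hT.pos hn
  have hl : Lay (params q n₀ n₁ n₂ R) := params_lay hq.le hn h1 h2
  have hS : 2 ≤ q + n₀ + n₁ + n₂ + R + 2 := by omega
  have hS3 : 2 ≤ (q + n₀ + n₁ + n₂ + R + 2) ^ 3 := hS.trans (Nat.le_self_pow (by norm_num) _)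
  have hst := hK (params q n₀ n₁ n₂ R) _ _ (q ^ params q n₀ n₁ n₂ R 14) (q ^ n₂) hS3
    (fun p hp => params_small hq.le hn h1 h2 hp) (Nat.one_le_pow _ _ hq.le) (Nat.one_le_pow _ _ hq.le)
    (Nat.pow_le_pow_right hq.le hl.n14) le_rfl le_rfl le_rfl
  rw [← pow_add, ← pow_mul] at hst
  have hv := ha _ _ _ _ hS hq.le (by omega) (params_exponent_le hq.le hn h1 h2) hst
  -- The bounds on contents, registers and memory are taken as small as `run_program` permits; the
  -- reflexivity proofs fix them by unification.
  obtain ⟨s, ⟨-, t, m, hex, ht, hm⟩, hsol⟩ := run_program code T hn hT (R := R)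
    (B := ⟨_, _, _⟩) (params_le hq.le hn h1 h2) le_rfl le_rfl le_rfl le_rfl le_rfl
  rw [exponent_eq (q := q)]
  refine ⟨s, t, m, hex, hsol, ht.trans ?_, hm.trans ?_⟩
  -- The time is the number of elementary steps times the logarithmic unit cost, and the latter is
  -- polynomial by the bound on bit lengths.
  · refine le_trans (Nat.mul_le_mul_right _ (Nat.add_le_add_right
      (ParOp.costList_le (hS3.trans' one_le_two) _) _)) ?_
    exact hA₁ _ _ _ _ hS (Nat.one_le_pow _ _ hq.le) hst hv
  · exact hA₂ _ _ _ hS params_memory_le hv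

end TensorCPD

/-! ### The number of factorizations of a matrix. -/

namespace TensorCPD

section

variable {F : Type*} [Field F] {ι κ ν : Type*} [Fintype ι] [Fintype κ] [Fintype ν]

lemma natCard_sigma_le {α : Type*} {β : α → Type*} [Finite α] [∀ a, Finite (β a)] {b : ℕ}
    (h : ∀ a, Nat.card (β a) ≤ b) : Nat.card (Sigma β) ≤ Nat.card α * b := by
  have := Fintype.ofFinite α
  rw [Nat.card_sigma, Nat.card_eq_fintype_card, ← smul_eq_mul, ← Finset.card_univ]
  exact Finset.sum_le_card_nsmul _ _ _ fun a _ => h a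

lemma exists_rank_submatrix (M : Matrix ι ν F) : ∃ (c : Fin M.rank → ν), Function.Injective c ∧
    (M.submatrix id c).rank = M.rank := by
  obtain ⟨κ', a, ha, hspan, hli⟩ := exists_linearIndependent' F M.col
  have : Finite κ' := Finite.of_injective a ha
  have : Fintype κ' := Fintype.ofFinite κ'
  have hcard : Fintype.card κ' = M.rank := by
    rw [Matrix.rank_eq_finrank_span_cols, ← hspan, finrank_span_eq_card hli]
  obtain ⟨e⟩ := Fintype.card_eq.mp ((Fintype.card_fin _).trans hcard.symm)
  refine ⟨a ∘ e, ha.comp e.injective, ?_⟩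
  rw [Matrix.rank_eq_finrank_span_cols]
  refine Eq.trans ?_ ((congrArg (fun S : Submodule F (ι → F) => Module.finrank F S) hspan).trans
    M.rank_eq_finrank_span_cols.symm)
  rw [← e.surjective.range_comp (M.col ∘ a)]
  rfl

variable [Finite F]

/-- The solution set is empty or a translate of the kernel, whose dimension is the number of columns
minus the rank. -/
lemma card_mulVec_eq_le (A : Matrix ι κ F) (b : ι → F) {s : ℕ} (hs : s ≤ A.rank) :
    Nat.card {x : κ → F // A.mulVec x = b} ≤ Nat.card F ^ (Fintype.card κ - s) := by
  classical
  rcases isEmpty_or_nonempty {x : κ → F // A.mulVec x = b} with h | ⟨⟨x₀, h₀⟩⟩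
  · simp
  have h1 : Nat.card {x : κ → F // A.mulVec x = b} ≤ Nat.card (LinearMap.ker A.mulVecLin) := by
    refine Nat.card_le_card_of_injective (fun x => ⟨x.1 - x₀, ?_⟩) fun x y h => ?_
    · rw [LinearMap.mem_ker, Matrix.mulVecLin_apply, Matrix.mulVec_sub, x.2, h₀, sub_self]
    · exact Subtype.ext (sub_left_injective (congrArg Subtype.val h))
  refine h1.trans ?_
  rw [Module.natCard_eq_pow_finrank (K := F)]
  refine Nat.pow_le_pow_right Nat.card_pos ?_
  have h2 := LinearMap.finrank_range_add_finrank_ker A.mulVecLin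
  rw [Module.finrank_pi] at h2
  have h3 : A.rank = Module.finrank F (LinearMap.range A.mulVecLin) := rfl
  omega

/-- The columns of `X` are solved for separately. The rank bound is required only if a solution
exists, because in the application it is the equation itself that forces `A` to have large rank. -/
lemma card_mul_eq_le (A : Matrix ι κ F) (B : Matrix ι ν F) {s : ℕ}
    (hs : ∀ X : Matrix κ ν F, A * X = B → s ≤ A.rank) :
    Nat.card {X : Matrix κ ν F // A * X = B} ≤ Nat.card F ^ ((Fintype.card κ - s) * Fintype.card ν) := by
  rcases isEmpty_or_nonempty {X : Matrix κ ν F // A * X = B} with h | ⟨⟨X₀, h₀⟩⟩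
  · simp
  have h1 : Nat.card {X : Matrix κ ν F // A * X = B} ≤
      Nat.card (∀ j : ν, {x : κ → F // A.mulVec x = B.col j}) := by
    refine Nat.card_le_card_of_injective (fun X j => ⟨X.1.col j, ?_⟩) fun X Y h => ?_
    · exact congrArg (fun Y : Matrix ι ν F => Y.col j) X.2
    · refine Subtype.ext (Matrix.ext fun i j => ?_)
      exact congrFun (congrArg Subtype.val (congrFun h j)) i
  refine h1.trans ?_
  rw [Nat.card_pi, pow_mul, ← Finset.card_univ (α := ν)]
  exact Finset.prod_le_pow_card _ _ _ fun j _ => card_mulVec_eq_le A _ (hs X₀ h₀)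

lemma card_mul_eq_le' (A : Matrix κ ν F) (B : Matrix ι ν F) {s : ℕ}
    (hs : ∀ X : Matrix ι κ F, X * A = B → s ≤ A.rank) :
    Nat.card {X : Matrix ι κ F // X * A = B} ≤ Nat.card F ^ ((Fintype.card κ - s) * Fintype.card ι) := by
  refine (Nat.card_le_card_of_injective
    (β := {X : Matrix κ ι F // A.transpose * X = B.transpose})
    (fun X => ⟨X.1.transpose, by rw [← Matrix.transpose_mul, X.2]⟩) fun X Y h =>
      Subtype.ext (Matrix.transpose_injective (congrArg Subtype.val h))).trans
    (card_mul_eq_le _ _ fun X h => ?_)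
  rw [Matrix.rank_transpose]
  refine hs X.transpose ?_
  rw [← Matrix.transpose_transpose A, ← Matrix.transpose_mul, h, Matrix.transpose_transpose]

/-- A matrix `M` has at most `|F| ^ ((k - r) (m + n) + r ^ 2)` factorizations with inner dimension `k`,
where `r` is its rank. -/
theorem card_factorizations_le {m n k : ℕ} (M : Matrix (Fin m) (Fin n) F) (hk : M.rank ≤ k) :
    Nat.card {UV : Matrix (Fin m) (Fin k) F × Matrix (Fin k) (Fin n) F // M = UV.1 * UV.2} ≤
      Nat.card F ^ ((k - M.rank) * (m + n) + M.rank ^ 2) := by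
  classical
  obtain ⟨c, hc, hr⟩ := exists_rank_submatrix M
  have hrn : M.rank ≤ n := by simpa using M.rank_le_card_width
  have := Fintype.ofFinite F
  let N := {j : Fin n // j ∉ Set.range c}
  have hN : Fintype.card N = n - M.rank := by
    rw [Fintype.card_subtype_compl, Fintype.card_fin]
    exact congrArg (n - ·) ((Set.card_range_of_injective hc).trans (Fintype.card_fin _))
  -- A factorization splits into the columns of `V` at the independent columns of `M`, then `U`,
  -- then the other columns of `V`.
  let E := Σ V : Matrix (Fin k) (Fin M.rank) F, Σ U : {U : Matrix (Fin m) (Fin k) F //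
    U * V = M.submatrix id c}, {X : Matrix (Fin k) N F // U.1 * X = M.submatrix id Subtype.val}
  have h1 : Nat.card {UV : Matrix (Fin m) (Fin k) F × Matrix (Fin k) (Fin n) F // M = UV.1 * UV.2} ≤
      Nat.card E := by
    refine Nat.card_le_card_of_injective (fun UV => ⟨UV.1.2.submatrix id c, ⟨UV.1.1, ?_⟩,
      UV.1.2.submatrix id Subtype.val, ?_⟩) fun x y h => ?_
    · exact congrArg (fun Y => Y.submatrix id c) UV.2.symm
    · exact congrArg (fun Y => Y.submatrix id Subtype.val) UV.2.symm
    · have e1 := congrArg (fun e : E => e.1) h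
      have e2 := congrArg (fun e : E => e.2.1.1) h
      have e3 := congrArg (fun e : E => e.2.2.1) h
      refine Subtype.ext (Prod.ext e2 (Matrix.ext fun i j => ?_))
      by_cases hj : j ∈ Set.range c
      · obtain ⟨l, rfl⟩ := hj
        exact congrFun (congrFun e1 i) l
      · exact congrFun (congrFun e3 i) ⟨j, hj⟩
  have h2 : Nat.card E ≤ Nat.card F ^ (k * M.rank) * (Nat.card F ^ ((k - M.rank) * m) *
      Nat.card F ^ ((k - M.rank) * (n - M.rank))) := by
    -- A product of rank `r` forces both the chosen columns of `V` and the matrix `U` to have rank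
    -- at least `r`. Each of the two remaining linear systems thus loses `r` of its `k` degrees of
    -- freedom per row or column.
    refine (natCard_sigma_le fun V => (natCard_sigma_le fun U => ?_).trans
      (Nat.mul_le_mul_right _ ?_)).trans (Nat.mul_le_mul_right _ ?_)
    · rw [← hN]
      exact (card_mul_eq_le U.1 _ fun X hX => hr.ge.trans
        ((congrArg Matrix.rank U.2).ge.trans (Matrix.rank_mul_le_left _ _))).trans
        (by rw [Fintype.card_fin])
    · exact (card_mul_eq_le' V _ fun X hX => hr.ge.trans (hX ▸ Matrix.rank_mul_le_right _ _)).trans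
        (by rw [Fintype.card_fin, Fintype.card_fin])
    · rw [Matrix, Nat.card_fun, Nat.card_fun, ← pow_mul, Nat.card_fin, Nat.card_fin, mul_comm]
  refine (h1.trans h2).trans (le_of_eq ?_)
  rw [← pow_add, ← pow_add]
  congr 1
  have key : ∀ r ≤ k, r ≤ n →
      k * r + ((k - r) * m + (k - r) * (n - r)) = (k - r) * (m + n) + r ^ 2 := by
    intro r hk hn
    obtain ⟨a, rfl⟩ := Nat.exists_eq_add_of_le hk
    obtain ⟨b, rfl⟩ := Nat.exists_eq_add_of_le hn
    simp only [Nat.add_sub_cancel_left]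
    ring
  exact key _ hk hrn

end

end TensorCPD

/-! ### Assembly: the bounds as polynomials in five variables. -/

namespace TensorCPD

/-- The polynomial `n₀ + n₁ + n₂ + R + q + 2`. -/
noncomputable def sizePoly : MvPolynomial (Fin 5) ℕ :=
  .X 4 + .X 0 + .X 1 + .X 2 + .X 3 + .C 2

lemma eval_sizePoly_pow (n₀ n₁ n₂ R q A : ℕ) : MvPolynomial.eval ![n₀, n₁, n₂, R, q] (sizePoly ^ A) =
    (q + n₀ + n₁ + n₂ + R + 2) ^ A := by
  simp [sizePoly]

end TensorCPD

/-- First part: one program, and two polynomials in `n₀, n₁, n₂, R, |F|` that bound the factor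
hidden in the running time and the space, serve all finite fields (given by their operation tables
under an arbitrary numbering of the elements), all shapes, all rank thresholds, and all concise
tensors. Second part: the bound on the number of factorizations of a matrix. -/
theorem theorem2 :
    (∃ (P : TensorCPD.Prog) (pTime pSpace : MvPolynomial (Fin 5) ℕ),
      ∀ (F : Type*) [Field F] (q : ℕ) (code : F ≃ Fin q) (n₀ n₁ n₂ R : ℕ)
        (T : TensorCPD.Tensor3 F n₀ n₁ n₂), 1 ≤ n₀ → TensorCPD.Concise T →
        ∃ (s : TensorCPD.State) (time space : ℕ),
          TensorCPD.Exec P (TensorCPD.State.init (TensorCPD.encodeInput code R T)) s time space ∧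
          TensorCPD.Solves code R T s ∧
          time ≤ MvPolynomial.eval ![n₀, n₁, n₂, R, q] pTime *
            q ^ TensorCPD.exponent n₀ n₁ n₂ R ∧
          space ≤ MvPolynomial.eval ![n₀, n₁, n₂, R, q] pSpace) ∧
    (∀ (F : Type*) [Field F] [Finite F] (m n k : ℕ) (M : Matrix (Fin m) (Fin n) F),
      M.rank ≤ k →
      Nat.card {UV : Matrix (Fin m) (Fin k) F × Matrix (Fin k) (Fin n) F // M = UV.1 * UV.2} ≤
        Nat.card F ^ ((k - M.rank) * (m + n) + M.rank ^ 2)) := by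
  refine ⟨?_, fun F _ _ m n k M hk => TensorCPD.card_factorizations_le M hk⟩
  obtain ⟨A₁, A₂, h⟩ := TensorCPD.exists_bounds
  refine ⟨TensorCPD.program, TensorCPD.sizePoly ^ A₁, TensorCPD.sizePoly ^ A₂,
    fun F _ q code n₀ n₁ n₂ R T hn hT => ?_⟩
  rw [TensorCPD.eval_sizePoly_pow, TensorCPD.eval_sizePoly_pow]
  exact h F q code n₀ n₁ n₂ R T hn hT
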